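/- Let $M$ be a time-oriented globally hyperbolic spacetime and let the field multiplet $\varphi=(\varphi^\alpha)$ be the smooth sections of a finite-rank graded vector bundle over $M$ (even fields and odd ghosts/antighosts). Let $\varphi^\ddagger_\alpha$ be the antifields: sections of the dual bundle tensored with densities, with parity opposite to that of $\varphi^\alpha$. Let $\mathcal{BV}$ be the algebra of multilocal functionals of $(\varphi,\varphi^\ddagger)$, i.e. the algebra generated (under the pointwise graded product) by the compactly supported local functionals $\int_M\omega(j^k_x(\varphi,\varphi^\ddagger))\,d\mu(x)$. They are regarded as functionals on a graded space (equivalently, they are evaluated on fields with coefficients in a complex Grassmann algebra), smooth in the even fields, while the odd variables and the antifields are formal. The antibracket with an even functional or action $Y$ is $$\{X,Y\}=\sum_\alpha\Big\langle\frac{\delta_r X}{\delta\varphi^\alpha},\frac{\delta_l Y}{\delta\varphi^\ddagger_\alpha}\Big\rangle-\Big\langle\frac{\delta_r X}{\delta\varphi^\ddagger_\alpha},\frac{\delta_l Y}{\delta\varphi^\alpha}\Big\rangle .$$ An action $S$ is given by a generalized Lagrangian $f\mapsto L(f)$, $f\in C_c^\infty(M,\mathbb R)$ (local values, additive, $\operatorname{supp}L(f)\subseteq\operatorname{supp}f$);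 its derivatives are those of $L(f)$ with $f\equiv1$ near the point considered. Set $\mathrm{CME}(S)=\tfrac12\{S,S\}$, i.e. $f\mapsto\tfrac12\{L(f),L(f)\}$. The action $S$ satisfies the classical master equation if $\operatorname{supp}\tfrac12\{L(f),L(f)\}\subseteq\operatorname{supp}df$ for all $f$. Let $S_0=S_{00}+\theta_0$ be an even action, quadratic in fields and antifields, where $S_{00}$ contains no antifields and $\theta_0$ is linear in the antifields, and assume that $S_0$ satisfies the classical master equation. Let $P$ be the operator with $\frac{\delta_l S_{00}}{\delta\varphi^\alpha}=P_{\alpha\beta}\varphi^\beta$, and assume that $P$ is Green hyperbolic, i.e. that it has a unique retarded and a unique advanced Green function; let $\Delta^{\rm R}$ be the retarded one, so that $P\Delta^{\rm R}u=u$ and $\Delta^{\rm R}Pu=u$ for compactly supported $u$ and $\operatorname{supp}\Delta^{\rm R}u\subseteq J^+(\operatorname{supp}u)$. Let $V$ be an even, compactly supported local functional of fields and antifields, and assume that the parts of $S_{00}$ and $V$ that contain neither odd fields nor antifields are real. Put $S=S_0+V$. Define $$\mathtt r_V^{-1}(\varphi^\alpha)=\varphi^\alpha+(\Delta^{\rm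 R})^{\alpha\beta}\frac{\delta_l V}{\delta\varphi^\beta}(\varphi),\qquad \mathtt r_V^{-1}(\varphi^\ddagger_\alpha)=\varphi^\ddagger_\alpha,\qquad r_V^{-1}(X)(\varphi)=X(\mathtt r_V^{-1}(\varphi)).$$ Then for every $X\in\mathcal{BV}$ all expressions in the following formula are well defined, and $$r_V^{-1}(\{X,S_0\})=\{r_V^{-1}(X),S_0+V\}-\int\frac{\delta_r X}{\delta\varphi^\gamma(y)}(\mathtt r_V^{-1}(\varphi))\,\Delta^{\rm R}(y,z)^{\gamma\beta}\,\frac{\delta_l}{\delta\varphi^\beta(z)}\big(\mathrm{CME}(S)\big).$$ -/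

import Mathlib

open scoped Manifold ContDiff Topology
open Bundle MeasureTheory Set Filter

noncomputable section

namespace BV

/-! ### The complex Grassmann algebra and `Λ`-valued vectors -/

/-- The complex Grassmann algebra `Λ` with generators `θ_n`, `n ∈ ℕ`. -/
abbrev Grassmann : Type := ExteriorAlgebra ℂ (ℕ →₀ ℂ)

/-- The basis element `θ_I = θ_{i₁} ⋯ θ_{i_k}` for `I = {i₁ < ⋯ < i_k}`. -/
def θ (I : Finset ℕ) : Grassmann :=
  (Finsupp.basisSingleOne : Module.Basis ℕ ℂ (ℕ →₀ ℂ)).ExteriorAlgebra I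

/-- The complexification of a real vector space; `(a, b)` stands for `a + i b`. -/
abbrev Cx (W : Type*) : Type _ := W × W

/-- Multiplication by the imaginary unit on a complexification. -/
def Cx.mulI {W : Type*} [Neg W] (z : Cx W) : Cx W := (-z.2, z.1)

/-- `Λ ⊗_ℝ W`: the finitely supported family `(z_I)` stands for `∑ I, θ_I z_I`, with the
complex coefficients `z_I ∈ W ⊗ ℂ`. -/
abbrev GrVec (W : Type*) [Zero W] : Type _ := Finset ℕ →₀ Cx W

/-- Right multiplication `q ↦ q θ_n`, for `n` larger than all generators that occur in `q`. -/
def GrVec.mulRight {W : Type*} [AddCommMonoid W] (n : ℕ) (q : GrVec W) : GrVec W :=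
  Finsupp.mapDomain (insert n) q

section Spacetime

variable {d : ℕ} {M : Type*} [TopologicalSpace M] [ChartedSpace (EuclideanSpace ℝ (Fin d)) M]
  [IsManifold (𝓡 d) ∞ M]

variable (d M) in
/-- A time-oriented Lorentzian metric on `M`, of signature `(+,-,…,-)`. The vector field `time`
fixes the time orientation. -/
structure LorentzStructure where
  metric (x : M) : TangentSpace (𝓡 d) x →L[ℝ] TangentSpace (𝓡 d) x →L[ℝ] ℝ
  symm : ∀ x v w, metric x v w = metric x w v
  smooth : ContMDiff (𝓡 d)
    ((𝓡 d).prod 𝓘(ℝ, EuclideanSpace ℝ (Fin d) →L[ℝ] EuclideanSpace ℝ (Fin d) →L[ℝ] ℝ)) ∞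
    (fun x ↦ TotalSpace.mk' (EuclideanSpace ℝ (Fin d) →L[ℝ] EuclideanSpace ℝ (Fin d) →L[ℝ] ℝ)
      (E := fun x : M ↦ TangentSpace (𝓡 d) x →L[ℝ] TangentSpace (𝓡 d) x →L[ℝ] ℝ) x (metric x))
  time : Cₛ^∞⟮𝓡 d; EuclideanSpace ℝ (Fin d), (TangentSpace (𝓡 d) : M → Type)⟯
  time_pos : ∀ x, 0 < metric x (time x) (time x)
  neg_of_orthogonal : ∀ x v w, 0 < metric x v v → metric x v w = 0 → w ≠ 0 → metric x w w < 0

namespace LorentzStructure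

/-- There is a `C¹` future directed causal curve from `p` to `q`. -/
def CausalStep (g : LorentzStructure d M) (p q : M) : Prop :=
  ∃ γ : ℝ → M, ContMDiffOn 𝓘(ℝ, ℝ) (𝓡 d) 1 γ (Icc 0 1) ∧ γ 0 = p ∧ γ 1 = q ∧
    ∀ t ∈ Icc (0 : ℝ) 1,
      let v : TangentSpace (𝓡 d) (γ t) :=
        mfderivWithin 𝓘(ℝ, ℝ) (𝓡 d) γ (Icc 0 1) t (1 : ℝ)
      0 ≤ g.metric (γ t) v v ∧ 0 < g.metric (γ t) (g.time (γ t)) v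

/-- The causal future `J⁺(A)`: endpoints of piecewise `C¹` future directed causal curves that
start in `A`, and `A` itself. -/
def future (g : LorentzStructure d M) (A : Set M) : Set M :=
  {q | ∃ p ∈ A, Relation.ReflTransGen g.CausalStep p q}

/-- The causal past `J⁻(A)`. -/
def past (g : LorentzStructure d M) (A : Set M) : Set M :=
  {p | ∃ q ∈ A, Relation.ReflTransGen g.CausalStep p q}

/-- Global hyperbolicity: there is no closed causal curve, and the causal diamonds are compact. -/
def GloballyHyperbolic (g : LorentzStructure d M) : Prop :=
  (∀ p, ¬ Relation.TransGen g.CausalStep p p) ∧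
    ∀ p q, IsCompact (g.future {p} ∩ g.past {q})

end LorentzStructure

variable (d) in
/-- A smooth, everywhere positive density on `M`. -/
def IsSmoothDensity [MeasurableSpace M] (μ : Measure M) : Prop :=
  ∀ x : M, ∃ ρ : EuclideanSpace ℝ (Fin d) → ℝ,
    ContDiffOn ℝ ∞ ρ (extChartAt (𝓡 d) x).target ∧
    (∀ y ∈ (extChartAt (𝓡 d) x).target, 0 < ρ y) ∧
    ∀ s ⊆ (extChartAt (𝓡 d) x).source, MeasurableSet s →
      μ s = ∫⁻ y in extChartAt (𝓡 d) x '' s, ENNReal.ofReal (ρ y)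

variable (d) in
/-- The cutoff functions `f ∈ 𝒟 = C_c^∞(M, ℝ)`. -/
def IsTest (f : M → ℝ) : Prop := ContMDiff (𝓡 d) 𝓘(ℝ, ℝ) ∞ f ∧ HasCompactSupport f

variable (d) in
/-- The support of the differential `df`. -/
def dsupp (f : M → ℝ) : Set M := closure {x | mfderiv (𝓡 d) 𝓘(ℝ, ℝ) f x ≠ 0}

end Spacetime

section Sections

variable {d : ℕ} {M : Type*} [TopologicalSpace M] [ChartedSpace (EuclideanSpace ℝ (Fin d)) M]
  {F : Type*} [NormedAddCommGroup F] [NormedSpace ℝ F]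
  {E : M → Type*} [TopologicalSpace (TotalSpace F E)] [∀ x, TopologicalSpace (E x)]
  [∀ x, AddCommGroup (E x)] [∀ x, Module ℝ (E x)]
  [FiberBundle F E]
  {F' : Type*} [NormedAddCommGroup F'] [NormedSpace ℝ F']
  {E' : M → Type*} [TopologicalSpace (TotalSpace F' E')] [∀ x, TopologicalSpace (E' x)]
  [∀ x, AddCommGroup (E' x)] [∀ x, Module ℝ (E' x)]
  [FiberBundle F' E']

variable (d F E) in
/-- The smooth sections of a vector bundle. -/
abbrev Sec : Type _ := ContMDiffSection (𝓡 d) F ∞ E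

/-- The section `σ` near `x`, read in the preferred chart and trivialization at `x`. -/
def localRep (x : M) (σ : Sec d F E) (y : EuclideanSpace ℝ (Fin d)) : F :=
  (trivializationAt F E x
    (TotalSpace.mk' F ((extChartAt (𝓡 d) x).symm y) (σ ((extChartAt (𝓡 d) x).symm y)))).2

/-- The sections `σ` and `τ` have the same `r`-jet at `x`. -/
def SameJet (r : ℕ) (x : M) (σ τ : Sec d F E) : Prop :=
  ∀ j ≤ r, iteratedFDeriv ℝ j (localRep x σ) (extChartAt (𝓡 d) x x) =
    iteratedFDeriv ℝ j (localRep x τ) (extChartAt (𝓡 d) x x)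

/-- The family `(σ_s)_{s ∈ ℝⁿ}` of sections is smooth in `(s, x)` jointly. -/
def SmoothFamily {n : ℕ} (σ : (Fin n → ℝ) → Sec d F E) : Prop :=
  ContMDiff (𝓘(ℝ, Fin n → ℝ).prod (𝓡 d)) ((𝓡 d).prod 𝓘(ℝ, F)) ∞
    (fun p : (Fin n → ℝ) × M ↦ TotalSpace.mk' F p.2 (σ p.1 p.2))

variable [VectorBundle ℝ F E] [VectorBundle ℝ F' E']

/-- The support of a pair of sections. -/
def supp (s : Sec d F E × Sec d F' E') : Set M := closure {x | s.1 x ≠ 0 ∨ s.2 x ≠ 0}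

/-- The support of a complexified pair of sections. -/
def cxSupp (z : Cx (Sec d F E × Sec d F' E')) : Set M := supp z.1 ∪ supp z.2

theorem supp_zero : supp (0 : Sec d F E × Sec d F' E') = ∅ := by
  simp [supp]

theorem supp_add (s t : Sec d F E × Sec d F' E') : supp (s + t) ⊆ supp s ∪ supp t := by
  unfold supp
  rw [← closure_union]
  refine closure_mono fun x hx ↦ ?_
  by_contra h
  simp only [mem_union, mem_ofPred_eq, not_or, not_not] at h
  simp [h.1.1, h.1.2, h.2.1, h.2.2] at hx

theorem supp_smul (c : ℝ) (s : Sec d F E × Sec d F' E') : supp (c • s) ⊆ supp s := by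
  refine closure_mono fun x hx ↦ ?_
  by_contra h
  simp only [mem_ofPred_eq, not_or, not_not] at h
  simp [h.1, h.2] at hx

variable (d F E F' E') in
/-- The compactly supported complexified pairs of sections. -/
def CompactlySupported : Submodule ℝ (Cx (Sec d F E × Sec d F' E')) where
  carrier := {z | IsCompact (cxSupp z)}
  zero_mem' := by
    have h : cxSupp (0 : Cx (Sec d F E × Sec d F' E')) = ∅ := by
      simp only [cxSupp, Prod.fst_zero, Prod.snd_zero, supp_zero, union_self]
    simp only [mem_ofPred_eq, h, isCompact_empty]
  add_mem' := fun {a b} ha hb ↦ (ha.union hb).of_isClosed_subset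
    (isClosed_closure.union isClosed_closure) (by
      rintro x (hx | hx)
      · rcases supp_add _ _ hx with h | h
        exacts [Or.inl (Or.inl h), Or.inr (Or.inl h)]
      · rcases supp_add _ _ hx with h | h
        exacts [Or.inl (Or.inr h), Or.inr (Or.inr h)])
  smul_mem' := fun c z hz ↦ IsCompact.of_isClosed_subset hz
    (isClosed_closure.union isClosed_closure)
    (union_subset_union (supp_smul c _) (supp_smul c _))

variable (d F E) in
/-- The smooth sections of the dual bundle. -/
abbrev DualSec [∀ x, IsTopologicalAddGroup (E x)] [∀ x, ContinuousSMul ℝ (E x)] : Type _ :=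
  Sec d (F →L[ℝ] ℝ) (fun x ↦ E x →L[ℝ] ℝ)

instance [∀ x, IsTopologicalAddGroup (E x)] [∀ x, ContinuousSMul ℝ (E x)] :
    AddCommGroup (DualSec d F E) := ContMDiffSection.instAddCommGroup

instance [∀ x, IsTopologicalAddGroup (E x)] [∀ x, ContinuousSMul ℝ (E x)] :
    Module ℝ (DualSec d F E) := ContMDiffSection.instModule

end Sections

section FieldTheory

variable {d : ℕ} {M : Type*} [TopologicalSpace M] [ChartedSpace (EuclideanSpace ℝ (Fin d)) M]
  {F₀ : Type*} [NormedAddCommGroup F₀] [NormedSpace ℝ F₀]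
  {E₀ : M → Type*} [TopologicalSpace (TotalSpace F₀ E₀)] [∀ x, TopologicalSpace (E₀ x)]
  [∀ x, AddCommGroup (E₀ x)] [∀ x, Module ℝ (E₀ x)] [∀ x, IsTopologicalAddGroup (E₀ x)]
  [∀ x, ContinuousSMul ℝ (E₀ x)] [FiberBundle F₀ E₀] [VectorBundle ℝ F₀ E₀]
  {F₁ : Type*} [NormedAddCommGroup F₁] [NormedSpace ℝ F₁]
  {E₁ : M → Type*} [TopologicalSpace (TotalSpace F₁ E₁)] [∀ x, TopologicalSpace (E₁ x)]
  [∀ x, AddCommGroup (E₁ x)] [∀ x, Module ℝ (E₁ x)] [∀ x, IsTopologicalAddGroup (E₁ x)]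
  [∀ x, ContinuousSMul ℝ (E₁ x)] [FiberBundle F₁ E₁] [VectorBundle ℝ F₁ E₁]

/-! ### Fields and antifields

`E₀` is the bundle of the even fields, `E₁` the bundle of the odd ones (ghosts, antighosts). -/

variable (d F₀ E₀ F₁ E₁) in
/-- The field multiplets `φ = (φ₀, φ₁)`. -/
abbrev Fields : Type _ := Sec d F₀ E₀ × Sec d F₁ E₁

variable (d F₀ E₀ F₁ E₁) in
/-- The antifields `φ‡ = (φ₀‡, φ₁‡)`, where a smooth density on `M` is split off: `φ₀‡` is odd and
`φ₁‡` is even. -/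
abbrev Antifields : Type _ :=
  DualSec d F₀ E₀ × DualSec d F₁ E₁

variable (d F₀ E₀ F₁ E₁) in
/-- The sections that make up the graded space `T^*[-1]` of the extended configuration space. -/
abbrev Tot : Type _ := Fields d F₀ E₀ F₁ E₁ × Antifields d F₀ E₀ F₁ E₁

variable (d F₀ E₀ F₁ E₁) in
/-- The even variables `(φ₀, φ₁‡)`. -/
abbrev Ev : Type _ := Sec d F₀ E₀ × DualSec d F₁ E₁

variable (d F₀ E₀ F₁ E₁) in
/-- The odd variables `(φ₁, φ₀‡)`. -/
abbrev Od : Type _ := Sec d F₁ E₁ × DualSec d F₀ E₀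

/-- The even components. -/
def evenPart (w : Tot d F₀ E₀ F₁ E₁) : Ev d F₀ E₀ F₁ E₁ := (w.1.1, w.2.2)

/-- The odd components. -/
def oddPart (w : Tot d F₀ E₀ F₁ E₁) : Od d F₀ E₀ F₁ E₁ := (w.1.2, w.2.1)

/-- The support of a multiplet of fields and antifields. -/
def totSupp (w : Tot d F₀ E₀ F₁ E₁) : Set M := supp w.1 ∪ supp w.2

variable (d F₀ E₀ F₁ E₁) in
/-- `Λ`-valued multiplets of fields and antifields. -/
abbrev Conf : Type _ := GrVec (Tot d F₀ E₀ F₁ E₁)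

/-- The `Λ`-points of the graded space of fields and antifields: even variables have even
coefficients, odd variables have odd ones, and only the even fields `φ₀` have a (real) body; the
antifields are formal variables. -/
def IsPoint (Φ : Conf d F₀ E₀ F₁ E₁) : Prop :=
  (∀ I : Finset ℕ, Even I.card → oddPart (Φ I).1 = 0 ∧ oddPart (Φ I).2 = 0) ∧
  (∀ I : Finset ℕ, Odd I.card → evenPart (Φ I).1 = 0 ∧ evenPart (Φ I).2 = 0) ∧
  (Φ ∅).2 = 0 ∧ (Φ ∅).1.2 = 0

/-! ### Graded functionals -/

variable (d F₀ E₀ F₁ E₁) in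
/-- A functional on the graded space, by its values on `Λ`-valued configurations. -/
abbrev Functional : Type _ := Conf d F₀ E₀ F₁ E₁ → Grassmann

variable (d F₀ E₀ F₁ E₁) in
/-- The homogeneous components of a graded functional: `c k v w` is the part that is alternating
multilinear in the `k` odd arguments `w`, at the even configuration `v`. -/
abbrev Components : Type _ :=
  (k : ℕ) → Ev d F₀ E₀ F₁ E₁ → (Fin k → Od d F₀ E₀ F₁ E₁) → ℂ

/-- The mixed directional derivative of order `j` of the `k`-th component in the even directions
`a 0, …, a (j - 1)`. -/
def mixedDeriv (c : Components d F₀ E₀ F₁ E₁) (k j : ℕ) (v : Ev d F₀ E₀ F₁ E₁)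
    (a : Fin j → Ev d F₀ E₀ F₁ E₁) (w : Fin k → Od d F₀ E₀ F₁ E₁) : ℂ :=
  iteratedFDeriv ℝ j (fun s : Fin j → ℝ ↦ c k (v + ∑ i, s i • a i) w) 0
    (fun i ↦ Pi.single i 1)

/-- The elements `θ_I` and `i θ_I` of the real basis of `Λ`. -/
def elt (i : Finset ℕ × Bool) : Grassmann := (if i.2 then Complex.I else 1 : ℂ) • θ i.1

/-- The coefficient of `Φ` at `θ_I` or `i θ_I`. -/
def coef (Φ : Conf d F₀ E₀ F₁ E₁) (i : Finset ℕ × Bool) : Tot d F₀ E₀ F₁ E₁ :=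
  if i.2 then (Φ i.1).2 else (Φ i.1).1

/-- The body of a configuration. -/
def body (Φ : Conf d F₀ E₀ F₁ E₁) : Ev d F₀ E₀ F₁ E₁ := ((Φ ∅).1.1.1, 0)

/-- Indices of the nilpotent even coefficients. -/
def evenIdx (Φ : Conf d F₀ E₀ F₁ E₁) : Finset (Finset ℕ × Bool) :=
  (Φ.support.filter fun I ↦ I.Nonempty ∧ Even I.card) ×ˢ Finset.univ

/-- Indices of the odd coefficients. -/
def oddIdx (Φ : Conf d F₀ E₀ F₁ E₁) : Finset (Finset ℕ × Bool) :=
  (Φ.support.filter fun I ↦ Odd I.card) ×ˢ Finset.univ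

/-- The number of generators of `Λ` that occur in `Φ`. -/
def numGen (Φ : Conf d F₀ E₀ F₁ E₁) : ℕ := (Φ.support.biUnion id).card

/-- The value of a graded functional at a `Λ`-point `Φ = v + n + ψ`, with body `v`, nilpotent even
part `n` and odd part `ψ`, by the (finite) Taylor expansion
`∑ j k, 1/(j! k!) • D^j c_k(v)(n, …, n; ψ, …, ψ)`. -/
def eval (c : Components d F₀ E₀ F₁ E₁) : Functional d F₀ E₀ F₁ E₁ := fun Φ ↦
  ∑ j ∈ Finset.range (numGen Φ + 1), ∑ k ∈ Finset.range (numGen Φ + 1),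
    ((j.factorial * k.factorial : ℕ) : ℂ)⁻¹ •
      ∑ a ∈ Fintype.piFinset (fun _ : Fin j ↦ evenIdx Φ),
        ∑ b ∈ Fintype.piFinset (fun _ : Fin k ↦ oddIdx Φ),
          mixedDeriv c k j (body Φ) (fun i ↦ evenPart (coef Φ (a i)))
              (fun i ↦ oddPart (coef Φ (b i))) •
            ((List.ofFn fun i ↦ elt (a i)).prod * (List.ofFn fun i ↦ elt (b i)).prod)

section Local

variable [MeasurableSpace M]

/-- The graded functional with components `c` is local and compactly supported:
`c_k(v; w) = ∫ ℓ_k(j^r_x v; j^r_x w) dμ(x)`, where `ℓ_k` is a smooth function on the bundle of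
`r`-jets, alternating multilinear in the jets of the odd variables, that vanishes for `x` outside a
compact set. Smoothness on the jet bundle is expressed by smoothness in `(s, x)` after insertion of
smooth families `(v_s, w_s)`; local coordinates of the jet bundle are such families. -/
def IsLocal (μ : Measure M) (c : Components d F₀ E₀ F₁ E₁) : Prop :=
  ∃ (K : Set M) (r : ℕ)
    (ℓ : (k : ℕ) → Ev d F₀ E₀ F₁ E₁ → (Fin k → Od d F₀ E₀ F₁ E₁) → M → ℂ),
    IsCompact K ∧
    (∀ k v w, c k v w = ∫ x, ℓ k v w x ∂μ) ∧
    (∀ k v w, ∀ x ∉ K, ℓ k v w x = 0) ∧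
    (∀ k x v v' w w', SameJet r x v.1 v'.1 → SameJet r x v.2 v'.2 →
      (∀ i, SameJet r x (w i).1 (w' i).1) → (∀ i, SameJet r x (w i).2 (w' i).2) →
      ℓ k v w x = ℓ k v' w' x) ∧
    (∀ k v x, ∃ A : Od d F₀ E₀ F₁ E₁ [⋀^Fin k]→ₗ[ℝ] ℂ, ∀ w, ℓ k v w x = A w) ∧
    (∀ (k n : ℕ) (v : (Fin n → ℝ) → Ev d F₀ E₀ F₁ E₁)
      (w : Fin k → (Fin n → ℝ) → Od d F₀ E₀ F₁ E₁),
      SmoothFamily (fun s ↦ (v s).1) → SmoothFamily (fun s ↦ (v s).2) →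
      (∀ i, SmoothFamily (fun s ↦ (w i s).1)) → (∀ i, SmoothFamily (fun s ↦ (w i s).2)) →
      ContMDiff (𝓘(ℝ, Fin n → ℝ).prod (𝓡 d)) 𝓘(ℝ, ℂ) ∞
        (fun p : (Fin n → ℝ) × M ↦ ℓ k (v p.1) (fun i ↦ w i p.1) p.2))

variable (d F₀ E₀ F₁ E₁) in
/-- The compactly supported local functionals of fields and antifields. -/
def Floc (μ : Measure M) : Set (Functional d F₀ E₀ F₁ E₁) := {F | ∃ c, IsLocal μ c ∧ F = eval c}

variable (d F₀ E₀ F₁ E₁) in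
/-- The algebra `BV` of multilocal functionals of fields and antifields. -/
def multilocal (μ : Measure M) : Subalgebra ℂ (Functional d F₀ E₀ F₁ E₁) :=
  Algebra.adjoin ℂ (Floc d F₀ E₀ F₁ E₁ μ)

/-- The spacetime support of a functional. -/
def fsupp (F : Functional d F₀ E₀ F₁ E₁) : Set M :=
  {x | ∀ U ∈ 𝓝 x, ∃ Φ Φ' : Conf d F₀ E₀ F₁ E₁, IsPoint Φ ∧ IsPoint Φ' ∧
    (∀ I, totSupp (Φ' I).1 ⊆ U ∧ totSupp (Φ' I).2 ⊆ U) ∧ F (Φ + Φ') ≠ F Φ}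

/-- `f ↦ L f` is a generalized Lagrangian (only the values at cutoff functions `f` matter). -/
structure IsGenLagrangian (μ : Measure M) (L : (M → ℝ) → Functional d F₀ E₀ F₁ E₁) : Prop where
  isLocal : ∀ f, IsTest d f → L f ∈ Floc d F₀ E₀ F₁ E₁ μ
  additive : ∀ f g h, IsTest d f → IsTest d g → IsTest d h → tsupport f ∩ tsupport h = ∅ →
    ∀ Φ, IsPoint Φ → L (f + g + h) Φ = L (f + g) Φ - L g Φ + L (g + h) Φ
  support : ∀ f, IsTest d f → fsupp (L f) ⊆ tsupport f

end Local

/-- `F` is even. -/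
def IsEvenFunctional (F : Functional d F₀ E₀ F₁ E₁) : Prop :=
  ∀ Φ, IsPoint Φ →
    F (Φ.mapRange (fun z ↦ (((z.1.1.1, -z.1.1.2), (-z.1.2.1, z.1.2.2)),
      ((z.2.1.1, -z.2.1.2), (-z.2.2.1, z.2.2.2)))) (by simp)) = F Φ

/-- The part of `F` that contains neither antifields nor odd fields is real. -/
def HasRealBody (F : Functional d F₀ E₀ F₁ E₁) : Prop :=
  ∀ φ : Sec d F₀ E₀, ∃ a : ℝ,
    F (Finsupp.single ∅ (((φ, 0), (0, 0)), 0)) = algebraMap ℂ Grassmann (a : ℂ)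

/-- `F` is homogeneous of degree two in fields and antifields. -/
def IsQuadratic (F : Functional d F₀ E₀ F₁ E₁) : Prop :=
  ∀ Φ, IsPoint Φ → ∀ a : ℝ, F (a • Φ) = ((a : ℂ) ^ 2) • F Φ

/-- `F` is of total antifield number `m`. -/
def HasAntifieldNumber (m : ℕ) (F : Functional d F₀ E₀ F₁ E₁) : Prop :=
  ∀ Φ, IsPoint Φ → ∀ a : ℝ,
    F (Φ.mapRange (fun z ↦ ((z.1.1, (a • z.1.2.1, a • z.1.2.2)),
      (z.2.1, (a • z.2.2.1, a • z.2.2.2))))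
      (by simp [smul_zero])) =
      ((a : ℂ) ^ m) • F Φ

/-! ### Functional derivatives and the antibracket -/

variable (d F₀ E₀ F₁ E₁) in
/-- Pairs `(∂/∂φ, ∂/∂φ‡)` of derivatives, in the bundles dual to those of `(φ, φ‡)`. -/
abbrev Der : Type _ := Antifields d F₀ E₀ F₁ E₁ × Fields d F₀ E₀ F₁ E₁

section Brackets

variable [MeasurableSpace M]

/-- `⟨w, u⟩ = ∫ w · u dμ`. -/
def pairing (μ : Measure M) (w : Tot d F₀ E₀ F₁ E₁) (u : Der d F₀ E₀ F₁ E₁) : ℝ :=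
  ∫ x, (u.1.1 x (w.1.1 x) + u.1.2 x (w.1.2 x) + w.2.1 x (u.2.1 x) + w.2.2 x (u.2.2 x)) ∂μ

/-- The `Λ`-valued pairing `⟨w, U⟩ = ∑ I, ⟨w, U_I⟩ θ_I`. -/
def grPairing (μ : Measure M) (w : Tot d F₀ E₀ F₁ E₁) (U : GrVec (Der d F₀ E₀ F₁ E₁)) :
    Grassmann :=
  U.sum fun I z ↦ ((pairing μ w z.1 : ℂ) + Complex.I * (pairing μ w z.2 : ℂ)) • θ I

/-- `U = (δ_l S/δφ, δ_l S/δφ‡)` at `Φ`, for the action `S` given by `f ↦ L f`: for every compactly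
supported direction `w` and `f ≡ 1` near its support, `L f (Φ + η w) = L f Φ + η ⟨w, U⟩`, where `η`
is `θ_n θ_{n+1}` for even `w` and `θ_n` for odd `w`, with generators that do not occur elsewhere.
For a functional (constant `L`) this is the left functional derivative. -/
def IsLeftDeriv (μ : Measure M) (L : (M → ℝ) → Functional d F₀ E₀ F₁ E₁)
    (Φ : Conf d F₀ E₀ F₁ E₁) (U : GrVec (Der d F₀ E₀ F₁ E₁)) : Prop :=
  ∀ w : Tot d F₀ E₀ F₁ E₁, IsCompact (totSupp w) →
    ∀ f, IsTest d f → (∀ x ∈ totSupp w, ∀ᶠ y in 𝓝 x, f y = 1) →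
      (oddPart w = 0 → ∀ᶠ n : ℕ in atTop,
        L f (Φ + Finsupp.single {n, n + 1} (w, 0)) =
          L f Φ + θ {n, n + 1} * grPairing μ w U) ∧
      (evenPart w = 0 → ∀ᶠ n : ℕ in atTop,
        L f (Φ + Finsupp.single {n} (w, 0)) = L f Φ + θ {n} * grPairing μ w U)

open Classical in
/-- The left functional derivative of the action `f ↦ L f` at `Φ`. -/
def leftDeriv (μ : Measure M) (L : (M → ℝ) → Functional d F₀ E₀ F₁ E₁)
    (Φ : Conf d F₀ E₀ F₁ E₁) : GrVec (Der d F₀ E₀ F₁ E₁) :=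
  if h : ∃ U, IsLeftDeriv μ L Φ U then h.choose else 0

/-- `a = ⟨δ_r X, q⟩` at `Φ`, for an odd `Λ`-valued direction `q`:
`X (Φ + q η) = X Φ + a η` for a generator `η` that does not occur elsewhere. -/
def IsRightDeriv (X : Functional d F₀ E₀ F₁ E₁) (Φ q : Conf d F₀ E₀ F₁ E₁) (a : Grassmann) :
    Prop :=
  ∀ᶠ n : ℕ in atTop, X (Φ + GrVec.mulRight n q) = X Φ + a * θ {n}

open Classical in
/-- `⟨δ_r X, q⟩` at `Φ`, for an odd `Λ`-valued direction `q`. -/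
def rightDeriv (X : Functional d F₀ E₀ F₁ E₁) (Φ q : Conf d F₀ E₀ F₁ E₁) : Grassmann :=
  if h : ∃ a, IsRightDeriv X Φ q a then h.choose else 0

/-- The odd vector field `(δ_l S/δφ‡, -δ_l S/δφ)` of an even action `S`. -/
def hamiltonian (μ : Measure M) (L : (M → ℝ) → Functional d F₀ E₀ F₁ E₁)
    (Φ : Conf d F₀ E₀ F₁ E₁) : Conf d F₀ E₀ F₁ E₁ :=
  (leftDeriv μ L Φ).mapRange (fun z ↦ ((z.1.2, -z.1.1), (z.2.2, -z.2.1))) (by simp)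

/-- The antibracket `{X, S} = ⟨δ_r X/δφ, δ_l S/δφ‡⟩ - ⟨δ_r X/δφ‡, δ_l S/δφ⟩` of a functional `X` with
an even action (or, for constant `L`, an even functional) `S`. -/
def antibracket (μ : Measure M) (X : Functional d F₀ E₀ F₁ E₁)
    (L : (M → ℝ) → Functional d F₀ E₀ F₁ E₁) : Functional d F₀ E₀ F₁ E₁ :=
  fun Φ ↦ rightDeriv X Φ (hamiltonian μ L Φ)

/-- The derivatives that enter the antibracket `{X, S}` exist at `Φ`. -/
def AntibracketDefined (μ : Measure M) (X : Functional d F₀ E₀ F₁ E₁)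
    (L : (M → ℝ) → Functional d F₀ E₀ F₁ E₁) (Φ : Conf d F₀ E₀ F₁ E₁) : Prop :=
  (∃ U, IsLeftDeriv μ L Φ U) ∧ ∃ a, IsRightDeriv X Φ (hamiltonian μ L Φ) a

/-- The left-hand side `½ {S, S}` of the classical master equation, with cutoff `f`. -/
def cme (μ : Measure M) (L : (M → ℝ) → Functional d F₀ E₀ F₁ E₁) :
    (M → ℝ) → Functional d F₀ E₀ F₁ E₁ :=
  fun f ↦ (2⁻¹ : ℂ) • antibracket μ (L f) (fun _ ↦ L f)

/-- The classical master equation: `½ {L f, L f}` vanishes up to terms supported in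
`supp df`. -/
def SatisfiesCME (μ : Measure M) (L : (M → ℝ) → Functional d F₀ E₀ F₁ E₁) : Prop :=
  ∀ f, IsTest d f → fsupp (cme μ L f) ⊆ dsupp d f

/-- The components `δ_l S/δφ` of a left derivative. -/
def fieldDeriv (μ : Measure M) (L : (M → ℝ) → Functional d F₀ E₀ F₁ E₁)
    (Φ : Conf d F₀ E₀ F₁ E₁) : GrVec (Antifields d F₀ E₀ F₁ E₁) :=
  (leftDeriv μ L Φ).mapRange (fun z ↦ (z.1.1, z.2.1)) rfl

end Brackets

/-! ### Green functions and the Møller map -/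

variable (d F₀ E₀ F₁ E₁) in
/-- Compactly supported complexified sections of the dual bundles. -/
abbrev CompactAntifields : Type _ :=
  CompactlySupported d (F₀ →L[ℝ] ℝ) (fun x ↦ E₀ x →L[ℝ] ℝ) (F₁ →L[ℝ] ℝ) (fun x ↦ E₁ x →L[ℝ] ℝ)

variable (d F₀ E₀ F₁ E₁) in
/-- Complexified linear operators from fields to sections of the dual bundles. -/
abbrev FieldOperator : Type _ :=
  Cx (Fields d F₀ E₀ F₁ E₁) →ₗ[ℝ] Cx (Antifields d F₀ E₀ F₁ E₁)

variable (d F₀ E₀ F₁ E₁) in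
/-- Candidates for Green functions of a field operator. -/
abbrev GreenOperator : Type _ :=
  CompactAntifields d F₀ E₀ F₁ E₁ →ₗ[ℝ] Cx (Fields d F₀ E₀ F₁ E₁)

/-- `Δ` is a complex linear Green function of `P` with `supp Δ u ⊆ J (supp u)`. -/
structure IsGreen (J : Set M → Set M) (P : FieldOperator d F₀ E₀ F₁ E₁)
    (Δ : GreenOperator d F₀ E₀ F₁ E₁) : Prop where
  mulI : ∀ u v : CompactAntifields d F₀ E₀ F₁ E₁,
    (v : Cx (Antifields d F₀ E₀ F₁ E₁)) = Cx.mulI (u : Cx (Antifields d F₀ E₀ F₁ E₁)) →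
      Δ v = Cx.mulI (Δ u)
  right_inv : ∀ u, P (Δ u) = u
  left_inv : ∀ (z : Cx (Fields d F₀ E₀ F₁ E₁)) (u : CompactAntifields d F₀ E₀ F₁ E₁),
    IsCompact (cxSupp z) → (u : Cx (Antifields d F₀ E₀ F₁ E₁)) = P z → Δ u = z
  support : ∀ u, cxSupp (Δ u) ⊆ J (cxSupp (u : Cx (Antifields d F₀ E₀ F₁ E₁)))

/-- `P` has a unique retarded and a unique advanced Green function. -/
def GreenHyperbolic [IsManifold (𝓡 d) ∞ M] (g : LorentzStructure d M)
    (P : FieldOperator d F₀ E₀ F₁ E₁) : Prop :=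
  (∃! Δ, IsGreen g.future P Δ) ∧ ∃! Δ, IsGreen g.past P Δ

/-- `P` is the operator of the field equations of the antifield-free quadratic action `S₀₀`:
`δ_l S₀₀/δφ = P φ`. -/
def IsFieldEquation [MeasurableSpace M] (μ : Measure M)
    (L : (M → ℝ) → Functional d F₀ E₀ F₁ E₁) (P : FieldOperator d F₀ E₀ F₁ E₁) : Prop :=
  ∀ Φ, IsPoint Φ → ∃ U, IsLeftDeriv μ L Φ U ∧
    ∀ I, ((U I).1.1, (U I).2.1) = P ((Φ I).1.1, (Φ I).2.1)

open Classical in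
/-- A Green function applied to the complexified section `z` (zero, if the support of `z` is not
compact). -/
def applyGreen (Δ : GreenOperator d F₀ E₀ F₁ E₁) (z : Cx (Antifields d F₀ E₀ F₁ E₁)) :
    Cx (Fields d F₀ E₀ F₁ E₁) :=
  if h : z ∈ CompactlySupported d (F₀ →L[ℝ] ℝ) (fun x ↦ E₀ x →L[ℝ] ℝ)
    (F₁ →L[ℝ] ℝ) (fun x ↦ E₁ x →L[ℝ] ℝ) then Δ ⟨z, h⟩ else 0

set_option linter.unusedSectionVars false in
theorem applyGreen_zero (Δ : GreenOperator d F₀ E₀ F₁ E₁) : applyGreen Δ 0 = 0 := by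
  unfold applyGreen
  rw [dif_pos (Submodule.zero_mem _)]
  exact map_zero Δ

/-- The `Λ`-valued direction `Δ u` in field space (with vanishing antifield components). -/
def greenDirection (Δ : GreenOperator d F₀ E₀ F₁ E₁)
    (u : GrVec (Antifields d F₀ E₀ F₁ E₁)) : Conf d F₀ E₀ F₁ E₁ :=
  u.mapRange (fun z ↦ (((applyGreen Δ z).1, 0), ((applyGreen Δ z).2, 0)))
    (by simp [applyGreen_zero])

/-- The map `φ ↦ φ + Δ (δ_l V/δφ)`, `φ‡ ↦ φ‡` of configurations. -/
def mollerField [MeasurableSpace M] (μ : Measure M) (Δ : GreenOperator d F₀ E₀ F₁ E₁)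
    (V : Functional d F₀ E₀ F₁ E₁) (Φ : Conf d F₀ E₀ F₁ E₁) : Conf d F₀ E₀ F₁ E₁ :=
  Φ + greenDirection Δ (fieldDeriv μ (fun _ ↦ V) Φ)

/-- The inverse classical Møller map on functionals. -/
def mollerInv [MeasurableSpace M] (μ : Measure M) (Δ : GreenOperator d F₀ E₀ F₁ E₁)
    (V X : Functional d F₀ E₀ F₁ E₁) : Functional d F₀ E₀ F₁ E₁ :=
  fun Φ ↦ X (mollerField μ Δ V Φ)

/-- All coefficients of `u` are compactly supported. -/
def HasCompactCoefficients (u : GrVec (Antifields d F₀ E₀ F₁ E₁)) : Prop :=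
  ∀ I, IsCompact (cxSupp (u I))

end FieldTheory

end BV

end

/-!
The formula compares values of the right derivative of `X` at the image `r(Φ)` of the Møller map.
That derivative exists and is additive in the direction (`exists_rightDeriv`), so the formula
reduces to an identity between three directions, `ham_mollerField_add`: the Hamiltonian vector field
of `S₀` at `r(Φ)`, plus the retarded Green function applied to the field derivative of `½ {S, S}`,
is the image under `dr` of the Hamiltonian vector field of `S` at `Φ`.

*Differentiation.* The evaluation of a graded functional on Grassmann-valued fields is a finite
Taylor expansion around the body, written as an exponential sum over words. Hence an increment of
the argument all of whose terms contain one new Grassmann generator changes the value by its first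
order term (`eval_add_single`, `eval_add_mulRight`). First and second derivatives of a local
functional are sums of integrals of differential operators; such an operator has an adjoint
(`IsDiffOp.exists_adjoint`, by induction on the order with commutators with coordinate functions),
so these derivatives are pairings with compactly supported smooth sections, called `variation` and
`secondVariation`. A section is determined by its pairings, so functional derivatives are unique
(`IsLeftDeriv.leftDeriv_eq`).

*The free action.* For a quadratic local functional `F` one has `F(tΦ) = t² F(Φ)`, which forces the
variation to be given by a complex linear operator, the second derivative at the origin
(`exists_linear_variation`). These operators, for cutoff functions equal to `1` on varying open
sets, glue to the Hessian `h` of the quadratic Lagrangian (`IsGenLagrangian.exists_isHessian`). The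
left derivative of `½ {S, S}` is the second variation of `S` in the direction of the Hamiltonian
vector field of `S` (`IsHessian.isLeftDeriv_cme`). For `S₀` it is linear in `Φ`, and the master
equation says that it vanishes near every point: `h J h = 0` with the symplectic involution `J`
(`IsHessian.nilpotent`). Counting antifields splits `h` into the field operator `P` of `S₀₀` and two
operators `K` (from fields to fields) and `K'` (from antifields to antifields) of `θ₀`; nilpotency
gives `P K = K' P` (`fieldOp_brstOp`).

*The Green function.* No causal geometry beyond the monotonicity of `J⁺` is needed, because the
uniqueness of the retarded Green function `Δ` does the work. As `Δ + K Δ - Δ K'` is again a retarded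
Green function, `K Δ = Δ K'` (`IsGreen.intertwine`). In the same way `Δ` preserves parity and is
real on even fields (`IsGreen.splitting`), so that `r` maps points to points
(`isPoint_mollerField`).

Write `U` for the variation of `V` at `Φ`, `Q` for the Hamiltonian vector field of `S` at `Φ`, and
`W` for the second variation of `V` along `Q`. Then `r(Φ) = Φ + Δ U` and `dr(Q) = Q + Δ W`, the
derivative of `½ {S, S}` is `h Q + W`, and `h Q = h J U` by nilpotency. The relations `P Δ = 1` and
`K Δ = Δ K'` turn the claimed identity into an identity of sections for each Grassmann coefficient.
-/

noncomputable section

set_option linter.unusedSectionVars false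

namespace BV

/-! ### Products and coefficients in the Grassmann algebra -/

/-- The basis `(θ_I)` of the Grassmann algebra. -/
def thetaBasis : Module.Basis (Finset ℕ) ℂ Grassmann :=
  (Finsupp.basisSingleOne : Module.Basis ℕ ℂ (ℕ →₀ ℂ)).ExteriorAlgebra

theorem thetaBasis_apply (I : Finset ℕ) : thetaBasis I = θ I := rfl

/-- The coefficient of an element of the Grassmann algebra at `θ_I`. -/
def coeffAt (I : Finset ℕ) : Grassmann →ₗ[ℂ] ℂ := thetaBasis.coord I

theorem coeffAt_θ (I J : Finset ℕ) : coeffAt I (θ J) = if J = I then 1 else 0 := by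
  rw [← thetaBasis_apply, coeffAt, Module.Basis.coord_apply, Module.Basis.repr_self,
    Finsupp.single_apply]

theorem coeffAt_eq_repr (I : Finset ℕ) (a : Grassmann) : coeffAt I a = thetaBasis.repr a I := rfl

theorem ext_coeffAt {a b : Grassmann} (h : ∀ I, coeffAt I a = coeffAt I b) : a = b :=
  thetaBasis.ext_elem h

theorem sum_coeffAt (a : Grassmann) :
    a = (thetaBasis.repr a).sum fun I z ↦ z • θ I := by
  conv_lhs => rw [← thetaBasis.linearCombination_repr a]
  rfl

/-- The generator `θ_n`, as an element of degree one. -/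
def gen (n : ℕ) : Grassmann := ExteriorAlgebra.ι ℂ (Finsupp.single n 1)

theorem θ_eq_ιMulti (I : Finset ℕ) :
    θ I = ExteriorAlgebra.ιMulti ℂ I.card (fun i ↦ Finsupp.single (I.orderEmbOfFin rfl i) 1) := by
  unfold θ
  rw [ExteriorAlgebra.basis_apply_ofCard (n := I.card) _ rfl]
  simp only [ExteriorAlgebra.ιMulti_family]
  rfl

theorem θ_eq_prod (I : Finset ℕ) :
    θ I = (List.ofFn fun i ↦ gen (I.orderEmbOfFin rfl i)).prod := by
  rw [θ_eq_ιMulti, ExteriorAlgebra.ιMulti_apply]; rfl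

theorem θ_empty : θ ∅ = 1 := by
  rw [θ_eq_prod]; simp

theorem θ_singleton (n : ℕ) : θ {n} = gen n := by
  have h : ∀ i, ({n} : Finset ℕ).orderEmbOfFin rfl i = n := fun i ↦
    Finset.mem_singleton.1 (Finset.orderEmbOfFin_mem _ _ _)
  rw [θ_eq_prod]
  simp only [h]
  simp

theorem θ_insert {I : Finset ℕ} {n : ℕ} (h : ∀ i ∈ I, i < n) : θ (insert n I) = θ I * θ {n} := by
  have hn : n ∉ I := fun hn ↦ (h n hn).false
  have hc : (insert n I).card = I.card + 1 := Finset.card_insert_of_notMem hn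
  have key : ∀ (k : ℕ) (J : Finset ℕ) (hk : J.card = k),
      θ J = (List.ofFn fun i ↦ gen (J.orderEmbOfFin hk i)).prod := by
    rintro k J rfl; exact θ_eq_prod J
  rw [key _ _ hc, key _ I rfl, θ_singleton]
  have hs : (fun i ↦ (insert n I).orderEmbOfFin hc i) =
      Fin.snoc (α := fun _ ↦ ℕ) (fun i ↦ I.orderEmbOfFin rfl i) n := by
    symm
    apply Finset.orderEmbOfFin_unique
    · intro i
      refine Fin.lastCases ?_ (fun i ↦ ?_) i
      · simp
      · simp only [Fin.snoc_castSucc]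
        exact Finset.mem_insert_of_mem (Finset.orderEmbOfFin_mem _ _ _)
    · intro i j hij
      revert hij
      refine Fin.lastCases ?_ (fun j ↦ ?_) j
      · refine Fin.lastCases ?_ (fun i ↦ ?_) i
        · intro h; exact absurd h (lt_irrefl _)
        · intro _
          simp only [Fin.snoc_castSucc, Fin.snoc_last]
          exact h _ (Finset.orderEmbOfFin_mem _ _ _)
      · refine Fin.lastCases ?_ (fun i ↦ ?_) i
        · intro h; exact absurd h (not_lt.2 (Fin.le_last _))
        · intro hij
          simp only [Fin.snoc_castSucc]
          exact (OrderEmbedding.lt_iff_lt _).2 (by simpa using hij)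
  have hs' : (fun i ↦ gen ((insert n I).orderEmbOfFin hc i)) =
      fun i ↦ gen (Fin.snoc (α := fun _ ↦ ℕ) (fun i ↦ I.orderEmbOfFin rfl i) n i) := by
    ext1 i; rw [← hs]
  rw [hs', List.ofFn_succ', List.concat_eq_append, List.prod_append]
  simp

theorem θ_mul_of_not_disjoint {I J : Finset ℕ} (h : ¬ Disjoint I J) : θ I * θ J = 0 :=
  ExteriorAlgebra.basis_mul_of_not_disjoint (m := I.card) (n := J.card)
    (Finsupp.basisSingleOne : Module.Basis ℕ ℂ (ℕ →₀ ℂ))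
    ⟨I, by simp⟩ ⟨J, by simp⟩ h

theorem θ_mul_of_disjoint {I J : Finset ℕ} (h : Disjoint I J) :
    ∃ s : ℤˣ, θ I * θ J = s • θ (I ∪ J) := by
  have key : ∀ {m n : ℕ} (s : Set.powersetCard ℕ m) (t : Set.powersetCard ℕ n)
      (_ : Disjoint s.val t.val), ∃ u : ℤˣ, θ s.val * θ t.val = u • θ (s.val ∪ t.val) := by
    intro m n s t h
    refine ⟨(Set.powersetCard.permOfDisjoint h).sign, (ExteriorAlgebra.basis_mul_of_disjoint
      (Finsupp.basisSingleOne : Module.Basis ℕ ℂ (ℕ →₀ ℂ)) s t h).trans ?_⟩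
    rw [← Finset.disjUnion_eq_union _ _ h]
    rfl
  exact key (m := I.card) (n := J.card) ⟨I, by simp⟩ ⟨J, by simp⟩ h

/-- The grading involution of the Grassmann algebra. -/
def inv : Grassmann →ₐ[ℂ] Grassmann := CliffordAlgebra.involute

theorem inv_inv (a : Grassmann) : inv (inv a) = a := CliffordAlgebra.involute_involute a

theorem inv_θ (I : Finset ℕ) : inv (θ I) = (-1 : ℂ) ^ I.card • θ I := by
  rw [θ_eq_prod, List.ofFn_eq_map]
  have := CliffordAlgebra.involute_prod_map_ι (Q := (0 : QuadraticForm ℂ (ℕ →₀ ℂ)))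
    ((List.finRange I.card).map fun i ↦ Finsupp.single (I.orderEmbOfFin rfl i) (1 : ℂ))
  rw [List.map_map, List.length_map, List.length_finRange] at this
  exact this

theorem inv_mul_of_odd {x : Grassmann} (hx : inv x = -x) (y : Grassmann) :
    x * y = inv y * x := by
  have hι (y : Grassmann) (m : ℕ →₀ ℂ) :
      ExteriorAlgebra.ι ℂ m * y = inv y * ExteriorAlgebra.ι ℂ m := by
    induction y using ExteriorAlgebra.induction with
    | algebraMap r => rw [AlgHom.commutes, Algebra.commutes]
    | ι m' =>
      have : inv (ExteriorAlgebra.ι ℂ m') = -ExteriorAlgebra.ι ℂ m' :=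
        CliffordAlgebra.involute_ι _
      rw [this, neg_mul, eq_neg_iff_add_eq_zero]
      exact ExteriorAlgebra.ι_add_mul_swap m m'
    | mul a b ha hb => rw [map_mul, ← mul_assoc, ha, mul_assoc, hb, mul_assoc]
    | add a b ha hb => rw [map_add, mul_add, add_mul, ha, hb]
  induction y using ExteriorAlgebra.induction with
  | algebraMap r => rw [AlgHom.commutes, Algebra.commutes]
  | ι m' =>
    have : inv (ExteriorAlgebra.ι ℂ m') = -ExteriorAlgebra.ι ℂ m' :=
      CliffordAlgebra.involute_ι _
    rw [this, neg_mul, hι, hx]; simp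
  | mul a b ha hb => rw [map_mul, ← mul_assoc, ha, mul_assoc, hb, mul_assoc]
  | add a b ha hb => rw [map_add, mul_add, add_mul, ha, hb]

theorem commute_of_even {x : Grassmann} (hx : inv x = x) (y : Grassmann) : x * y = y * x := by
  have hι (m : ℕ →₀ ℂ) :
      ExteriorAlgebra.ι ℂ m * x = inv x * ExteriorAlgebra.ι ℂ m :=
    inv_mul_of_odd (CliffordAlgebra.involute_ι _) x
  induction y using ExteriorAlgebra.induction with
  | algebraMap r => rw [Algebra.commutes]
  | ι m' => rw [hι, hx]
  | mul a b ha hb => rw [← mul_assoc, ha, mul_assoc, hb, mul_assoc]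
  | add a b ha hb => rw [mul_add, add_mul, ha, hb]

theorem inv_θ_of_even {I : Finset ℕ} (h : Even I.card) : inv (θ I) = θ I := by
  rw [inv_θ, h.neg_one_pow, one_smul]

theorem inv_θ_of_odd {I : Finset ℕ} (h : Odd I.card) : inv (θ I) = -θ I := by
  rw [inv_θ, h.neg_one_pow, neg_smul, one_smul]

theorem coeffAt_inv (I : Finset ℕ) (a : Grassmann) :
    coeffAt I (inv a) = (-1 : ℂ) ^ I.card * coeffAt I a := by
  have : (coeffAt I).comp inv.toLinearMap = (-1 : ℂ) ^ I.card • coeffAt I := by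
    refine thetaBasis.ext fun J ↦ ?_
    rw [thetaBasis_apply]
    simp only [LinearMap.comp_apply, AlgHom.toLinearMap_apply, inv_θ, map_smul, coeffAt_θ,
      LinearMap.smul_apply]
    split_ifs with h
    · rw [h]
    · simp
  exact LinearMap.congr_fun this a

theorem coeffAt_θ_mul (J I : Finset ℕ) (a : Grassmann) (h : ¬ J ⊆ I) : coeffAt I (θ J * a) = 0 := by
  have : (coeffAt I).comp (LinearMap.mulLeft ℂ (θ J)) = 0 := by
    refine thetaBasis.ext fun L ↦ ?_
    rw [thetaBasis_apply]
    simp only [LinearMap.comp_apply, LinearMap.mulLeft_apply, LinearMap.zero_apply]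
    by_cases hd : Disjoint J L
    · obtain ⟨s, hs⟩ := θ_mul_of_disjoint hd
      rw [hs, Units.smul_def, map_zsmul, coeffAt_θ, if_neg, smul_zero]
      rintro rfl
      exact h Finset.subset_union_left
    · rw [θ_mul_of_not_disjoint hd, map_zero]
  exact LinearMap.congr_fun this a

/-- An element `a` in which the generators of `θ_J` do not occur can be cancelled in `θ_J a`. -/
theorem θ_mul_cancel {J : Finset ℕ} {a : Grassmann} (h : θ J * a = 0)
    (hJ : ∀ I, coeffAt I a ≠ 0 → Disjoint J I) : a = 0 := by
  refine ext_coeffAt fun I ↦ ?_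
  rw [map_zero]
  by_contra hI
  have hd := hJ I hI
  have h1 : coeffAt (J ∪ I) (θ J * a) ≠ 0 := by
    rw [sum_coeffAt a, Finsupp.sum, Finset.mul_sum, map_sum, Finset.sum_eq_single I]
    · obtain ⟨s, hs⟩ := θ_mul_of_disjoint hd
      rw [mul_smul_comm, hs, map_smul, Units.smul_def, map_zsmul, coeffAt_θ, if_pos rfl]
      rcases Int.units_eq_one_or s with rfl | rfl
      · simpa [coeffAt_eq_repr] using hI
      · simpa [coeffAt_eq_repr] using hI
    · intro L hL hLI
      have hdL : Disjoint J L := hJ L (by simpa [coeffAt_eq_repr] using hL)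
      obtain ⟨s, hs⟩ := θ_mul_of_disjoint hdL
      rw [mul_smul_comm, hs, map_smul, Units.smul_def, map_zsmul, coeffAt_θ, if_neg]
      · simp
      · intro he
        apply hLI
        have := congrArg (· \ J) he
        simpa [Finset.union_sdiff_left, Finset.sdiff_eq_self_of_disjoint hdL.symm,
          Finset.sdiff_eq_self_of_disjoint hd.symm] using this
    · intro hI'
      exact absurd (by simpa [coeffAt_eq_repr] using hI' : coeffAt I a = 0) hI
  exact h1 (by rw [h, map_zero])

/-- Only finitely many generators occur in an element of the Grassmann algebra. -/
theorem eventually_fresh (a : Grassmann) :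
    ∀ᶠ n : ℕ in atTop, ∀ I, coeffAt I a ≠ 0 → ∀ i ∈ I, i < n := by
  let s : Finset ℕ := (thetaBasis.repr a).support.biUnion id
  filter_upwards [eventually_gt_atTop (s.sup id)] with n hn I hI i hi
  refine lt_of_le_of_lt ?_ hn
  refine Finset.le_sup (f := id) ?_
  simp only [s, Finset.mem_biUnion]
  exact ⟨I, by simpa [coeffAt_eq_repr] using hI, hi⟩

/-- An element annihilated by products of arbitrarily large generators vanishes. -/
theorem eventually_θ_mul_cancel {a : Grassmann} (J : ℕ → Finset ℕ) (hJ : ∀ n, ∀ i ∈ J n, n ≤ i)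
    (h : ∃ᶠ n : ℕ in atTop, θ (J n) * a = 0) : a = 0 := by
  obtain ⟨n, hn, hf⟩ := (h.and_eventually (eventually_fresh a)).exists
  refine θ_mul_cancel hn fun I hI ↦ Finset.disjoint_left.2 fun i hi hi' ↦ ?_
  exact absurd (hJ n i hi) (not_le.2 (hf I hI i hi'))

theorem mul_θ_eq (a : Grassmann) (n : ℕ) : a * θ {n} = θ {n} * inv a := by
  rw [inv_mul_of_odd (inv_θ_of_odd (by simp)), inv_inv]

theorem eventually_mul_θ_cancel {a b : Grassmann}
    (h : ∃ᶠ n : ℕ in atTop, a * θ {n} = b * θ {n}) : a = b := by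
  have h2 : inv (a - b) = 0 := by
    refine eventually_θ_mul_cancel (fun n ↦ {n}) (by simp) (h.mono fun n hn ↦ ?_)
    rw [← mul_θ_eq, sub_mul, hn, sub_self]
  have := congrArg inv h2
  rwa [inv_inv, map_zero, sub_eq_zero] at this

theorem θ_mul_mul_θ {I J : Finset ℕ} {n : ℕ} (hI : n ∈ I) (hJ : n ∈ J) (a : Grassmann) :
    θ I * a * θ J = 0 := by
  rw [sum_coeffAt a, Finsupp.sum, Finset.mul_sum, Finset.sum_mul]
  refine Finset.sum_eq_zero fun L _ ↦ ?_
  rw [mul_smul_comm, smul_mul_assoc]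
  by_cases hd : Disjoint I L
  · obtain ⟨s, hs⟩ := θ_mul_of_disjoint hd
    rw [hs, smul_mul_assoc, θ_mul_of_not_disjoint, smul_zero, smul_zero]
    exact Finset.not_disjoint_iff.2 ⟨n, Finset.mem_union_left _ hI, hJ⟩
  · rw [θ_mul_of_not_disjoint hd]; simp

/-- A word of nonempty monomials in the generators `G` vanishes once it is longer than `G`. -/
theorem prod_θ_eq_zero {G : Finset ℕ} (l : List (Finset ℕ))
    (hl : ∀ I ∈ l, I.Nonempty ∧ I ⊆ G) :
    (l.map θ).prod = 0 ∨
      ∃ (s : ℤˣ) (J : Finset ℕ), (l.map θ).prod = s • θ J ∧ J ⊆ G ∧ l.length ≤ J.card := by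
  induction l with
  | nil => exact Or.inr ⟨1, ∅, by simp [θ_empty], by simp, by simp⟩
  | cons I l ih =>
    rw [List.map_cons, List.prod_cons]
    rcases ih fun I hI ↦ hl I (List.mem_cons_of_mem _ hI) with h | ⟨s, J, h, hJ, hc⟩
    · left; rw [h, mul_zero]
    · rw [h, mul_smul_comm]
      have hI := hl I List.mem_cons_self
      by_cases hd : Disjoint I J
      · obtain ⟨s', hs'⟩ := θ_mul_of_disjoint hd
        refine Or.inr ⟨s * s', I ∪ J, by rw [hs', mul_smul], Finset.union_subset hI.2 hJ, ?_⟩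
        rw [Finset.card_union_of_disjoint hd, List.length_cons]
        have := hI.1.card_pos
        omega
      · left; rw [θ_mul_of_not_disjoint hd, smul_zero]

/-! ### Directional derivatives of graded components -/

section Components

variable {A B : Type*} [AddCommGroup A] [Module ℝ A] [AddCommGroup B] [Module ℝ B]

/-- Families `c_k(v; w)` of functions of an even and of `k` odd arguments. -/
abbrev GComp (A B : Type*) : Type _ := (k : ℕ) → A → (Fin k → B) → ℂ

/-- The components `c_k(v; w)` are smooth in `v` along finite dimensional affine subspaces and
alternating multilinear in `w`. -/
structure IsSmoothAlt (c : GComp A B) : Prop where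
  smooth : ∀ (k : ℕ) (v : A) (w : Fin k → B) (N : ℕ) (a : Fin N → A),
    ContDiff ℝ ∞ fun s : Fin N → ℝ ↦ c k (v + ∑ i, s i • a i) w
  alt : ∀ k v, ∃ L : B [⋀^Fin k]→ₗ[ℝ] ℂ, ∀ w, c k v w = L w

/-- The derivative of graded components in an even direction. -/
def dE (e : A) (c : GComp A B) : GComp A B :=
  fun k v w ↦ deriv (fun τ : ℝ ↦ c k (v + τ • e) w) 0

/-- The left derivative of graded components in an odd direction. -/
def dO (o : B) (c : GComp A B) : GComp A B :=
  fun k v w ↦ c (k + 1) v (Fin.cons o w)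

/-- The linear map `s ↦ ∑ i, s i • a i`. -/
def comb {N : ℕ} (a : Fin N → A) (s : Fin N → ℝ) : A := ∑ i, s i • a i

theorem comb_add {N : ℕ} (a : Fin N → A) (s t : Fin N → ℝ) :
    comb a (s + t) = comb a s + comb a t := by
  simp [comb, add_smul, Finset.sum_add_distrib]

theorem comb_smul {N : ℕ} (a : Fin N → A) (r : ℝ) (s : Fin N → ℝ) :
    comb a (r • s) = r • comb a s := by
  simp [comb, mul_smul, Finset.smul_sum]

theorem comb_single {N : ℕ} (a : Fin N → A) (i : Fin N) :
    comb a (Pi.single i 1) = a i := by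
  simp [comb, Pi.single_apply, ite_smul]

namespace IsSmoothAlt

variable {c c' : GComp A B}

theorem contDiff (h : IsSmoothAlt c) (k : ℕ) (v : A) (w : Fin k → B) {N : ℕ} (a : Fin N → A) :
    ContDiff ℝ ∞ fun s : Fin N → ℝ ↦ c k (v + comb a s) w :=
  h.smooth k v w N a

theorem contDiff_line (h : IsSmoothAlt c) (k : ℕ) (v : A) (w : Fin k → B) (e : A) :
    ContDiff ℝ ∞ fun τ : ℝ ↦ c k (v + τ • e) w := by
  have := (h.contDiff k v w ![e]).comp (g := fun s : Fin 1 → ℝ ↦ c k (v + comb ![e] s) w)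
    (f := fun τ : ℝ ↦ fun _ : Fin 1 ↦ τ) (contDiff_pi.2 fun _ ↦ contDiff_id)
  simpa [comb, Function.comp_def] using this

theorem fderiv_comb (h : IsSmoothAlt c) (k : ℕ) (v : A) (w : Fin k → B) {N : ℕ} (a : Fin N → A)
    (s m : Fin N → ℝ) :
    fderiv ℝ (fun s : Fin N → ℝ ↦ c k (v + comb a s) w) s m =
      dE (comb a m) c k (v + comb a s) w := by
  have hd : DifferentiableAt ℝ (fun s : Fin N → ℝ ↦ c k (v + comb a s) w) s :=
    (h.contDiff k v w a).differentiable (by simp) s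
  have h1 := hd.hasFDerivAt.comp_hasDerivAt_of_eq (0 : ℝ)
    (((hasDerivAt_id (0 : ℝ)).smul_const m).const_add s) (by simp)
  rw [one_smul] at h1
  rw [← h1.deriv, dE]
  congr 1
  ext τ
  simp [comb_add, comb_smul, add_assoc]

theorem hasDerivAt (h : IsSmoothAlt c) (k : ℕ) (v : A) (w : Fin k → B) (e : A) (τ : ℝ) :
    HasDerivAt (fun τ : ℝ ↦ c k (v + τ • e) w) (dE e c k (v + τ • e) w) τ := by
  have hd := ((h.contDiff_line k v w e).differentiable (by simp) τ).hasDerivAt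
  suffices hs : dE e c k (v + τ • e) w = deriv (fun τ : ℝ ↦ c k (v + τ • e) w) τ by
    rw [hs]; exact hd
  change deriv (fun σ : ℝ ↦ c k (v + τ • e + σ • e) w) 0 = _
  have := deriv_comp_const_add (fun τ : ℝ ↦ c k (v + τ • e) w) τ 0
  rw [add_zero] at this
  rw [← this]
  congr 1
  ext σ
  rw [add_smul, add_assoc]

theorem dE_add (h : IsSmoothAlt c) (e e' : A) : dE (e + e') c = dE e c + dE e' c := by
  ext k v w
  have h1 := h.fderiv_comb k v w ![e, e'] 0
  have h2 := h1 (Pi.single 0 1 + Pi.single 1 1)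
  rw [map_add, h1, h1, comb_add, comb_single, comb_single] at h2
  simpa [comb] using h2.symm

theorem dE_smul (h : IsSmoothAlt c) (r : ℝ) (e : A) (k : ℕ) (v : A) (w : Fin k → B) :
    dE (r • e) c k v w = r • dE e c k v w := by
  have h1 := h.fderiv_comb k v w ![e] 0
  have h2 := h1 (r • Pi.single 0 1)
  rw [map_smul, h1, comb_smul, comb_single] at h2
  simpa [comb] using h2.symm

theorem dE_zero (h : IsSmoothAlt c) : dE 0 c = 0 := by
  ext k v w
  simpa using h.dE_smul 0 0 k v w

theorem stable_dE (h : IsSmoothAlt c) (e : A) : IsSmoothAlt (dE e c) where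
  smooth k v w N a := by
    have h1 : ContDiff ℝ ∞ fun s : Fin (N + 1) → ℝ ↦
        c k (v + comb (Fin.cons e a : Fin (N + 1) → A) s) w := h.contDiff k v w _
    have h2 : ContDiff ℝ ∞ fun s : Fin N → ℝ ↦ fderiv ℝ (fun s : Fin (N + 1) → ℝ ↦
        c k (v + comb (Fin.cons e a : Fin (N + 1) → A) s) w) (Fin.cons 0 s : Fin (N + 1) → ℝ)
          (Pi.single 0 1) := by
      refine ContDiff.clm_apply ?_ contDiff_const
      refine ContDiff.comp (g := fderiv ℝ (fun s : Fin (N + 1) → ℝ ↦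
        c k (v + comb (Fin.cons e a : Fin (N + 1) → A) s) w)) (h1.fderiv_right (by simp)) ?_
      refine contDiff_pi.2 fun i ↦ ?_
      refine Fin.cases ?_ (fun i ↦ ?_) i
      · simpa using contDiff_const
      · simpa using contDiff_apply ℝ ℝ i
    convert h2 using 2 with s
    rw [h.fderiv_comb, comb_single]
    simp [comb, Fin.sum_univ_succ]
  alt k v := by
    choose L hL using h.alt k
    have hd (w : Fin k → B) := h.hasDerivAt k v w e 0
    simp only [hL] at hd
    refine ⟨AlternatingMap.mk (MultilinearMap.mk (fun w ↦ dE e c k v w) ?_ ?_) ?_,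
      fun w ↦ rfl⟩
    · intro _ w i x y
      have h1 := (hd (Function.update w i x)).add (hd (Function.update w i y))
      have h2 := hd (Function.update w i (x + y))
      simp only [AlternatingMap.map_update_add] at h2
      simpa using h2.unique h1
    · intro _ w i r x
      have h1 := (hd (Function.update w i x)).const_smul r
      have h2 := hd (Function.update w i (r • x))
      simp only [AlternatingMap.map_update_smul] at h2
      simpa using h2.unique h1
    · intro w i j hij hne
      have h2 := hd w
      simp only [AlternatingMap.map_eq_zero_of_eq _ w hij hne] at h2
      simpa using h2.unique (hasDerivAt_const _ _)

theorem stable_dO (h : IsSmoothAlt c) (o : B) : IsSmoothAlt (dO o c) where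
  smooth k v w N a := h.smooth (k + 1) v (Fin.cons o w) N a
  alt k v := by
    obtain ⟨L, hL⟩ := h.alt (k + 1) v
    refine ⟨L.curryLeft o, fun w ↦ ?_⟩
    rw [dO, hL]
    rfl

theorem add (h : IsSmoothAlt c) (h' : IsSmoothAlt c') : IsSmoothAlt (c + c') where
  smooth k v w N a := (h.smooth k v w N a).add (h'.smooth k v w N a)
  alt k v := by
    obtain ⟨L, hL⟩ := h.alt k v
    obtain ⟨L', hL'⟩ := h'.alt k v
    exact ⟨L + L', fun w ↦ by simp [hL, hL']⟩

theorem zero : IsSmoothAlt (0 : GComp A B) where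
  smooth _ _ _ _ _ := contDiff_const
  alt _ _ := ⟨0, fun _ ↦ rfl⟩

theorem dE_comm (h : IsSmoothAlt c) (e e' : A) :
    dE e (dE e' c) = dE e' (dE e c) := by
  ext k v w
  set g : (Fin 2 → ℝ) → ℂ := fun s ↦ c k (v + comb ![e, e'] s) w with hg
  have hgs : ContDiff ℝ ∞ g := h.contDiff k v w _
  have hsymm : IsSymmSndFDerivAt ℝ g 0 :=
    hgs.contDiffAt.isSymmSndFDerivAt (by
      rw [minSmoothness_of_isRCLikeNormedField]
      exact WithTop.coe_le_coe.2 le_top)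
  have key (m m' : Fin 2 → ℝ) : fderiv ℝ (fderiv ℝ g) 0 m m' =
      dE (comb ![e, e'] m) (dE (comb ![e, e'] m') c) k v w := by
    have h1 := (h.stable_dE (comb ![e, e'] m')).fderiv_comb k v w ![e, e'] 0 m
    have h2 : (fun s ↦ dE (comb ![e, e'] m') c k (v + comb ![e, e'] s) w) =
        fun s ↦ fderiv ℝ g s m' := by
      ext s; rw [hg, h.fderiv_comb]
    rw [h2] at h1
    have h3 : DifferentiableAt ℝ (fderiv ℝ g) 0 :=
      (hgs.fderiv_right (m := ∞) (by simp)).differentiable (by simp) 0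
    rw [fderiv_clm_apply h3 (differentiableAt_const _)] at h1
    simpa [comb] using h1
  have := hsymm (Pi.single 0 1) (Pi.single 1 1)
  rw [key, key, comb_single, comb_single] at this
  simpa using this

theorem dO_add (h : IsSmoothAlt c) (o o' : B) : dO (o + o') c = dO o c + dO o' c := by
  ext k v w
  obtain ⟨L, hL⟩ := h.alt (k + 1) v
  simp only [dO, Pi.add_apply, hL]
  have := L.map_update_add (Fin.cons 0 w) 0 o o'
  simpa using this

theorem dO_smul (h : IsSmoothAlt c) (r : ℝ) (o : B) (k : ℕ) (v : A) (w : Fin k → B) :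
    dO (r • o) c k v w = r • dO o c k v w := by
  obtain ⟨L, hL⟩ := h.alt (k + 1) v
  simp only [dO, hL]
  have := L.map_update_smul (Fin.cons 0 w) 0 r o
  simpa using this

theorem dO_zero (h : IsSmoothAlt c) : dO 0 c = 0 := by
  ext k v w
  simpa using h.dO_smul 0 0 k v w

theorem dO_comm (h : IsSmoothAlt c) (o o' : B) :
    dO o (dO o' c) = -dO o' (dO o c) := by
  ext k v w
  obtain ⟨L, hL⟩ := h.alt (k + 2) v
  simp only [dO, Pi.neg_apply, hL]
  have := L.map_swap (Fin.cons o' (Fin.cons o w)) (i := 0) (j := 1) (by simp)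
  rw [← neg_eq_iff_eq_neg, ← this]
  congr 1
  ext i
  refine Fin.cases ?_ (fun i ↦ ?_) i
  · simp [Equiv.swap_apply_left]
  · refine Fin.cases ?_ (fun i ↦ ?_) i
    · have : (Fin.succ 0 : Fin (k + 2)) = 1 := rfl
      simp [Equiv.swap_apply_right, this]
    · have h1 : (i.succ.succ : Fin (k + 2)) ≠ 0 := Fin.succ_ne_zero _
      have h2 : (i.succ.succ : Fin (k + 2)) ≠ 1 := by
        rw [← Fin.succ_zero_eq_one']
        exact fun h ↦ Fin.succ_ne_zero _ (Fin.succ_injective _ h)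
      simp [Equiv.swap_apply_of_ne_of_ne h1 h2]

end IsSmoothAlt

theorem dE_dO (e : A) (o : B) (c : GComp A B) : dE e (dO o c) = dO o (dE e c) := rfl

/-- The operators attached to the letters of a word, applied from the first letter on. -/
def opWord {ι C : Type*} (op : ι → C → C) : (j : ℕ) → (Fin j → ι) → C → C
  | 0, _, c => c
  | j + 1, a, c => opWord op j (Fin.tail a) (op (a 0) c)

theorem IsSmoothAlt.opWord_dE {c : GComp A B} (h : IsSmoothAlt c) (j : ℕ) (a : Fin j → A) :
    IsSmoothAlt (opWord dE j a c) := by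
  induction j generalizing c with
  | zero => exact h
  | succ j ih => exact ih (h.stable_dE _) _

theorem IsSmoothAlt.dE_opWord {c : GComp A B} (h : IsSmoothAlt c) (j : ℕ) (a : Fin j → A) (e : A) :
    dE e (opWord dE j a c) = opWord dE j a (dE e c) := by
  induction j generalizing c with
  | zero => rfl
  | succ j ih =>
    simp only [opWord]
    rw [ih (h.stable_dE _), h.dE_comm]

/-- Along a finite-dimensional family, iterated Fréchet derivatives are iterated directional
derivatives. -/
theorem IsSmoothAlt.iteratedFDeriv_comb {c : GComp A B} (h : IsSmoothAlt c) (k : ℕ) (v : A)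
    (w : Fin k → B) {N : ℕ} (a : Fin N → A) (j : ℕ) (s : Fin N → ℝ) (m : Fin j → Fin N → ℝ) :
    iteratedFDeriv ℝ j (fun s : Fin N → ℝ ↦ c k (v + comb a s) w) s m =
      opWord dE j (fun i ↦ comb a (m i)) c k (v + comb a s) w := by
  induction j generalizing s with
  | zero => simp [opWord]
  | succ j ih =>
    rw [iteratedFDeriv_succ_apply_left]
    have hd : DifferentiableAt ℝ
        (iteratedFDeriv ℝ j (fun s : Fin N → ℝ ↦ c k (v + comb a s) w)) s :=
      (h.contDiff k v w a).differentiable_iteratedFDeriv (by exact_mod_cast WithTop.coe_lt_top _) s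
    have h1 : fderiv ℝ (iteratedFDeriv ℝ j (fun s : Fin N → ℝ ↦ c k (v + comb a s) w)) s (m 0)
        (Fin.tail m) = fderiv ℝ (fun s ↦ iteratedFDeriv ℝ j
          (fun s : Fin N → ℝ ↦ c k (v + comb a s) w) s (Fin.tail m)) s (m 0) := by
      have := (hd.hasFDerivAt.continuousMultilinear_apply_const (Fin.tail m)).fderiv
      rw [this]; rfl
    rw [h1]
    simp only [ih]
    rw [(h.opWord_dE _ _).fderiv_comb, h.dE_opWord]
    rfl

/-- Mixed partial derivatives are iterated directional derivatives. -/
theorem IsSmoothAlt.mixed_eq {c : GComp A B} (h : IsSmoothAlt c) (k j : ℕ) (v : A)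
    (a : Fin j → A) (w : Fin k → B) :
    iteratedFDeriv ℝ j (fun s : Fin j → ℝ ↦ c k (v + ∑ i, s i • a i) w) 0
      (fun i ↦ Pi.single i 1) = opWord dE j a c k v w := by
  have := h.iteratedFDeriv_comb k v w a j 0 (fun i ↦ Pi.single i 1)
  simp only [comb_single] at this
  simpa [comb] using this

theorem opWord_dO_apply (c : GComp A B) (k : ℕ) (v : A) (w : Fin k → B) (i : Fin 0 → B) :
    opWord dO k w c 0 v i = c k v w := by
  induction k generalizing c with
  | zero =>
    simp only [opWord]
    congr 1
    exact Subsingleton.elim _ _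
  | succ k ih =>
    simp only [opWord]
    rw [ih, dO, Fin.cons_self_tail]

end Components

/-! ### Exponential sums over words -/

section Words

variable {ι C : Type*} [DecidableEq ι]

/-- The sum of `ε(a₁) ⋯ ε(a_j) G(D_{a_j} ⋯ D_{a_1} c)` over all words `a` of length `j` with
letters in `T`. -/
def wordSum (T : Finset ι) (ε : ι → Grassmann) (op : ι → C → C) (G : C → Grassmann) :
    ℕ → C → Grassmann
  | 0, c => G c
  | j + 1, c => ∑ i ∈ T, ε i * wordSum T ε op G j (op i c)

/-- The truncated exponential series `∑ j < N, 1/j! (∑ i ∈ T, ε_i D_i)^j`. -/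
def expSum (N : ℕ) (T : Finset ι) (ε : ι → Grassmann) (op : ι → C → C) (G : C → Grassmann)
    (c : C) : Grassmann :=
  ∑ j ∈ Finset.range N, ((j.factorial : ℂ)⁻¹) • wordSum T ε op G j c

theorem wordSum_eq_sum_words (T : Finset ι) (ε : ι → Grassmann) (op : ι → C → C)
    (G : C → Grassmann) (j : ℕ) (c : C) :
    wordSum T ε op G j c = ∑ a ∈ Fintype.piFinset (fun _ : Fin j ↦ T),
      (List.ofFn fun i ↦ ε (a i)).prod * G (opWord op j a c) := by
  induction j generalizing c with
  | zero => simp [wordSum, opWord]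
  | succ j ih =>
    simp only [wordSum, ih, Finset.mul_sum]
    rw [Finset.sum_sigma']
    refine Finset.sum_bij' (fun p _ ↦ (Fin.cons p.1 p.2 : Fin (j + 1) → ι))
      (fun a _ ↦ ⟨a 0, Fin.tail a⟩) ?_ ?_ ?_ ?_ ?_
    · rintro ⟨i, a⟩ h
      simp only [Finset.mem_sigma, Fintype.mem_piFinset] at h ⊢
      intro l
      refine Fin.cases ?_ (fun l ↦ ?_) l
      · simpa using h.1
      · simpa using h.2 l
    · intro a h
      simp only [Finset.mem_sigma, Fintype.mem_piFinset] at h ⊢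
      exact ⟨h 0, fun l ↦ h l.succ⟩
    · rintro ⟨i, a⟩ _
      simp
    · intro a _
      simp
    · rintro ⟨i, a⟩ _
      simp [opWord, mul_assoc]

theorem wordSum_map {C' : Type*} (T : Finset ι) (ε : ι → Grassmann) (op : ι → C → C)
    (op' : ι → C' → C') (G : C → Grassmann) (G' : C' → Grassmann) (F : C → C')
    (hop : ∀ i c, F (op i c) = op' i (F c)) (hG : ∀ c, G c = G' (F c)) (j : ℕ) (c : C) :
    wordSum T ε op G j c = wordSum T ε op' G' j (F c) := by
  induction j generalizing c with
  | zero => exact hG c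
  | succ j ih => simp only [wordSum, ih, hop]

theorem expSum_map {C' : Type*} (N : ℕ) (T : Finset ι) (ε : ι → Grassmann) (op : ι → C → C)
    (op' : ι → C' → C') (G : C → Grassmann) (G' : C' → Grassmann) (F : C → C')
    (hop : ∀ i c, F (op i c) = op' i (F c)) (hG : ∀ c, G c = G' (F c)) (c : C) :
    expSum N T ε op G c = expSum N T ε op' G' (F c) := by
  simp only [expSum, wordSum_map T ε op op' G G' F hop hG]

theorem wordSum_congr (T : Finset ι) {ε ε' : ι → Grassmann} {op op' : ι → C → C}
    (hε : ∀ i ∈ T, ε i = ε' i) (hop : ∀ i ∈ T, op i = op' i) (G : C → Grassmann) (j : ℕ) (c : C) :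
    wordSum T ε op G j c = wordSum T ε' op' G j c := by
  induction j generalizing c with
  | zero => rfl
  | succ j ih =>
    simp only [wordSum, ih]
    exact Finset.sum_congr rfl fun i hi ↦ by rw [hε i hi, hop i hi]

theorem expSum_congr (N : ℕ) (T : Finset ι) {ε ε' : ι → Grassmann} {op op' : ι → C → C}
    (hε : ∀ i ∈ T, ε i = ε' i) (hop : ∀ i ∈ T, op i = op' i) (G : C → Grassmann) (c : C) :
    expSum N T ε op G c = expSum N T ε' op' G c := by
  simp only [expSum, wordSum_congr T hε hop]

theorem wordSum_invariant {P : C → Prop} (T : Finset ι) (ε : ι → Grassmann) (op : ι → C → C)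
    {G G' : C → Grassmann} (hP : ∀ i c, P c → P (op i c)) (hG : ∀ c, P c → G c = G' c)
    (j : ℕ) {c : C} (hc : P c) :
    wordSum T ε op G j c = wordSum T ε op G' j c := by
  induction j generalizing c with
  | zero => exact hG c hc
  | succ j ih => exact Finset.sum_congr rfl fun i _ ↦ by rw [ih (hP i c hc)]

theorem expSum_invariant {P : C → Prop} (N : ℕ) (T : Finset ι) (ε : ι → Grassmann) (op : ι → C → C)
    {G G' : C → Grassmann} (hP : ∀ i c, P c → P (op i c)) (hG : ∀ c, P c → G c = G' c)
    {c : C} (hc : P c) :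
    expSum N T ε op G c = expSum N T ε op G' c := by
  simp only [expSum, fun j ↦ wordSum_invariant T ε op hP hG j hc]

theorem wordSum_add_fun (T : Finset ι) (ε : ι → Grassmann) (op : ι → C → C)
    (G G' : C → Grassmann) (j : ℕ) (c : C) :
    wordSum T ε op (fun c ↦ G c + G' c) j c = wordSum T ε op G j c + wordSum T ε op G' j c := by
  induction j generalizing c with
  | zero => rfl
  | succ j ih => simp only [wordSum, ih, mul_add, Finset.sum_add_distrib]

theorem expSum_add_fun (N : ℕ) (T : Finset ι) (ε : ι → Grassmann) (op : ι → C → C)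
    (G G' : C → Grassmann) (c : C) :
    expSum N T ε op (fun c ↦ G c + G' c) c = expSum N T ε op G c + expSum N T ε op G' c := by
  simp only [expSum, wordSum_add_fun, smul_add, Finset.sum_add_distrib]

theorem wordSum_sum_fun {κ : Type*} (S : Finset κ) (T : Finset ι) (ε : ι → Grassmann)
    (op : ι → C → C) (G : κ → C → Grassmann) (j : ℕ) (c : C) :
    wordSum T ε op (fun c ↦ ∑ s ∈ S, G s c) j c = ∑ s ∈ S, wordSum T ε op (G s) j c := by
  induction j generalizing c with
  | zero => rfl
  | succ j ih =>
    simp only [wordSum, ih, Finset.mul_sum]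
    exact Finset.sum_comm

theorem expSum_sum_fun {κ : Type*} (S : Finset κ) (N : ℕ) (T : Finset ι) (ε : ι → Grassmann)
    (op : ι → C → C) (G : κ → C → Grassmann) (c : C) :
    expSum N T ε op (fun c ↦ ∑ s ∈ S, G s c) c = ∑ s ∈ S, expSum N T ε op (G s) c := by
  simp only [expSum, wordSum_sum_fun, Finset.smul_sum]
  exact Finset.sum_comm

theorem wordSum_mul_left (T : Finset ι) (ε : ι → Grassmann) (op : ι → C → C)
    (G : C → Grassmann) (l : Grassmann) (hl : ∀ i ∈ T, ε i * l = l * ε i) (j : ℕ) (c : C) :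
    wordSum T ε op (fun c ↦ l * G c) j c = l * wordSum T ε op G j c := by
  induction j generalizing c with
  | zero => rfl
  | succ j ih =>
    simp only [wordSum, ih, Finset.mul_sum]
    exact Finset.sum_congr rfl fun i hi ↦ by rw [← mul_assoc, hl i hi, mul_assoc]

theorem expSum_mul_left (N : ℕ) (T : Finset ι) (ε : ι → Grassmann) (op : ι → C → C)
    (G : C → Grassmann) (l : Grassmann) (hl : ∀ i ∈ T, ε i * l = l * ε i) (c : C) :
    expSum N T ε op (fun c ↦ l * G c) c = l * expSum N T ε op G c := by
  simp only [expSum, wordSum_mul_left T ε op G l hl, Finset.mul_sum, mul_smul_comm]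

theorem wordSum_smul_fun (T : Finset ι) (ε : ι → Grassmann) (op : ι → C → C)
    (G : C → Grassmann) (z : ℂ) (j : ℕ) (c : C) :
    wordSum T ε op (fun c ↦ z • G c) j c = z • wordSum T ε op G j c := by
  induction j generalizing c with
  | zero => rfl
  | succ j ih => simp only [wordSum, ih, Finset.smul_sum, mul_smul_comm]

/-- The letters of `T₂` occur at most once, since their products vanish. -/
theorem wordSum_union {P : C → Prop} {T₁ T₂ : Finset ι} (hd : Disjoint T₁ T₂)
    (ε : ι → Grassmann) (op : ι → C → C) (G : C → Grassmann)
    (hP : ∀ i c, P c → P (op i c))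
    (hcomm : ∀ i i' c m, i ∈ T₁ → i' ∈ T₂ → P c →
      ε i * (ε i' * wordSum T₁ ε op G m (op i' (op i c))) =
        ε i' * (ε i * wordSum T₁ ε op G m (op i (op i' c))))
    (hkill : ∀ i ∈ T₂, ∀ i' ∈ T₂, ∀ x, ε i * x * ε i' = 0)
    (j : ℕ) {c : C} (hc : P c) :
    wordSum (T₁ ∪ T₂) ε op G (j + 1) c = wordSum T₁ ε op G (j + 1) c +
      ((j + 1 : ℕ) : ℂ) • ∑ i ∈ T₂, ε i * wordSum T₁ ε op G j (op i c) := by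
  induction j generalizing c with
  | zero =>
    simp [wordSum, Finset.sum_union hd]
  | succ j ih =>
    have hkill' (i : ι) (hi : i ∈ T₂) (i' : ι) (hi' : i' ∈ T₂) (x : Grassmann) :
        ε i * (ε i' * x) = 0 := by
      rw [← mul_assoc]
      have := hkill i hi i' hi' 1
      rw [mul_one] at this
      rw [this, zero_mul]
    rw [wordSum, Finset.sum_union hd]
    have h1 : ∑ i ∈ T₁, ε i * wordSum (T₁ ∪ T₂) ε op G (j + 1) (op i c) =
        wordSum T₁ ε op G (j + 2) c +
          ((j + 1 : ℕ) : ℂ) • ∑ i' ∈ T₂, ε i' * wordSum T₁ ε op G (j + 1) (op i' c) := by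
      rw [wordSum, Finset.smul_sum]
      simp only [fun i ↦ ih (hP i c hc), mul_add, Finset.sum_add_distrib]
      congr 1
      simp only [mul_smul_comm, ← Finset.smul_sum, Finset.mul_sum]
      congr 1
      rw [Finset.sum_comm]
      refine Finset.sum_congr rfl fun i' hi' ↦ ?_
      rw [wordSum, Finset.mul_sum]
      exact Finset.sum_congr rfl fun i hi ↦ hcomm i i' c j hi hi' hc
    have h2 : ∑ i ∈ T₂, ε i * wordSum (T₁ ∪ T₂) ε op G (j + 1) (op i c) =
        ∑ i ∈ T₂, ε i * wordSum T₁ ε op G (j + 1) (op i c) := by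
      refine Finset.sum_congr rfl fun i hi ↦ ?_
      rw [ih (hP i c hc), mul_add, mul_smul_comm, Finset.mul_sum]
      rw [Finset.sum_eq_zero fun i' hi' ↦ hkill' i hi i' hi' _, smul_zero, add_zero]
    rw [h1, h2, add_assoc]
    congr 1
    push_cast
    module

/-- Letters whose coefficients annihilate each other contribute to first order only. -/
theorem expSum_union {P : C → Prop} {T₁ T₂ : Finset ι} (hd : Disjoint T₁ T₂)
    (ε : ι → Grassmann) (op : ι → C → C) (G : C → Grassmann)
    (hP : ∀ i c, P c → P (op i c))
    (hcomm : ∀ i i' c m, i ∈ T₁ → i' ∈ T₂ → P c →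
      ε i * (ε i' * wordSum T₁ ε op G m (op i' (op i c))) =
        ε i' * (ε i * wordSum T₁ ε op G m (op i (op i' c))))
    (hkill : ∀ i ∈ T₂, ∀ i' ∈ T₂, ∀ x, ε i * x * ε i' = 0)
    (N : ℕ) {c : C} (hc : P c) :
    expSum (N + 1) (T₁ ∪ T₂) ε op G c = expSum (N + 1) T₁ ε op G c +
      ∑ i ∈ T₂, ε i * expSum N T₁ ε op G (op i c) := by
  simp only [expSum, Finset.sum_range_succ' _ N]
  have h0 : wordSum (T₁ ∪ T₂) ε op G 0 c = wordSum T₁ ε op G 0 c := rfl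
  rw [h0, add_right_comm]
  congr 1
  simp only [fun j ↦ wordSum_union hd ε op G hP hcomm hkill j hc, smul_add,
    Finset.sum_add_distrib]
  congr 1
  simp only [Finset.mul_sum, smul_smul]
  rw [Finset.sum_comm]
  refine Finset.sum_congr rfl fun j _ ↦ ?_
  rw [Finset.smul_sum]
  refine Finset.sum_congr rfl fun i _ ↦ ?_
  rw [mul_smul_comm]
  congr 1
  rw [Nat.factorial_succ]
  push_cast
  have h1 : ((j : ℂ) + 1) ≠ 0 := by exact_mod_cast Nat.succ_ne_zero j
  have h2 : (j.factorial : ℂ) ≠ 0 := by exact_mod_cast j.factorial_ne_zero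
  field_simp

end Words

/-! ### Shortcut instances

Without these instances, the search for the structure of an additive group on the iterated products
of spaces of sections dominates the elaboration of all that follows. -/

section Sections

variable {d : ℕ} {M : Type*} [TopologicalSpace M] [ChartedSpace (EuclideanSpace ℝ (Fin d)) M]
  {F : Type*} [NormedAddCommGroup F] [NormedSpace ℝ F]
  {E : M → Type*} [TopologicalSpace (TotalSpace F E)] [∀ x, TopologicalSpace (E x)]
  [∀ x, AddCommGroup (E x)] [∀ x, Module ℝ (E x)] [FiberBundle F E] [VectorBundle ℝ F E]

instance : AddCommGroup (Sec d F E) := ContMDiffSection.instAddCommGroup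
instance : AddCommMonoid (Sec d F E) := AddCommGroup.toAddCommMonoid
instance : Zero (Sec d F E) := ContMDiffSection.instZero
instance : Module ℝ (Sec d F E) := ContMDiffSection.instModule

variable [∀ x, IsTopologicalAddGroup (E x)] [∀ x, ContinuousSMul ℝ (E x)]

instance : AddCommMonoid (DualSec d F E) := AddCommGroup.toAddCommMonoid
instance : Zero (DualSec d F E) := ContMDiffSection.instZero

end Sections

/-! ### Taylor expansion of graded functionals -/

section Eval

section Linear

variable {ι C : Type*} [DecidableEq ι] [AddCommGroup C]

theorem wordSum_add_arg {P : C → Prop} (T : Finset ι) (ε : ι → Grassmann) (op : ι → C → C)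
    (G : C → Grassmann) (hP : ∀ i c, P c → P (op i c))
    (hop : ∀ i c c', P c → P c' → op i (c + c') = op i c + op i c')
    (hG : ∀ c c', P c → P c' → G (c + c') = G c + G c') (j : ℕ) {c c' : C} (hc : P c)
    (hc' : P c') :
    wordSum T ε op G j (c + c') = wordSum T ε op G j c + wordSum T ε op G j c' := by
  induction j generalizing c c' with
  | zero => exact hG c c' hc hc'
  | succ j ih =>
    simp only [wordSum, ← Finset.sum_add_distrib]
    exact Finset.sum_congr rfl fun i _ ↦ by
      rw [hop i c c' hc hc', ih (hP i c hc) (hP i c' hc'), mul_add]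

theorem expSum_add_arg {P : C → Prop} (N : ℕ) (T : Finset ι) (ε : ι → Grassmann) (op : ι → C → C)
    (G : C → Grassmann) (hP : ∀ i c, P c → P (op i c))
    (hop : ∀ i c c', P c → P c' → op i (c + c') = op i c + op i c')
    (hG : ∀ c c', P c → P c' → G (c + c') = G c + G c') {c c' : C} (hc : P c) (hc' : P c') :
    expSum N T ε op G (c + c') = expSum N T ε op G c + expSum N T ε op G c' := by
  simp only [expSum, fun j ↦ wordSum_add_arg T ε op G hP hop hG j hc hc', smul_add,
    Finset.sum_add_distrib]

theorem wordSum_neg_arg (T : Finset ι) (ε : ι → Grassmann) (op : ι → C → C)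
    (G : C → Grassmann) (hop : ∀ i c, op i (-c) = -op i c) (hG : ∀ c, G (-c) = -G c) (j : ℕ)
    (c : C) : wordSum T ε op G j (-c) = -wordSum T ε op G j c := by
  induction j generalizing c with
  | zero => exact hG c
  | succ j ih => simp only [wordSum, hop, ih, mul_neg, Finset.sum_neg_distrib]

theorem wordSum_neg_op {P : C → Prop} (T : Finset ι) (ε : ι → Grassmann) (op op' : ι → C → C)
    (G : C → Grassmann) (hP : ∀ i c, P c → P (op i c)) (hop' : ∀ i c, P c → op' i c = -op i c)
    (hop : ∀ i c, op' i (-c) = -op' i c) (hG : ∀ c, G (-c) = -G c) (j : ℕ)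
    {c : C} (hc : P c) : wordSum T ε op' G j c = wordSum T (-ε) op G j c := by
  induction j generalizing c with
  | zero => rfl
  | succ j ih =>
    simp only [wordSum]
    refine Finset.sum_congr rfl fun i _ ↦ ?_
    rw [hop' i c hc, wordSum_neg_arg T ε op' G hop hG, ih (hP i c hc)]
    simp

end Linear

theorem inv_wordSum {ι C : Type*} [DecidableEq ι] (T : Finset ι) (ε : ι → Grassmann)
    (op : ι → C → C) (G : C → Grassmann) (j : ℕ) (c : C) :
    inv (wordSum T ε op G j c) = wordSum T (fun i ↦ inv (ε i)) op (fun c ↦ inv (G c)) j c := by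
  induction j generalizing c with
  | zero => rfl
  | succ j ih => simp only [wordSum, map_sum, map_mul, ih]

theorem inv_expSum {ι C : Type*} [DecidableEq ι] (N : ℕ) (T : Finset ι) (ε : ι → Grassmann)
    (op : ι → C → C) (G : C → Grassmann) (c : C) :
    inv (expSum N T ε op G c) = expSum N T (fun i ↦ inv (ε i)) op (fun c ↦ inv (G c)) c := by
  simp only [expSum, map_sum, map_smul, inv_wordSum]

theorem elt_mul_elt_eq_zero {n : ℕ} {i i' : Finset ℕ × Bool} (h : n ∈ i.1) (h' : n ∈ i'.1)
    (x : Grassmann) : elt i * x * elt i' = 0 := by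
  simp only [elt, smul_mul_assoc, mul_smul_comm, θ_mul_mul_θ h h', smul_zero]

theorem inv_elt_of_even {i : Finset ℕ × Bool} (h : Even i.1.card) : inv (elt i) = elt i := by
  rw [elt, map_smul, inv_θ_of_even h]

theorem inv_elt_of_odd {i : Finset ℕ × Bool} (h : Odd i.1.card) : inv (elt i) = -elt i := by
  rw [elt, map_smul, inv_θ_of_odd h, smul_neg]

theorem prod_elt_eq_zero {G : Finset ℕ} (l : List (Finset ℕ × Bool))
    (hl : ∀ i ∈ l, i.1.Nonempty ∧ i.1 ⊆ G) (hG : G.card < l.length) : (l.map elt).prod = 0 := by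
  have h1 : ∃ z : ℂ, (l.map elt).prod = z • ((l.map Prod.fst).map θ).prod := by
    clear hl hG
    induction l with
    | nil => exact ⟨1, by simp⟩
    | cons i l ih =>
      obtain ⟨z, hz⟩ := ih
      refine ⟨(if i.2 then Complex.I else 1) * z, ?_⟩
      rw [List.map_cons, List.prod_cons, hz, elt]
      simp [smul_smul, mul_comm]
  obtain ⟨z, hz⟩ := h1
  rw [hz]
  rcases prod_θ_eq_zero (G := G) (l.map Prod.fst)
    (by simp only [List.mem_map]; rintro I ⟨i, hi, rfl⟩; exact hl i hi) with h | ⟨s, J, h, hJ, hc⟩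
  · rw [h, smul_zero]
  · rw [List.length_map] at hc
    exact absurd (hc.trans (Finset.card_le_card hJ)) (not_le.2 hG)

theorem wordSum_elt_eq_zero {C : Type*} {G : Finset ℕ} {T : Finset (Finset ℕ × Bool)}
    (hT : ∀ i ∈ T, i.1.Nonempty ∧ i.1 ⊆ G) (op : Finset ℕ × Bool → C → C) (H : C → Grassmann)
    {j : ℕ} (hj : G.card < j) (c : C) : wordSum T elt op H j c = 0 := by
  rw [wordSum_eq_sum_words]
  refine Finset.sum_eq_zero fun a ha ↦ ?_
  rw [Fintype.mem_piFinset] at ha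
  have : (List.ofFn fun i ↦ elt (a i)) = (List.ofFn a).map elt := by
    rw [List.map_ofFn]; rfl
  rw [this, prod_elt_eq_zero (G := G), zero_mul]
  · intro i hi
    obtain ⟨l, rfl⟩ := (List.mem_ofFn' _ _).1 hi
    exact hT _ (ha l)
  · rwa [List.length_ofFn]

theorem expSum_elt_eq {C : Type*} {G : Finset ℕ} {T : Finset (Finset ℕ × Bool)}
    (hT : ∀ i ∈ T, i.1.Nonempty ∧ i.1 ⊆ G) (op : Finset ℕ × Bool → C → C) (H : C → Grassmann)
    {N : ℕ} (hN : G.card + 1 ≤ N) (c : C) :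
    expSum N T elt op H c = expSum (G.card + 1) T elt op H c := by
  symm
  refine Finset.sum_subset (Finset.range_subset_range.2 hN) fun j _ hj ↦ ?_
  rw [Finset.mem_range, not_lt] at hj
  rw [wordSum_elt_eq_zero hT op H (by omega), smul_zero]

variable {d : ℕ} {M : Type*} [TopologicalSpace M] [ChartedSpace (EuclideanSpace ℝ (Fin d)) M]
  {F₀ : Type*} [NormedAddCommGroup F₀] [NormedSpace ℝ F₀]
  {E₀ : M → Type*} [TopologicalSpace (TotalSpace F₀ E₀)] [∀ x, TopologicalSpace (E₀ x)]
  [∀ x, AddCommGroup (E₀ x)] [∀ x, Module ℝ (E₀ x)] [∀ x, IsTopologicalAddGroup (E₀ x)]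
  [∀ x, ContinuousSMul ℝ (E₀ x)] [FiberBundle F₀ E₀] [VectorBundle ℝ F₀ E₀]
  {F₁ : Type*} [NormedAddCommGroup F₁] [NormedSpace ℝ F₁]
  {E₁ : M → Type*} [TopologicalSpace (TotalSpace F₁ E₁)] [∀ x, TopologicalSpace (E₁ x)]
  [∀ x, AddCommGroup (E₁ x)] [∀ x, Module ℝ (E₁ x)] [∀ x, IsTopologicalAddGroup (E₁ x)]
  [∀ x, ContinuousSMul ℝ (E₁ x)] [FiberBundle F₁ E₁] [VectorBundle ℝ F₁ E₁]

-- shortcut instances for multiplets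
instance : AddCommGroup (Fields d F₀ E₀ F₁ E₁) := Prod.instAddCommGroup
instance : AddCommMonoid (Fields d F₀ E₀ F₁ E₁) := Prod.instAddCommMonoid
instance : Zero (Fields d F₀ E₀ F₁ E₁) := Prod.instZero
instance : Module ℝ (Fields d F₀ E₀ F₁ E₁) := Prod.instModule

instance : AddCommGroup (Antifields d F₀ E₀ F₁ E₁) := Prod.instAddCommGroup
instance : AddCommMonoid (Antifields d F₀ E₀ F₁ E₁) := Prod.instAddCommMonoid
instance : Zero (Antifields d F₀ E₀ F₁ E₁) := Prod.instZero
instance : Module ℝ (Antifields d F₀ E₀ F₁ E₁) := Prod.instModule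

instance : AddCommGroup (Ev d F₀ E₀ F₁ E₁) := Prod.instAddCommGroup
instance : AddCommMonoid (Ev d F₀ E₀ F₁ E₁) := Prod.instAddCommMonoid
instance : Zero (Ev d F₀ E₀ F₁ E₁) := Prod.instZero
instance : Module ℝ (Ev d F₀ E₀ F₁ E₁) := Prod.instModule

instance : AddCommGroup (Od d F₀ E₀ F₁ E₁) := Prod.instAddCommGroup
instance : AddCommMonoid (Od d F₀ E₀ F₁ E₁) := Prod.instAddCommMonoid
instance : Zero (Od d F₀ E₀ F₁ E₁) := Prod.instZero
instance : Module ℝ (Od d F₀ E₀ F₁ E₁) := Prod.instModule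

instance : AddCommGroup (Tot d F₀ E₀ F₁ E₁) := Prod.instAddCommGroup
instance : AddCommMonoid (Tot d F₀ E₀ F₁ E₁) := Prod.instAddCommMonoid
instance : Zero (Tot d F₀ E₀ F₁ E₁) := Prod.instZero
instance : Module ℝ (Tot d F₀ E₀ F₁ E₁) := Prod.instModule

instance : AddCommGroup (Der d F₀ E₀ F₁ E₁) := Prod.instAddCommGroup
instance : AddCommMonoid (Der d F₀ E₀ F₁ E₁) := Prod.instAddCommMonoid
instance : Zero (Der d F₀ E₀ F₁ E₁) := Prod.instZero
instance : Module ℝ (Der d F₀ E₀ F₁ E₁) := Prod.instModule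

instance : AddCommGroup (Cx (Fields d F₀ E₀ F₁ E₁)) := Prod.instAddCommGroup
instance : AddCommMonoid (Cx (Fields d F₀ E₀ F₁ E₁)) := Prod.instAddCommMonoid
instance : Zero (Cx (Fields d F₀ E₀ F₁ E₁)) := Prod.instZero
instance : Module ℝ (Cx (Fields d F₀ E₀ F₁ E₁)) := Prod.instModule

instance : AddCommGroup (Cx (Antifields d F₀ E₀ F₁ E₁)) := Prod.instAddCommGroup
instance : AddCommMonoid (Cx (Antifields d F₀ E₀ F₁ E₁)) := Prod.instAddCommMonoid
instance : Zero (Cx (Antifields d F₀ E₀ F₁ E₁)) := Prod.instZero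
instance : Module ℝ (Cx (Antifields d F₀ E₀ F₁ E₁)) := Prod.instModule

instance : AddCommGroup (Cx (Tot d F₀ E₀ F₁ E₁)) := Prod.instAddCommGroup
instance : AddCommMonoid (Cx (Tot d F₀ E₀ F₁ E₁)) := Prod.instAddCommMonoid
instance : Zero (Cx (Tot d F₀ E₀ F₁ E₁)) := Prod.instZero
instance : Module ℝ (Cx (Tot d F₀ E₀ F₁ E₁)) := Prod.instModule

instance : AddCommGroup (Cx (Der d F₀ E₀ F₁ E₁)) := Prod.instAddCommGroup
instance : AddCommMonoid (Cx (Der d F₀ E₀ F₁ E₁)) := Prod.instAddCommMonoid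
instance : Zero (Cx (Der d F₀ E₀ F₁ E₁)) := Prod.instZero
instance : Module ℝ (Cx (Der d F₀ E₀ F₁ E₁)) := Prod.instModule

/-- The generators that occur in `Φ`. -/
def gens (Φ : Conf d F₀ E₀ F₁ E₁) : Finset ℕ := Φ.support.biUnion id

theorem subset_gens {Φ : Conf d F₀ E₀ F₁ E₁} {I : Finset ℕ} (h : I ∈ Φ.support) : I ⊆ gens Φ :=
  Finset.subset_biUnion_of_mem id h

theorem mem_evenIdx {Φ : Conf d F₀ E₀ F₁ E₁} {i : Finset ℕ × Bool} :
    i ∈ evenIdx Φ ↔ i.1 ∈ Φ.support ∧ i.1.Nonempty ∧ Even i.1.card := by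
  simp [evenIdx]

theorem mem_oddIdx {Φ : Conf d F₀ E₀ F₁ E₁} {i : Finset ℕ × Bool} :
    i ∈ oddIdx Φ ↔ i.1 ∈ Φ.support ∧ Odd i.1.card := by
  simp [oddIdx]

theorem evenIdx_gens {Φ : Conf d F₀ E₀ F₁ E₁} {i : Finset ℕ × Bool} (h : i ∈ evenIdx Φ) :
    i.1.Nonempty ∧ i.1 ⊆ gens Φ := by
  rw [mem_evenIdx] at h
  exact ⟨h.2.1, subset_gens h.1⟩

theorem oddIdx_gens {Φ : Conf d F₀ E₀ F₁ E₁} {i : Finset ℕ × Bool} (h : i ∈ oddIdx Φ) :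
    i.1.Nonempty ∧ i.1 ⊆ gens Φ := by
  rw [mem_oddIdx] at h
  exact ⟨Finset.card_pos.1 h.2.pos, subset_gens h.1⟩

/-- The antifield-free and ghost-free part of a graded functional, at an even configuration. -/
def scalarPart (v : Ev d F₀ E₀ F₁ E₁) (c : Components d F₀ E₀ F₁ E₁) : Grassmann :=
  algebraMap ℂ Grassmann (c 0 v Fin.elim0)

/-- The Taylor expansion in the odd coefficients, over words shorter than `N`. -/
def oddExp (N : ℕ) (Φ : Conf d F₀ E₀ F₁ E₁) (v : Ev d F₀ E₀ F₁ E₁)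
    (c : Components d F₀ E₀ F₁ E₁) : Grassmann :=
  expSum N (oddIdx Φ) elt (fun i ↦ dO (oddPart (coef Φ i))) (scalarPart v) c

/-- The Taylor expansion in all nilpotent coefficients, over words shorter than `N`. -/
def fullExp (N : ℕ) (Φ : Conf d F₀ E₀ F₁ E₁) (c : Components d F₀ E₀ F₁ E₁) : Grassmann :=
  expSum N (evenIdx Φ) elt (fun i ↦ dE (evenPart (coef Φ i))) (oddExp N Φ (body Φ)) c

theorem oddExp_eq {Φ : Conf d F₀ E₀ F₁ E₁} {N : ℕ} (hN : numGen Φ + 1 ≤ N)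
    (v : Ev d F₀ E₀ F₁ E₁) (c : Components d F₀ E₀ F₁ E₁) :
    oddExp N Φ v c = oddExp (numGen Φ + 1) Φ v c :=
  expSum_elt_eq (fun _ ↦ oddIdx_gens) _ _ hN c

theorem fullExp_eq {Φ : Conf d F₀ E₀ F₁ E₁} {N : ℕ} (hN : numGen Φ + 1 ≤ N)
    (c : Components d F₀ E₀ F₁ E₁) :
    fullExp N Φ c = fullExp (numGen Φ + 1) Φ c := by
  unfold fullExp
  rw [funext (oddExp_eq hN (body Φ))]
  exact expSum_elt_eq (fun _ ↦ evenIdx_gens) _ _ hN c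

variable {c c' : Components d F₀ E₀ F₁ E₁}

/-- The value of a graded functional as an iterated exponential series. -/
theorem eval_eq_fullExp (hc : IsSmoothAlt c) (Φ : Conf d F₀ E₀ F₁ E₁) {N : ℕ}
    (hN : numGen Φ + 1 ≤ N) : eval c Φ = fullExp N Φ c := by
  rw [fullExp_eq hN]
  unfold fullExp eval expSum
  refine Finset.sum_congr rfl fun j _ ↦ ?_
  have h1 : ∀ c, oddExp (numGen Φ + 1) Φ (body Φ) c = ∑ k ∈ Finset.range (numGen Φ + 1),
      ((k.factorial : ℂ)⁻¹) • wordSum (oddIdx Φ) elt (fun i ↦ dO (oddPart (coef Φ i)))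
        (scalarPart (body Φ)) k c := fun _ ↦ rfl
  rw [funext h1, wordSum_sum_fun, Finset.smul_sum]
  refine Finset.sum_congr rfl fun k _ ↦ ?_
  rw [wordSum_smul_fun, smul_smul]
  push_cast
  rw [mul_inv]
  congr 1
  rw [wordSum_eq_sum_words]
  refine Finset.sum_congr rfl fun a _ ↦ ?_
  rw [wordSum_eq_sum_words, Finset.mul_sum]
  refine Finset.sum_congr rfl fun b _ ↦ ?_
  have hE : ∀ (j : ℕ) (a : Fin j → Finset ℕ × Bool) (c : Components d F₀ E₀ F₁ E₁),
      opWord (fun i ↦ dE (evenPart (coef Φ i))) j a c =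
        opWord dE j (fun i ↦ evenPart (coef Φ (a i))) c := by
    intro j
    induction j with
    | zero => intro _ _; rfl
    | succ j ih => intro a c; simp only [opWord]; rw [ih]; rfl
  have hO : ∀ (j : ℕ) (a : Fin j → Finset ℕ × Bool) (c : Components d F₀ E₀ F₁ E₁),
      opWord (fun i ↦ dO (oddPart (coef Φ i))) j a c =
        opWord dO j (fun i ↦ oddPart (coef Φ (a i))) c := by
    intro j
    induction j with
    | zero => intro _ _; rfl
    | succ j ih => intro a c; simp only [opWord]; rw [ih]; rfl
  rw [hE, hO, scalarPart, opWord_dO_apply, mixedDeriv, hc.mixed_eq, ← mul_assoc,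
    ← Algebra.commutes, ← Algebra.smul_def]

theorem scalarPart_neg (v : Ev d F₀ E₀ F₁ E₁) (c : Components d F₀ E₀ F₁ E₁) :
    scalarPart v (-c) = -scalarPart v c := by
  simp [scalarPart]

theorem scalarPart_add (v : Ev d F₀ E₀ F₁ E₁) (c c' : Components d F₀ E₀ F₁ E₁) :
    scalarPart v (c + c') = scalarPart v c + scalarPart v c' := by
  simp [scalarPart]

theorem dE_add_arg {A B : Type*} [AddCommGroup A] [Module ℝ A] [AddCommGroup B] [Module ℝ B]
    {c c' : GComp A B} (hc : IsSmoothAlt c) (hc' : IsSmoothAlt c') (e : A) :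
    dE e (c + c') = dE e c + dE e c' := by
  ext k v w
  have h1 := (hc.hasDerivAt k v w e 0).add (hc'.hasDerivAt k v w e 0)
  refine Eq.trans h1.deriv ?_
  simp

theorem oddExp_add (N : ℕ) (Φ : Conf d F₀ E₀ F₁ E₁) (v : Ev d F₀ E₀ F₁ E₁)
    (c c' : Components d F₀ E₀ F₁ E₁) :
    oddExp N Φ v (c + c') = oddExp N Φ v c + oddExp N Φ v c' :=
  expSum_add_arg (P := fun _ ↦ True) N (oddIdx Φ) elt (fun i ↦ dO (oddPart (coef Φ i)))
    (scalarPart v) (fun _ _ _ ↦ trivial) (fun _ _ _ _ _ ↦ rfl)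
    (fun c c' _ _ ↦ scalarPart_add v c c') trivial trivial

theorem eval_add (hc : IsSmoothAlt c) (hc' : IsSmoothAlt c') (Φ : Conf d F₀ E₀ F₁ E₁) :
    eval (c + c') Φ = eval c Φ + eval c' Φ := by
  rw [eval_eq_fullExp (hc.add hc') Φ le_rfl, eval_eq_fullExp hc Φ le_rfl,
    eval_eq_fullExp hc' Φ le_rfl]
  exact expSum_add_arg (P := IsSmoothAlt) (numGen Φ + 1) (evenIdx Φ) elt
    (fun i ↦ dE (evenPart (coef Φ i))) (oddExp (numGen Φ + 1) Φ (body Φ))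
    (fun i c hc ↦ hc.stable_dE _)
    (fun i c c' hc hc' ↦ dE_add_arg hc hc' _) (fun c c' _ _ ↦ oddExp_add _ _ _ c c') hc hc'

theorem oddExp_dO {N : ℕ} {Φ δ : Conf d F₀ E₀ F₁ E₁} (hd : Disjoint Φ.support δ.support) {n : ℕ}
    (hn : ∀ I ∈ δ.support, n ∈ I) (v : Ev d F₀ E₀ F₁ E₁) (hc : IsSmoothAlt c) :
    oddExp (N + 1) (Φ + δ) v c = oddExp (N + 1) Φ v c +
      ∑ i ∈ oddIdx δ, elt i * oddExp N Φ v (dO (oddPart (coef δ i)) c) := by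
  have hs : (Φ + δ).support = Φ.support ∪ δ.support := Finsupp.support_add_eq hd
  have hT : oddIdx (Φ + δ) = oddIdx Φ ∪ oddIdx δ := by
    ext i; simp only [mem_oddIdx, Finset.mem_union, hs]; tauto
  have hc1 : ∀ i, i.1 ∈ Φ.support → coef (Φ + δ) i = coef Φ i := by
    intro i hi
    have : δ i.1 = 0 := Finsupp.notMem_support_iff.1 (Finset.disjoint_left.1 hd hi)
    simp [coef, this]
  have hc2 : ∀ i, i.1 ∈ δ.support → coef (Φ + δ) i = coef δ i := by
    intro i hi
    have : Φ i.1 = 0 := Finsupp.notMem_support_iff.1 (Finset.disjoint_right.1 hd hi)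
    simp [coef, this]
  unfold oddExp
  rw [hT, expSum_union (P := IsSmoothAlt) _ _ _ _ (fun i c hc ↦ hc.stable_dO _) _ _ _ hc]
  · refine congrArg₂ (· + ·) ?_ (Finset.sum_congr rfl fun i hi ↦ ?_)
    · refine expSum_congr _ _ (fun _ _ ↦ rfl) (fun i hi ↦ ?_) _ _
      rw [hc1 i (mem_oddIdx.1 hi).1]
    · rw [hc2 i (mem_oddIdx.1 hi).1]
      refine congrArg (elt i * ·) ?_
      refine expSum_congr _ _ (fun _ _ ↦ rfl) (fun i hi ↦ ?_) _ _
      rw [hc1 i (mem_oddIdx.1 hi).1]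
  · rw [Finset.disjoint_left]
    intro i hi hi'
    exact Finset.disjoint_left.1 hd (mem_oddIdx.1 hi).1 (mem_oddIdx.1 hi').1
  · intro i i' c m hi hi' hc
    rw [hc.dO_comm, wordSum_neg_arg (oddIdx Φ) elt (fun i ↦ dO (oddPart (coef (Φ + δ) i)))
      (scalarPart v) (fun _ _ ↦ rfl) (scalarPart_neg v), ← mul_assoc,
      ← mul_assoc, inv_mul_of_odd (inv_elt_of_odd (mem_oddIdx.1 hi).2),
      inv_elt_of_odd (mem_oddIdx.1 hi').2]
    simp
  · intro i hi i' hi' x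
    exact elt_mul_elt_eq_zero (hn _ (mem_oddIdx.1 hi).1) (hn _ (mem_oddIdx.1 hi').1) x

/-- The Taylor formula of first order: the increment `δ` is of square zero since all its terms
contain the generator `θ_n`. -/
theorem eval_add_increment (hc : IsSmoothAlt c) {Φ δ : Conf d F₀ E₀ F₁ E₁}
    (hd : Disjoint Φ.support δ.support) {n : ℕ} (hn : ∀ I ∈ δ.support, n ∈ I) :
    eval c (Φ + δ) = eval c Φ +
      (∑ i ∈ evenIdx δ, elt i * eval (dE (evenPart (coef δ i)) c) Φ +
        ∑ i ∈ oddIdx δ, elt i * eval (dO (oddPart (coef δ i)) c) Φ) := by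
  have hs : (Φ + δ).support = Φ.support ∪ δ.support := Finsupp.support_add_eq hd
  have hT : evenIdx (Φ + δ) = evenIdx Φ ∪ evenIdx δ := by
    ext i; simp only [mem_evenIdx, Finset.mem_union, hs]; tauto
  have hc1 : ∀ i, i.1 ∈ Φ.support → coef (Φ + δ) i = coef Φ i := by
    intro i hi
    have : δ i.1 = 0 := Finsupp.notMem_support_iff.1 (Finset.disjoint_left.1 hd hi)
    simp [coef, this]
  have hc2 : ∀ i, i.1 ∈ δ.support → coef (Φ + δ) i = coef δ i := by
    intro i hi
    have : Φ i.1 = 0 := Finsupp.notMem_support_iff.1 (Finset.disjoint_right.1 hd hi)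
    simp [coef, this]
  have hb : body (Φ + δ) = body Φ := by
    have : δ ∅ = 0 := by
      by_contra h
      exact absurd (hn ∅ (Finsupp.mem_support_iff.2 h)) (by simp)
    simp [body, this]
  have hdE : Disjoint (evenIdx Φ) (evenIdx δ) := by
    rw [Finset.disjoint_left]
    intro i hi hi'
    exact Finset.disjoint_left.1 hd (mem_evenIdx.1 hi).1 (mem_evenIdx.1 hi').1
  set N := max (numGen Φ + 1) (numGen (Φ + δ) + 1) with hN
  have hN1 : numGen Φ + 1 ≤ N := le_max_left _ _
  have hN2 : numGen (Φ + δ) + 1 ≤ N + 1 := (le_max_right _ _).trans (Nat.le_succ _)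
  -- the exponential series in the even coefficients, for any choice of the innermost functional
  have hEven : ∀ (G : Components d F₀ E₀ F₁ E₁ → Grassmann) (c : Components d F₀ E₀ F₁ E₁),
      IsSmoothAlt c →
      expSum (N + 1) (evenIdx Φ ∪ evenIdx δ) elt (fun i ↦ dE (evenPart (coef (Φ + δ) i))) G c =
        expSum (N + 1) (evenIdx Φ) elt (fun i ↦ dE (evenPart (coef Φ i))) G c +
        ∑ i ∈ evenIdx δ, elt i *
          expSum N (evenIdx Φ) elt (fun i ↦ dE (evenPart (coef Φ i))) G
            (dE (evenPart (coef δ i)) c) := by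
    intro G c hc
    rw [expSum_union (P := IsSmoothAlt) hdE _ _ _ (fun i c hc ↦ hc.stable_dE _) _ _ _ hc]
    · refine congrArg₂ (· + ·) ?_ (Finset.sum_congr rfl fun i hi ↦ ?_)
      · refine expSum_congr _ _ (fun _ _ ↦ rfl) (fun i hi ↦ ?_) _ _
        rw [hc1 i (mem_evenIdx.1 hi).1]
      · rw [hc2 i (mem_evenIdx.1 hi).1]
        refine congrArg (elt i * ·) ?_
        refine expSum_congr _ _ (fun _ _ ↦ rfl) (fun i hi ↦ ?_) _ _
        rw [hc1 i (mem_evenIdx.1 hi).1]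
    · intro i i' c m hi hi' hc
      rw [hc.dE_comm, ← mul_assoc, ← mul_assoc,
        commute_of_even (inv_elt_of_even (mem_evenIdx.1 hi).2.2)]
    · intro i hi i' hi' x
      exact elt_mul_elt_eq_zero (hn _ (mem_evenIdx.1 hi).1) (hn _ (mem_evenIdx.1 hi').1) x
  have hval : ∀ c, IsSmoothAlt c →
      expSum N (evenIdx Φ) elt (fun i ↦ dE (evenPart (coef Φ i)))
        (oddExp (N + 1) Φ (body Φ)) c = eval c Φ := by
    intro c hc
    rw [eval_eq_fullExp hc Φ hN1, fullExp]
    refine expSum_invariant (P := fun _ ↦ True) _ _ _ _ (fun _ _ _ ↦ trivial) (fun c _ ↦ ?_) trivial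
    rw [oddExp_eq hN1, oddExp_eq (hN1.trans (Nat.le_succ _))]
  rw [eval_eq_fullExp (hc) (Φ + δ) hN2, fullExp, hT, hb]
  rw [expSum_invariant (P := IsSmoothAlt) _ _ _ _ (fun i c hc ↦ hc.stable_dE _)
    (fun c hc ↦ oddExp_dO hd hn (body Φ) hc) hc, expSum_add_fun, hEven _ _ hc, expSum_sum_fun,
    eval_eq_fullExp hc Φ (hN1.trans (Nat.le_succ _)), fullExp, add_assoc]
  refine congrArg (_ + ·) (congrArg₂ (· + ·) (Finset.sum_congr rfl fun i _ ↦ ?_)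
    (Finset.sum_congr rfl fun i hi ↦ ?_))
  · rw [hval _ (hc.stable_dE _)]
  · rw [expSum_mul_left, hEven _ _ hc, mul_add, Finset.mul_sum]
    · rw [Finset.sum_eq_zero, add_zero]
      · refine congrArg (elt i * ·) ?_
        rw [expSum_map (F := dO (oddPart (coef δ i))) (op' := fun i ↦ dE (evenPart (coef Φ i)))
          (G' := oddExp N Φ (body Φ)) (hop := fun _ _ ↦ rfl) (hG := fun _ ↦ rfl)]
        rw [eval_eq_fullExp (hc.stable_dO _) Φ (hN1.trans (Nat.le_succ _)), fullExp]
        refine expSum_invariant (P := fun _ ↦ True) _ _ _ _ (fun _ _ _ ↦ trivial)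
          (fun c _ ↦ ?_) trivial
        rw [oddExp_eq hN1, oddExp_eq (hN1.trans (Nat.le_succ _))]
      · intro i' hi'
        have := elt_mul_elt_eq_zero (hn _ (mem_oddIdx.1 hi).1) (hn _ (mem_evenIdx.1 hi').1) 1
        rw [mul_one] at this
        rw [← mul_assoc, this, zero_mul]
    · intro i' hi'
      rcases Finset.mem_union.1 hi' with h | h
      · exact commute_of_even (inv_elt_of_even (mem_evenIdx.1 h).2.2) _
      · exact commute_of_even (inv_elt_of_even (mem_evenIdx.1 h).2.2) _

/-- The change of sign of the odd variables. -/
def flipOdd (Φ : Conf d F₀ E₀ F₁ E₁) : Conf d F₀ E₀ F₁ E₁ :=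
  Φ.mapRange (fun z ↦ (((z.1.1.1, -z.1.1.2), (-z.1.2.1, z.1.2.2)),
      ((z.2.1.1, -z.2.1.2), (-z.2.2.1, z.2.2.2)))) (by simp)

/-- The change of sign of the odd variables is the grading involution of the values. -/
theorem eval_flipOdd (hc : IsSmoothAlt c) (Φ : Conf d F₀ E₀ F₁ E₁) :
    eval c (flipOdd Φ) = inv (eval c Φ) := by
  have hs : (flipOdd Φ).support = Φ.support := by
    refine Finsupp.support_mapRange_of_injective _ _ ?_
    rintro ⟨⟨⟨a, b⟩, ⟨e, f⟩⟩, ⟨⟨a', b'⟩, ⟨e', f'⟩⟩⟩ ⟨⟨⟨x, y⟩, ⟨z, t⟩⟩, ⟨⟨x', y'⟩, ⟨z', t'⟩⟩⟩ h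
    simpa using h
  have hN : numGen (flipOdd Φ) = numGen Φ := by simp only [numGen, hs]
  have hE : evenIdx (flipOdd Φ) = evenIdx Φ := by simp only [evenIdx, hs]
  have hO : oddIdx (flipOdd Φ) = oddIdx Φ := by simp only [oddIdx, hs]
  have hb : body (flipOdd Φ) = body Φ := by simp [body, flipOdd]
  have hce : ∀ i, evenPart (coef (flipOdd Φ) i) = evenPart (coef Φ i) := by
    intro i
    simp only [coef, flipOdd, Finsupp.mapRange_apply, evenPart]
    split_ifs <;> rfl
  have hco : ∀ i, oddPart (coef (flipOdd Φ) i) = -oddPart (coef Φ i) := by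
    intro i
    simp only [coef, flipOdd, Finsupp.mapRange_apply, oddPart]
    split_ifs <;> rfl
  rw [eval_eq_fullExp hc _ le_rfl, eval_eq_fullExp hc _ le_rfl, fullExp, fullExp, inv_expSum, hE,
    hN, hb]
  simp only [hce]
  rw [expSum_congr _ _ (fun i hi ↦ (inv_elt_of_even (mem_evenIdx.1 hi).2.2)) (fun _ _ ↦ rfl)]
  refine expSum_invariant (P := IsSmoothAlt) _ _ _ _ (fun i c hc ↦ hc.stable_dE _)
    (fun c hc ↦ ?_) hc
  rw [oddExp, oddExp, inv_expSum, hO]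
  simp only [hco]
  have h1 : ∀ c : Components d F₀ E₀ F₁ E₁, inv (scalarPart (body Φ) c) = scalarPart (body Φ) c :=
    fun c ↦ AlgHom.commutes _ _
  simp only [h1]
  unfold expSum
  refine Finset.sum_congr rfl fun j _ ↦ ?_
  congr 1
  rw [wordSum_neg_op (P := IsSmoothAlt) (oddIdx Φ) elt (fun i ↦ dO (oddPart (coef Φ i)))
    (fun i ↦ dO (-oddPart (coef Φ i))) (scalarPart (body Φ))
    (fun i c hc ↦ hc.stable_dO _) (fun i c hc ↦ ?_) (fun _ _ ↦ rfl) (scalarPart_neg _) _ hc]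
  · refine wordSum_congr _ (fun i hi ↦ ?_) (fun _ _ ↦ rfl) _ _ _
    rw [inv_elt_of_odd (mem_oddIdx.1 hi).2]; rfl
  · ext k v w
    have := hc.dO_smul (-1) (oddPart (coef Φ i)) k v w
    simpa using this

end Eval

/-! ### Integrals with parameters and smooth densities -/

section Parametric

variable {d : ℕ} {M : Type*} [TopologicalSpace M] [ChartedSpace (EuclideanSpace ℝ (Fin d)) M]
  [IsManifold (𝓡 d) ∞ M]

/-- Partial derivatives of jointly smooth functions are jointly smooth. -/
theorem contMDiff_fderiv_param {E G : Type*} [NormedAddCommGroup E] [NormedSpace ℝ E]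
    [NormedAddCommGroup G] [NormedSpace ℝ G] {f : E × M → G}
    (hf : ContMDiff (𝓘(ℝ, E).prod (𝓡 d)) 𝓘(ℝ, G) ∞ f) :
    ContMDiff (𝓘(ℝ, E).prod (𝓡 d)) 𝓘(ℝ, E →L[ℝ] G) ∞
      (fun p : E × M ↦ fderiv ℝ (fun s ↦ f (s, p.2)) p.1) := by
  intro p
  have h1 : ContMDiffAt ((𝓘(ℝ, E).prod (𝓡 d)).prod 𝓘(ℝ, E)) 𝓘(ℝ, G) ∞
      (Function.uncurry fun (q : E × M) (s : E) ↦ f (s, q.2)) (p, p.1) := by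
    refine (hf.comp (f := fun q : (E × M) × E ↦ ((q.2, q.1.2) : E × M)) ?_).contMDiffAt
    exact contMDiff_snd.prodMk (contMDiff_snd.comp contMDiff_fst)
  have h2 := ContMDiffAt.mfderiv (m := ∞) (n := ∞) (fun (q : E × M) (s : E) ↦ f (s, q.2))
    (fun q : E × M ↦ q.1) h1 contMDiffAt_fst (by simp)
  simpa [inTangentCoordinates_model_space, mfderiv_eq_fderiv] using h2

variable [MeasurableSpace M] [BorelSpace M] [T2Space M] [SigmaCompactSpace M]

/-- Differentiation under the integral sign, for jointly smooth integrands of uniformly compact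
support. -/
theorem hasFDerivAt_integral_param {μ : Measure M} [IsFiniteMeasureOnCompacts μ]
    {E G : Type*} [NormedAddCommGroup E] [NormedSpace ℝ E] [FiniteDimensional ℝ E]
    [NormedAddCommGroup G] [NormedSpace ℝ G] {f : E × M → G}
    (hf : ContMDiff (𝓘(ℝ, E).prod (𝓡 d)) 𝓘(ℝ, G) ∞ f) {K : Set M} (hK : IsCompact K)
    (hfK : ∀ s, ∀ x ∉ K, f (s, x) = 0) (s₀ : E) :
    HasFDerivAt (fun s ↦ ∫ x, f (s, x) ∂μ) (∫ x, fderiv ℝ (fun s ↦ f (s, x)) s₀ ∂μ) s₀ := by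
  have : SecondCountableTopology M :=
    ChartedSpace.secondCountable_of_sigmaCompact (EuclideanSpace ℝ (Fin d)) M
  have : ProperSpace E := FiniteDimensional.proper ℝ E
  have hf' := contMDiff_fderiv_param hf
  have hcont (s : E) : Continuous fun x ↦ f (s, x) :=
    hf.continuous.comp (Continuous.prodMk_right s)
  have hint (s : E) : Integrable (fun x ↦ f (s, x)) μ :=
    (hcont s).integrable_of_hasCompactSupport (HasCompactSupport.intro hK fun x hx ↦ hfK s x hx)
  have hcont' (s : E) : Continuous fun x ↦ fderiv ℝ (fun s ↦ f (s, x)) s :=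
    hf'.continuous.comp (Continuous.prodMk_right s)
  obtain ⟨C, hC⟩ := ((isCompact_closedBall s₀ 1).prod hK).exists_bound_of_continuousOn
    hf'.continuous.continuousOn
  refine hasFDerivAt_integral_of_dominated_of_fderiv_le (μ := μ)
    (F := fun s x ↦ f (s, x)) (F' := fun s x ↦ fderiv ℝ (fun s ↦ f (s, x)) s)
    (bound := K.indicator fun _ ↦ C)
    (Metric.closedBall_mem_nhds s₀ one_pos)
    (Eventually.of_forall fun s ↦ (hcont s).aestronglyMeasurable) (hint s₀)
    (hcont' s₀).aestronglyMeasurable (Eventually.of_forall fun x s hs ↦ ?_) ?_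
    (Eventually.of_forall fun x s hs ↦ ?_)
  · by_cases hx : x ∈ K
    · rw [indicator_of_mem hx]
      exact hC (s, x) ⟨hs, hx⟩
    · have : (fun s ↦ f (s, x)) = fun _ ↦ 0 := funext fun s ↦ hfK s x hx
      simp [this, indicator_of_notMem hx]
  · exact (integrable_indicator_iff hK.measurableSet).2
      (integrableOn_const hK.measure_lt_top.ne)
  · have : ContDiff ℝ ∞ fun s ↦ f (s, x) := by
      rw [← contMDiff_iff_contDiff]
      exact hf.comp (contMDiff_id.prodMk contMDiff_const)
    exact (this.differentiable (by simp) s).hasFDerivAt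

/-- Integrals of jointly smooth functions with compact support depend smoothly on parameters. -/
theorem contDiff_integral_param {μ : Measure M} [IsFiniteMeasureOnCompacts μ]
    {E : Type} [NormedAddCommGroup E] [NormedSpace ℝ E] [FiniteDimensional ℝ E]
    {G : Type} [NormedAddCommGroup G] [NormedSpace ℝ G] {f : E × M → G}
    (hf : ContMDiff (𝓘(ℝ, E).prod (𝓡 d)) 𝓘(ℝ, G) ∞ f) {K : Set M} (hK : IsCompact K)
    (hfK : ∀ s, ∀ x ∉ K, f (s, x) = 0) :
    ContDiff ℝ ∞ (fun s ↦ ∫ x, f (s, x) ∂μ) := by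
  rw [contDiff_infty]
  intro n
  induction n generalizing G with
  | zero =>
    rw [Nat.cast_zero, contDiff_zero, continuous_iff_continuousAt]
    exact fun s ↦ (hasFDerivAt_integral_param hf hK hfK s).continuousAt
  | succ n ih =>
    rw [Nat.cast_add, Nat.cast_one, contDiff_succ_iff_fderiv]
    refine ⟨fun s ↦ (hasFDerivAt_integral_param hf hK hfK s).differentiableAt, by simp, ?_⟩
    have h1 : fderiv ℝ (fun s ↦ ∫ x, f (s, x) ∂μ) =
        fun s ↦ ∫ x, fderiv ℝ (fun s ↦ f (s, x)) s ∂μ :=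
      funext fun s ↦ (hasFDerivAt_integral_param hf hK hfK s).fderiv
    rw [h1]
    refine ih (f := fun p : E × M ↦ fderiv ℝ (fun s ↦ f (s, p.2)) p.1)
      (contMDiff_fderiv_param hf) fun s x hx ↦ ?_
    have : (fun s ↦ f (s, x)) = fun _ ↦ 0 := funext fun s ↦ hfK s x hx
    simp [this]

end Parametric

section Density

variable {d : ℕ} {M : Type*} [TopologicalSpace M] [ChartedSpace (EuclideanSpace ℝ (Fin d)) M]
  [MeasurableSpace M] [BorelSpace M] {μ : Measure M}

/-- In a chart, a smooth density is Lebesgue measure with a smooth weight. -/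
theorem IsSmoothDensity.restrict_eq_map {x₀ : M} {ρ : EuclideanSpace ℝ (Fin d) → ℝ}
    (hρ : ∀ s ⊆ (extChartAt (𝓡 d) x₀).source, MeasurableSet s →
      μ s = ∫⁻ y in extChartAt (𝓡 d) x₀ '' s, ENNReal.ofReal (ρ y)) :
    μ.restrict (extChartAt (𝓡 d) x₀).source =
      ((volume.restrict (extChartAt (𝓡 d) x₀).target).withDensity
        (fun y ↦ ENNReal.ofReal (ρ y))).map (extChartAt (𝓡 d) x₀).symm := by
  classical
  have hsm : MeasurableSet (extChartAt (𝓡 d) x₀).source :=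
    (isOpen_extChartAt_source x₀).measurableSet
  have htm : MeasurableSet (extChartAt (𝓡 d) x₀).target :=
    (isOpen_extChartAt_target x₀).measurableSet
  have hae : AEMeasurable (extChartAt (𝓡 d) x₀).symm
      ((volume.restrict (extChartAt (𝓡 d) x₀).target).withDensity
        (fun y ↦ ENNReal.ofReal (ρ y))) :=
    ((continuousOn_extChartAt_symm x₀).aemeasurable htm).mono_ac
      (withDensity_absolutelyContinuous _ _)
  ext s hs
  rw [Measure.restrict_apply hs, hρ _ inter_subset_right (hs.inter hsm)]
  rw [Measure.map_apply_of_aemeasurable hae hs]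
  have hset : extChartAt (𝓡 d) x₀ '' (s ∩ (extChartAt (𝓡 d) x₀).source) =
      (extChartAt (𝓡 d) x₀).target ∩ (extChartAt (𝓡 d) x₀).symm ⁻¹' s := by
    rw [inter_comm, (extChartAt (𝓡 d) x₀).image_source_inter_eq']
  have hnull : MeasurableSet ((extChartAt (𝓡 d) x₀).target ∩ (extChartAt (𝓡 d) x₀).symm ⁻¹' s) := by
    have h1 := (continuousOn_extChartAt_symm (I := 𝓡 d) x₀).measurable_piecewise
      (continuousOn_const (c := x₀)) htm
    have h2 : (extChartAt (𝓡 d) x₀).target ∩ (extChartAt (𝓡 d) x₀).symm ⁻¹' s =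
        (extChartAt (𝓡 d) x₀).target ∩ ((extChartAt (𝓡 d) x₀).target.piecewise
          (extChartAt (𝓡 d) x₀).symm (fun _ ↦ x₀)) ⁻¹' s := by
      ext y
      simp only [mem_inter_iff, mem_preimage, and_congr_right_iff]
      intro hy
      rw [piecewise_eq_of_mem _ _ _ hy]
    rw [h2]
    exact htm.inter (h1 hs)
  rw [hset, ← withDensity_apply _ hnull]
  rw [← restrict_withDensity htm, Measure.restrict_apply₀']
  · rw [inter_comm]
  · exact htm.nullMeasurableSet

theorem IsSmoothDensity.integral_eq {x₀ : M} {ρ : EuclideanSpace ℝ (Fin d) → ℝ}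
    (hc : ContinuousOn ρ (extChartAt (𝓡 d) x₀).target)
    (hpos : ∀ y ∈ (extChartAt (𝓡 d) x₀).target, 0 < ρ y)
    (hρ : ∀ s ⊆ (extChartAt (𝓡 d) x₀).source, MeasurableSet s →
      μ s = ∫⁻ y in extChartAt (𝓡 d) x₀ '' s, ENNReal.ofReal (ρ y))
    {f : M → ℝ} (hf : Continuous f) (hfs : ∀ x ∉ (extChartAt (𝓡 d) x₀).source, f x = 0) :
    ∫ x, f x ∂μ = ∫ y in (extChartAt (𝓡 d) x₀).target,
      f ((extChartAt (𝓡 d) x₀).symm y) * ρ y := by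
  have htm : MeasurableSet (extChartAt (𝓡 d) x₀).target :=
    (isOpen_extChartAt_target x₀).measurableSet
  have hae : AEMeasurable (extChartAt (𝓡 d) x₀).symm
      ((volume.restrict (extChartAt (𝓡 d) x₀).target).withDensity
        (fun y ↦ ENNReal.ofReal (ρ y))) :=
    ((continuousOn_extChartAt_symm x₀).aemeasurable htm).mono_ac
      (withDensity_absolutelyContinuous _ _)
  rw [← setIntegral_eq_integral_of_forall_compl_eq_zero hfs,
    IsSmoothDensity.restrict_eq_map hρ, integral_map hae hf.aestronglyMeasurable,
    integral_withDensity_eq_integral_toReal_smul₀ (hc.aemeasurable htm).ennreal_ofReal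
      (Eventually.of_forall fun _ ↦ ENNReal.ofReal_lt_top)]
  refine setIntegral_congr_fun htm fun y hy ↦ ?_
  simp only [smul_eq_mul]
  rw [ENNReal.toReal_ofReal (hpos y hy).le, mul_comm]

theorem IsSmoothDensity.isLocallyFiniteMeasure (hμ : IsSmoothDensity d μ) :
    IsLocallyFiniteMeasure μ where
  finiteAtNhds x := by
    obtain ⟨ρ, hρ, hpos, hs⟩ := hμ x
    have hmem : extChartAt (𝓡 d) x x ∈ (extChartAt (𝓡 d) x).target := mem_extChartAt_target x
    have ht := (isOpen_extChartAt_target (I := 𝓡 d) x).mem_nhds hmem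
    have hcont : ContinuousAt ρ (extChartAt (𝓡 d) x x) := hρ.continuousOn.continuousAt ht
    obtain ⟨ε, hε, hB⟩ := Metric.mem_nhds_iff.1 (inter_mem ht
      (hcont.preimage_mem_nhds (Iio_mem_nhds (lt_add_one (ρ (extChartAt (𝓡 d) x x))))))
    have hopen : IsOpen ((extChartAt (𝓡 d) x).source ∩
        extChartAt (𝓡 d) x ⁻¹' Metric.ball (extChartAt (𝓡 d) x x) ε) :=
      (continuousOn_extChartAt x).isOpen_inter_preimage (isOpen_extChartAt_source x)
        Metric.isOpen_ball
    refine ⟨_, hopen.mem_nhds ⟨mem_extChartAt_source x, Metric.mem_ball_self hε⟩, ?_⟩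
    rw [hs _ inter_subset_left hopen.measurableSet]
    have hsub : extChartAt (𝓡 d) x '' ((extChartAt (𝓡 d) x).source ∩
        extChartAt (𝓡 d) x ⁻¹' Metric.ball (extChartAt (𝓡 d) x x) ε) ⊆
        Metric.ball (extChartAt (𝓡 d) x x) ε := by
      rintro _ ⟨y, hy, rfl⟩; exact hy.2
    refine (lintegral_mono_set hsub).trans_lt ?_
    refine (setLIntegral_mono (g := fun _ ↦ ENNReal.ofReal (ρ (extChartAt (𝓡 d) x x) + 1))
      measurable_const
      fun y hy ↦ ENNReal.ofReal_le_ofReal (hB hy).2.le).trans_lt ?_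
    rw [setLIntegral_const]
    exact ENNReal.mul_lt_top ENNReal.ofReal_lt_top Metric.isBounded_ball.measure_lt_top

theorem IsSmoothDensity.isOpenPosMeasure (hμ : IsSmoothDensity d μ) :
    μ.IsOpenPosMeasure where
  open_pos U hU := by
    rintro ⟨x, hx⟩ h0
    obtain ⟨ρ, hρ, hpos, hs⟩ := hμ x
    have hopen : IsOpen (U ∩ (extChartAt (𝓡 d) x).source) := hU.inter (isOpen_extChartAt_source x)
    have h1 := hs _ inter_subset_right hopen.measurableSet
    rw [measure_mono_null inter_subset_left h0] at h1
    have himg : extChartAt (𝓡 d) x '' (U ∩ (extChartAt (𝓡 d) x).source) =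
        (extChartAt (𝓡 d) x).target ∩ (extChartAt (𝓡 d) x).symm ⁻¹' U := by
      rw [inter_comm, (extChartAt (𝓡 d) x).image_source_inter_eq']
    have hiopen : IsOpen (extChartAt (𝓡 d) x '' (U ∩ (extChartAt (𝓡 d) x).source)) := by
      rw [himg]
      exact (continuousOn_extChartAt_symm x).isOpen_inter_preimage (isOpen_extChartAt_target x) hU
    have hvol : volume (extChartAt (𝓡 d) x '' (U ∩ (extChartAt (𝓡 d) x).source)) = 0 := by
      have haem : AEMeasurable (fun y ↦ ENNReal.ofReal (ρ y))
          (volume.restrict (extChartAt (𝓡 d) x '' (U ∩ (extChartAt (𝓡 d) x).source))) := by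
        refine ((hρ.continuousOn.mono ?_).aemeasurable hiopen.measurableSet).ennreal_ofReal
        rw [himg]; exact inter_subset_left
      have h2 := (lintegral_eq_zero_iff' haem).1 h1.symm
      rw [Filter.EventuallyEq, ae_restrict_iff' hiopen.measurableSet] at h2
      refine measure_mono_null (fun y hy ↦ ?_) (ae_iff.1 h2)
      simp only [Pi.zero_apply, Classical.not_imp, mem_ofPred_eq]
      refine ⟨hy, ?_⟩
      rw [himg] at hy
      rw [ENNReal.ofReal_eq_zero, not_le]
      exact hpos y hy.1
    exact hiopen.measure_ne_zero _ ⟨_, x, ⟨hx, mem_extChartAt_source x⟩, rfl⟩ hvol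

end Density

/-! ### Adjoints of differential operators in a chart -/

section Euler

variable {E G : Type} [NormedAddCommGroup E] [NormedSpace ℝ E] [NormedAddCommGroup G]
  [NormedSpace ℝ G]

/-- Euler's identity for the Taylor coefficients: the radial derivative about `y₀` multiplies the
coefficient of order `j` at `y₀` by `j`. -/
theorem iteratedFDeriv_fderiv_radial {U : Set E} (hU : IsOpen U) {y₀ : E} (hy : y₀ ∈ U) (j : ℕ)
    {h : E → G} (hh : ContDiffOn ℝ ∞ h U) :
    iteratedFDeriv ℝ j (fun y ↦ fderiv ℝ h y (y - y₀)) y₀ = (j : ℝ) • iteratedFDeriv ℝ j h y₀ := by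
  induction j generalizing G with
  | zero => ext m; simp
  | succ j ih =>
    have hh' : ContDiffOn ℝ ∞ (fderiv ℝ h) U := hh.fderiv_of_isOpen hU (by simp)
    have hh'' : ContDiffOn ℝ ∞ (fderiv ℝ (fderiv ℝ h)) U := hh'.fderiv_of_isOpen hU (by simp)
    have hev : (fderiv ℝ fun y ↦ fderiv ℝ h y (y - y₀)) =ᶠ[𝓝 y₀]
        fun y ↦ fderiv ℝ h y + fderiv ℝ (fderiv ℝ h) y (y - y₀) := by
      filter_upwards [hU.mem_nhds hy] with y hyU
      have hd : DifferentiableAt ℝ (fderiv ℝ h) y :=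
        (hh'.contDiffAt (hU.mem_nhds hyU)).differentiableAt (by simp)
      have hsymm : IsSymmSndFDerivAt ℝ h y :=
        (hh.contDiffAt (hU.mem_nhds hyU)).isSymmSndFDerivAt (by
          rw [minSmoothness_of_isRCLikeNormedField]
          exact WithTop.coe_le_coe.2 le_top)
      ext v
      rw [fderiv_clm_apply hd (by fun_prop), fderiv_sub_const, fderiv_fun_id]
      simp [hsymm.eq v]
    have h1 : ContDiffAt ℝ j (fderiv ℝ h) y₀ :=
      (hh'.contDiffAt (hU.mem_nhds hy)).of_le (by exact_mod_cast le_top)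
    have h2 : ContDiffAt ℝ j (fun y ↦ fderiv ℝ (fderiv ℝ h) y (y - y₀)) y₀ :=
      (((hh''.contDiffAt (hU.mem_nhds hy)).clm_apply (by fun_prop))).of_le
        (by exact_mod_cast le_top)
    rw [iteratedFDeriv_succ_eq_comp_right, iteratedFDeriv_succ_eq_comp_right, Function.comp_apply,
      Function.comp_apply, (Filter.EventuallyEq.iteratedFDeriv ℝ hev j).eq_of_nhds]
    have h3 := iteratedFDeriv_add_apply h1 h2
    rw [ih hh'] at h3
    refine Eq.trans (congrArg _ h3) ?_
    rw [← map_smul]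
    congr 1
    push_cast
    module

end Euler

section Chart

variable {d : ℕ} {M : Type*} [TopologicalSpace M] [ChartedSpace (EuclideanSpace ℝ (Fin d)) M]
  [IsManifold (𝓡 d) ∞ M]

/-- A function that is smooth over an open set and vanishes off a closed subset of it is smooth. -/
theorem contMDiff_of_zero_off {E G : Type*} [NormedAddCommGroup E] [NormedSpace ℝ E]
    [NormedAddCommGroup G] [NormedSpace ℝ G] {f : E × M → G} {U K : Set M} (hU : IsOpen U)
    (hK : IsClosed K) (hKU : K ⊆ U)
    (hf : ContMDiffOn (𝓘(ℝ, E).prod (𝓡 d)) 𝓘(ℝ, G) ∞ f (univ ×ˢ U))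
    (h0 : ∀ s, ∀ x ∉ K, f (s, x) = 0) :
    ContMDiff (𝓘(ℝ, E).prod (𝓡 d)) 𝓘(ℝ, G) ∞ f := by
  rintro ⟨s, x⟩
  by_cases hx : x ∈ U
  · exact hf.contMDiffAt ((isOpen_univ.prod hU).mem_nhds ⟨mem_univ _, hx⟩)
  · refine (contMDiffAt_const (c := (0 : G))).congr_of_eventuallyEq ?_
    filter_upwards [(isOpen_univ.prod hK.isOpen_compl).mem_nhds
      ⟨mem_univ s, fun h ↦ hx (hKU h)⟩] with p hp
    exact h0 p.1 p.2 hp.2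

theorem contMDiff_of_zero_off' {G : Type*}
    [NormedAddCommGroup G] [NormedSpace ℝ G] {f : M → G} {U K : Set M} (hU : IsOpen U)
    (hK : IsClosed K) (hKU : K ⊆ U)
    (hf : ContMDiffOn (𝓡 d) 𝓘(ℝ, G) ∞ f U) (h0 : ∀ x ∉ K, f x = 0) :
    ContMDiff (𝓡 d) 𝓘(ℝ, G) ∞ f := by
  intro x
  by_cases hx : x ∈ U
  · exact hf.contMDiffAt (hU.mem_nhds hx)
  · refine (contMDiffAt_const (c := (0 : G))).congr_of_eventuallyEq ?_
    filter_upwards [hK.isOpen_compl.mem_nhds fun h ↦ hx (hKU h)] with y hy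
    exact h0 y hy

variable (d M) in
/-- The algebra of smooth real functions. -/
abbrev SmoothFun : Type _ := C^∞⟮𝓡 d, M; 𝓘(ℝ, ℝ), ℝ⟯

/-- The family `(h_s)` of functions is smooth in `(s, x)` jointly. -/
def SmoothFunFamily {n : ℕ} (h : (Fin n → ℝ) → SmoothFun d M) : Prop :=
  ContMDiff (𝓘(ℝ, Fin n → ℝ).prod (𝓡 d)) 𝓘(ℝ, ℝ) ∞ fun p : (Fin n → ℝ) × M ↦ h p.1 p.2

theorem smoothFunFamily_const (n : ℕ) (h : SmoothFun d M) :
    SmoothFunFamily fun _ : Fin n → ℝ ↦ h :=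
  h.contMDiff.comp contMDiff_snd

theorem SmoothFunFamily.mul {n : ℕ} {h h' : (Fin n → ℝ) → SmoothFun d M}
    (hh : SmoothFunFamily h) (hh' : SmoothFunFamily h') :
    SmoothFunFamily fun s ↦ h s * h' s :=
  ContMDiff.mul (I := 𝓘(ℝ, ℝ)) (G := ℝ) hh hh'

/-- The function `h` in the chart at `x₀`. -/
def inChart (x₀ : M) (h : M → ℝ) (y : EuclideanSpace ℝ (Fin d)) : ℝ :=
  h ((extChartAt (𝓡 d) x₀).symm y)

theorem contDiffOn_inChart (x₀ : M) {h : M → ℝ} (hh : ContMDiff (𝓡 d) 𝓘(ℝ, ℝ) ∞ h) :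
    ContDiffOn ℝ ∞ (inChart (d := d) x₀ h) (extChartAt (𝓡 d) x₀).target :=
  contMDiffOn_iff_contDiffOn.1 (hh.comp_contMDiffOn (contMDiffOn_extChartAt_symm x₀))

theorem differentiableAt_inChart {x₀ : M} {h : M → ℝ} (hh : ContMDiff (𝓡 d) 𝓘(ℝ, ℝ) ∞ h) {x : M}
    (hx : x ∈ (extChartAt (𝓡 d) x₀).source) :
    DifferentiableAt ℝ (inChart x₀ h) (extChartAt (𝓡 d) x₀ x) :=
  ((contDiffOn_inChart x₀ hh).contDiffAt ((isOpen_extChartAt_target x₀).mem_nhds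
    ((extChartAt (𝓡 d) x₀).map_source hx))).differentiableAt (by simp)

/-- The linear operator `t`, which maps functions to functions that vanish off `K`, is of order at
most `r` near the point `x₀`: in the chart at `x₀`, the value of `t h` at a point of `K` depends
on the derivatives of `h` of order at most `r`. Also, `t` preserves joint smoothness of families. -/
structure IsDiffOp (x₀ : M) (K : Set M) (r : ℕ) (t : SmoothFun d M →ₗ[ℝ] M → ℝ) : Prop where
  zero_off : ∀ h : SmoothFun d M, ∀ x ∉ K, t h x = 0
  order : ∀ h : SmoothFun d M, ∀ x ∈ K,
    (∀ j ≤ r, iteratedFDeriv ℝ j (inChart x₀ h) (extChartAt (𝓡 d) x₀ x) = 0) →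
    t h x = 0
  smooth : ∀ (n : ℕ) (h : (Fin n → ℝ) → SmoothFun d M), SmoothFunFamily h →
    ContMDiff (𝓘(ℝ, Fin n → ℝ).prod (𝓡 d)) 𝓘(ℝ, ℝ) ∞ fun p : (Fin n → ℝ) × M ↦ t (h p.1) p.2

theorem IsDiffOp.contMDiff_apply {x₀ : M} {K : Set M} {r : ℕ} {t : SmoothFun d M →ₗ[ℝ] M → ℝ}
    (ht : IsDiffOp x₀ K r t) (h : SmoothFun d M) : ContMDiff (𝓡 d) 𝓘(ℝ, ℝ) ∞ (t h) :=
  (ht.smooth 0 (fun _ ↦ h) (smoothFunFamily_const 0 h)).comp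
    (contMDiff_const (c := (0 : Fin 0 → ℝ)) |>.prodMk contMDiff_id)

/-- The partial derivative in the chart at `x₀`, multiplied by the cutoff function `ψ`. -/
def partialFun (x₀ : M) (ψ : SmoothFun d M) (i : Fin d) (h : M → ℝ) (x : M) : ℝ :=
  ψ x * fderiv ℝ (inChart x₀ h) (extChartAt (𝓡 d) x₀ x) (EuclideanSpace.single i 1)

theorem contMDiff_partialFun (x₀ : M) (ψ : SmoothFun d M)
    (hψ : tsupport ψ ⊆ (extChartAt (𝓡 d) x₀).source) (i : Fin d) {n : ℕ}
    {h : (Fin n → ℝ) → SmoothFun d M} (hh : SmoothFunFamily h) :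
    ContMDiff (𝓘(ℝ, Fin n → ℝ).prod (𝓡 d)) 𝓘(ℝ, ℝ) ∞
      fun p : (Fin n → ℝ) × M ↦ partialFun x₀ ψ i (h p.1) p.2 := by
  refine contMDiff_of_zero_off (isOpen_extChartAt_source (I := 𝓡 d) x₀) (isClosed_tsupport ψ) hψ ?_
    fun s x hx ↦ by simp [partialFun, image_eq_zero_of_notMem_tsupport hx]
  have h1 : ContDiffOn ℝ ∞ (fun q : (Fin n → ℝ) × EuclideanSpace ℝ (Fin d) ↦
      inChart x₀ (h q.1) q.2) (univ ×ˢ (extChartAt (𝓡 d) x₀).target) := by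
    rw [← contMDiffOn_iff_contDiffOn]
    refine hh.comp_contMDiffOn (s := univ ×ˢ (extChartAt (𝓡 d) x₀).target)
      (f := fun q : (Fin n → ℝ) × EuclideanSpace ℝ (Fin d) ↦
        ((q.1, (extChartAt (𝓡 d) x₀).symm q.2) : (Fin n → ℝ) × M)) ?_
    exact contDiff_fst.contMDiff.contMDiffOn.prodMk ((contMDiffOn_extChartAt_symm x₀).comp
      contDiff_snd.contMDiff.contMDiffOn fun q hq ↦ hq.2)
  have ho : IsOpen ((univ : Set (Fin n → ℝ)) ×ˢ (extChartAt (𝓡 d) x₀).target) :=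
    isOpen_univ.prod (isOpen_extChartAt_target x₀)
  have h2 : ContDiffOn ℝ ∞ (fun q : (Fin n → ℝ) × EuclideanSpace ℝ (Fin d) ↦
      fderiv ℝ (inChart x₀ (h q.1)) q.2 (EuclideanSpace.single i 1))
      (univ ×ˢ (extChartAt (𝓡 d) x₀).target) := by
    refine ((h1.fderiv_of_isOpen ho (m := ∞) (by simp)).clm_apply
      (contDiffOn_const (c := (0, EuclideanSpace.single i 1)))).congr fun q hq ↦ ?_
    have h3 := ((h1.contDiffAt (ho.mem_nhds hq)).differentiableAt (by simp)).hasFDerivAt.comp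
      q.2 (f := fun y ↦ (q.1, y)) (hasFDerivAt_prodMk_right q.1 q.2)
    rw [show (fderiv ℝ (inChart x₀ (h q.1)) q.2) = _ from h3.fderiv]
    simp
  refine ContMDiffOn.mul (I := 𝓘(ℝ, ℝ)) (G := ℝ) (ψ.contMDiff.comp contMDiff_snd).contMDiffOn ?_
  refine h2.contMDiffOn.comp (f := fun p : (Fin n → ℝ) × M ↦ (p.1, extChartAt (𝓡 d) x₀ p.2)) ?_ ?_
  · refine contMDiffOn_fst.prodMk_space ((contMDiffOn_extChartAt (x := x₀)).comp contMDiffOn_snd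
      fun q hq ↦ ?_)
    simpa using hq.2
  · intro q hq
    exact ⟨mem_univ _, (extChartAt (𝓡 d) x₀).map_source hq.2⟩

/-- The cut off partial derivative as an operator on smooth functions. -/
def partialOp (x₀ : M) (ψ : SmoothFun d M) (hψ : tsupport ψ ⊆ (extChartAt (𝓡 d) x₀).source)
    (i : Fin d) : SmoothFun d M →ₗ[ℝ] SmoothFun d M where
  toFun h := ⟨partialFun x₀ ψ i h, (contMDiff_partialFun x₀ ψ hψ i
    (smoothFunFamily_const 0 h)).comp
      (contMDiff_const (c := (0 : Fin 0 → ℝ)) |>.prodMk contMDiff_id)⟩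
  map_add' h h' := by
    ext x
    change ψ x * fderiv ℝ (inChart x₀ h + inChart x₀ h') (extChartAt (𝓡 d) x₀ x)
      (EuclideanSpace.single i 1) = partialFun x₀ ψ i h x + partialFun x₀ ψ i h' x
    by_cases hx : x ∈ (extChartAt (𝓡 d) x₀).source
    · rw [fderiv_add (differentiableAt_inChart h.contMDiff hx)
        (differentiableAt_inChart h'.contMDiff hx)]
      exact mul_add _ _ _
    · have : x ∉ tsupport ψ := fun h ↦ hx (hψ h)
      simp [partialFun, image_eq_zero_of_notMem_tsupport this]
  map_smul' c h := by
    ext x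
    change ψ x * fderiv ℝ (c • inChart x₀ h) (extChartAt (𝓡 d) x₀ x)
      (EuclideanSpace.single i 1) = c * partialFun x₀ ψ i h x
    by_cases hx : x ∈ (extChartAt (𝓡 d) x₀).source
    · rw [fderiv_const_smul (differentiableAt_inChart h.contMDiff hx)]
      exact mul_left_comm _ _ _
    · have : x ∉ tsupport ψ := fun h ↦ hx (hψ h)
      simp [partialFun, image_eq_zero_of_notMem_tsupport this]

/-- The coordinate functions of the chart at `x₀`, multiplied by the cutoff function `ψ`. -/
def coordFun (x₀ : M) (ψ : SmoothFun d M) (hψ : tsupport ψ ⊆ (extChartAt (𝓡 d) x₀).source)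
    (i : Fin d) : SmoothFun d M :=
  ⟨fun x ↦ ψ x * extChartAt (𝓡 d) x₀ x i, by
    refine contMDiff_of_zero_off' (isOpen_extChartAt_source (I := 𝓡 d) x₀) (isClosed_tsupport ψ)
      hψ ?_ fun x hx ↦ by simp [image_eq_zero_of_notMem_tsupport hx]
    refine ContMDiffOn.mul (I := 𝓘(ℝ, ℝ)) (G := ℝ) ψ.contMDiff.contMDiffOn ?_
    have h1 : ContMDiff 𝓘(ℝ, EuclideanSpace ℝ (Fin d)) 𝓘(ℝ, ℝ) ∞
        fun y : EuclideanSpace ℝ (Fin d) ↦ y i :=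
      (EuclideanSpace.proj (𝕜 := ℝ) i).contDiff.contMDiff
    refine h1.comp_contMDiffOn ((contMDiffOn_extChartAt (x := x₀)).mono ?_)
    rw [extChartAt_source]⟩

end Chart

section Adjoint

variable {d : ℕ} {M : Type*} [TopologicalSpace M] [ChartedSpace (EuclideanSpace ℝ (Fin d)) M]
  [IsManifold (𝓡 d) ∞ M]

theorem iteratedFDeriv_mul_eq_zero {E : Type*} [NormedAddCommGroup E] [NormedSpace ℝ E]
    {U : Set E} (hU : IsOpen U) {f g : E → ℝ} (hf : ContDiffOn ℝ ∞ f U) (hg : ContDiffOn ℝ ∞ g U)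
    {y : E} (hy : y ∈ U) {n : ℕ}
    (h : ∀ i ≤ n, iteratedFDeriv ℝ i f y = 0 ∨ iteratedFDeriv ℝ (n - i) g y = 0) :
    iteratedFDeriv ℝ n (fun y ↦ f y * g y) y = 0 := by
  have h1 := norm_iteratedFDerivWithin_mul_le hf hg hU.uniqueDiffOn hy (n := n)
    (by exact_mod_cast le_top)
  simp only [iteratedFDerivWithin_of_isOpen _ hU hy] at h1
  rw [← norm_le_zero_iff]
  refine h1.trans (Finset.sum_eq_zero fun i hi ↦ ?_).le
  rcases h i (Finset.mem_range_succ_iff.1 hi) with h | h <;> simp [h]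

/-- The commutator of an operator with the multiplication by a function. -/
def commOp (t : SmoothFun d M →ₗ[ℝ] M → ℝ) (f : SmoothFun d M) : SmoothFun d M →ₗ[ℝ] M → ℝ where
  toFun h x := t (f * h) x - f x * t h x
  map_add' h h' := by
    ext x; simp only [mul_add, map_add, Pi.add_apply]; ring
  map_smul' c h := by
    ext x; simp only [mul_smul_comm, map_smul, Pi.smul_apply, RingHom.id_apply, smul_eq_mul]; ring

theorem commOp_apply (t : SmoothFun d M →ₗ[ℝ] M → ℝ) (f h : SmoothFun d M) (x : M) :
    commOp t f h x = t (f * h - f x • h) x := by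
  simp [commOp]

theorem IsDiffOp.stable_commOp {x₀ : M} {K : Set M} (hK : K ⊆ (extChartAt (𝓡 d) x₀).source) {r : ℕ}
    {t : SmoothFun d M →ₗ[ℝ] M → ℝ} (ht : IsDiffOp x₀ K (r + 1) t) (f : SmoothFun d M) :
    IsDiffOp x₀ K r (commOp t f) where
  zero_off h x hx := by rw [commOp_apply, ht.zero_off _ x hx]
  order h x hx hj := by
    rw [commOp_apply]
    refine ht.order _ x hx fun j hjr ↦ ?_
    have hxs := (extChartAt (𝓡 d) x₀).map_source (hK hx)
    have h1 : inChart x₀ (f * h - f x • h : SmoothFun d M) =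
        fun y : EuclideanSpace ℝ (Fin d) ↦ (inChart x₀ f y - f x) * inChart x₀ h y := by
      ext y
      change f _ * h _ - f x * h _ = _
      rw [inChart, inChart]; ring
    rw [h1]
    refine iteratedFDeriv_mul_eq_zero (isOpen_extChartAt_target x₀)
      ((contDiffOn_inChart x₀ f.contMDiff).sub contDiffOn_const)
      (contDiffOn_inChart x₀ h.contMDiff) hxs fun i hi ↦ ?_
    rcases Nat.eq_zero_or_pos i with rfl | hi'
    · left
      ext m
      change f _ - f x = 0
      rw [(extChartAt (𝓡 d) x₀).left_inv (hK hx), sub_self]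
    · right
      exact hj _ (by omega)
  smooth n h hh := by
    refine ContMDiff.sub (I := 𝓘(ℝ, ℝ)) (G := ℝ)
      (ht.smooth n (fun s ↦ f * h s) ((smoothFunFamily_const n f).mul hh)) ?_
    exact ContMDiff.mul (I := 𝓘(ℝ, ℝ)) (G := ℝ) (f.contMDiff.comp contMDiff_snd) (ht.smooth n h hh)

/-- The remainder of `t` after its terms of highest order `r + 1` have been split off. -/
def lowerOp (x₀ : M) (ψ : SmoothFun d M) (hψ : tsupport ψ ⊆ (extChartAt (𝓡 d) x₀).source) (r : ℕ)
    (t : SmoothFun d M →ₗ[ℝ] M → ℝ) : SmoothFun d M →ₗ[ℝ] M → ℝ :=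
  ((r : ℝ) + 1) • t - ∑ i, commOp t (coordFun x₀ ψ hψ i) ∘ₗ partialOp x₀ ψ hψ i

theorem lowerOp_apply (x₀ : M) (ψ : SmoothFun d M)
    (hψ : tsupport ψ ⊆ (extChartAt (𝓡 d) x₀).source) (r : ℕ) (t : SmoothFun d M →ₗ[ℝ] M → ℝ)
    (h : SmoothFun d M) (x : M) : lowerOp x₀ ψ hψ r t h x = ((r : ℝ) + 1) * t h x -
      ∑ i, commOp t (coordFun x₀ ψ hψ i) (partialOp x₀ ψ hψ i h) x := by
  simp [lowerOp]

/-- The symbol of highest order is given by commutators with the coordinate functions. -/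
theorem IsDiffOp.stable_lowerOp {x₀ : M} {K : Set M} (hK : K ⊆ (extChartAt (𝓡 d) x₀).source) {r : ℕ}
    {t : SmoothFun d M →ₗ[ℝ] M → ℝ} (ht : IsDiffOp x₀ K (r + 1) t) (ψ : SmoothFun d M)
    (hψ : tsupport ψ ⊆ (extChartAt (𝓡 d) x₀).source) (hψK : ∀ x ∈ K, ∀ᶠ y in 𝓝 x, ψ y = 1) :
    IsDiffOp x₀ K r (lowerOp x₀ ψ hψ r t) where
  zero_off h x hx := by
    rw [lowerOp_apply, ht.zero_off _ x hx, mul_zero, zero_sub, neg_eq_zero]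
    exact Finset.sum_eq_zero fun i _ ↦ (ht.stable_commOp hK _).zero_off _ x hx
  order h x hx hj := by
    have hxs := (extChartAt (𝓡 d) x₀).map_source (hK hx)
    set g : SmoothFun d M := ((r : ℝ) + 1) • h - ∑ i, (coordFun x₀ ψ hψ i * partialOp x₀ ψ hψ i h -
      coordFun x₀ ψ hψ i x • partialOp x₀ ψ hψ i h) with hg
    have h1 : lowerOp x₀ ψ hψ r t h x = t g x := by
      rw [lowerOp_apply, hg]
      simp only [commOp_apply, map_sub, map_sum, map_smul]
      simp
    rw [h1]
    refine ht.order _ x hx fun j hjr ↦ ?_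
    have hcont : ContinuousAt (extChartAt (𝓡 d) x₀).symm (extChartAt (𝓡 d) x₀ x) :=
      continuousAt_extChartAt_symm'' hxs
    have h2 : inChart x₀ g =ᶠ[𝓝 (extChartAt (𝓡 d) x₀ x)] fun y ↦ ((r : ℝ) + 1) • inChart x₀ h y -
        fderiv ℝ (inChart x₀ h) y (y - extChartAt (𝓡 d) x₀ x) := by
      have h3 := hψK x hx
      rw [← (extChartAt (𝓡 d) x₀).left_inv (hK hx)] at h3
      filter_upwards [(isOpen_extChartAt_target x₀).mem_nhds hxs, hcont.eventually h3] with y hy hy1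
      have h4 : y - extChartAt (𝓡 d) x₀ x = ∑ i, (y i - extChartAt (𝓡 d) x₀ x i) •
          EuclideanSpace.single i (1 : ℝ) := by
        ext i
        simp [Finset.sum_apply, Pi.single_apply]
      rw [h4, map_sum]
      have h5 : g ((extChartAt (𝓡 d) x₀).symm y) = ((r : ℝ) + 1) * h ((extChartAt (𝓡 d) x₀).symm y) -
          ∑ i, (coordFun x₀ ψ hψ i ((extChartAt (𝓡 d) x₀).symm y) *
            partialOp x₀ ψ hψ i h ((extChartAt (𝓡 d) x₀).symm y) - coordFun x₀ ψ hψ i x *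
            partialOp x₀ ψ hψ i h ((extChartAt (𝓡 d) x₀).symm y)) := by
        rw [hg, ContMDiffMap.coe_sub, ContMDiffMap.coe_smul, Pi.sub_apply]
        congr 1
        rw [← ContMDiffMap.coeFnAddMonoidHom_apply, map_sum, Finset.sum_apply]
        rfl
      rw [inChart, h5]
      congr 1
      refine Finset.sum_congr rfl fun i _ ↦ ?_
      have h6 : coordFun x₀ ψ hψ i ((extChartAt (𝓡 d) x₀).symm y) = y i := by
        change ψ _ * (extChartAt (𝓡 d) x₀ ((extChartAt (𝓡 d) x₀).symm y)) i = _
        rw [hy1, one_mul, (extChartAt (𝓡 d) x₀).right_inv hy]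
      have h7 : coordFun x₀ ψ hψ i x = extChartAt (𝓡 d) x₀ x i := by
        change ψ _ * (extChartAt (𝓡 d) x₀ x) i = _
        rw [(hψK x hx).self_of_nhds, one_mul]
      have h8 : partialOp x₀ ψ hψ i h ((extChartAt (𝓡 d) x₀).symm y) =
          fderiv ℝ (inChart x₀ h) y (EuclideanSpace.single i 1) := by
        change ψ _ * fderiv ℝ _ (extChartAt (𝓡 d) x₀ ((extChartAt (𝓡 d) x₀).symm y)) _ = _
        rw [hy1, one_mul, (extChartAt (𝓡 d) x₀).right_inv hy]
      rw [h6, h7, h8, map_smul, smul_eq_mul]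
      ring
    have ho := isOpen_extChartAt_target (I := 𝓡 d) x₀
    have hh := contDiffOn_inChart x₀ h.contMDiff
    rw [(Filter.EventuallyEq.iteratedFDeriv ℝ h2 j).eq_of_nhds]
    have hA : ContDiffAt ℝ j (inChart x₀ h) (extChartAt (𝓡 d) x₀ x) :=
      (hh.contDiffAt (ho.mem_nhds hxs)).of_le (by exact_mod_cast le_top)
    have hB : ContDiffAt ℝ j (fun y ↦ fderiv ℝ (inChart x₀ h) y (y - extChartAt (𝓡 d) x₀ x))
        (extChartAt (𝓡 d) x₀ x) :=
      ((((hh.fderiv_of_isOpen ho (m := ∞) (by simp)).contDiffAt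
        (ho.mem_nhds hxs)).clm_apply (by fun_prop))).of_le (by exact_mod_cast le_top)
    have h9 := iteratedFDeriv_sub_apply (hA.const_smul ((r : ℝ) + 1)) hB
    refine Eq.trans h9 ?_
    refine (congrArg₂ (· - ·) (iteratedFDeriv_const_smul_apply
      (a := (r : ℝ) + 1) hA)
      (iteratedFDeriv_fderiv_radial ho hxs j hh)).trans ?_
    rcases Nat.lt_or_ge r j with hjr' | hjr'
    · obtain rfl : j = r + 1 := by omega
      push_cast
      exact sub_self _
    · rw [hj j hjr']
      simp
  smooth n h hh := by
    simp only [lowerOp_apply]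
    refine ContMDiff.sub (I := 𝓘(ℝ, ℝ)) (G := ℝ)
      (ContMDiff.mul (I := 𝓘(ℝ, ℝ)) (G := ℝ) contMDiff_const (ht.smooth n h hh)) ?_
    refine contMDiff_finsetSum fun i _ ↦ ?_
    exact (ht.stable_commOp hK _).smooth n (fun s ↦ partialOp x₀ ψ hψ i (h s))
      (contMDiff_partialFun x₀ ψ hψ i hh)

variable [MeasurableSpace M] [BorelSpace M] [T2Space M] [SigmaCompactSpace M]

/-- Integration by parts in a chart. -/
theorem exists_adjoint_partialFun {μ : Measure M} (hμ : IsSmoothDensity d μ) {x₀ : M} {K : Set M}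
    (hKc : IsCompact K) (hK : K ⊆ (extChartAt (𝓡 d) x₀).source) (ψ : SmoothFun d M)
    (hψ : tsupport ψ ⊆ (extChartAt (𝓡 d) x₀).source) (hψK : ∀ x ∈ K, ∀ᶠ y in 𝓝 x, ψ y = 1)
    (u : SmoothFun d M) (hu : ∀ x ∉ K, u x = 0) (i : Fin d) :
    ∃ u' : SmoothFun d M, (∀ x ∉ K, u' x = 0) ∧ ∀ h : SmoothFun d M,
      ∫ x, u x * partialOp x₀ ψ hψ i h x ∂μ = ∫ x, u' x * h x ∂μ := by
  classical
  obtain ⟨ρ, hρ, hpos, hs⟩ := hμ x₀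
  set κ := extChartAt (𝓡 d) x₀ with hκ
  have ho : IsOpen κ.target := isOpen_extChartAt_target x₀
  have hLc : IsCompact (κ '' K) := hKc.image_of_continuousOn ((continuousOn_extChartAt x₀).mono hK)
  have hLt : κ '' K ⊆ κ.target := by
    rintro _ ⟨x, hx, rfl⟩; exact κ.map_source (hK hx)
  have hoff : ∀ y ∈ κ.target, y ∉ κ '' K → κ.symm y ∉ K := fun y hy hyL hyK ↦
    hyL ⟨_, hyK, κ.right_inv hy⟩
  set A : EuclideanSpace ℝ (Fin d) → ℝ := κ.target.indicator fun y ↦ u (κ.symm y) * ρ y with hA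
  have hA0 : ∀ y ∉ κ '' K, A y = 0 := by
    intro y hy
    by_cases hyt : y ∈ κ.target
    · rw [hA, indicator_of_mem hyt, hu _ (hoff y hyt hy), zero_mul]
    · rw [hA, indicator_of_notMem hyt]
  have hAs : ContDiff ℝ ∞ A := by
    rw [← contMDiff_iff_contDiff]
    refine contMDiff_of_zero_off' ho hLc.isClosed hLt ?_ hA0
    rw [contMDiffOn_iff_contDiffOn]
    exact ((contDiffOn_inChart x₀ u.contMDiff).mul hρ).congr fun y hy ↦ indicator_of_mem hy _
  have hAt : tsupport A ⊆ κ '' K := closure_minimal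
    (fun y hy ↦ by by_contra h; exact hy (hA0 y h)) hLc.isClosed
  set B : EuclideanSpace ℝ (Fin d) → ℝ := fun y ↦ fderiv ℝ A y (EuclideanSpace.single i 1) with hB
  have hBs : ContDiff ℝ ∞ B := (hAs.fderiv_right (m := ∞) (by simp)).clm_apply contDiff_const
  have hB0 : ∀ y ∉ κ '' K, B y = 0 := fun y hy ↦ by
    rw [hB]
    have : fderiv ℝ A y = 0 := fderiv_of_notMem_tsupport ℝ (fun h ↦ hy (hAt h))
    simp [this]
  have hsrc : IsOpen κ.source := isOpen_extChartAt_source x₀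
  let u' : M → ℝ := κ.source.indicator fun x ↦ -(B (κ x) / ρ (κ x))
  have hu'0 : ∀ x ∉ K, u' x = 0 := by
    intro x hx
    by_cases hxs : x ∈ κ.source
    · have : κ x ∉ κ '' K := by
        rintro ⟨y, hy, hyx⟩
        exact hx (κ.injOn (hK hy) hxs hyx ▸ hy)
      simp [u', indicator_of_mem hxs, hB0 _ this]
    · exact indicator_of_notMem hxs _
  have hu's : ContMDiff (𝓡 d) 𝓘(ℝ, ℝ) ∞ u' := by
    refine contMDiff_of_zero_off' hsrc hKc.isClosed hK ?_ hu'0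
    have h1 : ContDiffOn ℝ ∞ (fun y ↦ -(B y / ρ y)) κ.target :=
      (hBs.contDiffOn.div hρ fun y hy ↦ (hpos y hy).ne').neg
    have h2 : ContMDiffOn (𝓡 d) 𝓘(ℝ, EuclideanSpace ℝ (Fin d)) ∞ κ κ.source := by
      have := contMDiffOn_extChartAt (I := 𝓡 d) (n := ∞) (x := x₀)
      rwa [← extChartAt_source (𝓡 d)] at this
    exact (h1.contMDiffOn.comp h2 fun x hx ↦ κ.map_source hx).congr
      fun x hx ↦ indicator_of_mem hx _
  refine ⟨⟨u', hu's⟩, hu'0, fun h ↦ ?_⟩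
  have hhc := contDiffOn_inChart x₀ h.contMDiff
  have hint (f : EuclideanSpace ℝ (Fin d) → ℝ) (hf : ContinuousOn f κ.target)
      (hf0 : ∀ y ∉ κ '' K, f y = 0) : Integrable f :=
    ((hf.mono hLt).integrableOn_compact hLc).integrable_of_forall_notMem_eq_zero hf0
  have hset (f : EuclideanSpace ℝ (Fin d) → ℝ) (hf0 : ∀ y ∉ κ '' K, f y = 0) :
      ∫ y in κ.target, f y = ∫ y, f y :=
    setIntegral_eq_integral_of_forall_compl_eq_zero fun y hy ↦ hf0 y fun h ↦ hy (hLt h)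
  have hD : ContinuousOn (fun y ↦ fderiv ℝ (inChart x₀ h) y (EuclideanSpace.single i 1))
      κ.target :=
    ((hhc.fderiv_of_isOpen ho (m := ∞) (by simp)).clm_apply contDiffOn_const).continuousOn
  change _ = ∫ x, u' x * h x ∂μ
  rw [IsSmoothDensity.integral_eq hρ.continuousOn hpos hs
      (f := fun x ↦ u x * partialOp x₀ ψ hψ i h x)
      (u.contMDiff.continuous.mul (partialOp x₀ ψ hψ i h).contMDiff.continuous)
      fun x hx ↦ by simp [hu x fun h ↦ hx (hK h)],
    IsSmoothDensity.integral_eq hρ.continuousOn hpos hs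
      (f := fun x ↦ u' x * h x) (hu's.continuous.mul h.contMDiff.continuous)
      fun x hx ↦ by rw [hu'0 x fun h ↦ hx (hK h), zero_mul]]
  have h1 : ∫ y in κ.target, u (κ.symm y) * partialOp x₀ ψ hψ i h (κ.symm y) * ρ y =
      ∫ y, A y * fderiv ℝ (inChart x₀ h) y (EuclideanSpace.single i 1) := by
    rw [← hset _ fun y hy ↦ by rw [hA0 y hy, zero_mul]]
    refine setIntegral_congr_fun ho.measurableSet fun y hy ↦ ?_
    simp only [hA, indicator_of_mem hy]
    by_cases hyK : κ.symm y ∈ K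
    · have : partialOp x₀ ψ hψ i h (κ.symm y) =
          fderiv ℝ (inChart x₀ h) y (EuclideanSpace.single i 1) := by
        change ψ _ * fderiv ℝ _ (κ (κ.symm y)) _ = _
        rw [(hψK _ hyK).self_of_nhds, one_mul, κ.right_inv hy]
      rw [this]; ring
    · rw [hu _ hyK]; ring
  have h2 : ∫ y in κ.target, u' (κ.symm y) * h (κ.symm y) * ρ y = -∫ y, B y * inChart x₀ h y := by
    rw [← integral_neg, ← hset _ fun y hy ↦ by rw [hB0 y hy, zero_mul, neg_zero]]
    refine setIntegral_congr_fun ho.measurableSet fun y hy ↦ ?_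
    simp only [u', indicator_of_mem (κ.map_target hy), κ.right_inv hy, inChart, ← hκ]
    have := (hpos y hy).ne'
    field_simp
  rw [h1, h2]
  refine integral_mul_fderiv_eq_neg_fderiv_mul_of_integrable
    (hint _ (hBs.continuous.continuousOn.mul hhc.continuousOn) fun y hy ↦ ?_)
    (hint _ (hAs.continuous.continuousOn.mul hD) fun y hy ↦ by rw [hA0 y hy, zero_mul])
    (hint _ (hAs.continuous.continuousOn.mul hhc.continuousOn)
      fun y hy ↦ by rw [hA0 y hy, zero_mul])
    (fun y _ ↦ hAs.differentiable (by simp) y)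
    (fun y hy ↦ (hhc.contDiffAt (ho.mem_nhds (hLt (hAt hy)))).differentiableAt (by simp))
  exact mul_eq_zero_of_left (hB0 y hy) _

/-- A differential operator that is supported in a chart has a formal adjoint: its order is reduced
by splitting off the symbol of highest order, which is integrated by parts. -/
theorem IsDiffOp.exists_adjoint {μ : Measure M} (hμ : IsSmoothDensity d μ) {x₀ : M} {K : Set M}
    (hKc : IsCompact K) (hK : K ⊆ (extChartAt (𝓡 d) x₀).source) {r : ℕ}
    {t : SmoothFun d M →ₗ[ℝ] M → ℝ} (ht : IsDiffOp x₀ K r t) :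
    ∃ u : SmoothFun d M, (∀ x ∉ K, u x = 0) ∧ ∀ h : SmoothFun d M,
      ∫ x, t h x ∂μ = ∫ x, u x * h x ∂μ := by
  have hlf := hμ.isLocallyFiniteMeasure
  have : LocallyCompactSpace M := ChartedSpace.locallyCompactSpace (EuclideanSpace ℝ (Fin d)) M
  have hint (f : M → ℝ) (hf : ContMDiff (𝓡 d) 𝓘(ℝ, ℝ) ∞ f) (hf0 : ∀ x ∉ K, f x = 0) :
      Integrable f μ :=
    (hf.continuous.continuousOn.integrableOn_compact hKc).integrable_of_forall_notMem_eq_zero hf0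
  obtain ⟨K', hK'c, hKK', hK's⟩ :=
    exists_compact_between hKc (isOpen_extChartAt_source (I := 𝓡 d) x₀) hK
  obtain ⟨ψ, hψ1, hψ0, -⟩ := exists_contMDiffMap_one_nhds_of_subset_interior (n := (⊤ : ℕ∞)) (𝓡 d)
    hKc.isClosed hKK'
  have hψ : tsupport ψ ⊆ (extChartAt (𝓡 d) x₀).source :=
    (closure_minimal (fun x hx ↦ by by_contra h; exact hx (hψ0 x h)) hK'c.isClosed).trans hK's
  have hψK : ∀ x ∈ K, ∀ᶠ y in 𝓝 x, ψ y = 1 := fun x hx ↦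
    hψ1.filter_mono (nhds_le_nhdsSet hx)
  induction r generalizing t with
  | zero =>
    refine ⟨⟨t 1, ht.contMDiff_apply 1⟩, ht.zero_off 1, fun h ↦ ?_⟩
    congr 1 with x
    by_cases hx : x ∈ K
    · have h1 := ht.order (h - h x • (1 : SmoothFun d M)) x hx fun j hj ↦ by
        obtain rfl : j = 0 := by omega
        ext m
        change h _ - h x * 1 = 0
        rw [(extChartAt (𝓡 d) x₀).left_inv (hK hx), mul_one, sub_self]
      rw [map_sub, map_smul, Pi.sub_apply, Pi.smul_apply, smul_eq_mul, sub_eq_zero] at h1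
      rw [h1, mul_comm]; rfl
    · rw [ht.zero_off h x hx]
      change 0 = t 1 x * h x
      rw [ht.zero_off 1 x hx, zero_mul]
  | succ r ih =>
    -- `(r + 1) t` is `∑ i, [t, x i] ∘ ∂ i` up to an operator of order at most `r`
    obtain ⟨u₀, hu₀, hU₀⟩ := ih (ht.stable_lowerOp hK ψ hψ hψK)
    choose u hu hU using fun i ↦ ih (ht.stable_commOp hK (coordFun x₀ ψ hψ i))
    choose u' hu' hU' using fun i ↦ exists_adjoint_partialFun hμ hKc hK ψ hψ hψK (u i) (hu i) i
    have hsum (x : M) : (((r : ℝ) + 1)⁻¹ • (u₀ + ∑ i, u' i) : SmoothFun d M) x =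
        ((r : ℝ) + 1)⁻¹ * (u₀ x + ∑ i, u' i x) := by
      rw [ContMDiffMap.coe_smul, Pi.smul_apply, ContMDiffMap.coe_add, Pi.add_apply,
        ← ContMDiffMap.coeFnAddMonoidHom_apply (∑ i, u' i), map_sum, Finset.sum_apply]
      rfl
    refine ⟨((r : ℝ) + 1)⁻¹ • (u₀ + ∑ i, u' i), fun x hx ↦ ?_, fun h ↦ ?_⟩
    · rw [hsum, hu₀ x hx]
      simp [fun i ↦ hu' i x hx]
    · have hr : (r : ℝ) + 1 ≠ 0 := by positivity
      have h1 : ∀ x, t h x = ((r : ℝ) + 1)⁻¹ * (lowerOp x₀ ψ hψ r t h x +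
          ∑ i, commOp t (coordFun x₀ ψ hψ i) (partialOp x₀ ψ hψ i h) x) := fun x ↦ by
        rw [lowerOp_apply, sub_add_cancel, inv_mul_cancel_left₀ hr]
      have hiL : Integrable (lowerOp x₀ ψ hψ r t h) μ := hint _
        ((ht.stable_lowerOp hK ψ hψ hψK).contMDiff_apply h) ((ht.stable_lowerOp hK ψ hψ hψK).zero_off h)
      have hiC (i : Fin d) : Integrable
          (fun x ↦ commOp t (coordFun x₀ ψ hψ i) (partialOp x₀ ψ hψ i h) x) μ :=
        hint _ ((ht.stable_commOp hK _).contMDiff_apply _) ((ht.stable_commOp hK _).zero_off _)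
      have hprod (v h : SmoothFun d M) (hv : ∀ x ∉ K, v x = 0) :
          Integrable (fun x ↦ v x * h x) μ :=
        hint _ (ContMDiff.mul (I := 𝓘(ℝ, ℝ)) (G := ℝ) v.contMDiff h.contMDiff)
          fun x hx ↦ by rw [hv x hx, zero_mul]
      simp only [h1, hsum]
      simp only [mul_assoc, integral_const_mul]
      rw [integral_add hiL (integrable_finsetSum _ fun i _ ↦ hiC i), integral_finsetSum _
        fun i _ ↦ hiC i, hU₀]
      simp only [hU, hU', add_mul, Finset.sum_mul]
      rw [integral_add (hprod _ _ hu₀) (integrable_finsetSum _ fun i _ ↦ hprod _ _ (hu' i)),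
        integral_finsetSum _ fun i _ ↦ hprod _ _ (hu' i)]

end Adjoint

/-! ### Jets and smooth families of sections -/

section Jets

variable {d : ℕ} {M : Type*} [TopologicalSpace M] [ChartedSpace (EuclideanSpace ℝ (Fin d)) M]
  [IsManifold (𝓡 d) ∞ M]
  {F : Type*} [NormedAddCommGroup F] [NormedSpace ℝ F]
  {E : M → Type*} [TopologicalSpace (TotalSpace F E)] [∀ x, TopologicalSpace (E x)]
  [∀ x, AddCommGroup (E x)] [∀ x, Module ℝ (E x)] [FiberBundle F E] [VectorBundle ℝ F E]
  [ContMDiffVectorBundle ∞ F E (𝓡 d)]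

theorem localRep_eventually_smooth (x : M) (σ : Sec d F E) :
    ∃ U : Set (EuclideanSpace ℝ (Fin d)), IsOpen U ∧ extChartAt (𝓡 d) x x ∈ U ∧
      U ⊆ (extChartAt (𝓡 d) x).target ∧
      (∀ y ∈ U, (extChartAt (𝓡 d) x).symm y ∈ (trivializationAt F E x).baseSet) ∧
      ContDiffOn ℝ ∞ (localRep x σ) U := by
  refine ⟨(extChartAt (𝓡 d) x).target ∩ (extChartAt (𝓡 d) x).symm ⁻¹'
    (trivializationAt F E x).baseSet, ?_, ?_, inter_subset_left, fun y hy ↦ hy.2, ?_⟩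
  · exact (continuousOn_extChartAt_symm x).isOpen_inter_preimage (isOpen_extChartAt_target x)
      (trivializationAt F E x).open_baseSet
  · refine ⟨mem_extChartAt_target x, ?_⟩
    rw [mem_preimage, extChartAt_to_inv]
    exact FiberBundle.mem_baseSet_trivializationAt' x
  · rw [← contMDiffOn_iff_contDiffOn]
    have h1 := ((trivializationAt F E x).contMDiffOn_section_baseSet_iff (n := ∞) (IB := 𝓡 d)
      (s := σ)).1 σ.contMDiff.contMDiffOn
    exact h1.comp ((contMDiffOn_extChartAt_symm x).mono inter_subset_left) fun y hy ↦ hy.2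

theorem contDiffAt_localRep (x : M) (σ : Sec d F E) :
    ContDiffAt ℝ ∞ (localRep x σ) (extChartAt (𝓡 d) x x) := by
  obtain ⟨U, hU, hx, -, -, h⟩ := localRep_eventually_smooth x σ
  exact h.contDiffAt (hU.mem_nhds hx)

theorem localRep_add (x : M) (σ τ : Sec d F E) :
    localRep x (σ + τ) =ᶠ[𝓝 (extChartAt (𝓡 d) x x)] localRep x σ + localRep x τ := by
  obtain ⟨U, hU, hx, -, hb, h⟩ := localRep_eventually_smooth x σ
  filter_upwards [hU.mem_nhds hx] with y hy
  exact ((trivializationAt F E x).linear ℝ (hb y hy)).map_add _ _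

theorem localRep_smul (x : M) (c : ℝ) (σ : Sec d F E) :
    localRep x (c • σ) =ᶠ[𝓝 (extChartAt (𝓡 d) x x)] c • localRep x σ := by
  obtain ⟨U, hU, hx, -, hb, h⟩ := localRep_eventually_smooth x σ
  filter_upwards [hU.mem_nhds hx] with y hy
  exact ((trivializationAt F E x).linear ℝ (hb y hy)).map_smul _ _

theorem localRep_congr {x : M} {σ τ : Sec d F E} (h : ∀ᶠ y in 𝓝 x, σ y = τ y) :
    localRep x σ =ᶠ[𝓝 (extChartAt (𝓡 d) x x)] localRep x τ := by
  have hc : ContinuousAt (extChartAt (𝓡 d) x).symm (extChartAt (𝓡 d) x x) :=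
    continuousAt_extChartAt_symm x
  rw [← extChartAt_to_inv (I := 𝓡 d) x] at h
  filter_upwards [hc.eventually h] with y hy
  rw [localRep, localRep, hy]

theorem SameJet.refl (r : ℕ) (x : M) (σ : Sec d F E) : SameJet r x σ σ := fun _ _ ↦ rfl

theorem sameJet_of_eventuallyEq (r : ℕ) {x : M} {σ τ : Sec d F E} (h : ∀ᶠ y in 𝓝 x, σ y = τ y) :
    SameJet r x σ τ := fun j _ ↦
  (Filter.EventuallyEq.iteratedFDeriv ℝ (localRep_congr h) j).eq_of_nhds

theorem SameJet.add {r : ℕ} {x : M} {σ σ' τ τ' : Sec d F E} (h : SameJet r x σ σ')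
    (h' : SameJet r x τ τ') : SameJet r x (σ + τ) (σ' + τ') := by
  intro j hj
  have hs (σ : Sec d F E) : ContDiffAt ℝ j (localRep x σ) (extChartAt (𝓡 d) x x) :=
    (contDiffAt_localRep x σ).of_le (by exact_mod_cast le_top)
  rw [(Filter.EventuallyEq.iteratedFDeriv ℝ (localRep_add x σ τ) j).eq_of_nhds,
    (Filter.EventuallyEq.iteratedFDeriv ℝ (localRep_add x σ' τ') j).eq_of_nhds,
    iteratedFDeriv_add_apply (hs _) (hs _), iteratedFDeriv_add_apply (hs _) (hs _), h j hj, h' j hj]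

theorem SameJet.smul {r : ℕ} {x : M} {σ σ' : Sec d F E} (h : SameJet r x σ σ') (c : ℝ) :
    SameJet r x (c • σ) (c • σ') := by
  intro j hj
  have hs (σ : Sec d F E) : ContDiffAt ℝ j (localRep x σ) (extChartAt (𝓡 d) x x) :=
    (contDiffAt_localRep x σ).of_le (by exact_mod_cast le_top)
  rw [(Filter.EventuallyEq.iteratedFDeriv ℝ (localRep_smul x c σ) j).eq_of_nhds,
    (Filter.EventuallyEq.iteratedFDeriv ℝ (localRep_smul x c σ') j).eq_of_nhds,
    iteratedFDeriv_const_smul_apply (hs _), iteratedFDeriv_const_smul_apply (hs _), h j hj]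

/-- The product of a function and a section. -/
def mulSec (h : SmoothFun d M) (σ : Sec d F E) : Sec d F E :=
  ⟨fun x ↦ h x • σ x, h.contMDiff.smul_section σ.contMDiff⟩

@[simp]
theorem mulSec_apply (h : SmoothFun d M) (σ : Sec d F E) (x : M) : mulSec h σ x = h x • σ x := rfl

/-- The vanishing of a jet does not depend on the chart. -/
theorem iteratedFDeriv_eq_zero_of_chart {x₀ x : M} (hx : x ∈ (extChartAt (𝓡 d) x₀).source) {r : ℕ}
    {h : M → ℝ} (hh : ContMDiff (𝓡 d) 𝓘(ℝ, ℝ) ∞ h)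
    (h0 : ∀ j ≤ r, iteratedFDeriv ℝ j (inChart x₀ h) (extChartAt (𝓡 d) x₀ x) = 0) (j : ℕ)
    (hj : j ≤ r) : iteratedFDeriv ℝ j (inChart x h) (extChartAt (𝓡 d) x x) = 0 := by
  set U := (extChartAt (𝓡 d) x).target ∩ (extChartAt (𝓡 d) x).symm ⁻¹'
    (extChartAt (𝓡 d) x₀).source with hU
  have hUo : IsOpen U := (continuousOn_extChartAt_symm x).isOpen_inter_preimage
    (isOpen_extChartAt_target x) (isOpen_extChartAt_source x₀)
  have hxU : extChartAt (𝓡 d) x x ∈ U :=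
    ⟨mem_extChartAt_target x, by rwa [mem_preimage, extChartAt_to_inv]⟩
  set f : EuclideanSpace ℝ (Fin d) → EuclideanSpace ℝ (Fin d) :=
    fun y ↦ extChartAt (𝓡 d) x₀ ((extChartAt (𝓡 d) x).symm y) with hf
  have hfs : ContDiffOn ℝ ∞ f U := by
    rw [← contMDiffOn_iff_contDiffOn]
    refine (contMDiffOn_extChartAt (I := 𝓡 d) (n := ∞) (x := x₀)).comp
      ((contMDiffOn_extChartAt_symm x).mono inter_subset_left) fun y hy ↦ ?_
    have := hy.2
    rwa [mem_preimage, extChartAt_source] at this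
  have hfU : MapsTo f U (extChartAt (𝓡 d) x₀).target := fun y hy ↦
    (extChartAt (𝓡 d) x₀).map_source hy.2
  have hev : inChart x h =ᶠ[𝓝 (extChartAt (𝓡 d) x x)] inChart x₀ h ∘ f := by
    filter_upwards [hUo.mem_nhds hxU] with y hy
    simp only [inChart, Function.comp_apply, hf]
    rw [(extChartAt (𝓡 d) x₀).left_inv hy.2]
  have hfx : f (extChartAt (𝓡 d) x x) = extChartAt (𝓡 d) x₀ x := by
    rw [hf]; simp only [extChartAt_to_inv]
  obtain ⟨D, hD⟩ : ∃ D : ℝ, ∀ i, i ≤ j →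
      ‖iteratedFDerivWithin ℝ i f U (extChartAt (𝓡 d) x x)‖ ≤ D :=
    ⟨∑ i ∈ Finset.range (j + 1), ‖iteratedFDerivWithin ℝ i f U (extChartAt (𝓡 d) x x)‖,
      fun i hi ↦ Finset.single_le_sum (f := fun i ↦
        ‖iteratedFDerivWithin ℝ i f U (extChartAt (𝓡 d) x x)‖) (fun _ _ ↦ norm_nonneg _)
        (Finset.mem_range_succ_iff.2 hi)⟩
  have hto := isOpen_extChartAt_target (I := 𝓡 d) x₀
  have key := norm_iteratedFDerivWithin_comp_le (n := j) (contDiffOn_inChart x₀ hh) hfs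
    (by exact_mod_cast le_top) hto.uniqueDiffOn hUo.uniqueDiffOn hfU hxU (C := 0) (D := max D 1)
    (fun i hi ↦ by
      rw [hfx, iteratedFDerivWithin_of_isOpen _ hto ((extChartAt (𝓡 d) x₀).map_source hx),
        h0 i (hi.trans hj), norm_zero])
    (fun i h1 hi ↦ ((hD i hi).trans (le_max_left _ _)).trans
      (le_self_pow₀ (le_max_right _ _) (by omega)))
  rw [mul_zero, zero_mul, iteratedFDerivWithin_of_isOpen _ hUo hxU] at key
  rw [(Filter.EventuallyEq.iteratedFDeriv ℝ hev j).eq_of_nhds]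
  exact norm_le_zero_iff.1 key

/-- If the derivatives of the function `h` vanish up to order `r`, so does the `r`-jet of every
product of `h` with a section. -/
theorem sameJet_mulSec_zero {x₀ x : M} (hx : x ∈ (extChartAt (𝓡 d) x₀).source) {r : ℕ}
    {h : SmoothFun d M}
    (h0 : ∀ j ≤ r, iteratedFDeriv ℝ j (inChart x₀ h) (extChartAt (𝓡 d) x₀ x) = 0)
    (σ : Sec d F E) : SameJet r x (mulSec h σ) 0 := by
  intro j hj
  obtain ⟨U, hU, hxU, hUt, hb, hs⟩ := localRep_eventually_smooth x σ
  have hz : localRep x (0 : Sec d F E) =ᶠ[𝓝 (extChartAt (𝓡 d) x x)] fun _ ↦ (0 : F) := by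
    filter_upwards [hU.mem_nhds hxU] with y hy
    exact ((trivializationAt F E x).linear ℝ (hb y hy)).map_zero
  have hm : localRep x (mulSec h σ) =ᶠ[𝓝 (extChartAt (𝓡 d) x x)]
      fun y ↦ inChart x h y • localRep x σ y := by
    filter_upwards [hU.mem_nhds hxU] with y hy
    exact ((trivializationAt F E x).linear ℝ (hb y hy)).map_smul _ _
  rw [(Filter.EventuallyEq.iteratedFDeriv ℝ hz j).eq_of_nhds,
    (Filter.EventuallyEq.iteratedFDeriv ℝ hm j).eq_of_nhds]
  have h2 : iteratedFDeriv ℝ j (fun _ : EuclideanSpace ℝ (Fin d) ↦ (0 : F)) = 0 :=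
    iteratedFDeriv_fun_zero
  rw [h2, Pi.zero_apply, ← norm_le_zero_iff, ← iteratedFDerivWithin_of_isOpen _ hU hxU]
  refine (norm_iteratedFDerivWithin_smul_le ((contDiffOn_inChart x h.contMDiff).mono hUt) hs
    hU.uniqueDiffOn hxU (by exact_mod_cast le_top)).trans (Finset.sum_eq_zero fun i hi ↦ ?_).le
  have hi' := Finset.mem_range_succ_iff.1 hi
  rw [iteratedFDerivWithin_of_isOpen _ hU hxU,
    iteratedFDeriv_eq_zero_of_chart hx h.contMDiff h0 i (hi'.trans hj)]
  simp

section Families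

variable {n : ℕ}

/-- A family of sections is smooth when it is smooth in local trivializations. -/
theorem smoothFamily_iff {σ : (Fin n → ℝ) → Sec d F E} :
    SmoothFamily σ ↔ ∀ p : (Fin n → ℝ) × M,
      ContMDiffAt (𝓘(ℝ, Fin n → ℝ).prod (𝓡 d)) 𝓘(ℝ, F) ∞ (fun q : (Fin n → ℝ) × M ↦
        (trivializationAt F E p.2 (TotalSpace.mk' F q.2 (σ q.1 q.2))).2) p := by
  refine forall_congr' fun p ↦ ?_
  rw [contMDiffAt_totalSpace]
  exact and_iff_right contMDiffAt_snd

theorem smoothFamily_const (n : ℕ) (σ : Sec d F E) : SmoothFamily fun _ : Fin n → ℝ ↦ σ :=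
  σ.contMDiff.comp contMDiff_snd

theorem eventually_mem_baseSet (p : (Fin n → ℝ) × M) :
    ∀ᶠ q : (Fin n → ℝ) × M in 𝓝 p, q.2 ∈ (trivializationAt F E p.2).baseSet :=
  continuous_snd.continuousAt.eventually ((trivializationAt F E p.2).open_baseSet.mem_nhds
    (FiberBundle.mem_baseSet_trivializationAt' p.2))

theorem SmoothFamily.add {σ τ : (Fin n → ℝ) → Sec d F E} (hσ : SmoothFamily σ)
    (hτ : SmoothFamily τ) : SmoothFamily fun s ↦ σ s + τ s := by
  rw [smoothFamily_iff] at *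
  intro p
  refine ((hσ p).add (hτ p)).congr_of_eventuallyEq ?_
  filter_upwards [eventually_mem_baseSet (F := F) (E := E) p] with q hq
  exact ((trivializationAt F E p.2).linear ℝ hq).map_add _ _

theorem SmoothFamily.mulSec {h : (Fin n → ℝ) → SmoothFun d M} {σ : (Fin n → ℝ) → Sec d F E}
    (hh : SmoothFunFamily h) (hσ : SmoothFamily σ) : SmoothFamily fun s ↦ mulSec (h s) (σ s) := by
  rw [smoothFamily_iff] at *
  intro p
  refine (ContMDiffAt.smul (hh p) (hσ p)).congr_of_eventuallyEq ?_
  filter_upwards [eventually_mem_baseSet (F := F) (E := E) p] with q hq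
  exact ((trivializationAt F E p.2).linear ℝ hq).map_smul _ _

theorem SmoothFamily.smul {h : (Fin n → ℝ) → ℝ} {σ : (Fin n → ℝ) → Sec d F E}
    (hh : ContDiff ℝ ∞ h) (hσ : SmoothFamily σ) : SmoothFamily fun s ↦ h s • σ s := by
  rw [smoothFamily_iff] at *
  intro p
  refine (ContMDiffAt.smul ((hh.contMDiff.comp contMDiff_fst).contMDiffAt)
    (hσ p)).congr_of_eventuallyEq ?_
  filter_upwards [eventually_mem_baseSet (F := F) (E := E) p] with q hq
  exact ((trivializationAt F E p.2).linear ℝ hq).map_smul _ _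

theorem smoothFamily_sum_smul (σ : Fin n → Sec d F E) :
    SmoothFamily fun s : Fin n → ℝ ↦ ∑ i, s i • σ i := by
  suffices h : ∀ T : Finset (Fin n), SmoothFamily fun s : Fin n → ℝ ↦ ∑ i ∈ T, s i • σ i from h _
  intro T
  classical
  induction T using Finset.induction_on with
  | empty => simpa using smoothFamily_const n (0 : Sec d F E)
  | insert i T hi ih =>
    simp only [Finset.sum_insert hi]
    exact SmoothFamily.add ((smoothFamily_const n (σ i)).smul (contDiff_apply ℝ ℝ i)) ih

theorem SmoothFamily.comp {m : ℕ} {σ : (Fin n → ℝ) → Sec d F E} (hσ : SmoothFamily σ)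
    {g : (Fin m → ℝ) → Fin n → ℝ} (hg : ContDiff ℝ ∞ g) : SmoothFamily fun s ↦ σ (g s) :=
  ContMDiff.comp (g := fun p : (Fin n → ℝ) × M ↦ TotalSpace.mk' F p.2 (σ p.1 p.2))
    (f := fun p : (Fin m → ℝ) × M ↦ ((g p.1, p.2) : (Fin n → ℝ) × M)) hσ
    ((hg.contMDiff.comp contMDiff_fst).prodMk contMDiff_snd)

end Families

section Dual

variable [∀ x, IsTopologicalAddGroup (E x)] [∀ x, ContinuousSMul ℝ (E x)]

theorem SmoothFamily.eval_smooth {n : ℕ} {u : (Fin n → ℝ) → DualSec d F E}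
    {σ : (Fin n → ℝ) → Sec d F E} (hu : SmoothFamily u) (hσ : SmoothFamily σ) :
    ContMDiff (𝓘(ℝ, Fin n → ℝ).prod (𝓡 d)) 𝓘(ℝ, ℝ) ∞
      fun p : (Fin n → ℝ) × M ↦ u p.1 p.2 (σ p.1 p.2) := by
  intro p
  have h1 : ContMDiffAt (𝓘(ℝ, Fin n → ℝ).prod (𝓡 d)) ((𝓡 d).prod 𝓘(ℝ, ℝ)) ∞
      (fun p : (Fin n → ℝ) × M ↦
        (TotalSpace.mk' ℝ p.2 (u p.1 p.2 (σ p.1 p.2)) : TotalSpace ℝ (Trivial M ℝ))) p :=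
    ContMDiffAt.clm_bundle_apply (F₁ := F) (E₁ := E) (E₂ := Trivial M ℝ) (F₂ := ℝ)
      (b := fun p : (Fin n → ℝ) × M ↦ p.2)
      (ϕ := fun p : (Fin n → ℝ) × M ↦ u p.1 p.2) (v := fun p ↦ σ p.1 p.2) (hu p) (hσ p)
  rw [contMDiffAt_totalSpace] at h1
  exact h1.2

end Dual

end Jets

/-! ### Adjoints of differential operators on sections -/

section Cutoff

variable {d : ℕ} {M : Type*} [TopologicalSpace M] [ChartedSpace (EuclideanSpace ℝ (Fin d)) M]
  [IsManifold (𝓡 d) ∞ M] [T2Space M] [SigmaCompactSpace M]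

theorem exists_cutoff {K U : Set M} (hK : IsCompact K) (hU : IsOpen U) (hKU : K ⊆ U) :
    ∃ ψ : SmoothFun d M, tsupport ψ ⊆ U ∧ HasCompactSupport ψ ∧ ∀ x ∈ K, ∀ᶠ y in 𝓝 x, ψ y = 1 := by
  have : LocallyCompactSpace M := ChartedSpace.locallyCompactSpace (EuclideanSpace ℝ (Fin d)) M
  obtain ⟨K', hK'c, hKK', hK's⟩ := exists_compact_between hK hU hKU
  obtain ⟨ψ, hψ1, hψ0, -⟩ := exists_contMDiffMap_one_nhds_of_subset_interior (n := (⊤ : ℕ∞)) (𝓡 d)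
    hK.isClosed hKK'
  have h1 : tsupport ψ ⊆ K' :=
    closure_minimal (fun x hx ↦ by by_contra h; exact hx (hψ0 x h)) hK'c.isClosed
  exact ⟨ψ, h1.trans hK's, hK'c.of_isClosed_subset (isClosed_tsupport _) h1,
    fun x hx ↦ hψ1.filter_mono (nhds_le_nhdsSet hx)⟩

end Cutoff

section DualFrame

variable {d : ℕ} {M : Type*} [TopologicalSpace M] [ChartedSpace (EuclideanSpace ℝ (Fin d)) M]
  [IsManifold (𝓡 d) ∞ M]
  {F : Type*} [NormedAddCommGroup F] [NormedSpace ℝ F]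
  {E : M → Type*} [TopologicalSpace (TotalSpace F E)] [∀ x, TopologicalSpace (E x)]
  [∀ x, AddCommGroup (E x)] [∀ x, Module ℝ (E x)] [FiberBundle F E] [VectorBundle ℝ F E]
  [ContMDiffVectorBundle ∞ F E (𝓡 d)]
variable [FiniteDimensional ℝ F] [T2Space M] [SigmaCompactSpace M]
  [∀ x, IsTopologicalAddGroup (E x)] [∀ x, ContinuousSMul ℝ (E x)]

/-- Near every point there are finitely many sections `e_i` and dual sections `e'_i`, all of them
globally defined, with `v = ∑ i, e'_i(v) e_i`. -/
theorem exists_dual_frame (x₀ : M) : ∃ (O : Set M) (m : ℕ) (e : Fin m → Sec d F E)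
    (e' : Fin m → DualSec d F E), IsOpen O ∧ x₀ ∈ O ∧
      ∀ x ∈ O, ∀ v : E x, v = ∑ i, e' i x v • e i x := by
  set T := trivializationAt F E x₀ with hT
  have hx₀ : x₀ ∈ T.baseSet := FiberBundle.mem_baseSet_trivializationAt' x₀
  set b := Module.finBasis ℝ F
  obtain ⟨ψ, hψs, -, hψ1⟩ := exists_cutoff (d := d) (isCompact_singleton (x := x₀)) T.open_baseSet
    (singleton_subset_iff.2 hx₀)
  let ε (i : Fin (Module.finrank ℝ F)) (x : M) : E x →L[ℝ] ℝ :=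
    (LinearMap.toContinuousLinearMap (b.coord i)).comp (T.continuousLinearMapAt ℝ x)
  have hε (i) : ContMDiffOn (𝓡 d) ((𝓡 d).prod 𝓘(ℝ, F →L[ℝ] ℝ)) ∞
      (fun x ↦ TotalSpace.mk' (F →L[ℝ] ℝ) (E := fun x ↦ E x →L[ℝ] ℝ) x (ε i x)) T.baseSet := by
    set T' := trivializationAt (F →L[ℝ] ℝ) (fun x ↦ E x →L[ℝ] ℝ) x₀ with hT'
    have hb : T'.baseSet = T.baseSet := by
      change T.baseSet ∩ (trivializationAt ℝ (Trivial M ℝ) x₀).baseSet = _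
      simp
    have h1 := T'.contMDiffOn_section_baseSet_iff (n := ∞) (IB := 𝓡 d) (s := ε i)
    rw [hb] at h1
    rw [h1]
    refine (contMDiffOn_const (c := LinearMap.toContinuousLinearMap (b.coord i))).congr fun x hx ↦ ?_
    change ContinuousLinearMap.inCoordinates F E ℝ (Trivial M ℝ) x₀ x x₀ x (ε i x) = _
    ext v
    simp [ContinuousLinearMap.inCoordinates, ε, ← hT, hx]
  refine ⟨interior {x | ψ x = 1} ∩ T.baseSet, _,
    fun i ↦ ⟨_, ContMDiffOn.smul_section_of_tsupport ψ.contMDiff.contMDiffOn T.open_baseSet hψs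
      (T.contMDiffOn_localFrame_baseSet ∞ b i)⟩,
    fun i ↦ ⟨_, ContMDiffOn.smul_section_of_tsupport ψ.contMDiff.contMDiffOn T.open_baseSet hψs
      (hε i)⟩, isOpen_interior.inter T.open_baseSet,
    ⟨mem_interior_iff_mem_nhds.2 (hψ1 x₀ rfl), hx₀⟩, ?_⟩
  rintro x ⟨hxψ, hx⟩ v
  have h1 : x ∈ {x | ψ x = 1} := interior_subset hxψ
  rw [mem_ofPred_eq] at h1
  have h2 := (T.basisAt b hx).sum_repr v
  conv_lhs => rw [← h2]
  refine Finset.sum_congr rfl fun i _ ↦ ?_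
  change _ = (ψ x • ε i x v) • (ψ x • T.localFrame b i x)
  rw [h1, one_smul, one_smul, T.localFrame_apply_of_mem_baseSet b hx]
  congr 1
  simp [ε, Trivialization.basisAt, Trivialization.coe_linearMapAt_of_mem _ hx]

end DualFrame

section EulerLagrange

variable {d : ℕ} {M : Type*} [TopologicalSpace M] [ChartedSpace (EuclideanSpace ℝ (Fin d)) M]
  [IsManifold (𝓡 d) ∞ M]
  {F : Type*} [NormedAddCommGroup F] [NormedSpace ℝ F]
  {E : M → Type*} [TopologicalSpace (TotalSpace F E)] [∀ x, TopologicalSpace (E x)]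
  [∀ x, AddCommGroup (E x)] [∀ x, Module ℝ (E x)] [FiberBundle F E] [VectorBundle ℝ F E]
  [ContMDiffVectorBundle ∞ F E (𝓡 d)]
variable {F' : Type*} [NormedAddCommGroup F'] [NormedSpace ℝ F']
  {E' : M → Type*} [TopologicalSpace (TotalSpace F' E')] [∀ x, TopologicalSpace (E' x)]
  [∀ x, AddCommGroup (E' x)] [∀ x, Module ℝ (E' x)] [FiberBundle F' E'] [VectorBundle ℝ F' E']
  [ContMDiffVectorBundle ∞ F' E' (𝓡 d)]

/-- A linear differential operator of order at most `r` from sections to functions that vanish off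
`K`. -/
structure IsSecDiffOp (K : Set M) (r : ℕ) (t : Sec d F E →ₗ[ℝ] M → ℝ) : Prop where
  zero_off : ∀ σ, ∀ x ∉ K, t σ x = 0
  order : ∀ σ x, SameJet r x σ 0 → t σ x = 0
  smooth : ∀ (n : ℕ) (σ : (Fin n → ℝ) → Sec d F E), SmoothFamily σ →
    ContMDiff (𝓘(ℝ, Fin n → ℝ).prod (𝓡 d)) 𝓘(ℝ, ℝ) ∞ fun p : (Fin n → ℝ) × M ↦ t (σ p.1) p.2

theorem mulSec_sum {ι : Type*} (s : Finset ι) (h : ι → SmoothFun d M) (e : ι → Sec d F E) (x : M) :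
    (∑ i ∈ s, mulSec (h i) (e i)) x = ∑ i ∈ s, h i x • e i x := by
  classical
  induction s using Finset.induction_on with
  | empty => rfl
  | insert i s hi ih =>
    rw [Finset.sum_insert hi, Finset.sum_insert hi, ContMDiffSection.coe_add, Pi.add_apply, ih]
    rfl

variable [T2Space M] [SigmaCompactSpace M] [MeasurableSpace M] [BorelSpace M]

/-- Differential operators from sections of `E` to functions have adjoints with values in a bundle
`E'` that is in duality with `E`. -/
theorem IsSecDiffOp.exists_adjoint {μ : Measure M} (hμ : IsSmoothDensity d μ)
    (β : ∀ x, E x →ₗ[ℝ] E' x →ₗ[ℝ] ℝ)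
    (hβ : ∀ (σ : Sec d F E) (u : Sec d F' E'), ContMDiff (𝓡 d) 𝓘(ℝ, ℝ) ∞ fun x ↦ β x (σ x) (u x))
    (hframe : ∀ x₀ : M, ∃ (O : Set M) (m : ℕ) (e : Fin m → Sec d F E) (e' : Fin m → Sec d F' E'),
      IsOpen O ∧ x₀ ∈ O ∧ ∀ x ∈ O, ∀ v : E x, v = ∑ i, β x v (e' i x) • e i x)
    {K : Set M} (hK : IsCompact K) {r : ℕ} {t : Sec d F E →ₗ[ℝ] M → ℝ}
    (ht : IsSecDiffOp K r t) :
    ∃ u : Sec d F' E', (∀ x ∉ K, u x = 0) ∧ ∀ σ, ∫ x, t σ x ∂μ = ∫ x, β x (σ x) (u x) ∂μ := by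
  classical
  have hlf := hμ.isLocallyFiniteMeasure
  choose O m e e' hO hxO hfr using hframe
  obtain ⟨S, hS⟩ := hK.elim_finite_subcover (fun x₀ ↦ O x₀ ∩ (extChartAt (𝓡 d) x₀).source)
    (fun x₀ ↦ (hO x₀).inter (isOpen_extChartAt_source x₀))
    fun x _ ↦ mem_iUnion.2 ⟨x, hxO x, mem_extChartAt_source x⟩
  obtain ⟨χ, hχ⟩ := SmoothPartitionOfUnity.exists_isSubordinate (𝓡 d) hK.isClosed
    (fun a : S ↦ O a ∩ (extChartAt (𝓡 d) (a : M)).source)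
    (fun a ↦ (hO a).inter (isOpen_extChartAt_source (a : M))) (by
      intro x hx
      obtain ⟨a, ha, hxa⟩ := mem_iUnion₂.1 (hS hx)
      exact mem_iUnion.2 ⟨⟨a, ha⟩, hxa⟩)
  have hsum : ∀ x ∈ K, ∑ a, χ a x = 1 := fun x hx ↦ by
    rw [← finsum_eq_sum_of_fintype]; exact χ.sum_eq_one hx
  -- the operator in the chart `a`, on multiples of the `i`-th element of the frame
  let T (a : S) (i : Fin (m a)) : SmoothFun d M →ₗ[ℝ] M → ℝ :=
    { toFun := fun h x ↦ χ a x * t (mulSec h (e a i)) x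
      map_add' := fun h h' ↦ by
        have : mulSec (h + h') (e a i) = mulSec h (e a i) + mulSec h' (e a i) := by
          ext x; exact add_smul _ _ _
        ext x; simp only [this, map_add, Pi.add_apply, mul_add]
      map_smul' := fun c h ↦ by
        have : mulSec (c • h) (e a i) = c • mulSec h (e a i) := by
          ext x; exact smul_assoc c (h x) (e a i x)
        ext x; simp only [this, map_smul, Pi.smul_apply, smul_eq_mul, RingHom.id_apply]; ring }
  have hKa (a : S) : IsCompact (K ∩ tsupport (χ a)) := hK.inter_right (isClosed_tsupport _)
  have hKas (a : S) : K ∩ tsupport (χ a) ⊆ (extChartAt (𝓡 d) (a : M)).source :=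
    fun x hx ↦ (hχ a hx.2).2
  have hT (a : S) (i : Fin (m a)) : IsDiffOp (a : M) (K ∩ tsupport (χ a)) r (T a i) := by
    refine ⟨fun h x hx ↦ ?_, fun h x hx h0 ↦ ?_, fun n h hh ↦ ?_⟩
    · change χ a x * t (mulSec h (e a i)) x = 0
      by_cases hxK : x ∈ K
      · rw [image_eq_zero_of_notMem_tsupport fun h ↦ hx ⟨hxK, h⟩, zero_mul]
      · rw [ht.zero_off _ x hxK, mul_zero]
    · change χ a x * t (mulSec h (e a i)) x = 0
      rw [ht.order _ x (sameJet_mulSec_zero (hKas a hx) h0 _), mul_zero]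
    · exact ContMDiff.mul (I := 𝓘(ℝ, ℝ)) (G := ℝ) ((χ a).contMDiff.comp contMDiff_snd)
        (ht.smooth n _ (SmoothFamily.mulSec hh (smoothFamily_const n (e a i))))
  choose u hu hU using fun a i ↦ (hT a i).exists_adjoint hμ (hKa a) (hKas a)
  let c (σ : Sec d F E) (a : S) (i : Fin (m a)) : SmoothFun d M :=
    ⟨fun x ↦ β x (σ x) (e' a i x), hβ σ (e' a i)⟩
  refine ⟨∑ a, ∑ i, mulSec (u a i) (e' a i), fun x hx ↦ ?_, fun σ ↦ ?_⟩
  · rw [Finset.sum_sigma', mulSec_sum]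
    refine Finset.sum_eq_zero fun p _ ↦ ?_
    rw [hu p.1 p.2 x fun h ↦ hx h.1, zero_smul]
  · have h1 : ∀ x, t σ x = ∑ a, ∑ i, T a i (c σ a i) x := by
      intro x
      by_cases hx : x ∈ K
      · have h2 (a : S) : χ a x * t σ x = ∑ i, T a i (c σ a i) x := by
          change _ = ∑ i, χ a x * t (mulSec (c σ a i) (e a i)) x
          rw [← Finset.mul_sum]
          by_cases hxa : x ∈ tsupport (χ a)
          · have h3 : SameJet r x (σ + (-1 : ℝ) • ∑ i, mulSec (c σ a i) (e a i)) 0 := by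
              refine sameJet_of_eventuallyEq r ?_
              filter_upwards [(hO a).mem_nhds (hχ a hxa).1] with y hy
              rw [ContMDiffSection.coe_add, Pi.add_apply, ContMDiffSection.coe_smul, Pi.smul_apply,
                mulSec_sum, neg_one_smul, ← sub_eq_add_neg]
              exact sub_eq_zero.2 (hfr a y hy (σ y))
            have h4 := ht.order _ x h3
            rw [map_add, map_smul, Pi.add_apply, Pi.smul_apply, neg_one_smul, ← sub_eq_add_neg,
              sub_eq_zero] at h4
            rw [h4, map_sum, Finset.sum_apply]
          · rw [image_eq_zero_of_notMem_tsupport hxa, zero_mul, zero_mul]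
        rw [← Finset.sum_congr rfl fun a _ ↦ h2 a, ← Finset.sum_mul, hsum x hx, one_mul]
      · rw [ht.zero_off σ x hx]
        refine (Finset.sum_eq_zero fun a _ ↦ Finset.sum_eq_zero fun i _ ↦ ?_).symm
        exact (hT a i).zero_off _ x fun h ↦ hx h.1
    have hint (f : M → ℝ) (hf : ContMDiff (𝓡 d) 𝓘(ℝ, ℝ) ∞ f) (hf0 : ∀ x ∉ K, f x = 0) :
        Integrable f μ :=
      (hf.continuous.continuousOn.integrableOn_compact hK).integrable_of_forall_notMem_eq_zero hf0
    have hi1 (a : S) (i : Fin (m a)) : Integrable (T a i (c σ a i)) μ :=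
      hint _ ((hT a i).contMDiff_apply _) fun x hx ↦ (hT a i).zero_off _ x fun h ↦ hx h.1
    have hi2 (a : S) (i : Fin (m a)) : Integrable (fun x ↦ u a i x * c σ a i x) μ :=
      hint _ (ContMDiff.mul (I := 𝓘(ℝ, ℝ)) (G := ℝ) (u a i).contMDiff (c σ a i).contMDiff)
        fun x hx ↦ by rw [hu a i x fun h ↦ hx h.1, zero_mul]
    have h5 : ∀ x, β x (σ x) ((∑ a, ∑ i, mulSec (u a i) (e' a i) : Sec d F' E') x) =
        ∑ a, ∑ i, u a i x * c σ a i x := by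
      intro x
      rw [Finset.sum_sigma', mulSec_sum, map_sum, Finset.sum_sigma']
      simp only [map_smul, smul_eq_mul]
      rfl
    simp only [h1, h5]
    rw [integral_finsetSum _ fun a _ ↦ integrable_finsetSum _ fun i _ ↦ hi1 a i,
      integral_finsetSum _ fun a _ ↦ integrable_finsetSum _ fun i _ ↦ hi2 a i]
    refine Finset.sum_congr rfl fun a _ ↦ ?_
    rw [integral_finsetSum _ fun i _ ↦ hi1 a i, integral_finsetSum _ fun i _ ↦ hi2 a i]
    exact Finset.sum_congr rfl fun i _ ↦ hU a i (c σ a i)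

end EulerLagrange

/-! ### Homogeneity of word sums -/

section Words

variable {ι C : Type*} [DecidableEq ι] [AddCommGroup C] [Module ℝ C]

theorem wordSum_smul_arg {P : C → Prop} (T : Finset ι) (ε : ι → Grassmann) (op : ι → C → C)
    (G : C → Grassmann) (a : ℝ) (hP : ∀ i c, P c → P (op i c))
    (hop : ∀ i c, P c → op i (a • c) = a • op i c) (hG : ∀ c, P c → G (a • c) = (a : ℂ) • G c)
    (j : ℕ) {c : C} (hc : P c) :
    wordSum T ε op G j (a • c) = (a : ℂ) • wordSum T ε op G j c := by
  induction j generalizing c with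
  | zero => exact hG c hc
  | succ j ih =>
    simp only [wordSum, Finset.smul_sum]
    exact Finset.sum_congr rfl fun i _ ↦ by rw [hop i c hc, ih (hP i c hc), mul_smul_comm]

theorem wordSum_smul_op {P : C → Prop} (T : Finset ι) (ε : ι → Grassmann) (op op' : ι → C → C)
    (G : C → Grassmann) (a : ℝ) (hP : ∀ i c, P c → P (op i c)) (hPa : ∀ c, P c → P (a • c))
    (hop' : ∀ i c, P c → op' i c = a • op i c)
    (hop : ∀ i c, P c → op i (a • c) = a • op i c) (hG : ∀ c, P c → G (a • c) = (a : ℂ) • G c)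
    (j : ℕ) {c : C} (hc : P c) :
    wordSum T ε op' G j c = (a : ℂ) ^ j • wordSum T ε op G j c := by
  induction j generalizing c with
  | zero => simp [wordSum]
  | succ j ih =>
    simp only [wordSum, Finset.smul_sum]
    refine Finset.sum_congr rfl fun i _ ↦ ?_
    rw [hop' i c hc, ih (hPa _ (hP i c hc)), wordSum_smul_arg T ε op G a hP hop hG j (hP i c hc),
      smul_smul, mul_smul_comm, pow_succ]

end Words

/-- All linear functionals of the family are differentiable. -/
def WeaklyDifferentiable (x : ℝ → Grassmann) : Prop :=
  ∀ L : Grassmann →ₗ[ℂ] ℂ, Differentiable ℝ fun a ↦ L (x a)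

theorem WeaklyDifferentiable.map {x : ℝ → Grassmann} (hx : WeaklyDifferentiable x)
    (T : Grassmann →ₗ[ℂ] Grassmann) : WeaklyDifferentiable fun a ↦ T (x a) := fun L ↦ hx (L ∘ₗ T)

theorem WeaklyDifferentiable.sum {ι : Type*} {S : Finset ι} {x : ι → ℝ → Grassmann}
    (hx : ∀ i ∈ S, WeaklyDifferentiable (x i)) :
    WeaklyDifferentiable fun a ↦ ∑ i ∈ S, x i a := fun L ↦ by
  simp only [map_sum]
  exact Differentiable.fun_sum fun i hi ↦ hx i hi L

theorem weaklyDifferentiable_wordSum {ι C : Type*} [DecidableEq ι] {P : C → Prop} (T : Finset ι)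
    (ε : ι → Grassmann) (op : ι → C → C) (G : ℝ → C → Grassmann) (hP : ∀ i c, P c → P (op i c))
    (hG : ∀ c, P c → WeaklyDifferentiable fun a ↦ G a c) (j : ℕ) {c : C} (hc : P c) :
    WeaklyDifferentiable fun a ↦ wordSum T ε op (G a) j c := by
  induction j generalizing c with
  | zero => exact hG c hc
  | succ j ih =>
    exact WeaklyDifferentiable.sum fun i _ ↦ (ih (hP i c hc)).map (LinearMap.mulLeft ℂ (ε i))

/-! ### Complexified pairs of sections -/

section Pairs

variable {A B : Type*} [AddCommGroup A] [Module ℝ A] [AddCommGroup B] [Module ℝ B]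

/-- The complex conjugate of the first component, with vanishing second component. -/
def conjFst : Cx (A × B) →ₗ[ℝ] Cx (A × B) where
  toFun z := ((z.1.1, 0), (-z.2.1, 0))
  map_add' z z' := by simp [add_comm]
  map_smul' a z := by simp

/-- The second component. -/
def projSnd : Cx (A × B) →ₗ[ℝ] Cx (A × B) where
  toFun z := ((0, z.1.2), (0, z.2.2))
  map_add' z z' := by simp
  map_smul' a z := by simp

theorem conjFst_conjFst_add (z : Cx (A × B)) :
    conjFst (conjFst z) + projSnd (projSnd z) = z := by
  simp [conjFst, projSnd]

theorem conjFst_mulI (z : Cx (A × B)) : conjFst (Cx.mulI z) = -Cx.mulI (conjFst z) := by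
  simp [conjFst, Cx.mulI]

theorem projSnd_mulI (z : Cx (A × B)) : projSnd (Cx.mulI z) = Cx.mulI (projSnd z) := by
  simp [projSnd, Cx.mulI]

theorem mulI_add (z z' : Cx A) : Cx.mulI (z + z') = Cx.mulI z + Cx.mulI z' :=
  Prod.ext (neg_add _ _) rfl

theorem mulI_sub (z z' : Cx A) : Cx.mulI (z - z') = Cx.mulI z - Cx.mulI z' :=
  Prod.ext (neg_sub' _ _) rfl

end Pairs

section Support

variable {d : ℕ} {M : Type*} [TopologicalSpace M] [ChartedSpace (EuclideanSpace ℝ (Fin d)) M]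
  {F : Type*} [NormedAddCommGroup F] [NormedSpace ℝ F]
  {E : M → Type*} [TopologicalSpace (TotalSpace F E)] [∀ x, TopologicalSpace (E x)]
  [∀ x, AddCommGroup (E x)] [∀ x, Module ℝ (E x)] [FiberBundle F E]
  {F' : Type*} [NormedAddCommGroup F'] [NormedSpace ℝ F']
  {E' : M → Type*} [TopologicalSpace (TotalSpace F' E')] [∀ x, TopologicalSpace (E' x)]
  [∀ x, AddCommGroup (E' x)] [∀ x, Module ℝ (E' x)] [FiberBundle F' E']
  [VectorBundle ℝ F E] [VectorBundle ℝ F' E']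

theorem isClosed_cxSupp (z : Cx (Sec d F E × Sec d F' E')) : IsClosed (cxSupp z) :=
  isClosed_closure.union isClosed_closure

theorem cxSupp_subset {z : Cx (Sec d F E × Sec d F' E')} {C : Set M} (hC : IsClosed C)
    (h : ∀ x ∉ C, (z.1.1 x = 0 ∧ z.1.2 x = 0) ∧ z.2.1 x = 0 ∧ z.2.2 x = 0) : cxSupp z ⊆ C := by
  refine union_subset (closure_minimal (fun x hx ↦ ?_) hC) (closure_minimal (fun x hx ↦ ?_) hC)
  · by_contra hx'
    obtain ⟨⟨h1, h2⟩, -⟩ := h x hx'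
    simp [h1, h2] at hx
  · by_contra hx'
    obtain ⟨-, h1, h2⟩ := h x hx'
    simp [h1, h2] at hx

theorem apply_eq_zero_of_notMem_cxSupp {z : Cx (Sec d F E × Sec d F' E')} {x : M}
    (hx : x ∉ cxSupp z) : (z.1.1 x = 0 ∧ z.1.2 x = 0) ∧ z.2.1 x = 0 ∧ z.2.2 x = 0 := by
  simp only [cxSupp, supp, mem_union, not_or] at hx
  have h1 := fun h ↦ hx.1 (subset_closure h)
  have h2 := fun h ↦ hx.2 (subset_closure h)
  simp only [mem_ofPred_eq, not_or, not_not, imp_false] at h1 h2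
  exact ⟨h1, h2⟩

theorem cxSupp_add (z z' : Cx (Sec d F E × Sec d F' E')) :
    cxSupp (z + z') ⊆ cxSupp z ∪ cxSupp z' := by
  rintro x (hx | hx)
  · exact (supp_add _ _ hx).imp Or.inl Or.inl
  · exact (supp_add _ _ hx).imp Or.inr Or.inr

theorem cxSupp_neg (z : Cx (Sec d F E × Sec d F' E')) : cxSupp (-z) ⊆ cxSupp z :=
  cxSupp_subset (isClosed_cxSupp z) fun x hx ↦ by
    obtain ⟨⟨h1, h2⟩, h3, h4⟩ := apply_eq_zero_of_notMem_cxSupp hx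
    exact ⟨⟨(congrArg Neg.neg h1).trans neg_zero, (congrArg Neg.neg h2).trans neg_zero⟩,
      (congrArg Neg.neg h3).trans neg_zero, (congrArg Neg.neg h4).trans neg_zero⟩

theorem cxSupp_conjFst (z : Cx (Sec d F E × Sec d F' E')) : cxSupp (conjFst z) ⊆ cxSupp z :=
  cxSupp_subset (isClosed_cxSupp z) fun x hx ↦ by
    obtain ⟨⟨h1, h2⟩, h3, h4⟩ := apply_eq_zero_of_notMem_cxSupp hx
    exact ⟨⟨h1, rfl⟩, (congrArg Neg.neg h3).trans neg_zero, rfl⟩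

theorem cxSupp_projSnd (z : Cx (Sec d F E × Sec d F' E')) : cxSupp (projSnd z) ⊆ cxSupp z :=
  cxSupp_subset (isClosed_cxSupp z) fun x hx ↦ by
    obtain ⟨⟨h1, h2⟩, h3, h4⟩ := apply_eq_zero_of_notMem_cxSupp hx
    exact ⟨⟨rfl, h2⟩, rfl, h4⟩

theorem isCompact_cxSupp_of_subset {z : Cx (Sec d F E × Sec d F' E')} {K : Set M}
    (hK : IsCompact K) (h : cxSupp z ⊆ K) : IsCompact (cxSupp z) :=
  hK.of_isClosed_subset (isClosed_cxSupp z) h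

end Support

section FieldTheory

variable {d : ℕ} {M : Type*} [TopologicalSpace M] [ChartedSpace (EuclideanSpace ℝ (Fin d)) M]
  [IsManifold (𝓡 d) ∞ M]
  {F₀ : Type*} [NormedAddCommGroup F₀] [NormedSpace ℝ F₀] [FiniteDimensional ℝ F₀]
  {E₀ : M → Type*} [TopologicalSpace (TotalSpace F₀ E₀)] [∀ x, TopologicalSpace (E₀ x)]
  [∀ x, AddCommGroup (E₀ x)] [∀ x, Module ℝ (E₀ x)] [∀ x, IsTopologicalAddGroup (E₀ x)]
  [∀ x, ContinuousSMul ℝ (E₀ x)] [FiberBundle F₀ E₀] [VectorBundle ℝ F₀ E₀]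
  [ContMDiffVectorBundle ∞ F₀ E₀ (𝓡 d)]
  {F₁ : Type*} [NormedAddCommGroup F₁] [NormedSpace ℝ F₁] [FiniteDimensional ℝ F₁]
  {E₁ : M → Type*} [TopologicalSpace (TotalSpace F₁ E₁)] [∀ x, TopologicalSpace (E₁ x)]
  [∀ x, AddCommGroup (E₁ x)] [∀ x, Module ℝ (E₁ x)] [∀ x, IsTopologicalAddGroup (E₁ x)]
  [∀ x, ContinuousSMul ℝ (E₁ x)] [FiberBundle F₁ E₁] [VectorBundle ℝ F₁ E₁]
  [ContMDiffVectorBundle ∞ F₁ E₁ (𝓡 d)]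
  [MeasurableSpace M] [BorelSpace M] [T2Space M] [SigmaCompactSpace M] {μ : Measure M}

local notation "𝒯" => Tot d F₀ E₀ F₁ E₁
local notation "𝒟" => Der d F₀ E₀ F₁ E₁
local notation "𝒞" => Conf d F₀ E₀ F₁ E₁
local notation "𝒦" => Components d F₀ E₀ F₁ E₁
local notation "ℰ" => Ev d F₀ E₀ F₁ E₁
local notation "ℱ" => Functional d F₀ E₀ F₁ E₁
local notation "𝒪" => Od d F₀ E₀ F₁ E₁
local notation "𝒜" => Antifields d F₀ E₀ F₁ E₁
local notation "𝒢" => Fields d F₀ E₀ F₁ E₁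
local notation "ℬ" => CompactAntifields d F₀ E₀ F₁ E₁

/-! ### Local functionals and their derivatives -/

section LocalDensity

/-- Smooth families of even configurations. -/
def EvFamily {n : ℕ} (v : (Fin n → ℝ) → ℰ) : Prop :=
  SmoothFamily (fun s ↦ (v s).1) ∧ SmoothFamily (fun s ↦ (v s).2)

/-- Smooth families of odd configurations. -/
def OdFamily {n : ℕ} (w : (Fin n → ℝ) → 𝒪) : Prop :=
  SmoothFamily (fun s ↦ (w s).1) ∧ SmoothFamily (fun s ↦ (w s).2)

/-- The even configurations `v` and `v'` have the same `r`-jet at `x`. -/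
def EvJet (r : ℕ) (x : M) (v v' : ℰ) : Prop :=
  SameJet r x v.1 v'.1 ∧ SameJet r x v.2 v'.2

/-- The odd configurations `w` and `w'` have the same `r`-jet at `x`. -/
def OdJet (r : ℕ) (x : M) (w w' : 𝒪) : Prop :=
  SameJet r x w.1 w'.1 ∧ SameJet r x w.2 w'.2

theorem EvFamily.add {n : ℕ} {v v' : (Fin n → ℝ) → ℰ} (h : EvFamily v)
    (h' : EvFamily v') : EvFamily fun s ↦ v s + v' s := ⟨h.1.add h'.1, h.2.add h'.2⟩

theorem EvFamily.smul {n : ℕ} {f : (Fin n → ℝ) → ℝ} {v : (Fin n → ℝ) → ℰ}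
    (hf : ContDiff ℝ ∞ f) (h : EvFamily v) : EvFamily fun s ↦ f s • v s :=
  ⟨h.1.smul hf, h.2.smul hf⟩

theorem EvFamily.comp {n m : ℕ} {v : (Fin n → ℝ) → ℰ} (h : EvFamily v)
    {g : (Fin m → ℝ) → Fin n → ℝ} (hg : ContDiff ℝ ∞ g) : EvFamily fun s ↦ v (g s) :=
  ⟨h.1.comp hg, h.2.comp hg⟩

theorem OdFamily.comp {n m : ℕ} {v : (Fin n → ℝ) → 𝒪} (h : OdFamily v)
    {g : (Fin m → ℝ) → Fin n → ℝ} (hg : ContDiff ℝ ∞ g) : OdFamily fun s ↦ v (g s) :=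
  ⟨h.1.comp hg, h.2.comp hg⟩

theorem evFamily_const (n : ℕ) (v : ℰ) : EvFamily fun _ : Fin n → ℝ ↦ v :=
  ⟨smoothFamily_const n v.1, smoothFamily_const n v.2⟩

theorem odFamily_const (n : ℕ) (v : 𝒪) : OdFamily fun _ : Fin n → ℝ ↦ v :=
  ⟨smoothFamily_const n v.1, smoothFamily_const n v.2⟩

theorem EvJet.add {r : ℕ} {x : M} {v v' w w' : ℰ} (h : EvJet r x v v')
    (h' : EvJet r x w w') : EvJet r x (v + w) (v' + w') := ⟨h.1.add h'.1, h.2.add h'.2⟩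

theorem EvJet.smul {r : ℕ} {x : M} {v v' : ℰ} (h : EvJet r x v v') (a : ℝ) :
    EvJet r x (a • v) (a • v') := ⟨h.1.smul a, h.2.smul a⟩

theorem EvJet.refl (r : ℕ) (x : M) (v : ℰ) : EvJet r x v v :=
  ⟨SameJet.refl r x _, SameJet.refl r x _⟩

theorem OdJet.refl (r : ℕ) (x : M) (v : 𝒪) : OdJet r x v v :=
  ⟨SameJet.refl r x _, SameJet.refl r x _⟩

/-- The components `ℓ_x` depend on the `r`-jets at `x`, vanish for `x ∉ K`, and are smooth. These
are the densities of local functionals. -/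
structure IsLocalDensity (K : Set M) (r : ℕ) (ℓ : M → 𝒦) : Prop where
  zero_off : ∀ x ∉ K, ∀ k v w, ℓ x k v w = 0
  jet : ∀ x k v v' w w', EvJet r x v v' → (∀ i, OdJet r x (w i) (w' i)) → ℓ x k v w = ℓ x k v' w'
  alt : ∀ x k v, ∃ A : 𝒪 [⋀^Fin k]→ₗ[ℝ] ℂ, ∀ w, ℓ x k v w = A w
  smooth : ∀ (k n : ℕ) (v : (Fin n → ℝ) → ℰ)
    (w : Fin k → (Fin n → ℝ) → 𝒪), EvFamily v → (∀ i, OdFamily (w i)) →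
    ContMDiff (𝓘(ℝ, Fin n → ℝ).prod (𝓡 d)) 𝓘(ℝ, ℂ) ∞
      (fun p : (Fin n → ℝ) × M ↦ ℓ p.2 k (v p.1) (fun i ↦ w i p.1))

theorem isLocal_iff {c : 𝒦} : IsLocal μ c ↔
    ∃ (K : Set M) (r : ℕ) (ℓ : M → 𝒦), IsCompact K ∧
      IsLocalDensity K r ℓ ∧ ∀ k v w, c k v w = ∫ x, ℓ x k v w ∂μ := by
  constructor
  · rintro ⟨K, r, ℓ, hK, hc, h0, hj, ha, hs⟩
    exact ⟨K, r, fun x k v w ↦ ℓ k v w x, hK, ⟨fun x hx k v w ↦ h0 k v w x hx,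
      fun x k v v' w w' hv hw ↦ hj k x v v' w w' hv.1 hv.2 (fun i ↦ (hw i).1) fun i ↦ (hw i).2,
      fun x k v ↦ ha k v x, fun k n v w hv hw ↦ hs k n v w hv.1 hv.2 (fun i ↦ (hw i).1)
        fun i ↦ (hw i).2⟩, hc⟩
  · rintro ⟨K, r, ℓ, hK, ⟨h0, hj, ha, hs⟩, hc⟩
    exact ⟨K, r, fun k v w x ↦ ℓ x k v w, hK, hc, fun k v w x hx ↦ h0 x hx k v w,
      fun k x v v' w w' h1 h2 h3 h4 ↦ hj x k v v' w w' ⟨h1, h2⟩ fun i ↦ ⟨h3 i, h4 i⟩,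
      fun k v x ↦ ha x k v, fun k n v w h1 h2 h3 h4 ↦ hs k n v w ⟨h1, h2⟩ fun i ↦ ⟨h3 i, h4 i⟩⟩

namespace IsLocalDensity

variable {K : Set M} {r : ℕ} {ℓ : M → Components d F₀ E₀ F₁ E₁}

theorem evFamily_affine {n : ℕ} (v : ℰ) (a : Fin n → ℰ) :
    EvFamily fun s : Fin n → ℝ ↦ v + ∑ i, s i • a i := by
  constructor
  · have := (smoothFamily_const n v.1).add (smoothFamily_sum_smul fun i ↦ (a i).1)
    simpa [Prod.fst_sum] using this
  · have := (smoothFamily_const n v.2).add (smoothFamily_sum_smul fun i ↦ (a i).2)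
    simpa [Prod.snd_sum] using this

theorem isSmoothAlt (h : IsLocalDensity K r ℓ) (x : M) : IsSmoothAlt (ℓ x) where
  smooth k v w N a := by
    have h1 := h.smooth k N _ (fun i _ ↦ w i) (evFamily_affine v a) fun i ↦ odFamily_const N (w i)
    rw [← contMDiff_iff_contDiff]
    exact h1.comp (f := fun s : Fin N → ℝ ↦ ((s, x) : (Fin N → ℝ) × M))
      (contMDiff_id.prodMk contMDiff_const)
  alt k v := h.alt x k v

theorem contMDiff_apply (h : IsLocalDensity K r ℓ) (k : ℕ) (v : ℰ)
    (w : Fin k → 𝒪) : ContMDiff (𝓡 d) 𝓘(ℝ, ℂ) ∞ fun x ↦ ℓ x k v w :=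
  (h.smooth k 0 _ _ (evFamily_const 0 v) fun i ↦ odFamily_const 0 (w i)).comp
    (contMDiff_const (c := (0 : Fin 0 → ℝ)) |>.prodMk contMDiff_id)

theorem smooth_dE (h : IsLocalDensity K r ℓ) (k n : ℕ) {e v : (Fin n → ℝ) → ℰ}
    {w : Fin k → (Fin n → ℝ) → 𝒪} (he : EvFamily e) (hv : EvFamily v)
    (hw : ∀ i, OdFamily (w i)) :
    ContMDiff (𝓘(ℝ, Fin n → ℝ).prod (𝓡 d)) 𝓘(ℝ, ℂ) ∞
      (fun p : (Fin n → ℝ) × M ↦ dE (e p.1) (ℓ p.2) k (v p.1) (fun i ↦ w i p.1)) := by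
  have ht : ContDiff ℝ ∞ (fun s : Fin (n + 1) → ℝ ↦ (Fin.tail s : Fin n → ℝ)) :=
    contDiff_pi.2 fun i ↦ contDiff_apply ℝ ℝ i.succ
  have h1 := h.smooth k (n + 1) (fun s ↦ v (Fin.tail s) + s 0 • e (Fin.tail s))
    (fun i s ↦ w i (Fin.tail s))
    ((hv.comp ht).add ((he.comp ht).smul (contDiff_apply ℝ ℝ 0))) fun i ↦ (hw i).comp ht
  have hc : ContDiff ℝ ∞ fun s : Fin n → ℝ ↦ (Fin.cons 0 s : Fin (n + 1) → ℝ) := by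
    refine contDiff_pi.2 fun i ↦ Fin.cases ?_ (fun i ↦ ?_) i
    · simpa using contDiff_const
    · simpa using contDiff_apply ℝ ℝ i
  have h2 := (contMDiff_fderiv_param h1).comp
    (f := fun p : (Fin n → ℝ) × M ↦ (((Fin.cons 0 p.1 : Fin (n + 1) → ℝ), p.2) :
      (Fin (n + 1) → ℝ) × M)) ((hc.contMDiff.comp contMDiff_fst).prodMk contMDiff_snd)
  have h3 := h2.clm_apply (contMDiff_const (c := (Pi.single 0 1 : Fin (n + 1) → ℝ)))
  refine h3.congr fun p ↦ ?_
  have h4 : DifferentiableAt ℝ (fun s : Fin (n + 1) → ℝ ↦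
      ℓ p.2 k (v (Fin.tail s) + s 0 • e (Fin.tail s)) fun i ↦ w i (Fin.tail s))
      (Fin.cons 0 p.1 : Fin (n + 1) → ℝ) := by
    have h5 := h1.comp (f := fun s : Fin (n + 1) → ℝ ↦ ((s, p.2) : (Fin (n + 1) → ℝ) × M))
      (contMDiff_id.prodMk contMDiff_const)
    exact (contMDiff_iff_contDiff.1 h5).differentiable (by simp) _
  have h6 := h4.hasFDerivAt.comp_hasDerivAt_of_eq (0 : ℝ)
    (f := fun τ : ℝ ↦ (Fin.cons 0 p.1 : Fin (n + 1) → ℝ) + τ • Pi.single 0 1)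
    (((hasDerivAt_id (0 : ℝ)).smul_const (Pi.single 0 1 : Fin (n + 1) → ℝ)).const_add _) (by simp)
  rw [one_smul] at h6
  rw [Function.comp_apply, ← h6.deriv, dE]
  congr 1
  ext τ
  have h7 : Fin.tail ((Fin.cons 0 p.1 : Fin (n + 1) → ℝ) + τ • Pi.single 0 1) = p.1 := by
    ext i; simp [Fin.tail]
  simp only [Function.comp_apply, h7]
  simp

theorem stable_dE (h : IsLocalDensity K r ℓ) (e : ℰ) :
    IsLocalDensity K r fun x ↦ dE e (ℓ x) where
  zero_off x hx k v w := by simp [dE, h.zero_off x hx]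
  jet x k v v' w w' hv hw := by
    unfold dE
    congr 1
    ext τ
    exact h.jet x k _ _ _ _ (hv.add (EvJet.refl r x _)) hw
  alt x k v := ((h.isSmoothAlt x).stable_dE e).alt k v
  smooth k n v w hv hw := h.smooth_dE k n (evFamily_const n e) hv hw

theorem stable_dO (h : IsLocalDensity K r ℓ) (o : 𝒪) :
    IsLocalDensity K r fun x ↦ dO o (ℓ x) where
  zero_off x hx k v w := h.zero_off x hx _ _ _
  jet x k v v' w w' hv hw := by
    refine h.jet x _ _ _ _ _ hv fun i ↦ Fin.cases ?_ (fun i ↦ ?_) i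
    · exact OdJet.refl r x _
    · exact hw i
  alt x k v := ((h.isSmoothAlt x).stable_dO o).alt k v
  smooth k n v w hv hw := by
    have h1 := h.smooth (k + 1) n v (Fin.cons (fun _ ↦ o) w : Fin (k + 1) → _) hv fun i ↦
      Fin.cases (odFamily_const n o) (fun i ↦ hw i) i
    refine h1.congr fun p ↦ ?_
    exact congrArg (ℓ p.2 (k + 1) (v p.1)) (funext fun i ↦ Fin.cases rfl (fun _ ↦ rfl) i)

theorem add {K' : Set M} {r' : ℕ} {ℓ' : M → 𝒦} (h : IsLocalDensity K r ℓ)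
    (h' : IsLocalDensity K' r' ℓ') : IsLocalDensity (K ∪ K') (max r r') fun x ↦ ℓ x + ℓ' x where
  zero_off x hx k v w := by
    rw [mem_union, not_or] at hx
    simp [h.zero_off x hx.1, h'.zero_off x hx.2]
  jet x k v v' w w' hv hw := by
    change ℓ x k v w + ℓ' x k v w = ℓ x k v' w' + ℓ' x k v' w'
    rw [h.jet x k v v' w w' ⟨fun j hj ↦ hv.1 j (hj.trans (le_max_left _ _)),
        fun j hj ↦ hv.2 j (hj.trans (le_max_left _ _))⟩
        fun i ↦ ⟨fun j hj ↦ (hw i).1 j (hj.trans (le_max_left _ _)),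
          fun j hj ↦ (hw i).2 j (hj.trans (le_max_left _ _))⟩,
      h'.jet x k v v' w w' ⟨fun j hj ↦ hv.1 j (hj.trans (le_max_right _ _)),
        fun j hj ↦ hv.2 j (hj.trans (le_max_right _ _))⟩
        fun i ↦ ⟨fun j hj ↦ (hw i).1 j (hj.trans (le_max_right _ _)),
          fun j hj ↦ (hw i).2 j (hj.trans (le_max_right _ _))⟩]
  alt x k v := ((h.isSmoothAlt x).add (h'.isSmoothAlt x)).alt k v
  smooth k n v w hv hw := (h.smooth k n v w hv hw).add (h'.smooth k n v w hv hw)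

theorem integrable [IsLocallyFiniteMeasure μ] (hK : IsCompact K) (h : IsLocalDensity K r ℓ) (k : ℕ)
    (v : ℰ) (w : Fin k → 𝒪) : Integrable (fun x ↦ ℓ x k v w) μ :=
  ((h.contMDiff_apply k v w).continuous.continuousOn.integrableOn_compact
    hK).integrable_of_forall_notMem_eq_zero fun x hx ↦ h.zero_off x hx k v w

/-- Differentiation under the integral. -/
theorem dE_integral [IsLocallyFiniteMeasure μ] (hK : IsCompact K) (h : IsLocalDensity K r ℓ)
    (e : ℰ) (k : ℕ) (v : ℰ) (w : Fin k → 𝒪) :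
    dE e (fun k v w ↦ ∫ x, ℓ x k v w ∂μ) k v w = ∫ x, dE e (ℓ x) k v w ∂μ := by
  have h1 := h.smooth k 1 (fun s ↦ v + ∑ i, s i • ![e] i) (fun i _ ↦ w i)
    (evFamily_affine v ![e]) fun i ↦ odFamily_const 1 (w i)
  have hc : ContDiff ℝ ∞ fun τ : ℝ ↦ (fun _ : Fin 1 ↦ τ) := contDiff_pi.2 fun _ ↦ contDiff_id
  have h2 : ContMDiff (𝓘(ℝ, ℝ).prod (𝓡 d)) 𝓘(ℝ, ℂ) ∞
      fun p : ℝ × M ↦ ℓ p.2 k (v + p.1 • e) w := by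
    refine (h1.comp (f := fun p : ℝ × M ↦ (((fun _ : Fin 1 ↦ p.1), p.2) : (Fin 1 → ℝ) × M))
      ((hc.contMDiff.comp contMDiff_fst).prodMk contMDiff_snd)).congr fun p ↦ ?_
    simp
  have h3 := hasFDerivAt_integral_param (μ := μ) h2 hK
    (fun s x hx ↦ h.zero_off x hx k (v + s • e) w) 0
  have hint : Integrable (fun x ↦ fderiv ℝ (fun s : ℝ ↦ ℓ x k (v + s • e) w) 0) μ := by
    have h4 := (contMDiff_fderiv_param h2).comp (f := fun x : M ↦ ((0 : ℝ), x))
      (contMDiff_const.prodMk contMDiff_id)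
    refine (h4.continuous.continuousOn.integrableOn_compact
      hK).integrable_of_forall_notMem_eq_zero fun x hx ↦ ?_
    change fderiv ℝ (fun s : ℝ ↦ ℓ x k (v + s • e) w) 0 = 0
    simp [h.zero_off x hx]
  have h5 := h3.hasDerivAt.deriv
  rw [ContinuousLinearMap.integral_apply hint] at h5
  exact h5

end IsLocalDensity

namespace IsLocal

variable {c c' : Components d F₀ E₀ F₁ E₁}

theorem isSmoothAlt [IsLocallyFiniteMeasure μ] (hc : IsLocal μ c) : IsSmoothAlt c := by
  obtain ⟨K, r, ℓ, hK, h, hi⟩ := isLocal_iff.1 hc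
  refine ⟨fun k v w N a ↦ ?_, fun k v ↦ ?_⟩
  · simp only [hi]
    exact contDiff_integral_param (h.smooth k N _ (fun i _ ↦ w i)
      (IsLocalDensity.evFamily_affine v a) fun i ↦ odFamily_const N (w i)) hK
      fun s x hx ↦ h.zero_off x hx _ _ _
  · choose A hA using fun x ↦ h.alt x k v
    have hint (w : Fin k → 𝒪) : Integrable (fun x ↦ A x w) μ := by
      simpa only [hA] using h.integrable hK k v w
    refine ⟨AlternatingMap.mk (MultilinearMap.mk (fun w ↦ ∫ x, A x w ∂μ) ?_ ?_) ?_,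
      fun w ↦ by simp only [hi, hA]; rfl⟩
    · intro _ w i o o'
      simp only [AlternatingMap.map_update_add]
      exact integral_add (hint _) (hint _)
    · intro _ w i a o
      simp only [AlternatingMap.map_update_smul]
      exact integral_smul _ _
    · intro w i j hij hne
      change ∫ x, A x w ∂μ = 0
      simp only [fun x ↦ (A x).map_eq_zero_of_eq w hij hne, integral_zero]

theorem stable_dE [IsLocallyFiniteMeasure μ] (hc : IsLocal μ c) (e : ℰ) :
    IsLocal μ (dE e c) := by
  obtain ⟨K, r, ℓ, hK, h, hi⟩ := isLocal_iff.1 hc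
  obtain rfl : c = fun k v w ↦ ∫ x, ℓ x k v w ∂μ := by ext k v w; exact hi k v w
  exact isLocal_iff.2 ⟨K, r, _, hK, h.stable_dE e, fun k v w ↦ h.dE_integral hK e k v w⟩

theorem stable_dO (hc : IsLocal μ c) (o : 𝒪) :
    IsLocal μ (dO o c) := by
  obtain ⟨K, r, ℓ, hK, h, hi⟩ := isLocal_iff.1 hc
  exact isLocal_iff.2 ⟨K, r, _, hK, h.stable_dO o, fun k v w ↦ hi _ _ _⟩

theorem add [IsLocallyFiniteMeasure μ] (hc : IsLocal μ c) (hc' : IsLocal μ c') :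
    IsLocal μ (c + c') := by
  obtain ⟨K, r, ℓ, hK, h, hi⟩ := isLocal_iff.1 hc
  obtain ⟨K', r', ℓ', hK', h', hi'⟩ := isLocal_iff.1 hc'
  refine isLocal_iff.2 ⟨_, _, _, hK.union hK', h.add h', fun k v w ↦ ?_⟩
  exact (congrArg₂ (· + ·) (hi k v w) (hi' k v w)).trans
    (integral_add (h.integrable hK k v w) (h'.integrable hK' k v w)).symm

end IsLocal

end LocalDensity

/-! ### Functional derivatives of local functionals -/

section Representation

/-- All components of the multiplet of derivatives `u` vanish off `K`. -/
def DerOff (K : Set M) (u : 𝒟) : Prop :=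
  ∀ x ∉ K, u.1.1 x = 0 ∧ u.1.2 x = 0 ∧ u.2.1 x = 0 ∧ u.2.2 x = 0

/-- The integrand of the pairing. -/
def pairFun (w : 𝒯) (u : 𝒟) (x : M) : ℝ :=
  u.1.1 x (w.1.1 x) + u.1.2 x (w.1.2 x) + w.2.1 x (u.2.1 x) + w.2.2 x (u.2.2 x)

theorem pairing_eq (w : 𝒯) (u : 𝒟) :
    pairing μ w u = ∫ x, pairFun w u x ∂μ := rfl

theorem pairFun_add_left (w w' : 𝒯) (u : 𝒟) (x : M) :
    pairFun (w + w') u x = pairFun w u x + pairFun w' u x := by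
  simp only [pairFun, Prod.fst_add, Prod.snd_add, ContMDiffSection.coe_add, Pi.add_apply, map_add,
    add_apply]
  ring

theorem pairFun_add_right (w : 𝒯) (u u' : 𝒟) (x : M) :
    pairFun w (u + u') x = pairFun w u x + pairFun w u' x := by
  simp only [pairFun, Prod.fst_add, Prod.snd_add, ContMDiffSection.coe_add, Pi.add_apply, map_add,
    add_apply]
  ring

theorem pairFun_smul_left (a : ℝ) (w : 𝒯) (u : 𝒟) (x : M) :
    pairFun (a • w) u x = a * pairFun w u x := by
  simp only [pairFun, Prod.smul_fst, Prod.smul_snd, ContMDiffSection.coe_smul, Pi.smul_apply,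
    map_smul, smul_apply, smul_eq_mul]
  ring

theorem pairFun_smul_right (a : ℝ) (w : 𝒯) (u : 𝒟) (x : M) :
    pairFun w (a • u) x = a * pairFun w u x := by
  simp only [pairFun, Prod.smul_fst, Prod.smul_snd, ContMDiffSection.coe_smul, Pi.smul_apply,
    map_smul, smul_apply, smul_eq_mul]
  ring

theorem contMDiff_evalDual {F : Type*} [NormedAddCommGroup F] [NormedSpace ℝ F]
    {E : M → Type*} [TopologicalSpace (TotalSpace F E)] [∀ x, TopologicalSpace (E x)]
    [∀ x, AddCommGroup (E x)] [∀ x, Module ℝ (E x)] [FiberBundle F E] [VectorBundle ℝ F E]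
    [ContMDiffVectorBundle ∞ F E (𝓡 d)] [∀ x, IsTopologicalAddGroup (E x)]
    [∀ x, ContinuousSMul ℝ (E x)] (u : DualSec d F E) (σ : Sec d F E) :
    ContMDiff (𝓡 d) 𝓘(ℝ, ℝ) ∞ fun x ↦ u x (σ x) :=
  ((smoothFamily_const 0 u).eval_smooth (smoothFamily_const 0 σ)).comp
    (contMDiff_const (c := (0 : Fin 0 → ℝ)) |>.prodMk contMDiff_id)

theorem contMDiff_pairFun (w : 𝒯) (u : 𝒟) :
    ContMDiff (𝓡 d) 𝓘(ℝ, ℝ) ∞ (pairFun w u) := by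
  have h1 := (contMDiff_evalDual u.1.1 w.1.1).add (contMDiff_evalDual u.1.2 w.1.2)
  have h2 := h1.add (contMDiff_evalDual w.2.1 u.2.1)
  exact h2.add (contMDiff_evalDual w.2.2 u.2.2)

theorem DerOff.pairFun_eq_zero {K : Set M} {u : 𝒟} (h : DerOff K u)
    (w : 𝒯) {x : M} (hx : x ∉ K) : pairFun w u x = 0 := by
  obtain ⟨h1, h2, h3, h4⟩ := h x hx
  simp [pairFun, h1, h2, h3, h4]

theorem pairFun_eq_zero_of_notMem {w : 𝒯} {x : M} (hx : x ∉ totSupp w)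
    (u : 𝒟) : pairFun w u x = 0 := by
  simp only [totSupp, supp, mem_union, not_or] at hx
  have h1 := fun h ↦ hx.1 (subset_closure h)
  have h2 := fun h ↦ hx.2 (subset_closure h)
  simp only [mem_ofPred_eq, not_or, not_not, imp_false] at h1 h2
  simp [pairFun, h1.1, h1.2, h2.1, h2.2]

theorem integrable_pairFun [IsLocallyFiniteMeasure μ] {w : 𝒯}
    {u : 𝒟} {K : Set M} (hK : IsCompact K) (h : ∀ x ∉ K, pairFun w u x = 0) :
    Integrable (pairFun w u) μ :=
  ((contMDiff_pairFun w u).continuous.continuousOn.integrableOn_compact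
    hK).integrable_of_forall_notMem_eq_zero h

section FirstVariation

variable {K : Set M} {r : ℕ}

/-- Linear functionals of multiplets that are given by differential operators are represented by
compactly supported sections. -/
theorem exists_pairing_repr (hμ : IsSmoothDensity d μ) (hK : IsCompact K)
    (G : 𝒯 →ₗ[ℝ] M → ℝ) (h0 : ∀ z, ∀ x ∉ K, G z x = 0)
    (hord : ∀ z x, EvJet r x (evenPart z) 0 → OdJet r x (oddPart z) 0 → G z x = 0)
    (hsm : ∀ (n : ℕ) (z : (Fin n → ℝ) → 𝒯), EvFamily (fun s ↦ evenPart (z s)) →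
      OdFamily (fun s ↦ oddPart (z s)) → ContMDiff (𝓘(ℝ, Fin n → ℝ).prod (𝓡 d)) 𝓘(ℝ, ℝ) ∞
        (fun p : (Fin n → ℝ) × M ↦ G (z p.1) p.2)) :
    ∃ u : 𝒟, DerOff K u ∧ ∀ z, ∫ x, G z x ∂μ = pairing μ z u := by
  have hlf := hμ.isLocallyFiniteMeasure
  have hz₀ (n : ℕ) := smoothFamily_const n (0 : Sec d F₀ E₀)
  have hz₁ (n : ℕ) := smoothFamily_const n (0 : Sec d F₁ E₁)
  have hz₀' (n : ℕ) := smoothFamily_const n (0 : DualSec d F₀ E₀)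
  have hz₁' (n : ℕ) := smoothFamily_const n (0 : DualSec d F₁ E₁)
  let ι₁ : Sec d F₀ E₀ →ₗ[ℝ] 𝒯 := LinearMap.inl ℝ _ _ ∘ₗ LinearMap.inl ℝ _ _
  let ι₂ : Sec d F₁ E₁ →ₗ[ℝ] 𝒯 := LinearMap.inl ℝ _ _ ∘ₗ LinearMap.inr ℝ _ _
  let ι₃ : DualSec d F₀ E₀ →ₗ[ℝ] 𝒯 := LinearMap.inr ℝ _ _ ∘ₗ LinearMap.inl ℝ _ _
  let ι₄ : DualSec d F₁ E₁ →ₗ[ℝ] 𝒯 := LinearMap.inr ℝ _ _ ∘ₗ LinearMap.inr ℝ _ _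
  have t₁ : IsSecDiffOp K r (G ∘ₗ ι₁) := ⟨fun σ x hx ↦ h0 _ x hx,
    fun σ x hσ ↦ hord _ x ⟨hσ, SameJet.refl r x _⟩ ⟨SameJet.refl r x _, SameJet.refl r x _⟩,
    fun n σ hσ ↦ hsm n (fun s ↦ ι₁ (σ s)) ⟨hσ, hz₁' n⟩ ⟨hz₁ n, hz₀' n⟩⟩
  have t₂ : IsSecDiffOp K r (G ∘ₗ ι₂) := ⟨fun σ x hx ↦ h0 _ x hx,
    fun σ x hσ ↦ hord _ x ⟨SameJet.refl r x _, SameJet.refl r x _⟩ ⟨hσ, SameJet.refl r x _⟩,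
    fun n σ hσ ↦ hsm n (fun s ↦ ι₂ (σ s)) ⟨hz₀ n, hz₁' n⟩ ⟨hσ, hz₀' n⟩⟩
  have t₃ : IsSecDiffOp K r (G ∘ₗ ι₃) := ⟨fun σ x hx ↦ h0 _ x hx,
    fun σ x hσ ↦ hord _ x ⟨SameJet.refl r x _, SameJet.refl r x _⟩ ⟨SameJet.refl r x _, hσ⟩,
    fun n σ hσ ↦ hsm n (fun s ↦ ι₃ (σ s)) ⟨hz₀ n, hz₁' n⟩ ⟨hz₁ n, hσ⟩⟩
  have t₄ : IsSecDiffOp K r (G ∘ₗ ι₄) := ⟨fun σ x hx ↦ h0 _ x hx,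
    fun σ x hσ ↦ hord _ x ⟨SameJet.refl r x _, hσ⟩ ⟨SameJet.refl r x _, SameJet.refl r x _⟩,
    fun n σ hσ ↦ hsm n (fun s ↦ ι₄ (σ s)) ⟨hz₀ n, hσ⟩ ⟨hz₁ n, hz₀' n⟩⟩
  obtain ⟨u₁, hu₁, hU₁⟩ := t₁.exists_adjoint hμ
    (fun x ↦ LinearMap.mk₂ ℝ (fun (v : E₀ x) (u : E₀ x →L[ℝ] ℝ) ↦ u v) (by simp) (by simp)
      (by simp) (by simp)) (fun σ u ↦ contMDiff_evalDual u σ) exists_dual_frame hK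
  obtain ⟨u₂, hu₂, hU₂⟩ := t₂.exists_adjoint hμ
    (fun x ↦ LinearMap.mk₂ ℝ (fun (v : E₁ x) (u : E₁ x →L[ℝ] ℝ) ↦ u v) (by simp) (by simp)
      (by simp) (by simp)) (fun σ u ↦ contMDiff_evalDual u σ) exists_dual_frame hK
  obtain ⟨u₃, hu₃, hU₃⟩ := t₃.exists_adjoint hμ
    (fun x ↦ LinearMap.mk₂ ℝ (fun (u : E₀ x →L[ℝ] ℝ) (v : E₀ x) ↦ u v) (by simp) (by simp)
      (by simp) (by simp)) (fun u σ ↦ contMDiff_evalDual u σ) (fun x₀ ↦ by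
        obtain ⟨O, m, e, e', hO, hx, h⟩ := exists_dual_frame (d := d) (F := F₀) (E := E₀) x₀
        refine ⟨O, m, e', e, hO, hx, fun x hx u ↦ ?_⟩
        ext v
        conv_lhs => rw [h x hx v]
        simp [mul_comm]) hK
  obtain ⟨u₄, hu₄, hU₄⟩ := t₄.exists_adjoint hμ
    (fun x ↦ LinearMap.mk₂ ℝ (fun (u : E₁ x →L[ℝ] ℝ) (v : E₁ x) ↦ u v) (by simp) (by simp)
      (by simp) (by simp)) (fun u σ ↦ contMDiff_evalDual u σ) (fun x₀ ↦ by
        obtain ⟨O, m, e, e', hO, hx, h⟩ := exists_dual_frame (d := d) (F := F₁) (E := E₁) x₀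
        refine ⟨O, m, e', e, hO, hx, fun x hx u ↦ ?_⟩
        ext v
        conv_lhs => rw [h x hx v]
        simp [mul_comm]) hK
  have hoff : DerOff K ((u₁, u₂), (u₃, u₄)) := fun x hx ↦ ⟨hu₁ x hx, hu₂ x hx, hu₃ x hx, hu₄ x hx⟩
  refine ⟨((u₁, u₂), (u₃, u₄)), hoff, fun z ↦ ?_⟩
  have hG (z : 𝒯) : Integrable (G z) μ := by
    have h1 := (hsm 0 (fun _ ↦ z) (evFamily_const 0 _) (odFamily_const 0 _)).comp
      (contMDiff_const (c := (0 : Fin 0 → ℝ)) |>.prodMk contMDiff_id)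
    exact (h1.continuous.continuousOn.integrableOn_compact
      hK).integrable_of_forall_notMem_eq_zero (h0 z)
  have hi (z : 𝒯) : Integrable (pairFun z ((u₁, u₂), (u₃, u₄))) μ :=
    integrable_pairFun hK fun x hx ↦ hoff.pairFun_eq_zero z hx
  have e₁ : ∫ x, G (ι₁ z.1.1) x ∂μ = ∫ x, pairFun (ι₁ z.1.1) ((u₁, u₂), (u₃, u₄)) x ∂μ :=
    (hU₁ z.1.1).trans (by congr 1; ext x; simp [pairFun, ι₁])
  have e₂ : ∫ x, G (ι₂ z.1.2) x ∂μ = ∫ x, pairFun (ι₂ z.1.2) ((u₁, u₂), (u₃, u₄)) x ∂μ :=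
    (hU₂ z.1.2).trans (by congr 1; ext x; simp [pairFun, ι₂])
  have e₃ : ∫ x, G (ι₃ z.2.1) x ∂μ = ∫ x, pairFun (ι₃ z.2.1) ((u₁, u₂), (u₃, u₄)) x ∂μ :=
    (hU₃ z.2.1).trans (by congr 1; ext x; simp [pairFun, ι₃])
  have e₄ : ∫ x, G (ι₄ z.2.2) x ∂μ = ∫ x, pairFun (ι₄ z.2.2) ((u₁, u₂), (u₃, u₄)) x ∂μ :=
    (hU₄ z.2.2).trans (by congr 1; ext x; simp [pairFun, ι₄])
  have hz : z = ι₁ z.1.1 + ι₂ z.1.2 + ι₃ z.2.1 + ι₄ z.2.2 := by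
    simp [ι₁, ι₂, ι₃, ι₄]
  have hadd (T : 𝒯 → M → ℝ) (hT : ∀ a b x, T (a + b) x = T a x + T b x)
      (hTi : ∀ a, Integrable (T a) μ) (a b : 𝒯) :
      ∫ x, T (a + b) x ∂μ = ∫ x, T a x ∂μ + ∫ x, T b x ∂μ := by
    simp only [hT]; exact integral_add (hTi a) (hTi b)
  have hGa := hadd (fun z ↦ G z) (fun a b x ↦ by rw [map_add]; rfl) hG
  have hPa := hadd (fun z ↦ pairFun z ((u₁, u₂), (u₃, u₄)))
    (fun a b x ↦ pairFun_add_left a b _ x) hi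
  rw [pairing_eq, hz, hGa, hGa, hGa, hPa, hPa, hPa, e₁, e₂, e₃, e₄]

end FirstVariation

end Representation

/-! ### Representation of first variations by sections -/

section Variation

/-- The functionals `w ↦ ⟨w, U⟩` with compactly supported `U`, as the additive group generated by
those with a single coefficient. -/
def Represented (μ : Measure M) : AddSubgroup (𝒯 → Grassmann) :=
  AddSubgroup.closure {T | ∃ (K : Set M) (u : 𝒟) (a : Grassmann),
    IsCompact K ∧ DerOff K u ∧ T = fun w ↦ (pairing μ w u : ℂ) • a}

theorem mem_represented {K : Set M} (hK : IsCompact K) {u : 𝒟} (hu : DerOff K u)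
    (a : Grassmann) : (fun w ↦ (pairing μ w u : ℂ) • a) ∈ Represented (d := d) (F₀ := F₀)
      (E₀ := E₀) (F₁ := F₁) (E₁ := E₁) μ :=
  AddSubgroup.subset_closure ⟨K, u, a, hK, hu, rfl⟩

theorem map_mem_represented {T : 𝒯 → Grassmann} (hT : T ∈ Represented μ)
    (L : Grassmann →ₗ[ℂ] Grassmann) : (fun w ↦ L (T w)) ∈ Represented μ := by
  induction hT using AddSubgroup.closure_induction with
  | mem T h =>
    obtain ⟨K, u, a, hK, hu, rfl⟩ := h
    simpa only [map_smul] using mem_represented hK hu (L a)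
  | zero =>
    simp only [Pi.zero_apply, map_zero]
    exact zero_mem (Represented μ)
  | add T T' _ _ h h' =>
    simp only [Pi.add_apply, map_add]
    exact add_mem h h'
  | neg T _ h =>
    simp only [Pi.neg_apply, map_neg]
    exact neg_mem h

theorem sum_mem_represented {ι : Type*} (S : Finset ι) {T : ι → 𝒯 → Grassmann}
    (hT : ∀ i ∈ S, T i ∈ Represented μ) : (fun w ↦ ∑ i ∈ S, T i w) ∈ Represented μ := by
  have := sum_mem (S := Represented μ) hT
  convert this using 1
  ext w
  simp

theorem DerOff.mono {K K' : Set M} (h : K ⊆ K') {u : 𝒟} (hu : DerOff K u) :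
    DerOff K' u := fun x hx ↦ hu x fun hx' ↦ hx (h hx')

theorem DerOff.zero (K : Set M) : DerOff K (0 : 𝒟) := fun x _ ↦ by simp

theorem DerOff.add {K : Set M} {u u' : 𝒟} (h : DerOff K u) (h' : DerOff K u') :
    DerOff K (u + u') := fun x hx ↦ by
  obtain ⟨h1, h2, h3, h4⟩ := h x hx
  obtain ⟨h1', h2', h3', h4'⟩ := h' x hx
  simp [h1, h2, h3, h4, h1', h2', h3', h4']

theorem DerOff.smul {K : Set M} {u : 𝒟} (h : DerOff K u) (a : ℝ) :
    DerOff K (a • u) := fun x hx ↦ by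
  obtain ⟨h1, h2, h3, h4⟩ := h x hx
  simp [h1, h2, h3, h4]

theorem DerOff.neg {K : Set M} {u : 𝒟} (h : DerOff K u) :
    DerOff K (-u) := by simpa using h.smul (-1)

section Pairing

variable [IsLocallyFiniteMeasure μ]

theorem pairing_add_left {w w' : 𝒯} {u : 𝒟} {K : Set M}
    (hK : IsCompact K) (h : ∀ x ∉ K, pairFun w u x = 0) (h' : ∀ x ∉ K, pairFun w' u x = 0) :
    pairing μ (w + w') u = pairing μ w u + pairing μ w' u := by
  simp only [pairing_eq, pairFun_add_left]
  exact integral_add (integrable_pairFun hK h) (integrable_pairFun hK h')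

theorem pairing_add_right {w : 𝒯} {u u' : 𝒟} {K : Set M}
    (hK : IsCompact K) (h : ∀ x ∉ K, pairFun w u x = 0) (h' : ∀ x ∉ K, pairFun w u' x = 0) :
    pairing μ w (u + u') = pairing μ w u + pairing μ w u' := by
  simp only [pairing_eq, pairFun_add_right]
  exact integral_add (integrable_pairFun hK h) (integrable_pairFun hK h')

end Pairing

theorem pairing_smul_left (a : ℝ) (w : 𝒯) (u : 𝒟) :
    pairing μ (a • w) u = a * pairing μ w u := by
  simp only [pairing_eq, pairFun_smul_left]
  exact integral_const_mul _ _

theorem pairing_smul_right (a : ℝ) (w : 𝒯) (u : 𝒟) :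
    pairing μ w (a • u) = a * pairing μ w u := by
  simp only [pairing_eq, pairFun_smul_right]
  exact integral_const_mul _ _

theorem pairing_zero_right (w : 𝒯) :
    pairing μ w (0 : 𝒟) = 0 := by
  simpa using pairing_smul_right (μ := μ) 0 w 0

theorem pairing_zero_left (u : 𝒟) :
    pairing μ (0 : 𝒯) u = 0 := by
  simpa using pairing_smul_left (μ := μ) 0 0 u

/-- The complex pairing `⟨w, z⟩` with a complexified multiplet of derivatives. -/
def cxPairing (μ : Measure M) (w : 𝒯) (z : Cx 𝒟) : ℂ :=
  (pairing μ w z.1 : ℂ) + Complex.I * (pairing μ w z.2 : ℂ)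

theorem cxPairing_zero_right (w : 𝒯) :
    cxPairing μ w (0 : Cx 𝒟) = 0 := by
  simp [cxPairing, pairing_zero_right]

theorem cxPairing_zero_left (z : Cx 𝒟) :
    cxPairing μ (0 : 𝒯) z = 0 := by
  simp [cxPairing, pairing_zero_left]

theorem cxPairing_re (w : 𝒯) (z : Cx 𝒟) :
    (cxPairing μ w z).re = pairing μ w z.1 := by
  simp [cxPairing]

theorem cxPairing_im (w : 𝒯) (z : Cx 𝒟) :
    (cxPairing μ w z).im = pairing μ w z.2 := by
  simp [cxPairing]

theorem grPairing_eq (w : 𝒯) (U : GrVec 𝒟) :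
    grPairing μ w U = U.sum fun I z ↦ cxPairing μ w z • θ I := rfl

theorem coeffAt_grPairing (I : Finset ℕ) (w : 𝒯)
    (U : GrVec 𝒟) : coeffAt I (grPairing μ w U) = cxPairing μ w (U I) := by
  rw [grPairing_eq, Finsupp.sum, map_sum]
  simp only [map_smul, coeffAt_θ, smul_eq_mul, mul_ite, mul_one, mul_zero]
  rw [Finset.sum_ite_eq']
  split_ifs with h
  · rfl
  · rw [Finsupp.notMem_support_iff.1 h, cxPairing_zero_right]

/-- All coefficients of `U` vanish off a compact set. -/
def CompactOff (U : GrVec 𝒟) : Prop :=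
  ∃ K : Set M, IsCompact K ∧ ∀ I, DerOff K (U I).1 ∧ DerOff K (U I).2

theorem CompactOff.add {U U' : GrVec 𝒟} (h : CompactOff U)
    (h' : CompactOff U') : CompactOff (U + U') := by
  obtain ⟨K, hK, h⟩ := h
  obtain ⟨K', hK', h'⟩ := h'
  exact ⟨K ∪ K', hK.union hK', fun I ↦
    ⟨((h I).1.mono subset_union_left).add ((h' I).1.mono subset_union_right),
      ((h I).2.mono subset_union_left).add ((h' I).2.mono subset_union_right)⟩⟩

theorem CompactOff.neg {U : GrVec 𝒟} (h : CompactOff U) : CompactOff (-U) := by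
  obtain ⟨K, hK, h⟩ := h
  exact ⟨K, hK, fun I ↦ ⟨(h I).1.neg, (h I).2.neg⟩⟩

variable [IsLocallyFiniteMeasure μ]

theorem cxPairing_add_right_of_off {w : 𝒯} {z z' : Cx 𝒟}
    {K : Set M} (hK : IsCompact K) (h : DerOff K z.1 ∧ DerOff K z.2)
    (h' : DerOff K z'.1 ∧ DerOff K z'.2) :
    cxPairing μ w (z + z') = cxPairing μ w z + cxPairing μ w z' := by
  simp only [cxPairing, Prod.fst_add, Prod.snd_add]
  rw [pairing_add_right hK (fun x hx ↦ h.1.pairFun_eq_zero w hx)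
      (fun x hx ↦ h'.1.pairFun_eq_zero w hx), pairing_add_right hK
      (fun x hx ↦ h.2.pairFun_eq_zero w hx) (fun x hx ↦ h'.2.pairFun_eq_zero w hx)]
  push_cast
  ring

theorem grPairing_add_right_of_off (w : 𝒯) {U U' : GrVec 𝒟}
    (h : CompactOff U) (h' : CompactOff U') :
    grPairing μ w (U + U') = grPairing μ w U + grPairing μ w U' := by
  obtain ⟨K, hK, h⟩ := h
  obtain ⟨K', hK', h'⟩ := h'
  refine ext_coeffAt fun I ↦ ?_
  rw [map_add, coeffAt_grPairing, coeffAt_grPairing, coeffAt_grPairing, Finsupp.add_apply]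
  exact cxPairing_add_right_of_off (hK.union hK')
    ⟨(h I).1.mono subset_union_left, (h I).2.mono subset_union_left⟩
    ⟨(h' I).1.mono subset_union_right, (h' I).2.mono subset_union_right⟩

theorem grPairing_neg_right (w : 𝒯) (U : GrVec 𝒟) :
    grPairing μ w (-U) = -grPairing μ w U := by
  refine ext_coeffAt fun I ↦ ?_
  have h (u : 𝒟) : pairing μ w (-u) = -pairing μ w u := by
    simpa using pairing_smul_right (μ := μ) (-1) w u
  rw [map_neg, coeffAt_grPairing, coeffAt_grPairing, Finsupp.neg_apply]
  simp only [cxPairing, Prod.fst_neg, Prod.snd_neg, h]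
  push_cast
  ring

/-- Functionals represented by integrals against sections are pairings with one Grassmann-valued
section. -/
theorem exists_grPairing {T : 𝒯 → Grassmann} (hT : T ∈ Represented μ) :
    ∃ U : GrVec 𝒟, CompactOff U ∧ ∀ w, T w = grPairing μ w U := by
  induction hT using AddSubgroup.closure_induction with
  | mem T h =>
    obtain ⟨K, u, a, hK, hu, rfl⟩ := h
    refine ⟨(thetaBasis.repr a).mapRange (fun c : ℂ ↦ (c.re • u, c.im • u)) (by simp), ⟨K, hK,
      fun I ↦ ?_⟩, fun w ↦ ext_coeffAt fun I ↦ ?_⟩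
    · simp only [Finsupp.mapRange_apply]
      exact ⟨hu.smul _, hu.smul _⟩
    · rw [coeffAt_grPairing, Finsupp.mapRange_apply, map_smul, coeffAt_eq_repr]
      simp only [cxPairing, pairing_smul_right, smul_eq_mul]
      conv_lhs => rw [← Complex.re_add_im (thetaBasis.repr a I)]
      push_cast
      ring
  | zero =>
    exact ⟨0, ⟨∅, isCompact_empty, fun I ↦ ⟨DerOff.zero _, DerOff.zero _⟩⟩,
      fun w ↦ by simp [grPairing]⟩
  | add T T' _ _ h h' =>
    obtain ⟨U, hU, h⟩ := h
    obtain ⟨U', hU', h'⟩ := h'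
    exact ⟨U + U', hU.add hU', fun w ↦ by
      rw [grPairing_add_right_of_off w hU hU', Pi.add_apply, h, h']⟩
  | neg T _ h =>
    obtain ⟨U, hU, h⟩ := h
    exact ⟨-U, hU.neg, fun w ↦ by rw [grPairing_neg_right, Pi.neg_apply, h]⟩

theorem algebraMap_mem_represented {T : 𝒯 → ℂ}
    (h : ∃ (K : Set M) (u u' : 𝒟), IsCompact K ∧ DerOff K u ∧ DerOff K u' ∧
      ∀ w, (T w).re = pairing μ w u ∧ (T w).im = pairing μ w u') :
    (fun w ↦ algebraMap ℂ Grassmann (T w)) ∈ Represented μ := by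
  obtain ⟨K, u, u', hK, hu, hu', h⟩ := h
  have h1 := add_mem (mem_represented (μ := μ) hK hu 1) (mem_represented (μ := μ) hK hu'
    (algebraMap ℂ Grassmann Complex.I))
  convert h1 using 1
  ext w
  rw [Pi.add_apply, ← (h w).1, ← (h w).2, ← Algebra.algebraMap_eq_smul_one,
    Algebra.smul_def, ← map_mul, ← map_add, Complex.re_add_im]

variable {c : Components d F₀ E₀ F₁ E₁}

theorem integral_mem_represented (hμ : IsSmoothDensity d μ) {K : Set M} {r : ℕ} (hK : IsCompact K)
    (G : 𝒯 →ₗ[ℝ] M → ℂ) (h0 : ∀ z, ∀ x ∉ K, G z x = 0)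
    (hord : ∀ z x, EvJet r x (evenPart z) 0 → OdJet r x (oddPart z) 0 → G z x = 0)
    (hsm : ∀ (n : ℕ) (z : (Fin n → ℝ) → 𝒯), EvFamily (fun s ↦ evenPart (z s)) →
      OdFamily (fun s ↦ oddPart (z s)) → ContMDiff (𝓘(ℝ, Fin n → ℝ).prod (𝓡 d)) 𝓘(ℝ, ℂ) ∞
        (fun p : (Fin n → ℝ) × M ↦ G (z p.1) p.2)) :
    (fun w ↦ algebraMap ℂ Grassmann (∫ x, G w x ∂μ)) ∈ Represented μ := by
  have key (L : ℂ →L[ℝ] ℝ) : ∃ u : 𝒟, DerOff K u ∧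
      ∀ z, ∫ x, L (G z x) ∂μ = pairing μ z u :=
    exists_pairing_repr (r := r) hμ hK
      ((L : ℂ →ₗ[ℝ] ℝ).compLeft M ∘ₗ G)
      (fun z x hx ↦ by simp [h0 z x hx]) (fun z x h h' ↦ by simp [hord z x h h'])
      (fun n z h h' ↦ L.contDiff.contMDiff.comp (hsm n z h h'))
  have hint (z : 𝒯) : Integrable (G z) μ := by
    have h1 := (hsm 0 (fun _ ↦ z) (evFamily_const 0 _) (odFamily_const 0 _)).comp
      (contMDiff_const (c := (0 : Fin 0 → ℝ)) |>.prodMk contMDiff_id)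
    exact (h1.continuous.continuousOn.integrableOn_compact
      hK).integrable_of_forall_notMem_eq_zero (h0 z)
  obtain ⟨u, hu, h⟩ := key Complex.reCLM
  obtain ⟨u', hu', h'⟩ := key Complex.imCLM
  refine algebraMap_mem_represented ⟨K, u, u', hK, hu, hu', fun w ↦ ⟨?_, ?_⟩⟩
  · rw [← h, Complex.reCLM.integral_comp_comm (hint w)]; rfl
  · rw [← h', Complex.imCLM.integral_comp_comm (hint w)]; rfl

theorem evenPart_add (w w' : 𝒯) : evenPart (w + w') = evenPart w + evenPart w' :=
  rfl

theorem oddPart_add (w w' : 𝒯) : oddPart (w + w') = oddPart w + oddPart w' := rfl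

theorem evenPart_smul (a : ℝ) (w : 𝒯) : evenPart (a • w) = a • evenPart w := rfl

theorem oddPart_smul (a : ℝ) (w : 𝒯) : oddPart (a • w) = a • oddPart w := rfl

theorem scalarPart_dE_represented (hμ : IsSmoothDensity d μ) (hc : IsLocal μ c)
    (v : ℰ) :
    (fun w : 𝒯 ↦ scalarPart v (dE (evenPart w) c)) ∈ Represented μ := by
  obtain ⟨K, r, ℓ, hK, h, hi⟩ := isLocal_iff.1 hc
  obtain rfl : c = fun k v w ↦ ∫ x, ℓ x k v w ∂μ := by ext k v w; exact hi k v w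
  have h1 := integral_mem_represented (r := r) hμ hK
    { toFun := fun w x ↦ dE (evenPart w) (ℓ x) 0 v Fin.elim0
      map_add' := fun w w' ↦ by
        ext x
        rw [evenPart_add, (h.isSmoothAlt x).dE_add]
        rfl
      map_smul' := fun a w ↦ by
        ext x
        rw [evenPart_smul, (h.isSmoothAlt x).dE_smul]
        rfl }
    (fun z x hx ↦ (h.stable_dE _).zero_off x hx _ _ _)
    (fun z x hz _ ↦ by
      have h2 (τ : ℝ) : ℓ x 0 (v + τ • evenPart z) Fin.elim0 = ℓ x 0 v Fin.elim0 := by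
        refine h.jet x _ _ _ _ _ ?_ fun i ↦ i.elim0
        simpa using (EvJet.refl r x v).add (hz.smul τ)
      change dE (evenPart z) (ℓ x) 0 v Fin.elim0 = 0
      simp [dE, h2])
    (fun n z hz _ ↦ by
      refine (h.smooth_dE 0 n hz (evFamily_const n v) (w := fun i ↦ i.elim0)
        fun i ↦ i.elim0).congr fun p ↦ ?_
      exact congrArg (dE (evenPart (z p.1)) (ℓ p.2) 0 v) (Subsingleton.elim _ _))
  convert h1 using 2 with w
  rw [scalarPart, h.dE_integral hK]
  rfl

theorem scalarPart_dO_represented (hμ : IsSmoothDensity d μ) (hc : IsLocal μ c)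
    (v : ℰ) :
    (fun w : 𝒯 ↦ scalarPart v (dO (oddPart w) c)) ∈ Represented μ := by
  obtain ⟨K, r, ℓ, hK, h, hi⟩ := isLocal_iff.1 hc
  have h1 := integral_mem_represented (r := r) hμ hK
    { toFun := fun w x ↦ dO (oddPart w) (ℓ x) 0 v Fin.elim0
      map_add' := fun w w' ↦ by
        ext x
        rw [oddPart_add, (h.isSmoothAlt x).dO_add]
        rfl
      map_smul' := fun a w ↦ by
        ext x
        rw [oddPart_smul, (h.isSmoothAlt x).dO_smul]
        rfl }
    (fun z x hx ↦ h.zero_off x hx _ _ _)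
    (fun z x _ hz ↦ by
      have h2 := congrFun (congrFun (congrFun (h.isSmoothAlt x).dO_zero 0) v) Fin.elim0
      refine Eq.trans ?_ h2
      exact h.jet x _ _ _ _ _ (EvJet.refl r x v) fun i ↦ Fin.cases hz (fun i ↦ i.elim0) i)
    (fun n z _ hz ↦ by
      refine (h.smooth 1 n _ (fun _ s ↦ oddPart (z s)) (evFamily_const n v)
        fun _ ↦ hz).congr fun p ↦ ?_
      refine congrArg (ℓ p.2 1 v) (funext fun i ↦ Fin.cases rfl (fun i ↦ i.elim0) i))
  convert h1 using 2 with w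
  exact congrArg _ (hi _ _ _)

theorem wordSum_represented {ι : Type*} [DecidableEq ι] {T : Finset ι} {ε : ι → Grassmann}
    {op : ι → 𝒦 → 𝒦}
    {G : 𝒦 → Grassmann}
    {D : 𝒯 → 𝒦 → 𝒦} {σ : ℂ}
    (hop : ∀ i c, IsLocal μ c → IsLocal μ (op i c))
    (hD : ∀ i w c j, IsLocal μ c →
      wordSum T ε op G j (op i (D w c)) = σ • wordSum T ε op G j (D w (op i c)))
    (hG : ∀ c, IsLocal μ c → (fun w ↦ G (D w c)) ∈ Represented μ) (j : ℕ)
    {c : 𝒦} (hc : IsLocal μ c) :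
    (fun w ↦ wordSum T ε op G j (D w c)) ∈ Represented μ := by
  induction j generalizing c with
  | zero => exact hG c hc
  | succ j ih =>
    refine sum_mem_represented T fun i _ ↦ ?_
    simp only [fun w ↦ hD i w c j hc]
    exact map_mem_represented (ih (hop i c hc)) (LinearMap.mulLeft ℂ (ε i) ∘ₗ (σ • LinearMap.id))

theorem expSum_represented {ι : Type*} [DecidableEq ι] {T : Finset ι} {ε : ι → Grassmann}
    {op : ι → 𝒦 → 𝒦}
    {G : 𝒦 → Grassmann}
    {D : 𝒯 → 𝒦 → 𝒦} {σ : ℂ}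
    (hop : ∀ i c, IsLocal μ c → IsLocal μ (op i c))
    (hD : ∀ i w c j, IsLocal μ c →
      wordSum T ε op G j (op i (D w c)) = σ • wordSum T ε op G j (D w (op i c)))
    (hG : ∀ c, IsLocal μ c → (fun w ↦ G (D w c)) ∈ Represented μ) (N : ℕ)
    {c : 𝒦} (hc : IsLocal μ c) :
    (fun w ↦ expSum N T ε op G (D w c)) ∈ Represented μ :=
  sum_mem_represented _ fun j _ ↦ map_mem_represented (wordSum_represented hop hD hG j hc)
    ((j.factorial : ℂ)⁻¹ • LinearMap.id)

theorem eval_dE_represented (hμ : IsSmoothDensity d μ) (hc : IsLocal μ c)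
    (Φ : 𝒞) :
    (fun w : 𝒯 ↦ eval (dE (evenPart w) c) Φ) ∈ Represented μ := by
  simp only [fun w : 𝒯 ↦
    eval_eq_fullExp (hc.isSmoothAlt.stable_dE (evenPart w)) Φ le_rfl]
  refine expSum_represented (σ := 1) (D := fun w c ↦ dE (evenPart w) c)
    (fun i c hc ↦ hc.stable_dE _) (fun i w c j hc ↦ ?_) (fun c hc ↦ ?_) _ hc
  · rw [hc.isSmoothAlt.dE_comm, one_smul]
  · exact expSum_represented (σ := 1) (D := fun w c ↦ dE (evenPart w) c)
      (fun i c hc ↦ hc.stable_dO _) (fun i w c j hc ↦ by rw [one_smul]; rfl)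
      (fun c hc ↦ scalarPart_dE_represented hμ hc _) _ hc

theorem eval_dO_represented (hμ : IsSmoothDensity d μ) (hc : IsLocal μ c)
    (Φ : 𝒞) :
    (fun w : 𝒯 ↦ eval (dO (oddPart w) c) Φ) ∈ Represented μ := by
  simp only [fun w : 𝒯 ↦
    eval_eq_fullExp (hc.isSmoothAlt.stable_dO (oddPart w)) Φ le_rfl]
  refine expSum_represented (σ := 1) (D := fun w c ↦ dO (oddPart w) c)
    (fun i c hc ↦ hc.stable_dE _) (fun i w c j hc ↦ by rw [one_smul]; rfl) (fun c hc ↦ ?_) _ hc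
  refine expSum_represented (σ := -1) (D := fun w c ↦ dO (oddPart w) c)
      (fun i c hc ↦ hc.stable_dO _) (fun i w c j hc ↦ ?_)
      (fun c hc ↦ scalarPart_dO_represented hμ hc _) _ hc
  rw [hc.isSmoothAlt.dO_comm, wordSum_neg_arg (oddIdx Φ) elt (fun i ↦ dO (oddPart (coef Φ i)))
    (scalarPart (body Φ)) (fun _ _ ↦ rfl) (scalarPart_neg _)]
  simp

end Variation

/-! ### Uniqueness of functional derivatives -/

section Uniqueness

theorem apply_eq_zero_of_integral (hμ : IsSmoothDensity d μ) {O : Set M} (hO : IsOpen O)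
    (f : SmoothFun d M)
    (h : ∀ g : SmoothFun d M, HasCompactSupport g → tsupport g ⊆ O → ∫ x, g x * f x ∂μ = 0)
    {x : M} (hx : x ∈ O) : f x = 0 := by
  have := hμ.isLocallyFiniteMeasure
  have := hμ.isOpenPosMeasure
  obtain ⟨χ, hχO, hχc, hχ1⟩ := exists_cutoff (d := d) (isCompact_singleton (x := x)) hO
    (singleton_subset_iff.2 hx)
  by_contra hf
  have hs : tsupport (χ * (χ * f) : SmoothFun d M) ⊆ tsupport χ :=
    closure_mono fun y hy hy' ↦ hy (by simp [hy'])
  have h0 := h (χ * (χ * f)) (hχc.of_isClosed_subset (isClosed_tsupport _) hs) (hs.trans hχO)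
  have hcont : Continuous fun y ↦ (χ y * f y) ^ 2 :=
    (χ.contMDiff.continuous.mul f.contMDiff.continuous).pow 2
  have hcs : HasCompactSupport fun y ↦ (χ y * f y) ^ 2 :=
    hχc.of_isClosed_subset (isClosed_tsupport _)
      (closure_mono fun y hy hy' ↦ hy (by simp [hy']))
  have hpos := hcont.integral_pos_of_hasCompactSupport_nonneg_nonzero (μ := μ) (x := x) hcs
    (fun y ↦ sq_nonneg _) (by
      have : χ x = 1 := (hχ1 x rfl).self_of_nhds
      simpa [this] using hf)
  refine hpos.ne' (Eq.trans ?_ h0)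
  congr 1
  ext y
  change (χ y * f y) ^ 2 = χ y * (χ y * f y) * f y
  ring

/-- A direction with only even or only odd components. -/
def IsPure (w : 𝒯) : Prop := oddPart w = 0 ∨ evenPart w = 0

theorem isClosed_totSupp (w : 𝒯) : IsClosed (totSupp w) :=
  isClosed_closure.union isClosed_closure

theorem totSupp_subset {w : 𝒯} {C : Set M} (hC : IsClosed C)
    (h : ∀ x ∉ C, w.1.1 x = 0 ∧ w.1.2 x = 0 ∧ w.2.1 x = 0 ∧ w.2.2 x = 0) : totSupp w ⊆ C := by
  refine union_subset (closure_minimal (fun x hx ↦ ?_) hC) (closure_minimal (fun x hx ↦ ?_) hC)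
  · by_contra hx'
    obtain ⟨h1, h2, -, -⟩ := h x hx'
    simp [h1, h2] at hx
  · by_contra hx'
    obtain ⟨-, -, h1, h2⟩ := h x hx'
    simp [h1, h2] at hx

theorem apply_eq_zero_of_notMem_totSupp {w : 𝒯} {x : M} (hx : x ∉ totSupp w) :
    w.1.1 x = 0 ∧ w.1.2 x = 0 ∧ w.2.1 x = 0 ∧ w.2.2 x = 0 := by
  simp only [totSupp, supp, mem_union, not_or] at hx
  have h1 := fun h ↦ hx.1 (subset_closure h)
  have h2 := fun h ↦ hx.2 (subset_closure h)
  simp only [mem_ofPred_eq, not_or, not_not, imp_false] at h1 h2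
  exact ⟨h1.1, h1.2, h2.1, h2.2⟩

/-- The pairing is nondegenerate over every open set. -/
theorem derOff_of_pairing_eq_zero (hμ : IsSmoothDensity d μ) {O : Set M} (hO : IsOpen O)
    {u : 𝒟} (h : ∀ w : 𝒯, IsCompact (totSupp w) → totSupp w ⊆ O →
      IsPure w → pairing μ w u = 0) : DerOff Oᶜ u := by
  intro x hx
  rw [notMem_compl_iff] at hx
  -- the pairing with `ι (g e)` is the integral of `g ⟨ι e, u⟩`
  have key (w : SmoothFun d M → 𝒯) (f : SmoothFun d M)
      (hw : ∀ g, ∀ y, pairFun (w g) u y = g y * f y) (hp : ∀ g, IsPure (w g))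
      (hs : ∀ g, totSupp (w g) ⊆ tsupport g) : f x = 0 :=
    apply_eq_zero_of_integral hμ hO f (fun g hg hgO ↦ by
      have := h (w g) (hg.of_isClosed_subset (isClosed_totSupp _) (hs g)) ((hs g).trans hgO) (hp g)
      simpa only [pairing_eq, hw] using this) hx
  have hn {g : SmoothFun d M} {y : M} (hy : y ∉ tsupport g) : g y = 0 :=
    image_eq_zero_of_notMem_tsupport hy
  refine ⟨?_, ?_, ?_, ?_⟩
  · obtain ⟨P, m, e, e', -, hxP, hP⟩ := exists_dual_frame (d := d) (F := F₀) (E := E₀) x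
    ext v
    rw [hP x hxP v, map_sum]
    refine Finset.sum_eq_zero fun i _ ↦ ?_
    have := key (fun g ↦ ((mulSec g (e i), 0), 0))
      (⟨_, contMDiff_evalDual u.1.1 (e i)⟩ : SmoothFun d M) (fun g y ↦ by
        simp [pairFun, mulSec_apply]) (fun g ↦ Or.inl rfl)
      (fun g ↦ totSupp_subset (isClosed_tsupport _) fun y hy ↦ by simp [mulSec_apply, hn hy])
    have h1 : u.1.1 x (e i x) = 0 := this
    rw [map_smul, h1, smul_zero]
  · obtain ⟨P, m, e, e', -, hxP, hP⟩ := exists_dual_frame (d := d) (F := F₁) (E := E₁) x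
    ext v
    rw [hP x hxP v, map_sum]
    refine Finset.sum_eq_zero fun i _ ↦ ?_
    have := key (fun g ↦ ((0, mulSec g (e i)), 0))
      (⟨_, contMDiff_evalDual u.1.2 (e i)⟩ : SmoothFun d M) (fun g y ↦ by
        simp [pairFun, mulSec_apply]) (fun g ↦ Or.inr rfl)
      (fun g ↦ totSupp_subset (isClosed_tsupport _) fun y hy ↦ by simp [mulSec_apply, hn hy])
    have h1 : u.1.2 x (e i x) = 0 := this
    rw [map_smul, h1, smul_zero]
  · obtain ⟨P, m, e, e', -, hxP, hP⟩ := exists_dual_frame (d := d) (F := F₀) (E := E₀) x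
    rw [hP x hxP (u.2.1 x)]
    refine Finset.sum_eq_zero fun i _ ↦ ?_
    have := key (fun g ↦ (0, (mulSec g (e' i), 0)))
      (⟨_, contMDiff_evalDual (e' i) u.2.1⟩ : SmoothFun d M) (fun g y ↦ by
        simp [pairFun, mulSec_apply]) (fun g ↦ Or.inr rfl)
      (fun g ↦ totSupp_subset (isClosed_tsupport _) fun y hy ↦ by simp [mulSec_apply, hn hy])
    have h1 : e' i x (u.2.1 x) = 0 := this
    rw [h1, zero_smul]
  · obtain ⟨P, m, e, e', -, hxP, hP⟩ := exists_dual_frame (d := d) (F := F₁) (E := E₁) x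
    rw [hP x hxP (u.2.2 x)]
    refine Finset.sum_eq_zero fun i _ ↦ ?_
    have := key (fun g ↦ (0, (0, mulSec g (e' i))))
      (⟨_, contMDiff_evalDual (e' i) u.2.2⟩ : SmoothFun d M) (fun g y ↦ by
        simp [pairFun, mulSec_apply]) (fun g ↦ Or.inl rfl)
      (fun g ↦ totSupp_subset (isClosed_tsupport _) fun y hy ↦ by simp [mulSec_apply, hn hy])
    have h1 : e' i x (u.2.2 x) = 0 := this
    rw [h1, zero_smul]

theorem DerOff.eq_zero {u : 𝒟} (h : DerOff univᶜ u) : u = 0 := by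
  have h' (x : M) := h x (by simp)
  refine Prod.ext (Prod.ext ?_ ?_) (Prod.ext ?_ ?_)
  exacts [ContMDiffSection.ext fun x ↦ (h' x).1, ContMDiffSection.ext fun x ↦ (h' x).2.1,
    ContMDiffSection.ext fun x ↦ (h' x).2.2.1, ContMDiffSection.ext fun x ↦ (h' x).2.2.2]

/-- Both parts of the complexified multiplet of derivatives vanish off `K`. -/
def CxDerOff (K : Set M) (z : Cx 𝒟) : Prop := DerOff K z.1 ∧ DerOff K z.2

theorem CxDerOff.mono {K K' : Set M} (h : K ⊆ K') {z : Cx 𝒟}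
    (hz : CxDerOff K z) : CxDerOff K' z := ⟨hz.1.mono h, hz.2.mono h⟩

theorem CxDerOff.add {K : Set M} {z z' : Cx 𝒟} (h : CxDerOff K z)
    (h' : CxDerOff K z') : CxDerOff K (z + z') := ⟨h.1.add h'.1, h.2.add h'.2⟩

theorem CxDerOff.neg {K : Set M} {z : Cx 𝒟} (h : CxDerOff K z) :
    CxDerOff K (-z) := ⟨h.1.neg, h.2.neg⟩

theorem CxDerOff.smul {K : Set M} {z : Cx 𝒟} (h : CxDerOff K z) (a : ℝ) :
    CxDerOff K (a • z) := ⟨h.1.smul a, h.2.smul a⟩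

theorem CxDerOff.sub {K : Set M} {z z' : Cx 𝒟} (h : CxDerOff K z)
    (h' : CxDerOff K z') : CxDerOff K (z - z') := by
  rw [sub_eq_add_neg]; exact h.add h'.neg

theorem CxDerOff.mulI {K : Set M} {z : Cx 𝒟} (h : CxDerOff K z) :
    CxDerOff K (Cx.mulI z) := ⟨h.2.neg, h.1⟩

theorem CxDerOff.eq_zero {z : Cx 𝒟} (h : CxDerOff univᶜ z) : z = 0 :=
  Prod.ext h.1.eq_zero h.2.eq_zero

theorem CxDerOff.cxPairing_eq_zero {K : Set M} {z : Cx 𝒟} (h : CxDerOff K z)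
    {w : 𝒯} (hw : Disjoint (totSupp w) K) : cxPairing μ w z = 0 := by
  have h1 {u : 𝒟} (hu : DerOff K u) : pairing μ w u = 0 := by
    have : pairFun w u = 0 := by
      ext x
      by_cases hx : x ∈ K
      · exact pairFun_eq_zero_of_notMem (disjoint_right.1 hw hx) u
      · exact hu.pairFun_eq_zero w hx
    simp [pairing_eq, this]
  simp [cxPairing, h1 h.1, h1 h.2]

theorem cxPairing_add_right [IsLocallyFiniteMeasure μ] {w : 𝒯}
    (hw : IsCompact (totSupp w)) (z z' : Cx 𝒟) :
    cxPairing μ w (z + z') = cxPairing μ w z + cxPairing μ w z' := by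
  simp only [cxPairing, Prod.fst_add, Prod.snd_add]
  rw [pairing_add_right hw (fun x hx ↦ pairFun_eq_zero_of_notMem hx _)
      (fun x hx ↦ pairFun_eq_zero_of_notMem hx _), pairing_add_right hw
      (fun x hx ↦ pairFun_eq_zero_of_notMem hx _) (fun x hx ↦ pairFun_eq_zero_of_notMem hx _)]
  push_cast
  ring

theorem cxPairing_smul_right (a : ℝ) (w : 𝒯) (z : Cx 𝒟) :
    cxPairing μ w (a • z) = a * cxPairing μ w z := by
  simp only [cxPairing, Prod.smul_fst, Prod.smul_snd, pairing_smul_right]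
  push_cast
  ring

theorem cxPairing_neg_right (w : 𝒯) (z : Cx 𝒟) :
    cxPairing μ w (-z) = -cxPairing μ w z := by
  simpa using cxPairing_smul_right (μ := μ) (-1) w z

theorem cxPairing_sub_right [IsLocallyFiniteMeasure μ] {w : 𝒯}
    (hw : IsCompact (totSupp w)) (z z' : Cx 𝒟) :
    cxPairing μ w (z - z') = cxPairing μ w z - cxPairing μ w z' := by
  rw [sub_eq_add_neg, cxPairing_add_right hw, cxPairing_neg_right, sub_eq_add_neg]

theorem cxPairing_mulI_right (w : 𝒯) (z : Cx 𝒟) :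
    cxPairing μ w (Cx.mulI z) = Complex.I * cxPairing μ w z := by
  have h : pairing μ w (-z.2) = -pairing μ w z.2 := by
    simpa using pairing_smul_right (μ := μ) (-1) w z.2
  simp only [cxPairing, Cx.mulI, h]
  push_cast
  linear_combination (-(pairing μ w z.2 : ℂ)) * Complex.I_mul_I

theorem cxDerOff_of_cxPairing_eq_zero (hμ : IsSmoothDensity d μ) {O : Set M} (hO : IsOpen O)
    {z : Cx 𝒟} (h : ∀ w : 𝒯, IsCompact (totSupp w) →
      totSupp w ⊆ O → IsPure w → cxPairing μ w z = 0) : CxDerOff Oᶜ z :=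
  ⟨derOff_of_pairing_eq_zero hμ hO fun w h1 h2 h3 ↦ by
      rw [← cxPairing_re, h w h1 h2 h3, Complex.zero_re],
    derOff_of_pairing_eq_zero hμ hO fun w h1 h2 h3 ↦ by
      rw [← cxPairing_im, h w h1 h2 h3, Complex.zero_im]⟩

theorem eq_of_cxPairing_eq (hμ : IsSmoothDensity d μ) {z z' : Cx 𝒟}
    (h : ∀ w : 𝒯, IsCompact (totSupp w) → IsPure w →
      cxPairing μ w z = cxPairing μ w z') : z = z' := by
  have := hμ.isLocallyFiniteMeasure
  rw [← sub_eq_zero]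
  refine (cxDerOff_of_cxPairing_eq_zero hμ isOpen_univ fun w hw _ hp ↦ ?_).eq_zero
  rw [cxPairing_sub_right hw, h w hw hp, sub_self]

theorem eq_of_grPairing_eq (hμ : IsSmoothDensity d μ) {U U' : GrVec 𝒟}
    (h : ∀ w : 𝒯, IsCompact (totSupp w) → IsPure w →
      grPairing μ w U = grPairing μ w U') : U = U' := by
  ext1 I
  refine eq_of_cxPairing_eq hμ fun w hw hp ↦ ?_
  rw [← coeffAt_grPairing, h w hw hp, coeffAt_grPairing]

/-- Functional derivatives of actions are unique. -/
theorem IsLeftDeriv.unique (hμ : IsSmoothDensity d μ) {L : (M → ℝ) → ℱ}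
    {Φ : 𝒞} {U U' : GrVec 𝒟} (h : IsLeftDeriv μ L Φ U)
    (h' : IsLeftDeriv μ L Φ U') : U = U' := by
  refine eq_of_grPairing_eq hμ fun w hw hp ↦ ?_
  obtain ⟨f, -, hfc, hf⟩ := exists_cutoff (d := d) hw isOpen_univ (subset_univ _)
  have hft : IsTest d f := ⟨f.contMDiff, hfc⟩
  rw [← sub_eq_zero]
  rcases hp with hp | hp
  · refine eventually_θ_mul_cancel (fun n ↦ {n, n + 1}) (by simp) (Eventually.frequently ?_)
    filter_upwards [(h w hw f hft hf).1 hp, (h' w hw f hft hf).1 hp] with n h1 h2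
    rw [mul_sub, sub_eq_zero]
    exact add_left_cancel (h1.symm.trans h2)
  · refine eventually_θ_mul_cancel (fun n ↦ {n}) (by simp) (Eventually.frequently ?_)
    filter_upwards [(h w hw f hft hf).2 hp, (h' w hw f hft hf).2 hp] with n h1 h2
    rw [mul_sub, sub_eq_zero]
    exact add_left_cancel (h1.symm.trans h2)

theorem IsLeftDeriv.leftDeriv_eq (hμ : IsSmoothDensity d μ)
    {L : (M → ℝ) → ℱ} {Φ : 𝒞}
    {U : GrVec 𝒟} (h : IsLeftDeriv μ L Φ U) : leftDeriv μ L Φ = U := by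
  have h' : ∃ U, IsLeftDeriv μ L Φ U := ⟨U, h⟩
  rw [leftDeriv, dif_pos h']
  exact h'.choose_spec.unique hμ h

theorem IsRightDeriv.rightDeriv_eq {X : ℱ} {Φ q : 𝒞}
    {a : Grassmann} (h : IsRightDeriv X Φ q a) : rightDeriv X Φ q = a := by
  have h' : ∃ a, IsRightDeriv X Φ q a := ⟨a, h⟩
  rw [rightDeriv, dif_pos h']
  refine eventually_mul_θ_cancel (Eventually.frequently ?_)
  filter_upwards [h'.choose_spec, h] with n h1 h2
  exact add_left_cancel (h1.symm.trans h2)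

end Uniqueness

/-! ### First and second variations of local functionals -/

section Calculus

/-- Even configurations, possibly with a complex body: even variables have even coefficients and odd
variables have odd ones. -/
def IsEvenConf (δ : 𝒞) : Prop :=
  (∀ I : Finset ℕ, Even I.card → oddPart (δ I).1 = 0 ∧ oddPart (δ I).2 = 0) ∧
    ∀ I : Finset ℕ, Odd I.card → evenPart (δ I).1 = 0 ∧ evenPart (δ I).2 = 0

/-- Odd directions: even variables have odd coefficients and odd variables have even ones. -/
def IsOddConf (q : 𝒞) : Prop :=
  (∀ I : Finset ℕ, Even I.card → evenPart (q I).1 = 0 ∧ evenPart (q I).2 = 0) ∧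
    ∀ I : Finset ℕ, Odd I.card → oddPart (q I).1 = 0 ∧ oddPart (q I).2 = 0

/-- The generator `θ_n` does not occur in `q`. -/
def IsFresh {W : Type*} [Zero W] (n : ℕ) (q : GrVec W) : Prop :=
  ∀ I ∈ q.support, ∀ i ∈ I, i < n

theorem eventually_isFresh {W : Type*} [Zero W] (q : GrVec W) :
    ∀ᶠ n : ℕ in atTop, IsFresh n q := by
  filter_upwards [eventually_gt_atTop ((q.support.biUnion id).sup id)] with n hn I hI i hi
  refine lt_of_le_of_lt (Finset.le_sup (f := id) ?_) hn
  simp only [Finset.mem_biUnion]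
  exact ⟨I, hI, hi⟩

theorem IsFresh.notMem {W : Type*} [Zero W] {n : ℕ} {q : GrVec W} (h : IsFresh n q)
    {I : Finset ℕ} (hI : I ∈ q.support) : n ∉ I := fun hn ↦ lt_irrefl _ (h I hI n hn)

theorem mulRight_apply {W : Type*} [AddCommMonoid W] {n : ℕ} {q : GrVec W} (h : IsFresh n q)
    (J : Finset ℕ) : GrVec.mulRight n q J = if n ∈ J then q (J.erase n) else 0 := by
  split_ifs with hJ
  · have := Finsupp.mapDomain_apply' (f := (insert n : Finset ℕ → Finset ℕ)) {I | n ∉ I} q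
      (fun I hI ↦ h.notMem hI) (fun I hI I' hI' he ↦ by
        rw [← Finset.erase_insert hI, he, Finset.erase_insert hI'])
      (a := J.erase n) (by simp)
    rwa [Finset.insert_erase hJ] at this
  · exact Finsupp.mapDomain_of_notMem_range _ _ fun ⟨I, hI⟩ ↦ hJ (hI ▸ Finset.mem_insert_self _ _)

theorem mem_of_mem_support_mulRight {W : Type*} [AddCommMonoid W] {n : ℕ} {q : GrVec W}
    (h : IsFresh n q) {J : Finset ℕ} (hJ : J ∈ (GrVec.mulRight n q).support) : n ∈ J := by
  by_contra hn
  rw [Finsupp.mem_support_iff, mulRight_apply h, if_neg hn] at hJ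
  exact hJ rfl

theorem IsOddConf.mulRight {q : 𝒞} (hq : IsOddConf q) {n : ℕ}
    (h : IsFresh n q) : IsEvenConf (GrVec.mulRight n q) := by
  constructor
  · intro J hJ
    rw [mulRight_apply h]
    split_ifs with hn
    · refine hq.2 _ ?_
      rw [Finset.card_erase_of_mem hn]
      exact Nat.Even.sub_odd (Finset.card_pos.2 ⟨n, hn⟩) hJ odd_one
    · exact ⟨rfl, rfl⟩
  · intro J hJ
    rw [mulRight_apply h]
    split_ifs with hn
    · refine hq.1 _ ?_
      rw [Finset.card_erase_of_mem hn]
      exact Nat.Odd.sub_odd hJ odd_one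
    · exact ⟨rfl, rfl⟩

theorem isEvenConf_single {η : Finset ℕ} {w : 𝒯}
    (h : (Even η.card ∧ oddPart w = 0) ∨ (Odd η.card ∧ evenPart w = 0)) :
    IsEvenConf (Finsupp.single η (w, 0)) := by
  constructor
  · intro J hJ
    rw [Finsupp.single_apply]
    split_ifs with hn
    · subst hn
      rcases h with h | h
      · exact ⟨h.2, rfl⟩
      · exact absurd hJ (Nat.not_even_iff_odd.2 h.1)
    · exact ⟨rfl, rfl⟩
  · intro J hJ
    rw [Finsupp.single_apply]
    split_ifs with hn
    · subst hn
      rcases h with h | h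
      · exact absurd h.1 (Nat.not_even_iff_odd.2 hJ)
      · exact ⟨h.2, rfl⟩
    · exact ⟨rfl, rfl⟩

theorem IsPoint.isEvenConf {Φ : 𝒞} (h : IsPoint Φ) : IsEvenConf Φ := ⟨h.1, h.2.1⟩

theorem IsEvenConf.add {Φ δ : 𝒞} (h : IsEvenConf Φ) (h' : IsEvenConf δ) :
    IsEvenConf (Φ + δ) := by
  refine ⟨fun I hI ↦ ?_, fun I hI ↦ ?_⟩
  · rw [Finsupp.add_apply]
    exact ⟨(congrArg₂ (· + ·) (h.1 I hI).1 (h'.1 I hI).1).trans (add_zero _),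
      (congrArg₂ (· + ·) (h.1 I hI).2 (h'.1 I hI).2).trans (add_zero _)⟩
  · rw [Finsupp.add_apply]
    exact ⟨(congrArg₂ (· + ·) (h.2 I hI).1 (h'.2 I hI).1).trans (add_zero _),
      (congrArg₂ (· + ·) (h.2 I hI).2 (h'.2 I hI).2).trans (add_zero _)⟩

theorem IsPoint.add {Φ δ : 𝒞} (h : IsPoint Φ) (h' : IsEvenConf δ)
    (h0 : δ ∅ = 0) : IsPoint (Φ + δ) := by
  have h1 := h.isEvenConf.add h'
  refine ⟨h1.1, h1.2, ?_⟩
  rw [Finsupp.add_apply, h0, add_zero]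
  exact h.2.2

theorem IsPoint.add_single {Φ : 𝒞} (h : IsPoint Φ) {η : Finset ℕ}
    (hη : η.Nonempty) {w : 𝒯}
    (hw : (Even η.card ∧ oddPart w = 0) ∨ (Odd η.card ∧ evenPart w = 0)) :
    IsPoint (Φ + Finsupp.single η (w, 0)) :=
  h.add (isEvenConf_single hw) (Finsupp.single_eq_of_ne hη.ne_empty.symm)

theorem isPoint_zero : IsPoint (0 : 𝒞) :=
  ⟨fun _ _ ↦ ⟨rfl, rfl⟩, fun _ _ ↦ ⟨rfl, rfl⟩, rfl, rfl⟩

/-- The derivative of graded components in the direction `w`. -/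
def dT (w : 𝒯) (c : 𝒦) : 𝒦 :=
  dE (evenPart w) c + dO (oddPart w) c

section SmoothAlt

variable {c : Components d F₀ E₀ F₁ E₁}

theorem dT_of_oddPart (hc : IsSmoothAlt c) {w : 𝒯} (h : oddPart w = 0) :
    dT w c = dE (evenPart w) c := by
  rw [dT, h, hc.dO_zero, add_zero]

theorem dT_of_evenPart (hc : IsSmoothAlt c) {w : 𝒯} (h : evenPart w = 0) :
    dT w c = dO (oddPart w) c := by
  rw [dT, h, hc.dE_zero, zero_add]

theorem dT_add (hc : IsSmoothAlt c) (w w' : 𝒯) :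
    dT (w + w') c = dT w c + dT w' c := by
  rw [dT, dT, dT, evenPart_add, oddPart_add, hc.dE_add, hc.dO_add, add_add_add_comm]

theorem dT_zero (hc : IsSmoothAlt c) : dT (0 : 𝒯) c = 0 := by
  rw [dT_of_oddPart hc rfl]
  exact hc.dE_zero

theorem stable_dT (hc : IsSmoothAlt c) (w : 𝒯) : IsSmoothAlt (dT w c) :=
  (hc.stable_dE _).add (hc.stable_dO _)

theorem eval_zero (Φ : 𝒞) :
    eval (0 : 𝒦) Φ = 0 := by
  have := eval_add (IsSmoothAlt.zero (A := ℰ) (B := 𝒪))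
    IsSmoothAlt.zero Φ
  rw [add_zero] at this
  exact left_eq_add.1 this

theorem eval_neg (hc : IsSmoothAlt c) (hc' : IsSmoothAlt (-c)) (Φ : 𝒞) :
    eval (-c) Φ = -eval c Φ := by
  have h := eval_add hc hc' Φ
  rw [add_neg_cancel, eval_zero] at h
  exact (neg_eq_of_add_eq_zero_right h.symm).symm

theorem eval_dT_add (hc : IsSmoothAlt c) (w w' : 𝒯) (Φ : 𝒞) :
    eval (dT (w + w') c) Φ = eval (dT w c) Φ + eval (dT w' c) Φ := by
  rw [dT_add hc, eval_add (stable_dT hc w) (stable_dT hc w')]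

theorem eval_dT_zero (hc : IsSmoothAlt c) (Φ : 𝒞) :
    eval (dT (0 : 𝒯) c) Φ = 0 := by
  rw [dT_zero hc, eval_zero]

/-- The Taylor formula of first order for an even increment of square zero. -/
theorem eval_add_evenConf (hc : IsSmoothAlt c) {Φ δ : 𝒞} {n : ℕ}
    (hΦ : ∀ I ∈ Φ.support, n ∉ I) (hδ : IsEvenConf δ) (hn : ∀ I ∈ δ.support, n ∈ I) :
    eval c (Φ + δ) = eval c Φ + δ.sum fun I z ↦
      θ I * (eval (dT z.1 c) Φ + Complex.I • eval (dT z.2 c) Φ) := by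
  rw [eval_add_increment hc (Finset.disjoint_left.2 fun I hI hI' ↦ hΦ I hI (hn I hI')) hn]
  congr 1
  simp only [evenIdx, oddIdx, Finset.sum_product, Fintype.sum_bool, Finset.sum_filter,
    ← Finset.sum_add_distrib]
  refine Finset.sum_congr rfl fun I hI ↦ ?_
  have hne : I.Nonempty := ⟨n, hn I hI⟩
  have e1 : elt (I, true) = Complex.I • θ I := rfl
  have e2 : elt (I, false) = θ I := one_smul ℂ _
  have e3 : coef δ (I, true) = (δ I).2 := rfl
  have e4 : coef δ (I, false) = (δ I).1 := rfl
  beta_reduce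
  rw [e1, e2, e3, e4, smul_mul_assoc, smul_mul_assoc, mul_add, mul_smul_comm]
  rcases Nat.even_or_odd I.card with h | h
  · rw [if_pos ⟨hne, h⟩, if_neg (Nat.not_odd_iff_even.2 h), add_zero,
      dT_of_oddPart hc (hδ.1 I h).1, dT_of_oddPart hc (hδ.1 I h).2, add_comm]
  · rw [if_neg (fun h' ↦ Nat.not_even_iff_odd.2 h h'.2), if_pos h, zero_add,
      dT_of_evenPart hc (hδ.2 I h).1, dT_of_evenPart hc (hδ.2 I h).2, add_comm]

/-- Derivatives are finite differences: an increment `θ η w` containing a new generator changes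
the value by its first order term. -/
theorem eval_add_single (hc : IsSmoothAlt c) {Φ : 𝒞} {n : ℕ}
    (hΦ : IsFresh n Φ) {η : Finset ℕ} (hη : n ∈ η) {w : 𝒯}
    (hw : (Even η.card ∧ oddPart w = 0) ∨ (Odd η.card ∧ evenPart w = 0)) :
    eval c (Φ + Finsupp.single η (w, 0)) = eval c Φ + θ η * eval (dT w c) Φ := by
  rw [eval_add_evenConf hc (n := n) (fun I hI ↦ hΦ.notMem hI) (isEvenConf_single hw) fun I hI ↦ by
    rwa [Finset.mem_singleton.1 (Finsupp.support_single_subset hI)], Finsupp.sum_single_index]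
  · simp [eval_dT_zero hc]
  · simp [eval_dT_zero hc]

end SmoothAlt

/-- The coefficient `∑ I, θ_I T(q_I)` of `θ_n` in the increment of a functional with the first
variation `T` in the odd direction `q θ_n`, with `θ_n` moved to the right. -/
def rApply (T : 𝒯 → Grassmann) (q : 𝒞) : Grassmann :=
  q.sum fun I z ↦ θ I * inv (T z.1 + Complex.I • T z.2)

theorem rApply_add {T : 𝒯 → Grassmann} (hT : ∀ w w', T (w + w') = T w + T w')
    (q q' : 𝒞) : rApply T (q + q') = rApply T q + rApply T q' := by
  have h0 : T 0 = 0 := by simpa using hT 0 0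
  refine Finsupp.sum_add_index' (fun I ↦ by simp [h0]) fun I z z' ↦ ?_
  rw [← mul_add, ← map_add]
  congr 2
  rw [Prod.fst_add, Prod.snd_add, hT, hT, smul_add, add_add_add_comm]

section SmoothAlt

variable {c : Components d F₀ E₀ F₁ E₁}

/-- The right-handed version of `eval_add_single`, for an odd direction times a new generator. -/
theorem eval_add_mulRight (hc : IsSmoothAlt c) {Φ q : 𝒞} {n : ℕ}
    (hΦ : IsFresh n Φ) (hn : IsFresh n q) (hq : IsOddConf q) :
    eval c (Φ + GrVec.mulRight n q) =
      eval c Φ + rApply (fun w ↦ eval (dT w c) Φ) q * θ {n} := by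
  rw [eval_add_evenConf hc (n := n) (fun I hI ↦ hΦ.notMem hI) (hq.mulRight hn) fun I hI ↦
    mem_of_mem_support_mulRight hn hI, GrVec.mulRight, Finsupp.sum_mapDomain_index, rApply,
    Finsupp.sum, Finsupp.sum, Finset.sum_mul]
  · refine congrArg (eval c Φ + ·) (Finset.sum_congr rfl fun I hI ↦ ?_)
    rw [θ_insert (hn I hI), mul_assoc, mul_assoc, mul_θ_eq, inv_inv]
  · intro I
    simp [eval_dT_zero hc]
  · intro I z z'
    rw [← mul_add, Prod.fst_add, Prod.snd_add, eval_dT_add hc, eval_dT_add hc, smul_add,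
      add_add_add_comm]

end SmoothAlt

/-! ### Variations as sections -/

variable {c : Components d F₀ E₀ F₁ E₁}

section

variable [IsLocallyFiniteMeasure μ]

theorem IsLocal.stable_dT (hc : IsLocal μ c) (w : 𝒯) : IsLocal μ (dT w c) :=
  (hc.stable_dE _).add (hc.stable_dO _)

theorem eval_dT_represented (hμ : IsSmoothDensity d μ) (hc : IsLocal μ c)
    (Φ : 𝒞) :
    (fun w : 𝒯 ↦ eval (dT w c) Φ) ∈ Represented μ := by
  have := add_mem (eval_dE_represented hμ hc Φ) (eval_dO_represented hμ hc Φ)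
  convert this using 1
  ext w
  exact eval_add (hc.isSmoothAlt.stable_dE _) (hc.isSmoothAlt.stable_dO _) Φ

/-- The second derivative, with `w` as the outer direction; derivatives in two odd directions
anticommute. -/
theorem dT_dT_eq (hc : IsSmoothAlt c) (z w : 𝒯) :
    dT z (dT w c) = (dE (evenPart w) (dT z c) + dO (oddPart w) (dE (evenPart z) c)) +
      -dO (oddPart w) (dO (oddPart z) c) := by
  have h1 := hc.dE_comm (evenPart w) (evenPart z)
  have h2 := hc.dO_comm (oddPart z) (oddPart w)
  rw [dT, dT, dT, dE_add_arg (hc.stable_dE _) (hc.stable_dO _),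
    dE_add_arg (hc.stable_dE _) (hc.stable_dO _), h1]
  have h3 : dO (oddPart z) (dE (evenPart w) c + dO (oddPart w) c) =
      dO (oddPart z) (dE (evenPart w) c) + dO (oddPart z) (dO (oddPart w) c) := rfl
  rw [h3, h2, dE_dO, dE_dO]
  abel

theorem eval_dT_dT_represented (hμ : IsSmoothDensity d μ) (hc : IsLocal μ c)
    (Φ : 𝒞) (z : 𝒯) :
    (fun w : 𝒯 ↦ eval (dT z (dT w c)) Φ) ∈ Represented μ := by
  have h1 := sub_mem (add_mem (eval_dE_represented hμ (hc.stable_dT z) Φ)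
    (eval_dO_represented hμ (hc.stable_dE (evenPart z)) Φ))
    (eval_dO_represented hμ (hc.stable_dO (oddPart z)) Φ)
  convert h1 using 1
  ext w
  have hs := hc.isSmoothAlt
  have hneg : IsSmoothAlt (-dO (oddPart w) (dO (oddPart z) c)) := by
    rw [← hs.dO_comm]
    exact (hs.stable_dO _).stable_dO _
  have hE := (BV.stable_dT hs z).stable_dE (evenPart w)
  have hEO := (hs.stable_dE (evenPart z)).stable_dO (oddPart w)
  rw [dT_dT_eq hs, eval_add (hE.add hEO) hneg, eval_add hE hEO,
    eval_neg ((hs.stable_dO _).stable_dO _) hneg, ← sub_eq_add_neg]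
  rfl

theorem rApply_represented (hμ : IsSmoothDensity d μ) (hc : IsLocal μ c)
    (Φ q : 𝒞) :
    (fun w : 𝒯 ↦ rApply (fun z ↦ eval (dT z (dT w c)) Φ) q) ∈ Represented μ := by
  refine sum_mem_represented _ fun I _ ↦ ?_
  have h1 : (fun w : 𝒯 ↦ Complex.I • eval (dT (q I).2 (dT w c)) Φ) ∈
      Represented μ :=
    map_mem_represented (eval_dT_dT_represented hμ hc Φ (q I).2) (Complex.I • LinearMap.id)
  have h2 : (fun w : 𝒯 ↦ eval (dT (q I).1 (dT w c)) Φ +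
      Complex.I • eval (dT (q I).2 (dT w c)) Φ) ∈ Represented μ :=
    add_mem (eval_dT_dT_represented hμ hc Φ (q I).1) h1
  exact map_mem_represented h2 (LinearMap.mulLeft ℂ (θ I) ∘ₗ inv.toLinearMap)

end

open Classical in
/-- The multiplet of sections that represents the first variation `w ↦ D_w c` at `Φ`. -/
def variation (μ : Measure M) (c : 𝒦) (Φ : 𝒞) :
    GrVec 𝒟 :=
  if h : ∃ U, CompactOff U ∧ ∀ w, eval (dT w c) Φ = grPairing μ w U then h.choose else 0

open Classical in
/-- The derivative of `variation μ c` at `Φ` in the odd direction `q`. -/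
def secondVariation (μ : Measure M) (c : 𝒦) (Φ q : 𝒞) :
    GrVec 𝒟 :=
  if h : ∃ U, CompactOff U ∧ ∀ w, rApply (fun z ↦ eval (dT z (dT w c)) Φ) q = grPairing μ w U then
    h.choose else 0

theorem variation_spec (hμ : IsSmoothDensity d μ) (hc : IsLocal μ c) (Φ : 𝒞) :
    CompactOff (variation μ c Φ) ∧ ∀ w, eval (dT w c) Φ = grPairing μ w (variation μ c Φ) := by
  have := hμ.isLocallyFiniteMeasure
  have h := exists_grPairing (eval_dT_represented hμ hc Φ)
  rw [variation, dif_pos h]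
  exact h.choose_spec

theorem secondVariation_spec (hμ : IsSmoothDensity d μ) (hc : IsLocal μ c)
    (Φ q : 𝒞) :
    CompactOff (secondVariation μ c Φ q) ∧ ∀ w, rApply (fun z ↦ eval (dT z (dT w c)) Φ) q =
      grPairing μ w (secondVariation μ c Φ q) := by
  have := hμ.isLocallyFiniteMeasure
  have h := exists_grPairing (rApply_represented hμ hc Φ q)
  rw [secondVariation, dif_pos h]
  exact h.choose_spec

theorem isLeftDeriv_eval (hμ : IsSmoothDensity d μ) (hc : IsLocal μ c) (Φ : 𝒞) :
    IsLeftDeriv μ (fun _ ↦ eval c) Φ (variation μ c Φ) := by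
  have := hμ.isLocallyFiniteMeasure
  intro w hw f hf hf1
  simp only [← (variation_spec hμ hc Φ).2]
  constructor
  · intro hp
    filter_upwards [eventually_isFresh Φ] with n hn
    exact eval_add_single hc.isSmoothAlt hn (by simp) (Or.inl ⟨by simp, hp⟩)
  · intro hp
    filter_upwards [eventually_isFresh Φ] with n hn
    exact eval_add_single hc.isSmoothAlt hn (by simp) (Or.inr ⟨by simp, hp⟩)

theorem grPairing_mulRight (hμ : IsSmoothDensity d μ) {w : 𝒯}
    (hw : IsCompact (totSupp w)) {n : ℕ} {U : GrVec 𝒟} (hn : IsFresh n U) :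
    grPairing μ w (GrVec.mulRight n U) = grPairing μ w U * θ {n} := by
  have := hμ.isLocallyFiniteMeasure
  rw [grPairing_eq, GrVec.mulRight, Finsupp.sum_mapDomain_index, grPairing_eq, Finsupp.sum,
    Finsupp.sum, Finset.sum_mul]
  · refine Finset.sum_congr rfl fun I hI ↦ ?_
    rw [θ_insert (hn I hI), smul_mul_assoc]
  · intro I
    rw [cxPairing_zero_right, zero_smul]
  · intro I z z'
    rw [cxPairing_add_right hw, add_smul]

theorem grPairing_add_right (hμ : IsSmoothDensity d μ) {w : 𝒯}
    (hw : IsCompact (totSupp w)) (U U' : GrVec 𝒟) :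
    grPairing μ w (U + U') = grPairing μ w U + grPairing μ w U' := by
  have := hμ.isLocallyFiniteMeasure
  refine ext_coeffAt fun I ↦ ?_
  rw [map_add, coeffAt_grPairing, coeffAt_grPairing, coeffAt_grPairing, Finsupp.add_apply,
    cxPairing_add_right hw]

/-- The second variation is the derivative of the first in an odd direction. -/
theorem variation_add_mulRight (hμ : IsSmoothDensity d μ) (hc : IsLocal μ c)
    (Φ : 𝒞) {q : 𝒞} (hq : IsOddConf q) :
    ∀ᶠ n : ℕ in atTop, variation μ c (Φ + GrVec.mulRight n q) =
      variation μ c Φ + GrVec.mulRight n (secondVariation μ c Φ q) := by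
  have := hμ.isLocallyFiniteMeasure
  filter_upwards [eventually_isFresh Φ, eventually_isFresh q,
    eventually_isFresh (secondVariation μ c Φ q)] with n h1 h2 h3
  refine eq_of_grPairing_eq hμ fun w hw _ ↦ ?_
  rw [grPairing_add_right hμ hw, grPairing_mulRight hμ hw h3,
    ← (variation_spec hμ hc Φ).2 w, ← (secondVariation_spec hμ hc Φ q).2 w,
    ← (variation_spec hμ hc (Φ + GrVec.mulRight n q)).2 w]
  exact eval_add_mulRight (hc.stable_dT w).isSmoothAlt h1 h2 hq

end Calculus

/-! ### Parity and the antibracket of a functional with itself -/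

section Bracket

/-- The Hamiltonian direction `(U_φ‡, -U_φ)` of a multiplet of derivatives. -/
def ham (U : GrVec 𝒟) : 𝒞 :=
  U.mapRange (fun z ↦ ((z.1.2, -z.1.1), (z.2.2, -z.2.1))) (by simp)

theorem hamiltonian_eq {L : (M → ℝ) → ℱ} {Φ : 𝒞} :
    hamiltonian μ L Φ = ham (leftDeriv μ L Φ) := rfl

theorem ham_apply (U : GrVec 𝒟) (I : Finset ℕ) :
    ham U I = (((U I).1.2, -(U I).1.1), ((U I).2.2, -(U I).2.1)) := Finsupp.mapRange_apply

theorem ham_add (U U' : GrVec 𝒟) : ham (U + U') = ham U + ham U' := by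
  ext1 I
  rw [Finsupp.add_apply, ham_apply, ham_apply, ham_apply, Finsupp.add_apply]
  simp only [Prod.fst_add, Prod.snd_add, neg_add]
  rfl

theorem support_ham_subset (U : GrVec 𝒟) : (ham U).support ⊆ U.support :=
  Finsupp.support_mapRange

theorem even_components_eq_zero (hμ : IsSmoothDensity d μ) {z : Cx 𝒟}
    (h : ∀ w : 𝒯, IsCompact (totSupp w) → oddPart w = 0 → cxPairing μ w z = 0) :
    (z.1.1.1 = 0 ∧ z.1.2.2 = 0) ∧ z.2.1.1 = 0 ∧ z.2.2.2 = 0 := by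
  have key : ((((z.1.1.1, 0), (0, z.1.2.2)), ((z.2.1.1, 0), (0, z.2.2.2))) :
      Cx 𝒟) = 0 := by
    refine eq_of_cxPairing_eq hμ fun w hw hp ↦ ?_
    rw [cxPairing_zero_right]
    rcases hp with hp | hp
    · rw [← h w hw hp]
      have h1 : w.1.2 = 0 := congrArg Prod.fst hp
      have h2 : w.2.1 = 0 := congrArg Prod.snd hp
      simp [cxPairing, pairing, h1, h2]
    · have h1 : w.1.1 = 0 := congrArg Prod.fst hp
      have h2 : w.2.2 = 0 := congrArg Prod.snd hp
      simp [cxPairing, pairing, h1, h2]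
  simpa only [Prod.mk_eq_zero, true_and, and_true] using key

theorem odd_components_eq_zero (hμ : IsSmoothDensity d μ) {z : Cx 𝒟}
    (h : ∀ w : 𝒯, IsCompact (totSupp w) → evenPart w = 0 → cxPairing μ w z = 0) :
    (z.1.1.2 = 0 ∧ z.1.2.1 = 0) ∧ z.2.1.2 = 0 ∧ z.2.2.1 = 0 := by
  have key : ((((0, z.1.1.2), (z.1.2.1, 0)), ((0, z.2.1.2), (z.2.2.1, 0))) :
      Cx 𝒟) = 0 := by
    refine eq_of_cxPairing_eq hμ fun w hw hp ↦ ?_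
    rw [cxPairing_zero_right]
    rcases hp with hp | hp
    · have h1 : w.1.2 = 0 := congrArg Prod.fst hp
      have h2 : w.2.1 = 0 := congrArg Prod.snd hp
      simp [cxPairing, pairing, h1, h2]
    · rw [← h w hw hp]
      have h1 : w.1.1 = 0 := congrArg Prod.fst hp
      have h2 : w.2.2 = 0 := congrArg Prod.snd hp
      simp [cxPairing, pairing, h1, h2]
  simpa only [Prod.mk_eq_zero, true_and, and_true] using key

theorem coeffAt_eq_zero_of_inv_eq {a : Grassmann} {I : Finset ℕ} (h : inv a = a)
    (hI : Odd I.card) : coeffAt I a = 0 := by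
  have h1 := coeffAt_inv I a
  rw [h, hI.neg_one_pow] at h1
  linear_combination (1 / 2 : ℂ) * h1

theorem coeffAt_eq_zero_of_inv_eq_neg {a : Grassmann} {I : Finset ℕ} (h : inv a = -a)
    (hI : Even I.card) : coeffAt I a = 0 := by
  have h1 := coeffAt_inv I a
  rw [h, hI.neg_one_pow, map_neg] at h1
  linear_combination (-1 / 2 : ℂ) * h1

/-- The derivatives of an even functional define an odd Hamiltonian direction. -/
theorem isOddConf_ham (hμ : IsSmoothDensity d μ) {U : GrVec 𝒟}
    (he : ∀ w, IsCompact (totSupp w) → oddPart w = 0 →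
      inv (grPairing μ w U) = grPairing μ w U)
    (ho : ∀ w, IsCompact (totSupp w) → evenPart w = 0 →
      inv (grPairing μ w U) = -grPairing μ w U) :
    IsOddConf (ham U) := by
  refine ⟨fun I hI ↦ ?_, fun I hI ↦ ?_⟩
  · obtain ⟨⟨h1, h2⟩, h3, h4⟩ := odd_components_eq_zero hμ (z := U I) fun w hc hw ↦ by
      rw [← coeffAt_grPairing, coeffAt_eq_zero_of_inv_eq_neg (ho w hc hw) hI]
    simp [ham_apply, evenPart, h1, h2, h3, h4]
  · obtain ⟨⟨h1, h2⟩, h3, h4⟩ := even_components_eq_zero hμ (z := U I) fun w hc hw ↦ by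
      rw [← coeffAt_grPairing, coeffAt_eq_zero_of_inv_eq (he w hc hw) hI]
    simp [ham_apply, oddPart, h1, h2, h3, h4]

section EvenFunctional

variable {c : Components d F₀ E₀ F₁ E₁}

theorem inv_eval (hc : IsSmoothAlt c) (he : IsEvenFunctional (eval c)) {Φ : 𝒞}
    (hΦ : IsPoint Φ) : inv (eval c Φ) = eval c Φ := by
  rw [← eval_flipOdd hc]
  exact he Φ hΦ

theorem inv_eval_dT_of_oddPart (hc : IsSmoothAlt c) (he : IsEvenFunctional (eval c))
    {Φ : 𝒞} (hΦ : IsPoint Φ) {w : 𝒯} (hw : oddPart w = 0) :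
    inv (eval (dT w c) Φ) = eval (dT w c) Φ := by
  rw [← sub_eq_zero]
  refine eventually_θ_mul_cancel (fun n ↦ {n, n + 1}) (by simp) (Eventually.frequently ?_)
  filter_upwards [eventually_isFresh Φ] with n hn
  have hp : (Even ({n, n + 1} : Finset ℕ).card ∧ oddPart w = 0) ∨
      (Odd ({n, n + 1} : Finset ℕ).card ∧ evenPart w = 0) := Or.inl ⟨by simp, hw⟩
  have h1 := inv_eval hc he (hΦ.add_single (by simp) hp)
  rw [eval_add_single hc hn (by simp) hp, map_add, inv_eval hc he hΦ, map_mul,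
    inv_θ_of_even (by simp)] at h1
  rw [mul_sub, sub_eq_zero]
  exact add_left_cancel h1

theorem inv_eval_dT_of_evenPart (hc : IsSmoothAlt c) (he : IsEvenFunctional (eval c))
    {Φ : 𝒞} (hΦ : IsPoint Φ) {w : 𝒯} (hw : evenPart w = 0) :
    inv (eval (dT w c) Φ) = -eval (dT w c) Φ := by
  rw [← add_eq_zero_iff_eq_neg]
  refine eventually_θ_mul_cancel (fun n ↦ {n}) (by simp) (Eventually.frequently ?_)
  filter_upwards [eventually_isFresh Φ] with n hn
  have hp : (Even ({n} : Finset ℕ).card ∧ oddPart w = 0) ∨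
      (Odd ({n} : Finset ℕ).card ∧ evenPart w = 0) := Or.inr ⟨by simp, hw⟩
  have h1 := inv_eval hc he (hΦ.add_single (by simp) hp)
  rw [eval_add_single hc hn (by simp) hp, map_add, inv_eval hc he hΦ, map_mul,
    inv_θ_of_odd (by simp)] at h1
  have h2 := add_left_cancel h1
  rw [mul_add, ← h2]
  simp

theorem isOddConf_ham_variation (hμ : IsSmoothDensity d μ) (hc : IsLocal μ c)
    (he : IsEvenFunctional (eval c)) {Φ : 𝒞} (hΦ : IsPoint Φ) :
    IsOddConf (ham (variation μ c Φ)) := by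
  have := hμ.isLocallyFiniteMeasure
  have hs := hc.isSmoothAlt
  refine isOddConf_ham hμ (fun w _ hw ↦ ?_) fun w _ hw ↦ ?_
  · rw [← (variation_spec hμ hc Φ).2 w]
    exact inv_eval_dT_of_oddPart hs he hΦ hw
  · rw [← (variation_spec hμ hc Φ).2 w]
    exact inv_eval_dT_of_evenPart hs he hΦ hw

end EvenFunctional

/-! ### The symplectic form on derivatives -/

/-- The complex bilinear extension of the pairing. -/
def cxPairing₂ (μ : Measure M) (z : Cx 𝒯) (u : Cx 𝒟) : ℂ :=
  cxPairing μ z.1 u + Complex.I * cxPairing μ z.2 u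

/-- The Hamiltonian direction of a complexified multiplet of derivatives. -/
def cxHam (z : Cx 𝒟) : Cx 𝒯 :=
  ((z.1.2, -z.1.1), (z.2.2, -z.2.1))

theorem pairing_ham_antisymm (u u' : 𝒟) :
    pairing μ (u.2, -u.1) u' = -pairing μ (u'.2, -u'.1) u := by
  rw [pairing, pairing, ← integral_neg]
  congr 1
  ext x
  simp
  ring

theorem cxPairing₂_antisymm (z z' : Cx 𝒟) :
    cxPairing₂ μ (cxHam z) z' = -cxPairing₂ μ (cxHam z') z := by
  simp only [cxPairing₂, cxPairing, cxHam]
  rw [pairing_ham_antisymm z.1 z'.1, pairing_ham_antisymm z.1 z'.2, pairing_ham_antisymm z.2 z'.1,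
    pairing_ham_antisymm z.2 z'.2]
  push_cast
  ring

/-- The bracket `∑ ± θ_I θ_K σ(A_K, B_I)` of two derivatives. -/
def derBracket (μ : Measure M) (A B : GrVec 𝒟) : Grassmann :=
  rApply (fun w ↦ grPairing μ w A) (ham B)

theorem derBracket_eq_sum (A B : GrVec 𝒟) {S : Finset (Finset ℕ)}
    (hA : A.support ⊆ S) (hB : B.support ⊆ S) :
    derBracket μ A B = ∑ I ∈ S, ∑ K ∈ S,
      cxPairing₂ μ (cxHam (B I)) (A K) • (θ I * inv (θ K)) := by
  have h0 (I : Finset ℕ) : θ I * inv (grPairing μ (0 : Cx 𝒯).1 A +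
      Complex.I • grPairing μ (0 : Cx 𝒯).2 A) = 0 := by
    have : grPairing μ (0 : 𝒯) A = 0 :=
      Finset.sum_eq_zero fun K _ ↦ by
        simpa [cxPairing] using congrArg (· • θ K) (cxPairing_zero_left (μ := μ) (A K))
    simp [this]
  rw [derBracket, rApply, Finsupp.sum_of_support_subset _ ((support_ham_subset B).trans hB) _
    fun I _ ↦ h0 I]
  refine Finset.sum_congr rfl fun I _ ↦ ?_
  have h1 (w : 𝒯) : grPairing μ w A = ∑ K ∈ S, cxPairing μ w (A K) • θ K :=
    Finsupp.sum_of_support_subset _ hA _ fun K _ ↦ by rw [← cxPairing, cxPairing_zero_right, zero_smul]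
  rw [h1, h1, Finset.smul_sum, ← Finset.sum_add_distrib, map_sum, Finset.mul_sum]
  refine Finset.sum_congr rfl fun K _ ↦ ?_
  rw [smul_smul, ← add_smul, map_smul, mul_smul_comm]
  rfl

/-- The bracket of derivatives of even functionals is symmetric: the antisymmetry of the
symplectic form is compensated by the oddness of the coefficients. -/
theorem derBracket_comm {A B : GrVec 𝒟} (hA : IsOddConf (ham A))
    (hB : IsOddConf (ham B)) : derBracket μ A B = derBracket μ B A := by
  rw [derBracket_eq_sum A B (S := A.support ∪ B.support) Finset.subset_union_left
    Finset.subset_union_right, derBracket_eq_sum B A (S := A.support ∪ B.support)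
    Finset.subset_union_right Finset.subset_union_left, Finset.sum_comm]
  refine Finset.sum_congr rfl fun K _ ↦ Finset.sum_congr rfl fun I _ ↦ ?_
  -- the components of opposite kind pair to zero
  have hz (u u' : 𝒟)
      (h : (u.2.1 = 0 ∧ u.1.2 = 0 ∧ u'.2.1 = 0 ∧ u'.1.2 = 0) ∨
        (u.2.2 = 0 ∧ u.1.1 = 0 ∧ u'.2.2 = 0 ∧ u'.1.1 = 0)) :
      pairing μ (u.2, -u.1) u' = 0 := by
    rcases h with ⟨h1, h2, h3, h4⟩ | ⟨h1, h2, h3, h4⟩ <;> simp [pairing, h1, h2, h3, h4]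
  have hev {U : GrVec 𝒟} (hU : IsOddConf (ham U)) {I : Finset ℕ}
      (hI : Even I.card) : ((U I).1.2.1 = 0 ∧ (U I).1.1.2 = 0) ∧
        ((U I).2.2.1 = 0 ∧ (U I).2.1.2 = 0) := by
    have h1 := hU.1 I hI
    simpa [ham_apply, evenPart] using h1
  have hod {U : GrVec 𝒟} (hU : IsOddConf (ham U)) {I : Finset ℕ}
      (hI : Odd I.card) : ((U I).1.2.2 = 0 ∧ (U I).1.1.1 = 0) ∧
        ((U I).2.2.2 = 0 ∧ (U I).2.1.1 = 0) := by
    have h1 := hU.2 I hI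
    simpa [ham_apply, oddPart] using h1
  rcases Nat.even_or_odd I.card with hI | hI <;> rcases Nat.even_or_odd K.card with hK | hK
  · obtain ⟨⟨a1, a2⟩, a3, a4⟩ := hev hA hK
    obtain ⟨⟨b1, b2⟩, b3, b4⟩ := hev hB hI
    have e (z z' : Cx 𝒟) (h1 : z.1.2.1 = 0) (h2 : z.1.1.2 = 0)
        (h3 : z.2.2.1 = 0) (h4 : z.2.1.2 = 0) (h1' : z'.1.2.1 = 0) (h2' : z'.1.1.2 = 0)
        (h3' : z'.2.2.1 = 0) (h4' : z'.2.1.2 = 0) : cxPairing₂ μ (cxHam z) z' = 0 := by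
      simp [cxPairing₂, cxPairing, cxHam, hz _ _ (Or.inl ⟨h1, h2, h1', h2'⟩),
        hz _ _ (Or.inl ⟨h1, h2, h3', h4'⟩), hz _ _ (Or.inl ⟨h3, h4, h1', h2'⟩),
        hz _ _ (Or.inl ⟨h3, h4, h3', h4'⟩)]
    rw [e _ _ a1 a2 a3 a4 b1 b2 b3 b4, e _ _ b1 b2 b3 b4 a1 a2 a3 a4, zero_smul, zero_smul]
  · rw [cxPairing₂_antisymm, inv_θ_of_odd hK, inv_θ_of_even hI, mul_neg,
      smul_neg, neg_smul, neg_neg, commute_of_even (inv_θ_of_even hI) (θ K)]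
  · rw [cxPairing₂_antisymm, inv_θ_of_odd hI, inv_θ_of_even hK,
      commute_of_even (inv_θ_of_even hK) (-θ I), neg_smul, neg_mul, smul_neg]
  · obtain ⟨⟨a1, a2⟩, a3, a4⟩ := hod hA hK
    obtain ⟨⟨b1, b2⟩, b3, b4⟩ := hod hB hI
    have e (z z' : Cx 𝒟) (h1 : z.1.2.2 = 0) (h2 : z.1.1.1 = 0)
        (h3 : z.2.2.2 = 0) (h4 : z.2.1.1 = 0) (h1' : z'.1.2.2 = 0) (h2' : z'.1.1.1 = 0)
        (h3' : z'.2.2.2 = 0) (h4' : z'.2.1.1 = 0) : cxPairing₂ μ (cxHam z) z' = 0 := by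
      simp [cxPairing₂, cxPairing, cxHam, hz _ _ (Or.inr ⟨h1, h2, h1', h2'⟩),
        hz _ _ (Or.inr ⟨h1, h2, h3', h4'⟩), hz _ _ (Or.inr ⟨h3, h4, h1', h2'⟩),
        hz _ _ (Or.inr ⟨h3, h4, h3', h4'⟩)]
    rw [e _ _ a1 a2 a3 a4 b1 b2 b3 b4, e _ _ b1 b2 b3 b4 a1 a2 a3 a4, zero_smul, zero_smul]

theorem pairing_add_left_of_off [IsLocallyFiniteMeasure μ] {K : Set M} (hK : IsCompact K)
    {u : 𝒟} (hu : DerOff K u) (w w' : 𝒯) :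
    pairing μ (w + w') u = pairing μ w u + pairing μ w' u :=
  pairing_add_left hK (fun _ hx ↦ hu.pairFun_eq_zero _ hx) fun _ hx ↦ hu.pairFun_eq_zero _ hx

theorem CompactOff.grPairing_add_left [IsLocallyFiniteMeasure μ]
    {U : GrVec 𝒟} (hU : CompactOff U) (w w' : 𝒯) :
    grPairing μ (w + w') U = grPairing μ w U + grPairing μ w' U := by
  obtain ⟨K, hK, h⟩ := hU
  refine ext_coeffAt fun I ↦ ?_
  rw [map_add, coeffAt_grPairing, coeffAt_grPairing, coeffAt_grPairing]
  simp only [cxPairing, pairing_add_left_of_off hK (h I).1, pairing_add_left_of_off hK (h I).2]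
  push_cast
  ring

theorem derBracket_add_right [IsLocallyFiniteMeasure μ] {A : GrVec 𝒟}
    (hA : CompactOff A) (B B' : GrVec 𝒟) :
    derBracket μ A (B + B') = derBracket μ A B + derBracket μ A B' := by
  rw [derBracket, ham_add, rApply_add fun w w' ↦ hA.grPairing_add_left w w']
  rfl

theorem derBracket_add_left [IsLocallyFiniteMeasure μ] {A A' : GrVec 𝒟}
    (hA : CompactOff A) (hA' : CompactOff A') (B : GrVec 𝒟) :
    derBracket μ (A + A') B = derBracket μ A B + derBracket μ A' B := by
  simp only [derBracket, rApply, fun w ↦ grPairing_add_right_of_off (μ := μ) w hA hA', Finsupp.sum,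
    ← Finset.sum_add_distrib]
  refine Finset.sum_congr rfl fun I _ ↦ ?_
  rw [← mul_add, ← map_add, smul_add, add_add_add_comm]

end Bracket

/-! ### The master equation of a local functional -/

section MasterEquation

variable {c : Components d F₀ E₀ F₁ E₁}

/-- `½ {F, F}` for an even functional `F`. -/
def selfBracket (μ : Measure M) (F : ℱ) : ℱ :=
  (2⁻¹ : ℂ) • antibracket μ F fun _ ↦ F

theorem cme_apply (L : (M → ℝ) → ℱ) (f : M → ℝ) :
    cme μ L f = selfBracket μ (L f) := rfl

theorem rightDeriv_eval (hc : IsSmoothAlt c) (Φ : 𝒞) {q : 𝒞}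
    (hq : IsOddConf q) : IsRightDeriv (eval c) Φ q (rApply (fun w ↦ eval (dT w c) Φ) q) := by
  filter_upwards [eventually_isFresh Φ, eventually_isFresh q] with n h1 h2
  exact eval_add_mulRight hc h1 h2 hq

/-- The antibracket of an even local functional with itself, expressed through its variation. -/
theorem selfBracket_eval (hμ : IsSmoothDensity d μ) (hc : IsLocal μ c)
    (he : IsEvenFunctional (eval c)) {Φ : 𝒞} (hΦ : IsPoint Φ) :
    selfBracket μ (eval c) Φ =
      (2⁻¹ : ℂ) • derBracket μ (variation μ c Φ) (variation μ c Φ) := by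
  have := hμ.isLocallyFiniteMeasure
  have h1 : hamiltonian μ (fun _ ↦ eval c) Φ = ham (variation μ c Φ) := by
    rw [hamiltonian_eq, (isLeftDeriv_eval hμ hc Φ).leftDeriv_eq hμ]
  have h2 := (rightDeriv_eval hc.isSmoothAlt Φ
    (isOddConf_ham_variation hμ hc he hΦ)).rightDeriv_eq
  have h3 : (fun w ↦ eval (dT w c) Φ) = fun w ↦ grPairing μ w (variation μ c Φ) :=
    funext fun w ↦ (variation_spec hμ hc Φ).2 w
  change (2⁻¹ : ℂ) • rightDeriv (eval c) Φ (hamiltonian μ (fun _ ↦ eval c) Φ) = _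
  rw [h1, h2, h3]
  rfl

theorem dT_comm_of_oddPart (hc : IsSmoothAlt c) {w : 𝒯} (hw : oddPart w = 0)
    (q : 𝒯) : dT w (dT q c) = dT q (dT w c) := by
  rw [dT_of_oddPart (stable_dT hc q) hw, dT_of_oddPart hc hw, dT, dT,
    dE_add_arg (hc.stable_dE _) (hc.stable_dO _), hc.dE_comm, dE_dO]

theorem dT_comm_of_evenPart (hc : IsSmoothAlt c) {w q : 𝒯} (hw : evenPart w = 0)
    (hq : evenPart q = 0) : dT w (dT q c) = -dT q (dT w c) := by
  rw [dT_of_evenPart (stable_dT hc q) hw, dT_of_evenPart hc hw, dT_of_evenPart hc hq,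
    dT_of_evenPart (hc.stable_dO _) hq, hc.dO_comm]

theorem eval_dT_comm_of_evenPart (hc : IsSmoothAlt c) {w q : 𝒯}
    (hw : evenPart w = 0) (hq : evenPart q = 0) (Φ : 𝒞) :
    eval (dT w (dT q c)) Φ = -eval (dT q (dT w c)) Φ := by
  have h := dT_comm_of_evenPart hc hw hq
  have h1 : IsSmoothAlt (-dT q (dT w c)) := h ▸ stable_dT (stable_dT hc q) w
  rw [h, eval_neg (stable_dT (stable_dT hc w) q) h1]

/-- The variation of `variation μ c` in the direction `w`, contracted with an odd direction. -/
theorem rApply_dT_dT (hc : IsSmoothAlt c) (Φ : 𝒞) {q : 𝒞}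
    (hq : IsOddConf q) {η : Finset ℕ} {w : 𝒯}
    (hw : (Even η.card ∧ oddPart w = 0) ∨ (Odd η.card ∧ evenPart w = 0)) :
    rApply (fun z ↦ θ η * eval (dT w (dT z c)) Φ) q =
      θ η * rApply (fun z ↦ eval (dT z (dT w c)) Φ) q := by
  rw [rApply, rApply, Finsupp.sum, Finsupp.sum, Finset.mul_sum]
  refine Finset.sum_congr rfl fun I _ ↦ ?_
  rw [← mul_smul_comm, ← mul_add, map_mul]
  rcases hw with ⟨hη, hw⟩ | ⟨hη, hw⟩
  · rw [dT_comm_of_oddPart hc hw, dT_comm_of_oddPart hc hw, inv_θ_of_even hη, ← mul_assoc,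
      ← mul_assoc, commute_of_even (inv_θ_of_even hη)]
  · rw [inv_θ_of_odd hη]
    rcases Nat.even_or_odd I.card with hI | hI
    · rw [eval_dT_comm_of_evenPart hc hw (hq.1 I hI).1, eval_dT_comm_of_evenPart hc hw (hq.1 I hI).2,
        smul_neg, ← neg_add, map_neg, neg_mul_neg, ← mul_assoc, ← mul_assoc,
        commute_of_even (inv_θ_of_even hI)]
    · rw [← dT_comm_of_oddPart hc (hq.2 I hI).1, ← dT_comm_of_oddPart hc (hq.2 I hI).2, ← mul_assoc,
        ← mul_assoc, inv_mul_of_odd (inv_θ_of_odd hI) (-θ η), map_neg, inv_θ_of_odd hη, neg_neg]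

/-- The left derivative of `½ {F, F}` is the derivative of the derivative of `F` in its own
Hamiltonian direction. -/
theorem selfBracket_add_single (hμ : IsSmoothDensity d μ) (hc : IsLocal μ c)
    (he : IsEvenFunctional (eval c)) {Φ : 𝒞} (hΦ : IsPoint Φ) {n : ℕ}
    (hn : IsFresh n Φ) {η : Finset ℕ} (hη : n ∈ η) {w : 𝒯}
    (hw : (Even η.card ∧ oddPart w = 0) ∨ (Odd η.card ∧ evenPart w = 0)) :
    selfBracket μ (eval c) (Φ + Finsupp.single η (w, 0)) = selfBracket μ (eval c) Φ +
      θ η * grPairing μ w (secondVariation μ c Φ (ham (variation μ c Φ))) := by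
  have := hμ.isLocallyFiniteMeasure
  have hΦ' := hΦ.add_single ⟨n, hη⟩ hw
  rw [selfBracket_eval hμ hc he hΦ, selfBracket_eval hμ hc he hΦ']
  set V := variation μ c Φ with hV
  set V' := variation μ c (Φ + Finsupp.single η (w, 0)) with hV'
  have hVc : CompactOff V := (variation_spec hμ hc Φ).1
  have hVc' : CompactOff V' := (variation_spec hμ hc _).1
  have hVo : IsOddConf (ham V) := isOddConf_ham_variation hμ hc he hΦ
  have hVo' : IsOddConf (ham V') := isOddConf_ham_variation hμ hc he hΦ'
  obtain ⟨Y, hY⟩ : ∃ Y, Y = V' + -V := ⟨_, rfl⟩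
  have hYc : CompactOff Y := hY ▸ hVc'.add hVc.neg
  have hVY : V' = V + Y := by rw [hY, add_comm V', add_neg_cancel_left]
  have hpY (z : 𝒯) : grPairing μ z Y = θ η * eval (dT w (dT z c)) Φ := by
    rw [hY, grPairing_add_right_of_off z hVc' hVc.neg, grPairing_neg_right,
      ← (variation_spec hμ hc Φ).2 z, ← (variation_spec hμ hc _).2 z,
      eval_add_single (stable_dT hc.isSmoothAlt z) hn hη hw]
    abel
  have h1 : derBracket μ Y V =
      θ η * grPairing μ w (secondVariation μ c Φ (ham V)) := by
    rw [derBracket]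
    simp only [hpY]
    rw [rApply_dT_dT hc.isSmoothAlt Φ hVo hw, (secondVariation_spec hμ hc Φ (ham V)).2 w]
  -- all terms of `Y` contain the generators of `η`
  have h2 : derBracket μ Y Y = 0 := by
    rw [derBracket]
    refine Finset.sum_eq_zero fun I hI ↦ ?_
    have hnI : n ∈ I := by
      by_contra hnI
      refine Finsupp.mem_support_iff.1 (support_ham_subset Y hI) (eq_of_cxPairing_eq hμ
        fun z _ _ ↦ ?_)
      rw [cxPairing_zero_right, ← coeffAt_grPairing, hpY, coeffAt_θ_mul _ _ _ fun h ↦ hnI (h hη)]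
    have h3 : θ I * θ η = 0 := θ_mul_of_not_disjoint (Finset.not_disjoint_iff.2 ⟨n, hnI, hη⟩)
    simp only [hpY]
    rw [← mul_smul_comm, ← mul_add, map_mul, inv_θ, smul_mul_assoc, mul_smul_comm, ← mul_assoc, h3,
      zero_mul, smul_zero]
  have h4 : derBracket μ V' V' =
      derBracket μ V V + (derBracket μ Y V + derBracket μ Y V) := by
    have h5 : derBracket μ V Y = derBracket μ Y V := by
      have h6 := derBracket_comm (μ := μ) hVo hVo'
      rw [hVY, derBracket_add_left hVc hYc, derBracket_add_right hVc] at h6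
      exact add_left_cancel h6
    rw [hVY, derBracket_add_left hVc hYc, derBracket_add_right hVc, derBracket_add_right hYc, h5, h2]
    abel
  rw [h4, h1, smul_add, ← two_smul ℂ (θ η * _), smul_smul]
  norm_num

/-! ### Right derivatives of multilocal functionals -/

/-- Multilocal functionals have right derivatives that are additive in the direction. For
products this is the Leibniz rule, with the new generator moved to the right. -/
theorem exists_rightDeriv (hμ : IsSmoothDensity d μ) {X : ℱ}
    (hX : X ∈ multilocal d F₀ E₀ F₁ E₁ μ) (Φ : 𝒞) :
    ∃ a : 𝒞 → Grassmann, (∀ q q', a (q + q') = a q + a q') ∧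
      ∀ q, IsOddConf q → IsRightDeriv X Φ q (a q) := by
  have := hμ.isLocallyFiniteMeasure
  induction hX using Algebra.adjoin_induction with
  | mem X h =>
    obtain ⟨c, hc, rfl⟩ := h
    exact ⟨rApply fun w ↦ eval (dT w c) Φ, rApply_add fun w w' ↦
      eval_dT_add hc.isSmoothAlt w w' Φ, fun q hq ↦ rightDeriv_eval hc.isSmoothAlt Φ hq⟩
  | algebraMap r =>
    exact ⟨0, fun _ _ ↦ by simp, fun q _ ↦ Eventually.of_forall fun n ↦ by simp⟩
  | add X Y _ _ hX hY =>
    obtain ⟨a, ha, hXa⟩ := hX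
    obtain ⟨b, hb, hYb⟩ := hY
    refine ⟨fun q ↦ a q + b q, fun q q' ↦ by simp only [ha, hb]; abel, fun q hq ↦ ?_⟩
    filter_upwards [hXa q hq, hYb q hq] with n h1 h2
    rw [Pi.add_apply, Pi.add_apply, h1, h2, add_mul]
    abel
  | mul X Y _ _ hX hY =>
    obtain ⟨a, ha, hXa⟩ := hX
    obtain ⟨b, hb, hYb⟩ := hY
    refine ⟨fun q ↦ X Φ * b q + a q * inv (Y Φ), fun q q' ↦ by
      simp only [ha, hb, mul_add, add_mul]; abel, fun q hq ↦ ?_⟩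
    filter_upwards [hXa q hq, hYb q hq] with n h1 h2
    have h3 : θ {n} * (b q * θ {n}) = 0 := by
      rw [← mul_assoc]
      exact θ_mul_mul_θ (Finset.mem_singleton_self n) (Finset.mem_singleton_self n) _
    rw [Pi.mul_apply, Pi.mul_apply, h1, h2, add_mul, mul_add, mul_add, mul_assoc (a q), mul_assoc
      (a q), h3, mul_zero, add_zero, add_mul, mul_assoc (a q), mul_θ_eq (inv (Y Φ)), inv_inv,
      mul_assoc (X Φ), add_assoc]

end MasterEquation

/-! ### Taylor expansion at the origin -/

section TaylorZero

variable {c : Components d F₀ E₀ F₁ E₁}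

theorem dE_smul_arg {A B : Type*} [AddCommGroup A] [Module ℝ A] [AddCommGroup B] [Module ℝ B]
    {c : GComp A B} (hc : IsSmoothAlt c) (a : ℝ) (e : A) : dE e (a • c) = a • dE e c := by
  ext k v w
  have h := (hc.hasDerivAt k v w e 0).const_smul a
  refine Eq.trans h.deriv ?_
  simp

theorem IsSmoothAlt.smul {A B : Type*} [AddCommGroup A] [Module ℝ A] [AddCommGroup B] [Module ℝ B]
    {c : GComp A B} (hc : IsSmoothAlt c) (a : ℝ) : IsSmoothAlt (a • c) where
  smooth k v w N e := (hc.smooth k v w N e).const_smul a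
  alt k v := by
    obtain ⟨L, hL⟩ := hc.alt k v
    exact ⟨a • L, fun w ↦ congrArg (a • ·) (hL w)⟩

theorem scalarPart_smul (v : ℰ) (a : ℝ) (c : 𝒦) :
    scalarPart v (a • c) = (a : ℂ) • scalarPart v c := by
  rw [scalarPart, scalarPart, Algebra.smul_def (a : ℂ), ← map_mul]
  rfl

/-- The part of the Taylor expansion of a functional at `t • body Φ` that is of order `j` in the
nilpotent even and of order `k` in the odd coefficients. -/
def taylorTerm (Φ : 𝒞) (t : ℝ) (j k : ℕ) (c : 𝒦) :
    Grassmann :=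
  wordSum (evenIdx Φ) elt (fun i ↦ dE (evenPart (coef Φ i)))
    (wordSum (oddIdx Φ) elt (fun i ↦ dO (oddPart (coef Φ i))) (scalarPart (t • body Φ)) k) j c

theorem eval_smul_conf (hc : IsSmoothAlt c) (Φ : 𝒞) {t : ℝ} (ht : t ≠ 0) {N : ℕ}
    (hN : numGen Φ + 1 ≤ N) :
    eval c (t • Φ) = ∑ j ∈ Finset.range N, ∑ k ∈ Finset.range N,
      ((j.factorial * k.factorial : ℕ) : ℂ)⁻¹ • ((t : ℂ) ^ (j + k) • taylorTerm Φ t j k c) := by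
  have hs : (t • Φ).support = Φ.support := by
    ext I
    rw [Finsupp.mem_support_iff, Finsupp.mem_support_iff, Finsupp.smul_apply, not_iff_not]
    refine ⟨fun h ↦ ?_, fun h ↦ by rw [h, smul_zero]⟩
    rw [← inv_smul_smul₀ ht (Φ I), h, smul_zero]
  have hN' : numGen (t • Φ) + 1 ≤ N := by rwa [numGen, hs]
  have hE : evenIdx (t • Φ) = evenIdx Φ := by simp only [evenIdx, hs]
  have hO : oddIdx (t • Φ) = oddIdx Φ := by simp only [oddIdx, hs]
  have hb : body (t • Φ) = t • body Φ := by
    refine Prod.ext rfl ?_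
    exact (smul_zero t).symm
  have hcf (i) : coef (t • Φ) i = t • coef Φ i := by
    simp only [coef, Finsupp.smul_apply]
    split_ifs <;> rfl
  have hsm (a : ℝ) (c : 𝒦) : IsSmoothAlt c → IsSmoothAlt (a • c) :=
    fun h ↦ h.smul a
  have hodd (c : 𝒦) (hc : IsSmoothAlt c) (k : ℕ) :
      wordSum (oddIdx Φ) elt (fun i ↦ dO (oddPart (coef (t • Φ) i))) (scalarPart (t • body Φ)) k c =
        (t : ℂ) ^ k • wordSum (oddIdx Φ) elt (fun i ↦ dO (oddPart (coef Φ i)))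
          (scalarPart (t • body Φ)) k c :=
    wordSum_smul_op (P := IsSmoothAlt) (oddIdx Φ) elt (fun i ↦ dO (oddPart (coef Φ i)))
      (fun i ↦ dO (oddPart (coef (t • Φ) i))) _ t (fun i c hc ↦ hc.stable_dO _) (hsm t)
      (fun i c hc ↦ by
        rw [hcf, oddPart_smul]
        ext k v w
        exact hc.dO_smul t _ k v w) (fun i c hc ↦ rfl) (fun c hc ↦ scalarPart_smul _ _ _) k hc
  rw [eval_eq_fullExp hc _ hN', fullExp, hE, hb, expSum]
  refine Finset.sum_congr rfl fun j _ ↦ ?_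
  rw [wordSum_smul_op (P := IsSmoothAlt) (evenIdx Φ) elt (fun i ↦ dE (evenPart (coef Φ i)))
    (fun i ↦ dE (evenPart (coef (t • Φ) i))) _ t (fun i c hc ↦ hc.stable_dE _) (hsm t)
    (fun i c hc ↦ by
        rw [hcf, evenPart_smul]
        ext k v w
        exact hc.dE_smul t _ k v w) (fun i c hc ↦ dE_smul_arg hc t _) (fun c hc ↦ ?_) j hc]
  · have h1 : ∀ c, IsSmoothAlt c → oddExp N (t • Φ) (t • body Φ) c =
        ∑ k ∈ Finset.range N, ((k.factorial : ℂ)⁻¹ * (t : ℂ) ^ k) • wordSum (oddIdx Φ) elt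
          (fun i ↦ dO (oddPart (coef Φ i))) (scalarPart (t • body Φ)) k c := by
      intro c hc
      rw [oddExp, hO, expSum]
      exact Finset.sum_congr rfl fun k _ ↦ by rw [hodd c hc, smul_smul]
    rw [wordSum_invariant (P := IsSmoothAlt) _ _ _ (fun i c hc ↦ hc.stable_dE _) h1 j hc,
      wordSum_sum_fun, smul_smul, Finset.smul_sum]
    refine Finset.sum_congr rfl fun k _ ↦ ?_
    rw [wordSum_smul_fun, smul_smul, smul_smul, taylorTerm]
    congr 1
    push_cast
    rw [mul_inv, pow_add]
    ring
  · rw [oddExp, oddExp, expSum, expSum, Finset.smul_sum]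
    refine Finset.sum_congr rfl fun k _ ↦ ?_
    rw [wordSum_smul_arg (P := IsSmoothAlt) (oddIdx (t • Φ)) elt
      (fun i ↦ dO (oddPart (coef (t • Φ) i))) (scalarPart (t • body Φ)) t
      (fun i c hc ↦ hc.stable_dO _)
      (fun i c hc ↦ rfl) (fun c hc ↦ scalarPart_smul _ _ _) k hc, smul_comm]

/-- Every Grassmann coefficient of a Taylor term is differentiable in the scaling parameter. -/
theorem weaklyDifferentiable_taylorTerm (hc : IsSmoothAlt c) (Φ : 𝒞) (j k : ℕ) :
    WeaklyDifferentiable fun t ↦ taylorTerm Φ t j k c := by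
  refine weaklyDifferentiable_wordSum (P := IsSmoothAlt) _ _ _ (fun t ↦ wordSum (oddIdx Φ) elt
    (fun i ↦ dO (oddPart (coef Φ i))) (scalarPart (t • body Φ)) k)
    (fun i c hc ↦ hc.stable_dE _) (fun c hc ↦ ?_) j hc
  refine weaklyDifferentiable_wordSum (P := IsSmoothAlt) _ _ _ (fun t ↦ scalarPart (t • body Φ))
    (fun i c hc ↦ hc.stable_dO _) (fun c hc ↦ ?_) k hc
  intro L
  have h1 := (hc.contDiff_line 0 0 Fin.elim0 (body Φ)).differentiable (by simp)
  have h2 : (fun t : ℝ ↦ L (scalarPart (t • body Φ) c)) =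
      fun t : ℝ ↦ c 0 (0 + t • body Φ) Fin.elim0 * L 1 := by
    ext t
    rw [scalarPart, Algebra.algebraMap_eq_smul_one, map_smul, smul_eq_mul, zero_add]
  rw [h2]
  exact h1.mul_const _

theorem hasDerivAt_taylorTerm_zero (hc : IsSmoothAlt c) (Φ : 𝒞)
    (L : Grassmann →ₗ[ℂ] ℂ) :
    HasDerivAt (fun t ↦ L (taylorTerm Φ t 0 0 c)) (L (scalarPart 0 (dE (body Φ) c))) 0 := by
  have h1 := (hc.hasDerivAt 0 0 Fin.elim0 (body Φ) 0).mul_const (L 1)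
  have h2 : (fun t : ℝ ↦ L (taylorTerm Φ t 0 0 c)) =
      fun t : ℝ ↦ c 0 (0 + t • body Φ) Fin.elim0 * L 1 := by
    ext t
    change L (scalarPart (t • body Φ) c) = _
    rw [scalarPart, Algebra.algebraMap_eq_smul_one, map_smul, smul_eq_mul, zero_add]
  rw [h2]
  refine h1.congr_deriv ?_
  rw [scalarPart, Algebra.algebraMap_eq_smul_one, map_smul, smul_eq_mul, zero_smul, zero_add]

theorem hasDerivAt_pow_mul {s : ℝ → ℂ} (hs : Differentiable ℝ s) (m : ℕ) :
    HasDerivAt (fun t : ℝ ↦ (t : ℂ) ^ m * s t)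
      (if m = 0 then deriv s 0 else if m = 1 then s 0 else 0) 0 := by
  have h1 := ((hasDerivAt_id (0 : ℝ)).ofReal_comp.pow m).mul (hs 0).hasDerivAt
  refine HasDerivAt.congr_deriv h1 ?_
  rcases m with _ | _ | m <;> simp

/-- A functional that is homogeneous of degree one is given by its linearization at `0`. -/
theorem eval_eq_of_homogeneous (hc : IsSmoothAlt c) (Φ : 𝒞)
    (h : ∀ t : ℝ, t ≠ 0 → eval c (t • Φ) = (t : ℂ) • eval c Φ) :
    eval c Φ = scalarPart 0 (dE (body Φ) c) +
      ((∑ i ∈ evenIdx Φ, elt i * scalarPart 0 (dE (evenPart (coef Φ i)) c)) +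
        ∑ i ∈ oddIdx Φ, elt i * scalarPart 0 (dO (oddPart (coef Φ i)) c)) := by
  refine ext_coeffAt fun K ↦ ?_
  set L := coeffAt K with hL
  set N := numGen Φ + 2 with hN
  let g : ℝ → ℂ := fun t ↦ ∑ j ∈ Finset.range N, ∑ k ∈ Finset.range N,
    ((j.factorial * k.factorial : ℕ) : ℂ)⁻¹ * ((t : ℂ) ^ (j + k) * L (taylorTerm Φ t j k c))
  let D : ℕ → ℕ → ℂ := fun j k ↦ ((j.factorial * k.factorial : ℕ) : ℂ)⁻¹ *
    (if j + k = 0 then deriv (fun t ↦ L (taylorTerm Φ t j k c)) 0 else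
      if j + k = 1 then L (taylorTerm Φ 0 j k c) else 0)
  have hg : HasDerivAt g (∑ j ∈ Finset.range N, ∑ k ∈ Finset.range N, D j k) 0 := by
    refine HasDerivAt.fun_sum fun j _ ↦ HasDerivAt.fun_sum fun k _ ↦ ?_
    exact (hasDerivAt_pow_mul (weaklyDifferentiable_taylorTerm hc Φ j k L) (j + k)).const_mul _
  have hg' (t : ℝ) (ht : t ≠ 0) : g t = (t : ℂ) * L (eval c Φ) := by
    have h1 := congrArg L (h t ht)
    rw [eval_smul_conf hc Φ ht (N := N) (by omega), map_smul, map_sum] at h1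
    simpa only [map_sum, map_smul, smul_eq_mul] using h1
  have hlin : HasDerivAt (fun t : ℝ ↦ (t : ℂ) * L (eval c Φ)) (L (eval c Φ)) 0 := by
    simpa using (hasDerivAt_id (0 : ℝ)).ofReal_comp.mul_const (L (eval c Φ))
  have h0 : g 0 = 0 := by
    have h1 : Tendsto g (𝓝[≠] 0) (𝓝 (g 0)) := hg.continuousAt.tendsto.mono_left nhdsWithin_le_nhds
    have h2 : Tendsto (fun t : ℝ ↦ (t : ℂ) * L (eval c Φ)) (𝓝[≠] 0) (𝓝 0) := by
      have := hlin.continuousAt.tendsto.mono_left (nhdsWithin_le_nhds (s := {0}ᶜ))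
      simpa using this
    refine tendsto_nhds_unique h1 (h2.congr' ?_)
    filter_upwards [self_mem_nhdsWithin] with t ht
    exact (hg' t ht).symm
  have hgl : g = fun t : ℝ ↦ (t : ℂ) * L (eval c Φ) := by
    ext t
    rcases eq_or_ne t 0 with rfl | ht
    · simpa using h0
    · exact hg' t ht
  rw [hgl] at hg
  rw [hlin.unique hg, Finset.sum_range_succ', Finset.sum_range_succ']
  have e2 (j : ℕ) : ∑ k ∈ Finset.range N, D (j + 1 + 1) k = 0 :=
    Finset.sum_eq_zero fun k _ ↦ by
      simp only [D]
      rw [if_neg (by omega), if_neg (by omega), mul_zero]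
  have e1 : ∑ k ∈ Finset.range N, D (0 + 1) k = D 1 0 := by
    rw [hN, Finset.sum_range_succ']
    rw [Finset.sum_eq_zero fun k _ ↦ ?_, zero_add]
    simp only [D]
    rw [if_neg (by omega), if_neg (by omega), mul_zero]
  have e0 : ∑ k ∈ Finset.range N, D 0 k = D 0 0 + D 0 1 := by
    rw [hN, Finset.sum_range_succ', Finset.sum_range_succ']
    rw [Finset.sum_eq_zero fun k _ ↦ ?_, zero_add, add_comm]
    simp only [D]
    rw [if_neg (by omega), if_neg (by omega), mul_zero]
  rw [Finset.sum_eq_zero fun j _ ↦ e2 j, e1, e0, zero_add, map_add, map_add]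
  have d00 : D 0 0 = L (scalarPart 0 (dE (body Φ) c)) := by
    simp only [D]
    rw [(hasDerivAt_taylorTerm_zero hc Φ L).deriv]
    simp
  have d10 : D 1 0 = L (∑ i ∈ evenIdx Φ, elt i * scalarPart 0 (dE (evenPart (coef Φ i)) c)) := by
    simp [D, taylorTerm, wordSum]
  have d01 : D 0 1 = L (∑ i ∈ oddIdx Φ, elt i * scalarPart 0 (dO (oddPart (coef Φ i)) c)) := by
    simp [D, taylorTerm, wordSum]
  rw [d00, d10, d01]
  ring

/-- At the origin only the constant component contributes. -/
theorem eval_at_zero (hc : IsSmoothAlt c) :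
    eval c (0 : 𝒞) = algebraMap ℂ Grassmann (c 0 0 Fin.elim0) := by
  rw [eval_eq_fullExp hc 0 le_rfl]
  have h1 : evenIdx (0 : 𝒞) = ∅ := rfl
  have h2 : oddIdx (0 : 𝒞) = ∅ := rfl
  have h3 : numGen (0 : 𝒞) = 0 := rfl
  have h4 : body (0 : 𝒞) = 0 := rfl
  simp only [fullExp, h1, h3, h4, expSum, Nat.reduceAdd, Finset.range_one, Finset.sum_singleton,
    wordSum, oddExp, Nat.factorial_zero, Nat.cast_one, inv_one, one_smul, scalarPart]

/-- A functional that is homogeneous of degree one is, on points, its linearization at `0`. -/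
theorem eval_eq_sum_of_homogeneous (hc : IsSmoothAlt c) {Φ : 𝒞} (hΦ : IsPoint Φ)
    (h : ∀ t : ℝ, t ≠ 0 → eval c (t • Φ) = (t : ℂ) • eval c Φ) :
    eval c Φ = Φ.sum fun I z ↦
      θ I * (eval (dT z.1 c) 0 + Complex.I • eval (dT z.2 c) 0) := by
  have hE (e : ℰ) : eval (dE e c) (0 : 𝒞) = scalarPart 0 (dE e c) :=
    eval_at_zero (hc.stable_dE e)
  have hO (o : 𝒪) : eval (dO o c) (0 : 𝒞) = scalarPart 0 (dO o c) :=
    eval_at_zero (hc.stable_dO o)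
  rw [eval_eq_of_homogeneous hc Φ h]
  simp only [← hE, ← hO]
  simp only [evenIdx, oddIdx, Finset.sum_product, Fintype.sum_bool, Finset.sum_filter,
    ← Finset.sum_add_distrib]
  have hsum : (Φ.sum fun I z ↦ θ I * (eval (dT z.1 c) 0 + Complex.I • eval (dT z.2 c) 0)) =
      (∑ I ∈ Φ.support, if I = ∅ then eval (dE (body Φ) c) 0 else 0) +
      ∑ I ∈ Φ.support, if I = ∅ then 0 else
        θ I * (eval (dT (Φ I).1 c) 0 + Complex.I • eval (dT (Φ I).2 c) 0) := by
    rw [Finsupp.sum, ← Finset.sum_add_distrib]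
    refine Finset.sum_congr rfl fun I _ ↦ ?_
    split_ifs with hI
    · subst hI
      have h1 : oddPart (Φ ∅).1 = 0 := (hΦ.1 ∅ (by simp)).1
      have h2 : evenPart (Φ ∅).1 = body Φ :=
        Prod.ext rfl (congrArg (fun z : 𝒜 ↦ z.2) hΦ.2.2.2)
      rw [hΦ.2.2.1, dT_of_oddPart hc h1, h2, eval_dT_zero hc, smul_zero, add_zero, θ_empty,
        one_mul]
    · rw [zero_add]
  have hbody : (∑ I ∈ Φ.support, if I = ∅ then eval (dE (body Φ) c) 0 else 0) =
      eval (dE (body Φ) c) 0 := by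
    rw [Finset.sum_ite_eq']
    split_ifs with hm
    · rfl
    · have h1 : body Φ = 0 := by
        rw [body, Finsupp.notMem_support_iff.1 hm]; rfl
      rw [h1, hc.dE_zero, eval_zero]
  rw [hsum, hbody]
  congr 1
  refine Finset.sum_congr rfl fun I _ ↦ ?_
  have e1 : elt (I, true) = Complex.I • θ I := rfl
  have e2 : elt (I, false) = θ I := one_smul ℂ _
  have e3 : coef Φ (I, true) = (Φ I).2 := rfl
  have e4 : coef Φ (I, false) = (Φ I).1 := rfl
  rw [e1, e2, e3, e4, smul_mul_assoc, smul_mul_assoc, mul_add, mul_smul_comm]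
  rcases Nat.even_or_odd I.card with hI | hI
  · rw [dT_of_oddPart hc (hΦ.1 I hI).1, dT_of_oddPart hc (hΦ.1 I hI).2,
      if_neg (Nat.not_odd_iff_even.2 hI), add_zero]
    rcases I.eq_empty_or_nonempty with hne | hne
    · rw [if_neg (fun h' ↦ h'.1.ne_empty hne), if_pos hne]
    · rw [if_pos ⟨hne, hI⟩, if_neg hne.ne_empty, add_comm]
  · have hne : I.Nonempty := Finset.card_pos.1 hI.pos
    rw [dT_of_evenPart hc (hΦ.2.1 I hI).1, dT_of_evenPart hc (hΦ.2.1 I hI).2, if_pos hI,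
      if_neg (fun h' ↦ Nat.not_even_iff_odd.2 hI h'.2), zero_add, if_neg hne.ne_empty, add_comm]

end TaylorZero

/-! ### Quadratic local functionals have linear variations -/

section Quadratic

variable {c : Components d F₀ E₀ F₁ E₁}

/-- A pure direction is multiplied by one or by two new generators to give an even increment. -/
theorem IsPure.exists_generators {w : 𝒯} (hw : IsPure w) :
    ∃ η : ℕ → Finset ℕ, (∀ n, n ∈ η n) ∧ (∀ n, ∀ i ∈ η n, n ≤ i) ∧
      ∀ n, (Even (η n).card ∧ oddPart w = 0) ∨ (Odd (η n).card ∧ evenPart w = 0) := by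
  rcases hw with hw | hw
  · exact ⟨fun n ↦ {n, n + 1}, by simp, by simp, fun n ↦ Or.inl ⟨by simp, hw⟩⟩
  · exact ⟨fun n ↦ {n}, by simp, by simp, fun n ↦ Or.inr ⟨by simp, hw⟩⟩

/-- Every multiplet is the sum of a multiplet with only even and one with only odd components. -/
theorem exists_pure_add (w : 𝒯) :
    ∃ w₀ w₁, w = w₀ + w₁ ∧ oddPart w₀ = 0 ∧ evenPart w₁ = 0 ∧
      totSupp w₀ ⊆ totSupp w ∧ totSupp w₁ ⊆ totSupp w := by
  refine ⟨((w.1.1, 0), (0, w.2.2)), ((0, w.1.2), (w.2.1, 0)), by simp, rfl, rfl,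
    totSupp_subset (isClosed_totSupp w) fun x hx ↦ ?_,
    totSupp_subset (isClosed_totSupp w) fun x hx ↦ ?_⟩ <;>
  obtain ⟨h1, h2, h3, h4⟩ := apply_eq_zero_of_notMem_totSupp hx
  · exact ⟨h1, rfl, rfl, h4⟩
  · exact ⟨rfl, h2, h3, rfl⟩

theorem cxPairing_smul_left (a : ℝ) (w : 𝒯) (z : Cx 𝒟) :
    cxPairing μ (a • w) z = a * cxPairing μ w z := by
  apply Complex.ext
  · simp [cxPairing_re, pairing_smul_left]
  · simp [cxPairing_im, pairing_smul_left]

theorem eval_dT_smul (hμ : IsSmoothDensity d μ) (hc : IsLocal μ c) (a : ℝ)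
    (w : 𝒯) (Φ : 𝒞) :
    eval (dT (a • w) c) Φ = (a : ℂ) • eval (dT w c) Φ := by
  refine ext_coeffAt fun I ↦ ?_
  rw [map_smul, (variation_spec hμ hc Φ).2 w, (variation_spec hμ hc Φ).2 (a • w),
    coeffAt_grPairing, coeffAt_grPairing, cxPairing_smul_left, smul_eq_mul]

/-- The derivatives of a quadratic functional are homogeneous of degree one. -/
theorem eval_dT_smul_conf (hμ : IsSmoothDensity d μ) (hc : IsLocal μ c)
    (hq : IsQuadratic (eval c)) {Φ : 𝒞} (hΦ : IsPoint Φ) {a : ℝ} (ha : a ≠ 0)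
    (w : 𝒯) : eval (dT w c) (a • Φ) = (a : ℂ) • eval (dT w c) Φ := by
  have := hμ.isLocallyFiniteMeasure
  have hs := hc.isSmoothAlt
  have key (w : 𝒯) (hw : IsPure w) :
      eval (dT w c) (a • Φ) = (a : ℂ) • eval (dT w c) Φ := by
    obtain ⟨η, hη, hη', hp⟩ := hw.exists_generators
    refine sub_eq_zero.1 (eventually_θ_mul_cancel η hη' (Eventually.frequently ?_))
    filter_upwards [eventually_isFresh Φ, eventually_isFresh (a • Φ)] with n hn hn'
    have h1 := hq _ (hΦ.add_single ⟨n, hη n⟩ (hp n)) a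
    have h2 : a • Finsupp.single (η n) ((w, 0) : Cx 𝒯) =
        Finsupp.single (η n) (a • w, 0) := by
      rw [Finsupp.smul_single, Prod.smul_mk, smul_zero]
    rw [smul_add, h2, eval_add_single hs hn' (hη n) (w := a • w), eval_add_single hs hn (hη n) (hp n),
      hq Φ hΦ a, smul_add, add_right_inj, eval_dT_smul hμ hc, mul_smul_comm, sq, mul_smul] at h1
    · have h3 := smul_right_injective _ (Complex.ofReal_ne_zero.2 ha) h1
      rw [mul_sub, h3, mul_smul_comm, sub_self]
    · rcases hp n with ⟨h, h'⟩ | ⟨h, h'⟩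
      · exact Or.inl ⟨h, by rw [oddPart_smul, h', smul_zero]⟩
      · exact Or.inr ⟨h, by rw [evenPart_smul, h', smul_zero]⟩
  obtain ⟨w₀, w₁, rfl, h0, h1, -, -⟩ := exists_pure_add w
  rw [eval_dT_add hs, eval_dT_add hs, key w₀ (Or.inl h0), key w₁ (Or.inr h1), smul_add]

/-! #### Locality of the derivatives -/

theorem evJet_of_eventually {r : ℕ} {x : M} {v : ℰ}
    (h : ∀ᶠ y in 𝓝 x, v.1 y = 0 ∧ v.2 y = 0) : EvJet r x v 0 :=
  ⟨sameJet_of_eventuallyEq r (h.mono fun _ hy ↦ hy.1),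
    sameJet_of_eventuallyEq r (h.mono fun _ hy ↦ hy.2)⟩

theorem odJet_of_eventually {r : ℕ} {x : M} {v : 𝒪}
    (h : ∀ᶠ y in 𝓝 x, v.1 y = 0 ∧ v.2 y = 0) : OdJet r x v 0 :=
  ⟨sameJet_of_eventuallyEq r (h.mono fun _ hy ↦ hy.1),
    sameJet_of_eventuallyEq r (h.mono fun _ hy ↦ hy.2)⟩

theorem dT_zero_arg (w : 𝒯) : dT w (0 : 𝒦) = 0 := by
  ext k v w'
  change deriv (fun _ ↦ (0 : ℂ)) 0 + 0 = 0
  rw [deriv_const, add_zero]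

theorem IsLocalDensity.dT_eq_zero {K : Set M} {r : ℕ} {ℓ : M → 𝒦}
    (h : IsLocalDensity K r ℓ) {w : 𝒯} {x : M} (hx : x ∉ totSupp w) :
    dT w (ℓ x) = 0 := by
  have h0 : ∀ᶠ y in 𝓝 x, y ∉ totSupp w := (isClosed_totSupp w).isOpen_compl.mem_nhds hx
  have he : EvJet r x (evenPart w) 0 := evJet_of_eventually <| h0.mono fun y hy ↦ by
    obtain ⟨h1, h2, h3, h4⟩ := apply_eq_zero_of_notMem_totSupp hy
    exact ⟨h1, h4⟩
  have ho : OdJet r x (oddPart w) 0 := odJet_of_eventually <| h0.mono fun y hy ↦ by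
    obtain ⟨h1, h2, h3, h4⟩ := apply_eq_zero_of_notMem_totSupp hy
    exact ⟨h2, h3⟩
  have h1 : dE (evenPart w) (ℓ x) = 0 := by
    ext k v w'
    have h2 (τ : ℝ) : ℓ x k (v + τ • evenPart w) w' = ℓ x k v w' := by
      refine h.jet x _ _ _ _ _ ?_ fun i ↦ OdJet.refl r x _
      simpa using (EvJet.refl r x v).add (he.smul τ)
    change deriv _ 0 = 0
    simp [h2]
  have h2 : dO (oddPart w) (ℓ x) = 0 := by
    rw [← (h.isSmoothAlt x).dO_zero]
    ext k v w'
    exact h.jet x _ _ _ _ _ (EvJet.refl r x v) fun i ↦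
      Fin.cases ho (fun i ↦ OdJet.refl r x _) i
  rw [dT, h1, h2, add_zero]

theorem IsLocalDensity.dT_integral [IsLocallyFiniteMeasure μ] {K : Set M} {r : ℕ}
    {ℓ : M → 𝒦} (hK : IsCompact K) (h : IsLocalDensity K r ℓ)
    (w : 𝒯) :
    dT w (fun k v w ↦ ∫ x, ℓ x k v w ∂μ) = fun k v w' ↦ ∫ x, dT w (ℓ x) k v w' ∂μ := by
  ext k v w'
  refine (congrArg₂ (· + ·) (h.dE_integral hK _ k v w') rfl).trans
    (integral_add ((h.stable_dE _).integrable hK k v w') ((h.stable_dO _).integrable hK k v w')).symm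

theorem IsLocalDensity.stable_dT {K : Set M} {r : ℕ} {ℓ : M → 𝒦}
    (h : IsLocalDensity K r ℓ) (w : 𝒯) :
    IsLocalDensity (K ∪ K) (max r r) fun x ↦ dT w (ℓ x) :=
  (h.stable_dE _).add (h.stable_dO _)

/-- Mixed derivatives in directions with disjoint supports vanish. -/
theorem IsLocal.dT_dT_eq_zero [IsLocallyFiniteMeasure μ] (hc : IsLocal μ c)
    {z w : 𝒯} (h : Disjoint (totSupp z) (totSupp w)) : dT z (dT w c) = 0 := by
  obtain ⟨K, r, ℓ, hK, hℓ, hi⟩ := isLocal_iff.1 hc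
  obtain rfl : c = fun k v w ↦ ∫ x, ℓ x k v w ∂μ := by ext k v w; exact hi k v w
  rw [hℓ.dT_integral hK, (hℓ.stable_dT w).dT_integral (hK.union hK)]
  have h1 (x : M) : dT z (dT w (ℓ x)) = 0 := by
    by_cases hx : x ∈ totSupp z
    · rw [hℓ.dT_eq_zero fun hx' ↦ h.le_bot ⟨hx, hx'⟩, dT_zero_arg]
    · exact (hℓ.stable_dT w).dT_eq_zero hx
  funext k v w'
  have h2 (x : M) : dT z (dT w (ℓ x)) k v w' = 0 := by rw [h1 x, Pi.zero_apply, Pi.zero_apply,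
    Pi.zero_apply]
  exact (integral_congr_ae (Eventually.of_forall h2)).trans (integral_zero M ℂ)

/-! #### The Hessian at the origin -/

/-- A complex linear differential operator, in the sense that supports do not grow. -/
structure IsLocalOp (h : Cx 𝒯 →ₗ[ℝ] Cx 𝒟) : Prop where
  mulI : ∀ z, h (Cx.mulI z) = Cx.mulI (h z)
  off : ∀ z, CxDerOff (totSupp z.1 ∪ totSupp z.2) (h z)

theorem dT_smul (hc : IsSmoothAlt c) (a : ℝ) (w : 𝒯) :
    dT (a • w) c = a • dT w c := by
  ext k v w'
  change dE _ c k v w' + dO _ c k v w' = a • (dE _ c k v w' + dO _ c k v w')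
  rw [evenPart_smul, oddPart_smul, hc.dE_smul, hc.dO_smul, smul_add]

theorem exists_hessian_repr (hμ : IsSmoothDensity d μ) (hc : IsLocal μ c)
    (z : 𝒯) : ∃ u : Cx 𝒟,
      ∀ w, dT z (dT w c) 0 0 Fin.elim0 = cxPairing μ w u := by
  have := hμ.isLocallyFiniteMeasure
  obtain ⟨U, -, h⟩ := exists_grPairing (eval_dT_dT_represented hμ hc 0 z)
  refine ⟨U ∅, fun w ↦ ?_⟩
  have h1 := congrArg (coeffAt ∅) (h w)
  rw [coeffAt_grPairing] at h1
  rw [← h1, eval_at_zero ((hc.stable_dT w).stable_dT z).isSmoothAlt,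
    Algebra.algebraMap_eq_smul_one, map_smul, ← θ_empty, coeffAt_θ, if_pos rfl, smul_eq_mul,
    mul_one]

/-- The Hessian at the origin is represented by a complex linear differential operator. -/
theorem exists_hessian (hμ : IsSmoothDensity d μ) (hc : IsLocal μ c) :
    ∃ h : Cx 𝒯 →ₗ[ℝ] Cx 𝒟, IsLocalOp h ∧
      ∀ z w, IsCompact (totSupp w) → cxPairing μ w (h z) =
        dT z.1 (dT w c) 0 0 Fin.elim0 + Complex.I * dT z.2 (dT w c) 0 0 Fin.elim0 := by
  have := hμ.isLocallyFiniteMeasure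
  choose H hH using exists_hessian_repr hμ hc
  have hs (w : 𝒯) := (hc.stable_dT w).isSmoothAlt
  have hadd (z z' : 𝒯) : H (z + z') = H z + H z' :=
    eq_of_cxPairing_eq hμ fun w hw _ ↦ by
      rw [cxPairing_add_right hw, ← hH, ← hH, ← hH, dT_add (hs w)]; rfl
  have hsmul (a : ℝ) (z : 𝒯) : H (a • z) = a • H z :=
    eq_of_cxPairing_eq hμ fun w hw _ ↦ by
      rw [cxPairing_smul_right, ← hH, ← hH, dT_smul (hs w)]
      simp only [Pi.smul_apply, Complex.real_smul]
  let Hl : 𝒯 →ₗ[ℝ] Cx 𝒟 :=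
    { toFun := H, map_add' := hadd, map_smul' := hsmul }
  let J : Cx 𝒟 →ₗ[ℝ] Cx 𝒟 :=
    { toFun := Cx.mulI
      map_add' := fun a b ↦ Prod.ext (neg_add _ _) rfl
      map_smul' := fun a b ↦ Prod.ext (smul_neg _ _).symm rfl }
  have hoff (z : 𝒯) : CxDerOff (totSupp z) (H z) := by
    have := cxDerOff_of_cxPairing_eq_zero hμ (isClosed_totSupp z).isOpen_compl (z := H z)
      fun w _ hw _ ↦ by
        rw [← hH, hc.dT_dT_eq_zero (disjoint_left.2 fun x hx hx' ↦ hw hx' hx)]; rfl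
    rwa [compl_compl] at this
  refine ⟨Hl.coprod (J ∘ₗ Hl), ⟨fun z ↦ ?_, fun z ↦ ?_⟩, fun z w hw ↦ ?_⟩
  · change Hl (-z.2) + J (Hl z.1) = J (Hl z.1 + J (Hl z.2))
    have hJ (u) : J (J u) = -u := Prod.ext rfl rfl
    rw [map_add, hJ, map_neg, add_comm]
  · exact ((hoff z.1).mono subset_union_left).add ((hoff z.2).mono subset_union_right).mulI
  · change cxPairing μ w (H z.1 + Cx.mulI (H z.2)) = _
    rw [cxPairing_add_right hw, cxPairing_mulI_right, hH, hH]

/-- The variation of a quadratic local functional is linear: it is homogeneous of degree one in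
the field, hence equal to its derivative at the origin. -/
theorem exists_linear_variation (hμ : IsSmoothDensity d μ) (hc : IsLocal μ c)
    (hq : IsQuadratic (eval c)) :
    ∃ h : Cx 𝒯 →ₗ[ℝ] Cx 𝒟, IsLocalOp h ∧
      ∀ Φ, IsPoint Φ → ∀ I, variation μ c Φ I = h (Φ I) := by
  have := hμ.isLocallyFiniteMeasure
  obtain ⟨h, hl, hh⟩ := exists_hessian hμ hc
  refine ⟨h, hl, fun Φ hΦ I ↦ eq_of_cxPairing_eq hμ fun w hw _ ↦ ?_⟩
  have hs := ((hc.stable_dT w).isSmoothAlt)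
  rw [← coeffAt_grPairing, ← (variation_spec hμ hc Φ).2, hh _ _ hw,
    eval_eq_sum_of_homogeneous hs hΦ fun t ht ↦ eval_dT_smul_conf hμ hc hq hΦ ht w]
  have h0 (z : 𝒯) : eval (dT z (dT w c)) 0 =
      algebraMap ℂ Grassmann (dT z (dT w c) 0 0 Fin.elim0) :=
    eval_at_zero (BV.stable_dT hs z)
  have h1 (J : Finset ℕ) (a b : ℂ) : coeffAt I (θ J * (algebraMap ℂ Grassmann a +
      Complex.I • algebraMap ℂ Grassmann b)) = if J = I then a + Complex.I * b else 0 := by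
    rw [Algebra.algebraMap_eq_smul_one, Algebra.algebraMap_eq_smul_one, smul_smul, ← add_smul,
      mul_smul_comm, mul_one, map_smul, coeffAt_θ]
    split_ifs <;> simp
  rw [Finsupp.sum, map_sum]
  simp only [h0, h1]
  rw [Finset.sum_ite_eq']
  split_ifs with hI
  · rfl
  · rw [Finsupp.notMem_support_iff.1 hI]
    simp only [Prod.fst_zero, Prod.snd_zero, dT_zero hs]
    simp

end Quadratic

/-! ### Linear variations of quadratic Lagrangians -/

section Lagrangian

theorem exists_test (x : M) {O : Set M} (hO : IsOpen O) (hx : x ∈ O) :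
    ∃ f : M → ℝ, IsTest d f ∧ tsupport f ⊆ O ∧ ∀ᶠ y in 𝓝 x, f y = 1 := by
  obtain ⟨χ, hχO, hχc, hχ1⟩ := exists_cutoff (d := d) (isCompact_singleton (x := x)) hO
    (singleton_subset_iff.2 hx)
  exact ⟨χ, ⟨χ.contMDiff, hχc⟩, hχO, hχ1 x rfl⟩

theorem IsTest.add {f g : M → ℝ} (hf : IsTest d f) (hg : IsTest d g) : IsTest d (f + g) :=
  ⟨hf.1.add hg.1, hf.2.add hg.2⟩

theorem IsTest.neg {f : M → ℝ} (hf : IsTest d f) : IsTest d (-f) :=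
  ⟨hf.1.neg, hf.2.of_isClosed_subset (isClosed_tsupport _) (by rw [tsupport_neg])⟩

theorem CxDerOff.of_forall {K : Set M} {u : Cx 𝒟}
    (h : ∀ x ∉ K, CxDerOff {x}ᶜ u) : CxDerOff K u :=
  ⟨fun x hx ↦ (h x hx).1 x (by simp), fun x hx ↦ (h x hx).2 x (by simp)⟩

theorem CxDerOff.at {K : Set M} {u : Cx 𝒟} (h : CxDerOff K u) {x : M}
    (hx : x ∉ K) : CxDerOff {x}ᶜ u := h.mono (subset_compl_singleton_iff.2 hx)

theorem eq_of_forall_cxDerOff {u v : Cx 𝒟} (h : ∀ x, CxDerOff {x}ᶜ (u - v)) :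
    u = v := sub_eq_zero.1 (CxDerOff.of_forall fun x _ ↦ h x).eq_zero

/-- Locally compatible sections can be glued. -/
theorem exists_glued_section {F : Type*} [NormedAddCommGroup F] [NormedSpace ℝ F] {E : M → Type*}
    [TopologicalSpace (TotalSpace F E)] [∀ x, TopologicalSpace (E x)] [∀ x, AddCommGroup (E x)]
    [∀ x, Module ℝ (E x)] [FiberBundle F E] [VectorBundle ℝ F E] (σ : M → Sec d F E)
    (h : ∀ x, ∀ᶠ y in 𝓝 x, σ y y = σ x y) : ∃ s : Sec d F E, ∀ x, s x = σ x x :=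
  ⟨⟨fun x ↦ σ x x, fun x ↦ (σ x).contMDiff.contMDiffAt.congr_of_eventuallyEq <|
    (h x).mono fun y hy ↦ congrArg (TotalSpace.mk' F y) hy⟩, fun _ ↦ rfl⟩

/-- Sections `u x` glue if `u x` and `u y` have the same value at `y`, for `y` near `x`. -/
theorem exists_glued_der (u : M → 𝒟)
    (h : ∀ x, ∀ᶠ y in 𝓝 x, DerOff {y}ᶜ (u y - u x)) :
    ∃ s : 𝒟, ∀ x, DerOff {x}ᶜ (s - u x) := by
  have h' (x : M) := (h x).mono fun y hy ↦ hy y (by simp)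
  obtain ⟨s₁, h1⟩ := exists_glued_section (fun x ↦ (u x).1.1)
    fun x ↦ (h' x).mono fun y hy ↦ sub_eq_zero.1 hy.1
  obtain ⟨s₂, h2⟩ := exists_glued_section (fun x ↦ (u x).1.2)
    fun x ↦ (h' x).mono fun y hy ↦ sub_eq_zero.1 hy.2.1
  obtain ⟨s₃, h3⟩ := exists_glued_section (fun x ↦ (u x).2.1)
    fun x ↦ (h' x).mono fun y hy ↦ sub_eq_zero.1 hy.2.2.1
  obtain ⟨s₄, h4⟩ := exists_glued_section (fun x ↦ (u x).2.2)
    fun x ↦ (h' x).mono fun y hy ↦ sub_eq_zero.1 hy.2.2.2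
  refine ⟨((s₁, s₂), (s₃, s₄)), fun x y hy ↦ ?_⟩
  obtain rfl : y = x := by simpa using hy
  exact ⟨sub_eq_zero.2 (h1 y), sub_eq_zero.2 (h2 y), sub_eq_zero.2 (h3 y), sub_eq_zero.2 (h4 y)⟩

theorem exists_glued_cx (u : M → Cx 𝒟)
    (h : ∀ x, ∀ᶠ y in 𝓝 x, CxDerOff {y}ᶜ (u y - u x)) :
    ∃ s : Cx 𝒟, ∀ x, CxDerOff {x}ᶜ (s - u x) := by
  obtain ⟨s, hs⟩ := exists_glued_der (fun x ↦ (u x).1) fun x ↦ (h x).mono fun y hy ↦ hy.1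
  obtain ⟨t, ht⟩ := exists_glued_der (fun x ↦ (u x).2) fun x ↦ (h x).mono fun y hy ↦ hy.2
  exact ⟨(s, t), fun x ↦ ⟨hs x, ht x⟩⟩

/-- Every complex multiplet is made of coefficients of a `Λ`-point. -/
theorem exists_isPoint_add (z : Cx 𝒯) :
    ∃ Φ : 𝒞, IsPoint Φ ∧ z = Φ {0, 1} + Φ {0} := by
  have hne : ({0, 1} : Finset ℕ) ≠ {0} := by decide
  refine ⟨Finsupp.single {0, 1} (((z.1.1.1, 0), (0, z.1.2.2)), ((z.2.1.1, 0), (0, z.2.2.2))) +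
    Finsupp.single {0} (((0, z.1.1.2), (z.1.2.1, 0)), ((0, z.2.1.2), (z.2.2.1, 0))),
    ⟨fun I hI ↦ ?_, fun I hI ↦ ?_, ?_, ?_⟩, ?_⟩
  · have h1 : ({0} : Finset ℕ) ≠ I := by rintro rfl; simp at hI
    rw [Finsupp.add_apply, Finsupp.single_eq_of_ne h1.symm, add_zero]
    rcases eq_or_ne ({0, 1} : Finset ℕ) I with rfl | h2
    · rw [Finsupp.single_eq_same]; exact ⟨rfl, rfl⟩
    · rw [Finsupp.single_eq_of_ne h2.symm]; exact ⟨rfl, rfl⟩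
  · have h1 : ({0, 1} : Finset ℕ) ≠ I := by
      rintro rfl
      exact absurd hI (by decide)
    rw [Finsupp.add_apply, Finsupp.single_eq_of_ne h1.symm, zero_add]
    rcases eq_or_ne ({0} : Finset ℕ) I with rfl | h2
    · rw [Finsupp.single_eq_same]; exact ⟨rfl, rfl⟩
    · rw [Finsupp.single_eq_of_ne h2.symm]; exact ⟨rfl, rfl⟩
  · rw [Finsupp.add_apply, Finsupp.single_eq_of_ne (by decide), Finsupp.single_eq_of_ne (by decide),
      add_zero]
    rfl
  · rw [Finsupp.add_apply, Finsupp.single_eq_of_ne (by decide), Finsupp.single_eq_of_ne (by decide),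
      add_zero]
    rfl
  · rw [Finsupp.add_apply, Finsupp.add_apply, Finsupp.single_eq_same, Finsupp.single_eq_same,
      Finsupp.single_eq_of_ne hne, Finsupp.single_eq_of_ne hne.symm, add_zero, zero_add]
    simp

/-- Outside its support, a functional does not react to nilpotent increments. -/
theorem exists_nhds_of_notMem_fsupp {F : ℱ} {x : M} (hx : x ∉ fsupp F) :
    ∃ O : Set M, IsOpen O ∧ x ∈ O ∧ ∀ Φ, IsPoint Φ → ∀ (w : 𝒯) (η : Finset ℕ),
      η.Nonempty → ((Even η.card ∧ oddPart w = 0) ∨ (Odd η.card ∧ evenPart w = 0)) →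
      totSupp w ⊆ O → F (Φ + Finsupp.single η (w, 0)) = F Φ := by
  simp only [fsupp, mem_ofPred_eq, not_forall, not_exists, not_and, not_not] at hx
  obtain ⟨U, hU, h⟩ := hx
  obtain ⟨O, hOU, hO, hxO⟩ := mem_nhds_iff.1 hU
  refine ⟨O, hO, hxO, fun Φ hΦ w η hη hw hwO ↦ h Φ _ hΦ ?_ fun I ↦ ?_⟩
  · simpa using isPoint_zero.add_single hη hw
  · have h0 : totSupp (0 : 𝒯) ⊆ U := by simp [totSupp, supp_zero]
    rcases eq_or_ne I η with rfl | hI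
    · rw [Finsupp.single_eq_same]
      exact ⟨hwO.trans hOU, h0⟩
    · rw [Finsupp.single_eq_of_ne hI]
      exact ⟨h0, h0⟩

/-- Where two cutoff functions are equal to one, the functionals that they define have the same
derivatives. -/
theorem sub_eq_zero_of_additivity {A : Type*} [AddCommGroup A] {a b c d e : A}
    (h : a - (b + c) + (d + e) = a - b + d) : c - e = 0 := by
  have h1 : c - e = (a - b + d) - (a - (b + c) + (d + e)) := by abel
  rw [h1, h, sub_self]

/-- By additivity and locality, the derivatives of a Lagrangian for two cutoffs agree where both
are `1`. -/
theorem IsGenLagrangian.eval_dT_eq (hμ : IsSmoothDensity d μ)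
    {L : (M → ℝ) → ℱ} (hL : IsGenLagrangian μ L) {f f' : M → ℝ}
    (hf : IsTest d f) (hf' : IsTest d f') {O : Set M} (hO : IsOpen O) (h1 : ∀ x ∈ O, f x = 1)
    (h1' : ∀ x ∈ O, f' x = 1) {c c' : 𝒦} (hc : IsLocal μ c)
    (hc' : IsLocal μ c') (hfc : L f = eval c) (hfc' : L f' = eval c') {x : M} (hx : x ∈ O) :
    ∃ O' : Set M, IsOpen O' ∧ x ∈ O' ∧ ∀ Φ, IsPoint Φ → ∀ w : 𝒯, IsPure w →
      totSupp w ⊆ O' → eval (dT w c) Φ = eval (dT w c') Φ := by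
  have := hμ.isLocallyFiniteMeasure
  obtain ⟨χ, hχ, hχO, hχ1⟩ := exists_test (d := d) x hO hx
  have hdisj : tsupport (-χ) ∩ tsupport (f' + -f) = ∅ := by
    rw [tsupport_neg]
    refine disjoint_iff_inter_eq_empty.1 (disjoint_left.2 fun y hy hy' ↦ ?_)
    have hs : Function.support (f' + -f) ⊆ Oᶜ := fun y hy hyO ↦
      hy (by simp [h1 y hyO, h1' y hyO])
    exact closure_minimal hs hO.isClosed_compl hy' (hχO hy)
  have hadd := hL.additive (-χ) f (f' + -f) hχ.neg hf (hf'.add hf.neg) hdisj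
  rw [add_assoc, show f + (f' + -f) = f' by abel] at hadd
  have hoff {g : M → ℝ} (hg : IsTest d g) (hg1 : ∀ y ∈ O, g y = 1) : x ∉ fsupp (L (-χ + g)) := by
    refine fun hx' ↦ notMem_tsupport_iff_eventuallyEq.2 ?_ (hL.support _ (hχ.neg.add hg) hx')
    filter_upwards [hχ1, hO.mem_nhds hx] with y hy hyO
    simp [hy, hg1 y hyO]
  obtain ⟨O₁, hO₁, hx₁, H₁⟩ := exists_nhds_of_notMem_fsupp (hoff hf h1)
  obtain ⟨O₂, hO₂, hx₂, H₂⟩ := exists_nhds_of_notMem_fsupp (hoff hf' h1')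
  refine ⟨O₁ ∩ O₂, hO₁.inter hO₂, ⟨hx₁, hx₂⟩, fun Φ hΦ w hw hwO ↦ ?_⟩
  obtain ⟨η, hη, hη', hp⟩ := hw.exists_generators
  refine sub_eq_zero.1 (eventually_θ_mul_cancel η hη' (Eventually.frequently ?_))
  filter_upwards [eventually_isFresh Φ] with n hn
  have e1 := hadd _ (hΦ.add_single ⟨n, hη n⟩ (hp n))
  have e2 := hadd _ hΦ
  rw [H₁ Φ hΦ w (η n) ⟨n, hη n⟩ (hp n) (hwO.trans inter_subset_left),
    H₂ Φ hΦ w (η n) ⟨n, hη n⟩ (hp n) (hwO.trans inter_subset_right), hfc, hfc',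
    eval_add_single hc.isSmoothAlt hn (hη n) (hp n),
    eval_add_single hc'.isSmoothAlt hn (hη n) (hp n)] at e1
  rw [hfc, hfc', e1] at e2
  rw [mul_sub]
  exact sub_eq_zero_of_additivity e2

/-- The complex linear operator `h` gives the variations `δ_l L/δ(φ, φ‡) = h (φ, φ‡)` of a quadratic
Lagrangian; the variations of `L f` are given by operators that agree with `h` where `f = 1`. -/
structure IsHessian (μ : Measure M) (L : (M → ℝ) → ℱ)
    (h : Cx 𝒯 →ₗ[ℝ] Cx 𝒟) : Prop where
  isLocalOp : IsLocalOp h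
  exists_cutoff : ∀ f, IsTest d f → ∀ c, IsLocal μ c → L f = eval c →
    ∃ h' : Cx 𝒯 →ₗ[ℝ] Cx 𝒟, IsLocalOp h' ∧
      (∀ Φ, IsPoint Φ → ∀ I, variation μ c Φ I = h' (Φ I)) ∧
      ∀ O, IsOpen O → (∀ x ∈ O, f x = 1) → ∀ z, CxDerOff Oᶜ (h z - h' z)

/-- The linear variations for two cutoffs agree where both cutoffs are `1`. -/
theorem IsGenLagrangian.cxDerOff_sub (hμ : IsSmoothDensity d μ)
    {L : (M → ℝ) → ℱ} (hL : IsGenLagrangian μ L) {f f' : M → ℝ}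
    (hf : IsTest d f) (hf' : IsTest d f') {O : Set M} (hO : IsOpen O) (h1 : ∀ x ∈ O, f x = 1)
    (h1' : ∀ x ∈ O, f' x = 1) {c c' : 𝒦} (hc : IsLocal μ c)
    (hc' : IsLocal μ c') (hfc : L f = eval c) (hfc' : L f' = eval c')
    {h h' : Cx 𝒯 →ₗ[ℝ] Cx 𝒟}
    (hh : ∀ Φ, IsPoint Φ → ∀ I, variation μ c Φ I = h (Φ I))
    (hh' : ∀ Φ, IsPoint Φ → ∀ I, variation μ c' Φ I = h' (Φ I)) (z : Cx 𝒯) :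
    CxDerOff Oᶜ (h z - h' z) := by
  have := hμ.isLocallyFiniteMeasure
  refine CxDerOff.of_forall fun x hx ↦ ?_
  obtain ⟨O', hO', hxO', H⟩ := hL.eval_dT_eq hμ hf hf' hO h1 h1' hc hc' hfc hfc'
    (notMem_compl_iff.1 hx)
  obtain ⟨Φ, hΦ, rfl⟩ := exists_isPoint_add z
  have key (I : Finset ℕ) : CxDerOff O'ᶜ (h (Φ I) - h' (Φ I)) :=
    cxDerOff_of_cxPairing_eq_zero hμ hO' fun w hw hwO hp ↦ by
      rw [← hh Φ hΦ, ← hh' Φ hΦ, cxPairing_sub_right hw, ← coeffAt_grPairing, ← coeffAt_grPairing,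
        ← (variation_spec hμ hc Φ).2, ← (variation_spec hμ hc' Φ).2, H Φ hΦ w hp hwO, sub_self]
  rw [map_add, map_add, add_sub_add_comm]
  exact ((key _).add (key _)).at (notMem_compl_iff.2 hxO')

/-- The linear variations of a quadratic Lagrangian for all cutoffs glue to a Hessian. -/
theorem IsGenLagrangian.exists_isHessian (hμ : IsSmoothDensity d μ)
    {L : (M → ℝ) → ℱ} (hL : IsGenLagrangian μ L)
    (hq : ∀ f, IsTest d f → IsQuadratic (L f)) : ∃ h, IsHessian μ L h := by
  choose f hf _ hf1 using fun x : M ↦ exists_test (d := d) x isOpen_univ (mem_univ x)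
  choose c hc hfc using fun x ↦ hL.isLocal (f x) (hf x)
  choose T hT hTv using fun x ↦ exists_linear_variation hμ (hc x) (hfc x ▸ hq (f x) (hf x))
  choose O hO1 hO hxO using fun x ↦ eventually_nhds_iff.1 (hf1 x)
  have hcomp (x : M) {f' : M → ℝ} (hf' : IsTest d f') {c' : 𝒦}
      (hc' : IsLocal μ c') (hfc' : L f' = eval c')
      {T' : Cx 𝒯 →ₗ[ℝ] Cx 𝒟}
      (hT' : ∀ Φ, IsPoint Φ → ∀ I, variation μ c' Φ I = T' (Φ I)) {O' : Set M} (hO' : IsOpen O')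
      (hO1' : ∀ x ∈ O', f' x = 1) (z : Cx 𝒯) :
      CxDerOff (O x ∩ O')ᶜ (T x z - T' z) :=
    hL.cxDerOff_sub hμ (hf x) hf' ((hO x).inter hO') (fun y hy ↦ hO1 x y hy.1)
      (fun y hy ↦ hO1' y hy.2) (hc x) hc' (hfc x) hfc' (hTv x) hT' z
  choose H hH using fun z ↦ exists_glued_cx (fun x ↦ T x z) fun x ↦ by
    filter_upwards [(hO x).mem_nhds (hxO x)] with y hy
    exact (hcomp y (hf x) (hc x) (hfc x) (hTv x) (hO x) (hO1 x) z).at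
      (notMem_compl_iff.2 ⟨hxO y, hy⟩)
  have hadd (z z') : H (z + z') = H z + H z' := eq_of_forall_cxDerOff fun x ↦ by
    have h1 := (hH (z + z') x).sub ((hH z x).add (hH z' x))
    rw [map_add] at h1
    convert h1 using 1
    abel
  have hsmul (a : ℝ) (z) : H (a • z) = a • H z := eq_of_forall_cxDerOff fun x ↦ by
    have h1 := (hH (a • z) x).sub ((hH z x).smul a)
    rw [map_smul, smul_sub] at h1
    convert h1 using 1
    abel
  have hmulI (z) : H (Cx.mulI z) = Cx.mulI (H z) := eq_of_forall_cxDerOff fun x ↦ by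
    have h1 := (hH (Cx.mulI z) x).sub (hH z x).mulI
    rw [(hT x).mulI] at h1
    convert h1 using 1
    refine Prod.ext ?_ ?_ <;> simp only [Cx.mulI, Prod.fst_sub, Prod.snd_sub] <;> abel
  refine ⟨{ toFun := H, map_add' := hadd, map_smul' := hsmul }, ⟨⟨hmulI, fun z ↦ ?_⟩, ?_⟩⟩
  · refine CxDerOff.of_forall fun x hx ↦ ?_
    have h1 := (hH z x).add (((hT x).off z).at hx)
    rwa [sub_add_cancel] at h1
  · intro f' hf' c' hc' hfc'
    obtain ⟨T', hT', hTv'⟩ := exists_linear_variation hμ hc' (hfc' ▸ hq f' hf')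
    refine ⟨T', hT', hTv', fun O' hO' hO1' z ↦ CxDerOff.of_forall fun x hx ↦ ?_⟩
    have h1 := (hH z x).add ((hcomp x hf' hc' hfc' hTv' hO' hO1' z).at
      (notMem_compl_iff.2 ⟨hxO x, notMem_compl_iff.1 hx⟩))
    rwa [sub_add_sub_cancel] at h1

end Lagrangian

/-! ### Hessians of Lagrangians and the master equation -/

section MasterEquation

variable {c c' : Components d F₀ E₀ F₁ E₁}

/-- The coefficientwise extension of a complex linear operator to `Λ`-valued vectors. -/
def grMap (h : Cx 𝒯 →ₗ[ℝ] Cx 𝒟) (q : 𝒞) :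
    GrVec 𝒟 := q.mapRange h (map_zero h)

theorem grMap_apply (h : Cx 𝒯 →ₗ[ℝ] Cx 𝒟)
    (q : 𝒞) (I : Finset ℕ) : grMap h q I = h (q I) := Finsupp.mapRange_apply

theorem variation_congr (hμ : IsSmoothDensity d μ) (hc : IsLocal μ c) (hc' : IsLocal μ c')
    (h : eval c = eval c') (Φ : 𝒞) : variation μ c Φ = variation μ c' Φ :=
  (isLeftDeriv_eval hμ hc Φ).unique hμ (by rw [h]; exact isLeftDeriv_eval hμ hc' Φ)

theorem dT_add_arg (hc : IsSmoothAlt c) (hc' : IsSmoothAlt c') (w : 𝒯) :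
    dT w (c + c') = dT w c + dT w c' := by
  rw [dT, dE_add_arg hc hc', dT, dT, add_add_add_comm]
  rfl

theorem variation_add (hμ : IsSmoothDensity d μ) (hc : IsLocal μ c) (hc' : IsLocal μ c')
    (Φ : 𝒞) :
    haveI := hμ.isLocallyFiniteMeasure
    variation μ (c + c') Φ = variation μ c Φ + variation μ c' Φ := by
  have := hμ.isLocallyFiniteMeasure
  refine eq_of_grPairing_eq hμ fun w hw _ ↦ ?_
  rw [grPairing_add_right hμ hw, ← (variation_spec hμ hc Φ).2, ← (variation_spec hμ hc' Φ).2,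
    ← (variation_spec hμ (hc.add hc') Φ).2, dT_add_arg hc.isSmoothAlt hc'.isSmoothAlt,
    eval_add (hc.stable_dT w).isSmoothAlt (hc'.stable_dT w).isSmoothAlt]

theorem IsFresh.of_support_subset {W W' : Type*} [Zero W] [Zero W'] {n : ℕ} {q : GrVec W}
    {q' : GrVec W'} (h : IsFresh n q) (hs : q'.support ⊆ q.support) : IsFresh n q' :=
  fun I hI ↦ h I (hs hI)

theorem eq_of_mulRight_eq {W : Type*} [AddCommMonoid W] {n : ℕ} {q q' : GrVec W}
    (h : IsFresh n q) (h' : IsFresh n q') (he : GrVec.mulRight n q = GrVec.mulRight n q') :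
    q = q' := by
  ext1 J
  by_cases hJ : n ∈ J
  · rw [Finsupp.notMem_support_iff.1 fun h1 ↦ h.notMem h1 hJ,
      Finsupp.notMem_support_iff.1 fun h1 ↦ h'.notMem h1 hJ]
  · have h1 := DFunLike.congr_fun he (insert n J)
    rwa [mulRight_apply h, mulRight_apply h', if_pos (Finset.mem_insert_self _ _),
      if_pos (Finset.mem_insert_self _ _), Finset.erase_insert hJ] at h1

theorem mulRight_add {W : Type*} [AddCommMonoid W] (n : ℕ) (q q' : GrVec W) :
    GrVec.mulRight n (q + q') = GrVec.mulRight n q + GrVec.mulRight n q' := Finsupp.mapDomain_add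

/-- The second variation is determined by the change of the first along `q` times a new
generator. -/
theorem secondVariation_unique (hμ : IsSmoothDensity d μ) (hc : IsLocal μ c)
    (Φ : 𝒞) {q : 𝒞} (hq : IsOddConf q)
    {W : GrVec 𝒟} (h : ∀ᶠ n : ℕ in atTop,
      variation μ c (Φ + GrVec.mulRight n q) = variation μ c Φ + GrVec.mulRight n W) :
    secondVariation μ c Φ q = W := by
  obtain ⟨n, h1, h2, h3, h4⟩ := (h.and ((variation_add_mulRight hμ hc Φ hq).and
    ((eventually_isFresh (secondVariation μ c Φ q)).and (eventually_isFresh W)))).exists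
  exact eq_of_mulRight_eq h3 h4 (add_left_cancel (h2.symm.trans h1))

theorem secondVariation_add (hμ : IsSmoothDensity d μ) (hc : IsLocal μ c) (hc' : IsLocal μ c')
    (Φ : 𝒞) {q : 𝒞} (hq : IsOddConf q) :
    secondVariation μ (c + c') Φ q = secondVariation μ c Φ q + secondVariation μ c' Φ q := by
  have := hμ.isLocallyFiniteMeasure
  refine secondVariation_unique hμ (hc.add hc') Φ hq ?_
  filter_upwards [variation_add_mulRight hμ hc Φ hq, variation_add_mulRight hμ hc' Φ hq]
    with n h h'
  rw [variation_add hμ hc hc', variation_add hμ hc hc', h, h', mulRight_add, add_add_add_comm]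

theorem IsPoint.add_mulRight {Φ q : 𝒞}
    (hΦ : IsPoint Φ) (hq : IsOddConf q) {n : ℕ}
    (hn : IsFresh n q) : IsPoint (Φ + GrVec.mulRight n q) :=
  hΦ.add (hq.mulRight hn) (by rw [mulRight_apply hn, if_neg (Finset.notMem_empty n)])

/-- The second variation of a functional with linear variation is that linear operator. -/
theorem secondVariation_eq_grMap (hμ : IsSmoothDensity d μ) (hc : IsLocal μ c)
    {h : Cx 𝒯 →ₗ[ℝ] Cx 𝒟}
    (hh : ∀ Φ, IsPoint Φ → ∀ I, variation μ c Φ I = h (Φ I)) {Φ : 𝒞}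
    (hΦ : IsPoint Φ) {q : 𝒞} (hq : IsOddConf q) :
    secondVariation μ c Φ q = grMap h q := by
  refine secondVariation_unique hμ hc Φ hq ?_
  filter_upwards [eventually_isFresh q] with n hn
  ext1 I
  have hn' : IsFresh n (grMap h q) := hn.of_support_subset Finsupp.support_mapRange
  rw [hh _ (hΦ.add_mulRight hq hn), Finsupp.add_apply, Finsupp.add_apply, map_add, hh Φ hΦ,
    mulRight_apply hn, mulRight_apply hn']
  split_ifs
  · rw [grMap_apply]
  · rw [map_zero]

theorem secondVariation_add_right (hμ : IsSmoothDensity d μ) (hc : IsLocal μ c)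
    (Φ q q' : 𝒞) :
    secondVariation μ c Φ (q + q') = secondVariation μ c Φ q + secondVariation μ c Φ q' := by
  have := hμ.isLocallyFiniteMeasure
  refine eq_of_grPairing_eq hμ fun w hw _ ↦ ?_
  rw [grPairing_add_right hμ hw, ← (secondVariation_spec hμ hc Φ q).2,
    ← (secondVariation_spec hμ hc Φ q').2, ← (secondVariation_spec hμ hc Φ (q + q')).2]
  exact rApply_add (fun z z' ↦ eval_dT_add (hc.stable_dT w).isSmoothAlt z z' Φ) q q'

/-- The second variation of a local functional does not enlarge supports. -/
theorem cxDerOff_secondVariation (hμ : IsSmoothDensity d μ) (hc : IsLocal μ c)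
    (Φ : 𝒞) {q : 𝒞} {C : Set M} (hC : IsClosed C)
    (hq : ∀ I, totSupp (q I).1 ⊆ C ∧ totSupp (q I).2 ⊆ C) (I : Finset ℕ) :
    CxDerOff C (secondVariation μ c Φ q I) := by
  have := hμ.isLocallyFiniteMeasure
  rw [← compl_compl C]
  refine cxDerOff_of_cxPairing_eq_zero hμ hC.isOpen_compl fun w _ hwC _ ↦ ?_
  rw [← coeffAt_grPairing, ← (secondVariation_spec hμ hc Φ q).2 w]
  have h1 {z : 𝒯} (hz : totSupp z ⊆ C) : eval (dT z (dT w c)) Φ = 0 := by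
    rw [hc.dT_dT_eq_zero (disjoint_left.2 fun x hx hx' ↦ hwC hx' (hz hx)), eval_zero]
  have h2 : rApply (fun z ↦ eval (dT z (dT w c)) Φ) q = 0 :=
    Finset.sum_eq_zero fun J _ ↦ by
      simp only [h1 (hq J).1, h1 (hq J).2, smul_zero, add_zero, map_zero, mul_zero]
  rw [h2, map_zero]

theorem totSupp_cxHam {K : Set M} (hK : IsClosed K) {u : Cx 𝒟}
    (hu : CxDerOff K u) : totSupp (cxHam u).1 ⊆ K ∧ totSupp (cxHam u).2 ⊆ K := by
  have key {v : 𝒟} (hv : DerOff K v) :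
      totSupp (M := M) ((v.2, -v.1) : 𝒯) ⊆ K :=
    totSupp_subset hK fun x hx ↦ by
      obtain ⟨h1, h2, h3, h4⟩ := hv x hx
      exact ⟨h3, h4, (congrArg Neg.neg h1).trans neg_zero, (congrArg Neg.neg h2).trans neg_zero⟩
  exact ⟨key hu.1, key hu.2⟩

theorem cxHam_add (u v : Cx 𝒟) : cxHam (u + v) = cxHam u + cxHam v :=
  Prod.ext (Prod.ext rfl (neg_add _ _)) (Prod.ext rfl (neg_add _ _))

theorem ham_apply_eq (U : GrVec 𝒟) (I : Finset ℕ) : ham U I = cxHam (U I) :=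
  ham_apply U I

theorem grPairing_congr (hμ : IsSmoothDensity d μ) {O : Set M} {U U' : GrVec 𝒟}
    (h : ∀ I, CxDerOff Oᶜ (U I - U' I)) {w : 𝒯} (hw : IsCompact (totSupp w))
    (hwO : totSupp w ⊆ O) : grPairing μ w U = grPairing μ w U' := by
  have := hμ.isLocallyFiniteMeasure
  refine ext_coeffAt fun I ↦ ?_
  rw [coeffAt_grPairing, coeffAt_grPairing, ← sub_eq_zero, ← cxPairing_sub_right hw]
  exact (h I).cxPairing_eq_zero (disjoint_compl_right_iff_subset.2 hwO)

theorem IsEvenFunctional.add {F G : ℱ} (hF : IsEvenFunctional F)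
    (hG : IsEvenFunctional G) : IsEvenFunctional (F + G) := fun Φ hΦ ↦
  congrArg₂ (· + ·) (hF Φ hΦ) (hG Φ hΦ)

variable {L : (M → ℝ) → Functional d F₀ E₀ F₁ E₁}
  {h : Cx (Tot d F₀ E₀ F₁ E₁) →ₗ[ℝ] Cx (Der d F₀ E₀ F₁ E₁)}

/-- The values of `L` at cutoff functions are even local functionals. -/
def IsEvenLocal (μ : Measure M) (L : (M → ℝ) → ℱ) : Prop :=
  ∀ f, IsTest d f → ∃ c, IsLocal μ c ∧ L f = eval c ∧ IsEvenFunctional (eval c)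

theorem IsHessian.add {L' : (M → ℝ) → ℱ}
    {h' : Cx 𝒯 →ₗ[ℝ] Cx 𝒟} (hμ : IsSmoothDensity d μ)
    (hL : IsHessian μ L h) (hL' : IsHessian μ L' h') (hl : IsEvenLocal μ L)
    (hl' : IsEvenLocal μ L') : IsHessian μ (L + L') (h + h') := by
  have := hμ.isLocallyFiniteMeasure
  have hop {h h' : Cx 𝒯 →ₗ[ℝ] Cx 𝒟} (hh : IsLocalOp h)
      (hh' : IsLocalOp h') : IsLocalOp (h + h') := by
    refine ⟨fun z ↦ ?_, fun z ↦ (hh.off z).add (hh'.off z)⟩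
    rw [LinearMap.add_apply, LinearMap.add_apply, hh.mulI, hh'.mulI]
    exact Prod.ext (neg_add _ _).symm rfl
  refine ⟨hop hL.isLocalOp hL'.isLocalOp, fun f hf c hc hfc ↦ ?_⟩
  obtain ⟨c₁, hc₁, hfc₁, -⟩ := hl f hf
  obtain ⟨c₂, hc₂, hfc₂, -⟩ := hl' f hf
  obtain ⟨T, hT, hTv, hTO⟩ := hL.exists_cutoff f hf c₁ hc₁ hfc₁
  obtain ⟨T', hT', hTv', hTO'⟩ := hL'.exists_cutoff f hf c₂ hc₂ hfc₂
  have he : eval c = eval (c₁ + c₂) := by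
    rw [← hfc, Pi.add_apply, hfc₁, hfc₂]
    ext1 Φ
    exact (eval_add hc₁.isSmoothAlt hc₂.isSmoothAlt Φ).symm
  refine ⟨T + T', hop hT hT', fun Φ hΦ I ↦ ?_, fun O hO hf1 z ↦ ?_⟩
  · rw [variation_congr hμ hc (hc₁.add hc₂) he, variation_add hμ hc₁ hc₂, Finsupp.add_apply,
      hTv Φ hΦ, hTv' Φ hΦ, LinearMap.add_apply]
  · rw [LinearMap.add_apply, LinearMap.add_apply, add_sub_add_comm]
    exact (hTO O hO hf1 z).add (hTO' O hO hf1 z)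

/-- The interior of the set where a cutoff function is one. -/
theorem exists_open_eq_one {f : M → ℝ} {K : Set M} (hf : ∀ x ∈ K, ∀ᶠ y in 𝓝 x, f y = 1) :
    ∃ O : Set M, IsOpen O ∧ K ⊆ O ∧ ∀ x ∈ O, f x = 1 :=
  ⟨interior {x | f x = 1}, isOpen_interior, fun x hx ↦ mem_interior_iff_mem_nhds.2 (hf x hx),
    fun x hx ↦ (interior_subset hx : x ∈ {x | f x = 1})⟩

/-- A relation of first order in the increment that determines left derivatives. -/
theorem isLeftDeriv_of_single {L : (M → ℝ) → ℱ} {Φ : 𝒞}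
    {U : GrVec 𝒟}
    (H : ∀ w : 𝒯, IsCompact (totSupp w) → ∀ f, IsTest d f →
      (∀ x ∈ totSupp w, ∀ᶠ y in 𝓝 x, f y = 1) → ∀ n, IsFresh n Φ → ∀ η : Finset ℕ, n ∈ η →
      ((Even η.card ∧ oddPart w = 0) ∨ (Odd η.card ∧ evenPart w = 0)) →
      L f (Φ + Finsupp.single η (w, 0)) = L f Φ + θ η * grPairing μ w U) :
    IsLeftDeriv μ L Φ U := by
  refine fun w hw f hf hf1 ↦ ⟨fun hp ↦ ?_, fun hp ↦ ?_⟩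
  · filter_upwards [eventually_isFresh Φ] with n hn
    exact H w hw f hf hf1 n hn _ (by simp) (Or.inl ⟨by simp, hp⟩)
  · filter_upwards [eventually_isFresh Φ] with n hn
    exact H w hw f hf hf1 n hn _ (by simp) (Or.inr ⟨by simp, hp⟩)

/-- The left derivative of an interacting action `L + V`, with quadratic `L`. -/
theorem IsHessian.isLeftDeriv (hμ : IsSmoothDensity d μ) (hL : IsHessian μ L h)
    (hl : IsEvenLocal μ L) (hc : IsLocal μ c) {Φ : 𝒞} (hΦ : IsPoint Φ) :
    IsLeftDeriv μ (fun f ↦ L f + eval c) Φ (grMap h Φ + variation μ c Φ) := by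
  have := hμ.isLocallyFiniteMeasure
  refine isLeftDeriv_of_single fun w hw f hf hf1 n hn η hη hp ↦ ?_
  obtain ⟨O, hO, hwO, hO1⟩ := exists_open_eq_one hf1
  obtain ⟨cf, hcf, hfc, -⟩ := hl f hf
  obtain ⟨T, hT, hTv, hTO⟩ := hL.exists_cutoff f hf cf hcf hfc
  have h1 : grPairing μ w (grMap h Φ) = grPairing μ w (variation μ cf Φ) :=
    grPairing_congr hμ (fun I ↦ by rw [hTv Φ hΦ, grMap_apply]; exact hTO O hO hO1 _) hw hwO
  rw [Pi.add_apply, Pi.add_apply, hfc, eval_add_single hcf.isSmoothAlt hn hη hp,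
    eval_add_single hc.isSmoothAlt hn hη hp, grPairing_add_right hμ hw, h1,
    ← (variation_spec hμ hcf Φ).2, ← (variation_spec hμ hc Φ).2, mul_add, add_add_add_comm]

theorem isLocal_zero : IsLocal μ (0 : 𝒦) :=
  ⟨∅, 0, fun _ _ _ _ ↦ 0, isCompact_empty, by simp, by simp, by simp,
    fun k v x ↦ ⟨0, fun w ↦ rfl⟩, fun k n v w _ _ _ _ ↦ contMDiff_const⟩

theorem variation_zero (hμ : IsSmoothDensity d μ) (Φ : 𝒞) :
    variation μ (0 : 𝒦) Φ = 0 := eq_of_grPairing_eq hμ fun w _ _ ↦ by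
  rw [← (variation_spec hμ isLocal_zero Φ).2, dT_zero_arg, eval_zero]
  rfl

theorem eval_zero' : eval (0 : 𝒦) = 0 := funext eval_zero

theorem IsHessian.isLeftDeriv_self (hμ : IsSmoothDensity d μ) (hL : IsHessian μ L h)
    (hl : IsEvenLocal μ L) {Φ : 𝒞} (hΦ : IsPoint Φ) :
    IsLeftDeriv μ L Φ (grMap h Φ) := by
  have h1 := hL.isLeftDeriv hμ hl isLocal_zero hΦ
  simpa only [eval_zero', variation_zero hμ, add_zero] using h1

/-- The left derivative of `½ {S, S}` for an interacting action `S = L + V`, with quadratic `L`, is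
the second variation of `S` in the direction of the Hamiltonian vector field of `S`. -/
theorem IsHessian.isLeftDeriv_cme (hμ : IsSmoothDensity d μ) (hL : IsHessian μ L h)
    (hl : IsEvenLocal μ L) (hc : IsLocal μ c) (he : IsEvenFunctional (eval c))
    {Φ : 𝒞} (hΦ : IsPoint Φ) :
    IsLeftDeriv μ (cme μ fun f ↦ L f + eval c) Φ
      (grMap h (ham (grMap h Φ + variation μ c Φ)) +
        secondVariation μ c Φ (ham (grMap h Φ + variation μ c Φ))) := by
  have := hμ.isLocallyFiniteMeasure
  refine isLeftDeriv_of_single fun w hw f hf hf1 n hn η hη hp ↦ ?_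
  obtain ⟨O, hO, hwO, hO1⟩ := exists_open_eq_one hf1
  obtain ⟨cf, hcf, hfc, hfe⟩ := hl f hf
  obtain ⟨T, hT, hTv, hTO⟩ := hL.exists_cutoff f hf cf hcf hfc
  have hsum : eval cf + eval c = eval (cf + c) := by
    ext1 Φ
    exact (eval_add hcf.isSmoothAlt hc.isSmoothAlt Φ).symm
  have hse : IsEvenFunctional (eval (cf + c)) := hsum ▸ hfe.add he
  have hs := hcf.add hc
  set Q := ham (grMap h Φ + variation μ c Φ) with hQ
  set Qf := ham (variation μ (cf + c) Φ) with hQf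
  have hQo : IsOddConf Qf := isOddConf_ham_variation hμ hs hse hΦ
  -- the Hamiltonian vector field for the cutoff `f` differs from `Q` only where `f ≠ 1`
  have hD (I : Finset ℕ) :
      totSupp ((Q - Qf) I).1 ⊆ Oᶜ ∧ totSupp ((Q - Qf) I).2 ⊆ Oᶜ := by
    have h1 : (Q - Qf) I = cxHam (h (Φ I) - T (Φ I)) := by
      rw [Finsupp.sub_apply, sub_eq_iff_eq_add, hQ, hQf, ham_apply_eq, ham_apply_eq, ← cxHam_add,
        variation_add hμ hcf hc, Finsupp.add_apply, Finsupp.add_apply, grMap_apply, hTv Φ hΦ]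
      congr 1
      abel
    rw [h1]
    exact totSupp_cxHam hO.isClosed_compl (hTO O hO hO1 _)
  have hQD : Q = Qf + (Q - Qf) := by abel
  rw [cme_apply]
  simp only [hfc, hsum]
  rw [selfBracket_add_single hμ hs hse hΦ hn hη hp]
  congr 2
  refine grPairing_congr hμ (fun I ↦ ?_) hw hwO
  rw [← hQf, secondVariation_add hμ hcf hc Φ hQo, secondVariation_eq_grMap hμ hcf hTv hΦ hQo,
    hQD, secondVariation_add_right hμ hc, ← hQD]
  simp only [Finsupp.add_apply, grMap_apply]
  have h1 : T (Qf I) = T (Q I) - T ((Q - Qf) I) := by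
    rw [← map_sub, Finsupp.sub_apply, sub_sub_cancel]
  have h2 : ∀ a b s t e : Cx 𝒟,
      a - b + s - (e + (s + t)) = -((e - a) + b + t) := by
    intros; abel
  rw [h1, h2]
  refine (((hTO O hO hO1 (Q I)).add ?_).add
    (cxDerOff_secondVariation hμ hc Φ hO.isClosed_compl hD I)).neg
  exact (hT.off _).mono (union_subset (hD I).1 (hD I).2)

/-- The classical master equation for a quadratic action: its Hamiltonian vector field squares to
zero. -/
theorem IsHessian.nilpotent (hμ : IsSmoothDensity d μ) (hL : IsHessian μ L h)
    (hl : IsEvenLocal μ L) (hcme : SatisfiesCME μ L) (z : Cx 𝒯) :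
    h (cxHam (h z)) = 0 := by
  have := hμ.isLocallyFiniteMeasure
  have hz : IsSmoothAlt (0 : 𝒦) := (isLocal_zero (μ := μ)).isSmoothAlt
  obtain ⟨Φ, hΦ, rfl⟩ := exists_isPoint_add z
  have hv2 (q) : secondVariation μ (0 : 𝒦) Φ q = 0 :=
    eq_of_grPairing_eq hμ fun w _ _ ↦ by
      rw [← (secondVariation_spec hμ isLocal_zero Φ q).2]
      simp [dT_zero_arg, eval_zero, rApply, grPairing]
  have hd := hL.isLeftDeriv_cme hμ hl isLocal_zero
    (by rw [eval_zero']; exact fun _ _ ↦ rfl) hΦ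
  simp only [eval_zero', variation_zero hμ, hv2, add_zero] at hd
  -- `z` is a sum of two coefficients of the point `Φ`; at each `x` a cutoff equal to `1` near
  -- `x` is taken, for which `½ {S, S}` is insensitive to changes near `x`
  have key (I : Finset ℕ) : h (cxHam (h (Φ I))) = 0 := by
    refine eq_of_forall_cxDerOff fun x ↦ ?_
    obtain ⟨f, hf, -, hf1⟩ := exists_test (d := d) x isOpen_univ (mem_univ x)
    have hx : x ∉ dsupp d f := by
      rw [dsupp, mem_closure_iff_frequently, not_frequently]
      filter_upwards [hf1.eventually_nhds] with y hy
      have h1 : f =ᶠ[𝓝 y] fun _ ↦ (1 : ℝ) := hy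
      rw [not_not, h1.mfderiv_eq, mfderiv_const]
      rfl
    obtain ⟨O, hO, hxO, H⟩ := exists_nhds_of_notMem_fsupp fun h ↦ hx (hcme f hf h)
    obtain ⟨O', hO', hxO', hO1⟩ := exists_open_eq_one (K := {x}) (by simpa using hf1)
    rw [sub_zero]
    refine CxDerOff.at (K := (O ∩ O')ᶜ) ?_ (notMem_compl_iff.2 ⟨hxO, hxO' rfl⟩)
    refine cxDerOff_of_cxPairing_eq_zero hμ (hO.inter hO') fun w hw hwO hp ↦ ?_
    have h1 : grPairing μ w (grMap h (ham (grMap h Φ))) = 0 := by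
      have h2 := hd w hw f hf fun y hy ↦
        eventually_of_mem (hO'.mem_nhds (hwO hy).2) fun t ht ↦ hO1 t ht
      rcases hp with hp | hp
      · refine eventually_θ_mul_cancel (fun n ↦ {n, n + 1}) (by simp) (Eventually.frequently ?_)
        filter_upwards [h2.1 hp] with n hn
        rwa [H Φ hΦ w _ ⟨n, by simp⟩ (Or.inl ⟨by simp, hp⟩) (hwO.trans inter_subset_left),
          left_eq_add] at hn
      · refine eventually_θ_mul_cancel (fun n ↦ {n}) (by simp) (Eventually.frequently ?_)
        filter_upwards [h2.2 hp] with n hn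
        rwa [H Φ hΦ w _ ⟨n, by simp⟩ (Or.inr ⟨by simp, hp⟩) (hwO.trans inter_subset_left),
          left_eq_add] at hn
    have h3 := congrArg (coeffAt I) h1
    rwa [coeffAt_grPairing, grMap_apply, ham_apply_eq, grMap_apply, map_zero] at h3
  rw [map_add, cxHam_add, map_add, key, key, add_zero]

end MasterEquation

/-! ### Consequences of the uniqueness of Green functions -/

section Green

theorem LorentzStructure.future_mono {d : ℕ} {M : Type*} [TopologicalSpace M]
    [ChartedSpace (EuclideanSpace ℝ (Fin d)) M] [IsManifold (𝓡 d) ∞ M]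
    (g : LorentzStructure d M) : Monotone g.future :=
  fun _ _ h _ ⟨p, hp, hpq⟩ ↦ ⟨p, h hp, hpq⟩

variable {J : Set M → Set M} {P : FieldOperator d F₀ E₀ F₁ E₁} {Δ : GreenOperator d F₀ E₀ F₁ E₁}

/-- A real linear operator that does not enlarge supports acts on compactly supported sections. -/
def compactRestrict
    (T : Cx 𝒜 →ₗ[ℝ] Cx 𝒜)
    (hT : ∀ z, cxSupp (T z) ⊆ cxSupp z) :
    ℬ →ₗ[ℝ] ℬ :=
  T.restrict fun z hz ↦ isCompact_cxSupp_of_subset hz (hT z)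

/-- If `P K = K' P` for operators that do not enlarge supports, then `K Δ = Δ K'`, because
`Δ + K Δ - Δ K'` is again a Green function. -/
theorem IsGreen.intertwine (hJ : Monotone J) (hΔ : IsGreen J P Δ)
    (huniq : ∀ Δ', IsGreen J P Δ' → Δ' = Δ)
    {K : Cx 𝒢 →ₗ[ℝ] Cx 𝒢}
    {K' : Cx 𝒜 →ₗ[ℝ] Cx 𝒜}
    (hK : ∀ z, K (Cx.mulI z) = Cx.mulI (K z)) (hK' : ∀ z, K' (Cx.mulI z) = Cx.mulI (K' z))
    (hKs : ∀ z, cxSupp (K z) ⊆ cxSupp z) (hKs' : ∀ z, cxSupp (K' z) ⊆ cxSupp z)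
    (hP : ∀ z, P (K z) = K' (P z)) (u : ℬ) :
    K (Δ u) = Δ (compactRestrict K' hKs' u) := by
  -- a second Green function, which coincides with `Δ` by uniqueness
  have hg : IsGreen J P (Δ + K ∘ₗ Δ - Δ ∘ₗ compactRestrict K' hKs') := by
    refine ⟨fun u v huv ↦ ?_, fun u ↦ ?_, fun z u hz hu ↦ ?_, fun u ↦ ?_⟩
    · have h1 := hΔ.mulI u v huv
      have h2 := hΔ.mulI (compactRestrict K' hKs' u) (compactRestrict K' hKs' v) (by
        change K' v = Cx.mulI (K' u)
        rw [huv, hK'])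
      change Δ v + K (Δ v) - Δ (compactRestrict K' hKs' v) =
        Cx.mulI (Δ u + K (Δ u) - Δ (compactRestrict K' hKs' u))
      rw [h1, h2, hK, mulI_sub, mulI_add]
    · change P (Δ u + K (Δ u) - Δ (compactRestrict K' hKs' u)) = u
      rw [map_sub, map_add, hΔ.right_inv, hP, hΔ.right_inv, hΔ.right_inv]
      exact add_sub_cancel_right _ _
    · change Δ u + K (Δ u) - Δ (compactRestrict K' hKs' u) = z
      rw [hΔ.left_inv z u hz hu, hΔ.left_inv (K z) (compactRestrict K' hKs' u)
        (isCompact_cxSupp_of_subset hz (hKs z)) (by rw [hP, ← hu]; rfl), add_sub_cancel_right]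
    · change cxSupp (Δ u + K (Δ u) - Δ (compactRestrict K' hKs' u)) ⊆ _
      rw [sub_eq_add_neg]
      refine (cxSupp_add _ _).trans (union_subset ((cxSupp_add _ _).trans (union_subset
        (hΔ.support u) ((hKs _).trans (hΔ.support u)))) ((cxSupp_neg _).trans
        ((hΔ.support _).trans (hJ (hKs' _)))))
  have h1 := LinearMap.congr_fun (huniq _ hg) u
  have h2 : Δ u + K (Δ u) - Δ (compactRestrict K' hKs' u) = Δ u := h1
  rwa [add_sub_assoc, add_eq_left, sub_eq_zero] at h2

/-- Complex conjugation of the first component, followed by projection to it. -/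
def restrictConj : ℬ →ₗ[ℝ] ℬ :=
  compactRestrict conjFst cxSupp_conjFst

/-- The projection to the second component. -/
def restrictProj : ℬ →ₗ[ℝ] ℬ :=
  compactRestrict projSnd cxSupp_projSnd

/-- `Δ` is block diagonal, and real on the even fields. -/
def IsSplit (Δ : GreenOperator d F₀ E₀ F₁ E₁) : Prop :=
  ∀ u, Δ u = conjFst (Δ (restrictConj u)) + projSnd (Δ (restrictProj u))

/-- If `P` is block diagonal and real on the first component, then so is `Δ`: the operator on the
right-hand side of `IsSplit` is again a Green function. -/
theorem IsGreen.splitting (hJ : Monotone J) (hΔ : IsGreen J P Δ)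
    (huniq : ∀ Δ', IsGreen J P Δ' → Δ' = Δ) (h₀ : ∀ z, P (conjFst z) = conjFst (P z))
    (h₁ : ∀ z, P (projSnd z) = projSnd (P z)) : IsSplit Δ := fun u ↦ by
  set ρ : ℬ →ₗ[ℝ] ℬ := restrictConj
  set σ : ℬ →ₗ[ℝ] ℬ := restrictProj
  have hρ (u) : (ρ u : Cx 𝒜) = conjFst (u : Cx 𝒜) :=
    rfl
  have hσ (u) : (σ u : Cx 𝒜) = projSnd (u : Cx 𝒜) :=
    rfl
  have hg : IsGreen J P (conjFst ∘ₗ Δ ∘ₗ ρ + projSnd ∘ₗ Δ ∘ₗ σ) := by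
    refine ⟨fun u v huv ↦ ?_, fun u ↦ ?_, fun z u hz hu ↦ ?_, fun u ↦ ?_⟩
    · have h1 : Δ (ρ v) = -Cx.mulI (Δ (ρ u)) := by
        rw [← hΔ.mulI (ρ u) (-ρ v), map_neg, neg_neg]
        change -(conjFst (v : Cx 𝒜)) = _
        rw [huv, conjFst_mulI, neg_neg]
        rfl
      have h2 := hΔ.mulI (σ u) (σ v) (by rw [hσ, hσ, huv, projSnd_mulI])
      change conjFst (Δ (ρ v)) + projSnd (Δ (σ v)) =
        Cx.mulI (conjFst (Δ (ρ u)) + projSnd (Δ (σ u)))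
      rw [h1, h2, mulI_add, map_neg, conjFst_mulI, neg_neg, projSnd_mulI]
    · change P (conjFst (Δ (ρ u)) + projSnd (Δ (σ u))) = u
      rw [map_add, h₀, h₁, hΔ.right_inv, hΔ.right_inv, hρ, hσ, conjFst_conjFst_add]
    · change conjFst (Δ (ρ u)) + projSnd (Δ (σ u)) = z
      rw [hΔ.left_inv (conjFst z) (ρ u) (isCompact_cxSupp_of_subset hz (cxSupp_conjFst z))
        (by rw [h₀, ← hu, hρ]), hΔ.left_inv (projSnd z) (σ u)
        (isCompact_cxSupp_of_subset hz (cxSupp_projSnd z)) (by rw [h₁, ← hu, hσ]),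
        conjFst_conjFst_add]
    · refine (cxSupp_add _ _).trans (union_subset ?_ ?_)
      · exact (cxSupp_conjFst _).trans ((hΔ.support _).trans (hJ (cxSupp_conjFst _)))
      · exact (cxSupp_projSnd _).trans ((hΔ.support _).trans (hJ (cxSupp_projSnd _)))
  exact (LinearMap.congr_fun (huniq _ hg) u).symm

theorem applyGreen_of_isCompact {z : Cx 𝒜} (h : IsCompact (cxSupp z)) :
    applyGreen Δ z = Δ ⟨z, h⟩ := dif_pos h

theorem applyGreen_add {z z' : Cx 𝒜} (h : IsCompact (cxSupp z))
    (h' : IsCompact (cxSupp z')) :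
    applyGreen Δ (z + z') = applyGreen Δ z + applyGreen Δ z' := by
  rw [applyGreen_of_isCompact h, applyGreen_of_isCompact h', applyGreen_of_isCompact
    (isCompact_cxSupp_of_subset (h.union h') (cxSupp_add z z')), ← map_add]
  rfl

end Green

/-! ### Antifield numbers -/

section FreeTheory

/-- The complexified fields. -/
def cxFields (z : Cx 𝒯) : Cx 𝒢 := (z.1.1, z.2.1)

/-- The complexified antifields. -/
def cxAntifields (z : Cx 𝒯) : Cx 𝒜 := (z.1.2, z.2.2)

/-- The derivatives with respect to the fields. -/
def derField (u : Cx 𝒟) : Cx 𝒜 := (u.1.1, u.2.1)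

/-- The derivatives with respect to the antifields. -/
def derAntifield (u : Cx 𝒟) : Cx 𝒢 := (u.1.2, u.2.2)

/-- The multiplet with vanishing antifields. -/
def ofFields (z : Cx 𝒢) : Cx 𝒯 := ((z.1, 0), (z.2, 0))

/-- The multiplet with vanishing fields. -/
def ofAntifields (z : Cx 𝒜) : Cx 𝒯 :=
  ((0, z.1), (0, z.2))

theorem ofFields_add_ofAntifields (z : Cx 𝒯) :
    ofFields (cxFields z) + ofAntifields (cxAntifields z) = z := by
  simp [ofFields, ofAntifields, cxFields, cxAntifields]

theorem isCompact_totSupp_of_subset {w : 𝒯} {K : Set M} (hK : IsCompact K)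
    (h : totSupp w ⊆ K) : IsCompact (totSupp w) := hK.of_isClosed_subset (isClosed_totSupp w) h

theorem derField_eq_zero (hμ : IsSmoothDensity d μ) {u : Cx 𝒟}
    (h : ∀ w : 𝒯, IsCompact (totSupp w) → IsPure w → w.2 = 0 →
      cxPairing μ w u = 0) : derField u = 0 := by
  have key : (((u.1.1, 0), (u.2.1, 0)) : Cx 𝒟) = 0 :=
    eq_of_cxPairing_eq hμ fun w hw hp ↦ by
      have h1 (v : 𝒟) : pairing μ w (v.1, 0) = pairing μ (w.1, 0) v := by
        simp only [pairing_eq]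
        congr 1
        ext x
        simp [pairFun]
      refine Eq.trans ?_ ((h (w.1, 0) (isCompact_totSupp_of_subset hw ?_) ?_ rfl).trans
        (cxPairing_zero_right w).symm)
      · apply Complex.ext
        · rw [cxPairing_re, cxPairing_re, h1]
        · rw [cxPairing_im, cxPairing_im, h1]
      · exact totSupp_subset (isClosed_totSupp w) fun x hx ↦ by
          obtain ⟨e1, e2, -, -⟩ := apply_eq_zero_of_notMem_totSupp hx
          exact ⟨e1, e2, rfl, rfl⟩
      · rcases hp with e | e
        · have e1 : w.1.2 = 0 := congrArg (fun p : 𝒪 ↦ p.1) e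
          exact Or.inl (Prod.ext e1 rfl)
        · have e1 : w.1.1 = 0 := congrArg (fun p : ℰ ↦ p.1) e
          exact Or.inr (Prod.ext e1 rfl)
  exact Prod.ext (congrArg (fun z : Cx 𝒟 ↦ z.1.1) key)
    (congrArg (fun z : Cx 𝒟 ↦ z.2.1) key)

theorem derAntifield_eq_zero (hμ : IsSmoothDensity d μ) {u : Cx 𝒟}
    (h : ∀ w : 𝒯, IsCompact (totSupp w) → IsPure w → w.1 = 0 →
      cxPairing μ w u = 0) : derAntifield u = 0 := by
  have key : (((0, u.1.2), (0, u.2.2)) : Cx 𝒟) = 0 :=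
    eq_of_cxPairing_eq hμ fun w hw hp ↦ by
      have h1 (v : 𝒟) : pairing μ w (0, v.2) = pairing μ (0, w.2) v := by
        simp only [pairing_eq]
        congr 1
        ext x
        simp [pairFun]
      refine Eq.trans ?_ ((h (0, w.2) (isCompact_totSupp_of_subset hw ?_) ?_ rfl).trans
        (cxPairing_zero_right w).symm)
      · apply Complex.ext
        · rw [cxPairing_re, cxPairing_re, h1]
        · rw [cxPairing_im, cxPairing_im, h1]
      · exact totSupp_subset (isClosed_totSupp w) fun x hx ↦ by
          obtain ⟨-, -, e1, e2⟩ := apply_eq_zero_of_notMem_totSupp hx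
          exact ⟨rfl, rfl, e1, e2⟩
      · rcases hp with e | e
        · have e1 : w.2.1 = 0 := congrArg (fun p : 𝒪 ↦ p.2) e
          exact Or.inl (Prod.ext rfl e1)
        · have e1 : w.2.2 = 0 := congrArg (fun p : ℰ ↦ p.2) e
          exact Or.inr (Prod.ext rfl e1)
  exact Prod.ext (congrArg (fun z : Cx 𝒟 ↦ z.1.2) key)
    (congrArg (fun z : Cx 𝒟 ↦ z.2.2) key)

variable {c : Components d F₀ E₀ F₁ E₁} {L : (M → ℝ) → Functional d F₀ E₀ F₁ E₁}
  {h : Cx (Tot d F₀ E₀ F₁ E₁) →ₗ[ℝ] Cx (Der d F₀ E₀ F₁ E₁)}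

/-- Multiplication of the antifields by `2`. -/
def doubleAntifields (w : 𝒯) : 𝒯 := (w.1, (2 : ℝ) • w.2)

theorem totSupp_doubleAntifields (w : 𝒯) :
    totSupp (doubleAntifields w) ⊆ totSupp w :=
  totSupp_subset (isClosed_totSupp w) fun x hx ↦ by
    obtain ⟨h1, h2, h3, h4⟩ := apply_eq_zero_of_notMem_totSupp hx
    exact ⟨h1, h2, (congrArg ((2 : ℝ) • ·) h3).trans (smul_zero _),
      (congrArg ((2 : ℝ) • ·) h4).trans (smul_zero _)⟩

theorem exists_test_of_isCompact {K : Set M} (hK : IsCompact K) :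
    ∃ f : M → ℝ, IsTest d f ∧ ∀ x ∈ K, ∀ᶠ y in 𝓝 x, f y = 1 := by
  obtain ⟨χ, -, hχc, hχ1⟩ := exists_cutoff (d := d) hK isOpen_univ (subset_univ K)
  exact ⟨χ, ⟨χ.contMDiff, hχc⟩, hχ1⟩

/-- The quadratic form of a Lagrangian of antifield number `m` has antifield number `m`. -/
theorem IsHessian.cxPairing_doubleAntifields (hμ : IsSmoothDensity d μ) (hL : IsHessian μ L h)
    (hl : IsEvenLocal μ L) {m : ℕ} (haf : ∀ f, IsTest d f → HasAntifieldNumber m (L f))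
    {w : 𝒯} (hw : IsCompact (totSupp w)) (hp : IsPure w)
    (z : Cx 𝒯) :
    cxPairing μ (doubleAntifields w) (h (doubleAntifields z.1, doubleAntifields z.2)) =
      2 ^ m * cxPairing μ w (h z) := by
  have := hμ.isLocallyFiniteMeasure
  obtain ⟨f, hf, hf1⟩ := exists_test_of_isCompact (d := d) hw
  obtain ⟨O, hO, hwO, hO1⟩ := exists_open_eq_one hf1
  obtain ⟨c, hc, hfc, -⟩ := hl f hf
  obtain ⟨T, hT, hTv, hTO⟩ := hL.exists_cutoff f hf c hc hfc
  have hs := hc.isSmoothAlt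
  have hw' := isCompact_totSupp_of_subset hw (totSupp_doubleAntifields w)
  have hTh {w : 𝒯} (hw : IsCompact (totSupp w)) (hwO : totSupp w ⊆ O)
      (z : Cx 𝒯) : cxPairing μ w (h z) = cxPairing μ w (T z) := by
    rw [← sub_eq_zero, ← cxPairing_sub_right hw]
    exact (hTO O hO hO1 z).cxPairing_eq_zero (disjoint_compl_right_iff_subset.2 hwO)
  rw [hTh hw hwO, hTh hw' ((totSupp_doubleAntifields w).trans hwO)]
  let D (Φ : 𝒞) : 𝒞 :=
    Φ.mapRange (fun z ↦ (doubleAntifields z.1, doubleAntifields z.2)) (by simp [doubleAntifields])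
  have hD (Φ : 𝒞) (I) :
      D Φ I = (doubleAntifields (Φ I).1, doubleAntifields (Φ I).2) := Finsupp.mapRange_apply
  have hDF (Φ : 𝒞) (hΦ : IsPoint Φ) :
      eval c (D Φ) = (2 : ℂ) ^ m • eval c Φ := by
    have h1 := haf f hf Φ hΦ 2
    rw [hfc] at h1
    rw [Complex.ofReal_ofNat] at h1
    exact h1
  have hev (w : 𝒯) (hw : evenPart w = 0) : evenPart (doubleAntifields w) = 0 := by
    have e1 : w.1.1 = 0 := congrArg (fun p : ℰ ↦ p.1) hw
    have e2 : w.2.2 = 0 := congrArg (fun p : ℰ ↦ p.2) hw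
    have e3 : (2 : ℝ) • w.2.2 = 0 := by rw [e2, smul_zero]
    exact Prod.ext e1 e3
  have hod (w : 𝒯) (hw : oddPart w = 0) : oddPart (doubleAntifields w) = 0 := by
    have e1 : w.1.2 = 0 := congrArg (fun p : 𝒪 ↦ p.1) hw
    have e2 : w.2.1 = 0 := congrArg (fun p : 𝒪 ↦ p.2) hw
    have e3 : (2 : ℝ) • w.2.1 = 0 := by rw [e2, smul_zero]
    exact Prod.ext e1 e3
  have hDp {Φ : 𝒞} (hΦ : IsPoint Φ) : IsPoint (D Φ) := by
    refine ⟨fun I hI ↦ ?_, fun I hI ↦ ?_, ?_, ?_⟩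
    · rw [hD]; exact ⟨hod _ (hΦ.1 I hI).1, hod _ (hΦ.1 I hI).2⟩
    · rw [hD]; exact ⟨hev _ (hΦ.2.1 I hI).1, hev _ (hΦ.2.1 I hI).2⟩
    · rw [hD, hΦ.2.2.1]; simp [doubleAntifields]
    · rw [hD]; simp [doubleAntifields, hΦ.2.2.2]
  have key {Φ : 𝒞} (hΦ : IsPoint Φ) :
      eval (dT (doubleAntifields w) c) (D Φ) = (2 : ℂ) ^ m • eval (dT w c) Φ := by
    obtain ⟨η, hη, hη', hpar⟩ := hp.exists_generators
    refine sub_eq_zero.1 (eventually_θ_mul_cancel η hη' (Eventually.frequently ?_))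
    filter_upwards [eventually_isFresh Φ] with n hn
    have hpar' : (Even (η n).card ∧ oddPart (doubleAntifields w) = 0) ∨
        (Odd (η n).card ∧ evenPart (doubleAntifields w) = 0) :=
      (hpar n).imp (fun h ↦ ⟨h.1, hod _ h.2⟩) fun h ↦ ⟨h.1, hev _ h.2⟩
    have hDs : D (Φ + Finsupp.single (η n) (w, 0)) =
        D Φ + Finsupp.single (η n) (doubleAntifields w, 0) := by
      ext1 I
      rw [hD, Finsupp.add_apply, Finsupp.add_apply, hD]
      rcases eq_or_ne I (η n) with rfl | hI
      · rw [Finsupp.single_eq_same, Finsupp.single_eq_same]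
        simp [doubleAntifields]
      · rw [Finsupp.single_eq_of_ne hI, Finsupp.single_eq_of_ne hI, add_zero, add_zero]
    have hn' : IsFresh n (D Φ) := hn.of_support_subset Finsupp.support_mapRange
    have h1 := hDF _ (hΦ.add_single ⟨n, hη n⟩ (hpar n))
    rw [hDs, eval_add_single hs hn' (hη n) hpar', eval_add_single hs hn (hη n) (hpar n), hDF Φ hΦ,
      smul_add, add_right_inj] at h1
    rw [mul_sub, h1, mul_smul_comm, sub_self]
  obtain ⟨Φ, hΦ, rfl⟩ := exists_isPoint_add z
  have hcoef (I : Finset ℕ) : cxPairing μ (doubleAntifields w) (T (D Φ I)) =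
      2 ^ m * cxPairing μ w (T (Φ I)) := by
    have h1 := congrArg (coeffAt I) (key hΦ)
    rwa [(variation_spec hμ hc _).2, map_smul, (variation_spec hμ hc Φ).2 w, coeffAt_grPairing,
      coeffAt_grPairing, hTv Φ hΦ, hTv (D Φ) (hDp hΦ), smul_eq_mul] at h1
  have hsplit : ((doubleAntifields (Φ {0, 1} + Φ {0}).1, doubleAntifields (Φ {0, 1} + Φ {0}).2) :
      Cx 𝒯) = D Φ {0, 1} + D Φ {0} := by
    rw [hD, hD]
    simp [doubleAntifields]
  rw [hsplit, map_add, map_add, cxPairing_add_right hw, cxPairing_add_right hw', hcoef, hcoef,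
    mul_add]

theorem doubleAntifields_of_snd_eq_zero {w : 𝒯} (hw : w.2 = 0) :
    doubleAntifields w = (1 : ℝ) • w := by
  rw [one_smul]
  exact Prod.ext rfl (by simp [doubleAntifields, hw])

theorem doubleAntifields_of_fst_eq_zero {w : 𝒯} (hw : w.1 = 0) :
    doubleAntifields w = (2 : ℝ) • w := Prod.ext (by simp [doubleAntifields, hw]) rfl

/-- Doubling the antifields detects the antifield number `m`, so blocks of the Hessian of another
degree vanish. -/
theorem IsHessian.cxPairing_eq_zero (hμ : IsSmoothDensity d μ) (hL : IsHessian μ L h)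
    (hl : IsEvenLocal μ L) {m : ℕ} (haf : ∀ f, IsTest d f → HasAntifieldNumber m (L f))
    {w : 𝒯} (hw : IsCompact (totSupp w)) (hp : IsPure w)
    {z : Cx 𝒯} {a b : ℝ} (hwa : doubleAntifields w = a • w)
    (hz₁ : doubleAntifields z.1 = b • z.1) (hz₂ : doubleAntifields z.2 = b • z.2)
    (hab : a * b ≠ 2 ^ m) : cxPairing μ w (h z) = 0 := by
  have h1 := hL.cxPairing_doubleAntifields hμ hl haf hw hp z
  have h2 : ((doubleAntifields z.1, doubleAntifields z.2) : Cx 𝒯) = b • z :=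
    Prod.ext hz₁ hz₂
  rw [h2, hwa, map_smul, cxPairing_smul_right, cxPairing_smul_left] at h1
  have h3 : ((a * b : ℝ) - (2 ^ m : ℝ) : ℂ) * cxPairing μ w (h z) = 0 := by
    push_cast
    linear_combination h1
  refine (mul_eq_zero.1 h3).resolve_left fun h4 ↦ hab ?_
  exact_mod_cast sub_eq_zero.1 h4

/-- An antifield-free quadratic Lagrangian has an antifield-free variation, without derivatives in
the directions of the antifields. -/
theorem IsHessian.of_antifieldNumber_zero (hμ : IsSmoothDensity d μ) (hL : IsHessian μ L h)
    (hl : IsEvenLocal μ L) (haf : ∀ f, IsTest d f → HasAntifieldNumber 0 (L f))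
    (z : Cx 𝒯) :
    derField (h z) = derField (h (ofFields (cxFields z))) ∧ derAntifield (h z) = 0 := by
  have h1 : derField (h (ofAntifields (cxAntifields z))) = 0 :=
    derField_eq_zero hμ fun w hw hp hw0 ↦ hL.cxPairing_eq_zero hμ hl haf hw hp
      (doubleAntifields_of_snd_eq_zero hw0) (doubleAntifields_of_fst_eq_zero rfl)
      (doubleAntifields_of_fst_eq_zero rfl) (by norm_num)
  have h2 : derAntifield (h (ofAntifields (cxAntifields z))) = 0 :=
    derAntifield_eq_zero hμ fun w hw hp hw0 ↦ hL.cxPairing_eq_zero hμ hl haf hw hp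
      (doubleAntifields_of_fst_eq_zero hw0) (doubleAntifields_of_fst_eq_zero rfl)
      (doubleAntifields_of_fst_eq_zero rfl) (by norm_num)
  have h3 : derAntifield (h (ofFields (cxFields z))) = 0 :=
    derAntifield_eq_zero hμ fun w hw hp hw0 ↦ hL.cxPairing_eq_zero hμ hl haf hw hp
      (doubleAntifields_of_fst_eq_zero hw0) (doubleAntifields_of_snd_eq_zero rfl)
      (doubleAntifields_of_snd_eq_zero rfl) (by norm_num)
  have h4 := congrArg h (ofFields_add_ofAntifields z)
  rw [map_add] at h4
  constructor
  · rw [← h4]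
    exact (congrArg (derField (h (ofFields (cxFields z))) + ·) h1).trans (add_zero _)
  · rw [← h4]
    exact (congrArg₂ (· + ·) h3 h2).trans (add_zero _)

/-- The variation of a quadratic Lagrangian that is linear in the antifields. -/
theorem IsHessian.of_antifieldNumber_one (hμ : IsSmoothDensity d μ) (hL : IsHessian μ L h)
    (hl : IsEvenLocal μ L) (haf : ∀ f, IsTest d f → HasAntifieldNumber 1 (L f))
    (z : Cx 𝒯) :
    derField (h z) = derField (h (ofAntifields (cxAntifields z))) ∧
      derAntifield (h z) = derAntifield (h (ofFields (cxFields z))) := by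
  have h1 : derField (h (ofFields (cxFields z))) = 0 :=
    derField_eq_zero hμ fun w hw hp hw0 ↦ hL.cxPairing_eq_zero hμ hl haf hw hp
      (doubleAntifields_of_snd_eq_zero hw0) (doubleAntifields_of_snd_eq_zero rfl)
      (doubleAntifields_of_snd_eq_zero rfl) (by norm_num)
  have h2 : derAntifield (h (ofAntifields (cxAntifields z))) = 0 :=
    derAntifield_eq_zero hμ fun w hw hp hw0 ↦ hL.cxPairing_eq_zero hμ hl haf hw hp
      (doubleAntifields_of_fst_eq_zero hw0) (doubleAntifields_of_fst_eq_zero rfl)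
      (doubleAntifields_of_fst_eq_zero rfl) (by norm_num)
  have h4 := congrArg h (ofFields_add_ofAntifields z)
  rw [map_add] at h4
  constructor
  · rw [← h4]
    exact (congrArg (· + derField (h (ofAntifields (cxAntifields z)))) h1).trans (zero_add _)
  · rw [← h4]
    exact (congrArg (derAntifield (h (ofFields (cxFields z))) + ·) h2).trans (add_zero _)

end FreeTheory

/-! ### Bodies and reality -/

section Body

theorem coeffAt_empty_prod {s : ℕ} {I : Fin s → Finset ℕ × Bool} (hs : s ≠ 0)
    (hI : ∀ i, (I i).1.Nonempty) (a : Grassmann) :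
    coeffAt ∅ ((List.ofFn fun i ↦ elt (I i)).prod * a) = 0 := by
  obtain ⟨s, rfl⟩ := Nat.exists_eq_succ_of_ne_zero hs
  rw [List.ofFn_succ, List.prod_cons, elt, smul_mul_assoc, smul_mul_assoc, map_smul, mul_assoc,
    coeffAt_θ_mul _ _ _ fun h ↦ (hI 0).ne_empty (Finset.subset_empty.1 h), smul_zero]

/-- The body of the value of a graded functional is the value of its lowest component at the
body. -/
theorem coeffAt_empty_eval (c : 𝒦) (Φ : 𝒞) :
    coeffAt ∅ (eval c Φ) = c 0 (body Φ) Fin.elim0 := by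
  have hev (i : Finset ℕ × Bool) (hi : i ∈ evenIdx Φ) : i.1.Nonempty := by
    simp only [evenIdx, Finset.mem_product, Finset.mem_filter] at hi
    exact hi.1.2.1
  have hod (i : Finset ℕ × Bool) (hi : i ∈ oddIdx Φ) : i.1.Nonempty := by
    simp only [oddIdx, Finset.mem_product, Finset.mem_filter] at hi
    exact Finset.card_pos.1 hi.1.2.pos
  unfold eval
  rw [map_sum, Finset.sum_eq_single 0, map_sum, Finset.sum_eq_single 0]
  · rw [map_smul, map_sum, Fintype.piFinset_of_isEmpty, Finset.univ_unique, Finset.sum_singleton,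
      map_sum, Fintype.piFinset_of_isEmpty, Finset.univ_unique, Finset.sum_singleton, map_smul]
    have h1 : coeffAt ∅ (1 : Grassmann) = 1 := by rw [← θ_empty, coeffAt_θ, if_pos rfl]
    simp only [List.ofFn_zero, List.prod_nil, mul_one, h1, mixedDeriv, iteratedFDeriv_zero_apply,
      Finset.univ_eq_empty, Finset.sum_empty, add_zero, smul_eq_mul, Nat.factorial_zero,
      Nat.cast_one, inv_one, one_mul]
    exact congrArg _ (Subsingleton.elim _ _)
  · intro k _ hk
    rw [map_smul, map_sum, Finset.sum_eq_zero, smul_zero]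
    intro a ha
    rw [map_sum]
    refine Finset.sum_eq_zero fun b hb ↦ ?_
    have h1 : (List.ofFn fun i : Fin 0 ↦ elt (a i)).prod *
        (List.ofFn fun i ↦ elt (b i)).prod = (List.ofFn fun i ↦ elt (b i)).prod * 1 := by
      rw [List.ofFn_zero, List.prod_nil, one_mul, mul_one]
    rw [map_smul, h1, coeffAt_empty_prod hk fun i ↦ hod _ (Fintype.mem_piFinset.1 hb i), smul_zero]
  · intro h
    exact absurd (Finset.mem_range.2 (Nat.succ_pos _)) h
  · intro j _ hj
    rw [map_sum]
    refine Finset.sum_eq_zero fun k _ ↦ ?_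
    rw [map_smul, map_sum, Finset.sum_eq_zero, smul_zero]
    intro a ha
    rw [map_sum]
    refine Finset.sum_eq_zero fun b _ ↦ ?_
    rw [map_smul, coeffAt_empty_prod hj fun i ↦ hev _ (Fintype.mem_piFinset.1 ha i), smul_zero]
  · intro h
    exact absurd (Finset.mem_range.2 (Nat.succ_pos _)) h

variable {c : Components d F₀ E₀ F₁ E₁}

/-- A functional with real body has a real component without odd arguments, on real fields. -/
theorem HasRealBody.im_eq_zero (hr : HasRealBody (eval c)) (φ : Sec d F₀ E₀) :
    (c 0 ((φ, 0) : ℰ) Fin.elim0).im = 0 := by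
  obtain ⟨a, ha⟩ := hr φ
  have h1 := coeffAt_empty_eval c (Finsupp.single ∅ (((φ, 0), (0, 0)), 0))
  have h2 : body (Finsupp.single ∅ (((φ, 0), (0, 0)), 0) : 𝒞) = (φ, 0) := by
    rw [body, Finsupp.single_eq_same]
  rw [h2, ha, Algebra.algebraMap_eq_smul_one, map_smul, ← θ_empty, coeffAt_θ, if_pos rfl,
    smul_eq_mul, mul_one] at h1
  rw [← h1, Complex.ofReal_im]

/-- The derivative of a real functional with respect to the even fields has a real body. -/
theorem variation_empty_im (hμ : IsSmoothDensity d μ) (hc : IsLocal μ c)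
    (hr : HasRealBody (eval c)) (Φ : 𝒞) : (variation μ c Φ ∅).2.1.1 = 0 := by
  have := hμ.isLocallyFiniteMeasure
  set u := (variation μ c Φ ∅).2
  let z : Cx 𝒟 := (((u.1.1, 0), 0), 0)
  refine (even_components_eq_zero hμ (z := z) fun w hw ho ↦ ?_).1.1
  have h1 : pairing μ w z.1 = pairing μ ((w.1.1, 0), 0) u := by
    simp only [pairing_eq]
    congr 1
    ext x
    simp [pairFun, z]
  have h2 : pairing μ ((w.1.1, 0), 0) u = 0 := by
    have h3 := congrArg (coeffAt ∅) ((variation_spec hμ hc Φ).2 ((w.1.1, 0), 0))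
    rw [coeffAt_empty_eval, coeffAt_grPairing] at h3
    rw [← cxPairing_im ((w.1.1, 0), 0) (variation μ c Φ ∅), ← h3,
      dT_of_oddPart hc.isSmoothAlt (w := ((w.1.1, 0), 0)) rfl]
    have h4 := hc.isSmoothAlt.hasDerivAt 0 (body Φ) Fin.elim0
      ((w.1.1, 0) : ℰ) 0
    rw [zero_smul, add_zero] at h4
    have h5 := Complex.imCLM.hasFDerivAt.comp_hasDerivAt (0 : ℝ) h4
    refine h5.unique ?_
    have h6 (τ : ℝ) : (c 0 (body Φ + τ • ((w.1.1, 0) : ℰ)) Fin.elim0).im = 0 := by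
      have h7 : body Φ + τ • ((w.1.1, 0) : ℰ) =
          ((Φ ∅).1.1.1 + τ • w.1.1, 0) := by simp [body]
      rw [h7]
      exact hr.im_eq_zero _
    exact (hasDerivAt_const (0 : ℝ) (0 : ℝ)).congr_of_eventuallyEq (Eventually.of_forall h6)
  apply Complex.ext
  · rw [cxPairing_re, h1, h2, Complex.zero_re]
  · rw [cxPairing_im, pairing_zero_right, Complex.zero_im]

end Body

section FreeTheory

variable {L : (M → ℝ) → Functional d F₀ E₀ F₁ E₁}
  {h : Cx (Tot d F₀ E₀ F₁ E₁) →ₗ[ℝ] Cx (Der d F₀ E₀ F₁ E₁)}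

/-- Near a compact set, the variation of a quadratic Lagrangian is that of a local functional. -/
theorem IsHessian.exists_grPairing_eq (hμ : IsSmoothDensity d μ) (hL : IsHessian μ L h)
    {w : 𝒯} (hw : IsCompact (totSupp w)) :
    ∃ f, IsTest d f ∧ ∀ c, IsLocal μ c → L f = eval c → ∀ Φ, IsPoint Φ →
      grPairing μ w (grMap h Φ) = eval (dT w c) Φ := by
  obtain ⟨f, hf, hf1⟩ := exists_test_of_isCompact (d := d) hw
  obtain ⟨O, hO, hwO, hO1⟩ := exists_open_eq_one hf1
  refine ⟨f, hf, fun c hc hfc Φ hΦ ↦ ?_⟩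
  obtain ⟨T, hT, hTv, hTO⟩ := hL.exists_cutoff f hf c hc hfc
  rw [(variation_spec hμ hc Φ).2 w]
  refine grPairing_congr hμ (O := O) (fun I ↦ ?_) hw hwO
  rw [grMap_apply, hTv Φ hΦ I]
  exact hTO O hO hO1 _

theorem IsHessian.isOddConf (hμ : IsSmoothDensity d μ) (hL : IsHessian μ L h)
    (hl : IsEvenLocal μ L) {Φ : 𝒞} (hΦ : IsPoint Φ) :
    IsOddConf (ham (grMap h Φ)) := by
  have := hμ.isLocallyFiniteMeasure
  refine isOddConf_ham hμ (fun w hw ho ↦ ?_) fun w hw he ↦ ?_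
  · obtain ⟨f, hf, H⟩ := hL.exists_grPairing_eq hμ hw
    obtain ⟨c, hc, hfc, hce⟩ := hl f hf
    rw [H c hc hfc Φ hΦ]
    exact inv_eval_dT_of_oddPart hc.isSmoothAlt hce hΦ ho
  · obtain ⟨f, hf, H⟩ := hL.exists_grPairing_eq hμ hw
    obtain ⟨c, hc, hfc, hce⟩ := hl f hf
    rw [H c hc hfc Φ hΦ]
    exact inv_eval_dT_of_evenPart hc.isSmoothAlt hce hΦ he

theorem isPoint_single_even (e : Sec d F₀ E₀) :
    IsPoint (Finsupp.single ∅ (((e, 0), 0), 0) : 𝒞) := by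
  refine ⟨(isEvenConf_single (Or.inl ⟨by simp, rfl⟩)).1,
    (isEvenConf_single (Or.inl ⟨by simp, rfl⟩)).2, ?_, ?_⟩
  · rw [Finsupp.single_eq_same]
  · rw [Finsupp.single_eq_same]

/-- The field equations do not mix even and odd fields. -/
theorem IsHessian.derField_even (hμ : IsSmoothDensity d μ) (hL : IsHessian μ L h)
    (hl : IsEvenLocal μ L) (e : Sec d F₀ E₀) :
    (derField (h (((e, 0), 0), 0))).1.2 = 0 ∧ (derField (h (((e, 0), 0), 0))).2.2 = 0 := by
  have h1 := (hL.isOddConf hμ hl (isPoint_single_even e)).1 ∅ (by simp)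
  rw [ham_apply, grMap_apply, Finsupp.single_eq_same] at h1
  exact ⟨neg_eq_zero.1 (congrArg (fun p : ℰ ↦ p.2) h1.1),
    neg_eq_zero.1 (congrArg (fun p : ℰ ↦ p.2) h1.2)⟩

/-- The Hessian of an even action does not mix even and odd fields. -/
theorem IsHessian.derField_odd (hμ : IsSmoothDensity d μ) (hL : IsHessian μ L h)
    (hl : IsEvenLocal μ L) (e : Sec d F₁ E₁) :
    (derField (h (((0, e), 0), 0))).1.1 = 0 ∧ (derField (h (((0, e), 0), 0))).2.1 = 0 := by
  have h0 : IsPoint (0 + Finsupp.single {0} (((0, e), 0), 0) : 𝒞) :=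
    isPoint_zero.add_single (Finset.singleton_nonempty 0) (Or.inr ⟨by simp, rfl⟩)
  rw [zero_add] at h0
  have h1 := (hL.isOddConf hμ hl h0).2 {0} (by simp)
  rw [ham_apply, grMap_apply, Finsupp.single_eq_same] at h1
  exact ⟨neg_eq_zero.1 (congrArg (fun p : 𝒪 ↦ p.2) h1.1),
    neg_eq_zero.1 (congrArg (fun p : 𝒪 ↦ p.2) h1.2)⟩

/-- The field equations of the even fields are real. -/
theorem IsHessian.derField_real (hμ : IsSmoothDensity d μ) (hL : IsHessian μ L h)
    (hl : ∀ f, IsTest d f → ∃ c, IsLocal μ c ∧ L f = eval c)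
    (hr : ∀ f, IsTest d f → HasRealBody (L f)) (e : Sec d F₀ E₀) :
    (derField (h (((e, 0), 0), 0))).2.1 = 0 := by
  have := hμ.isLocallyFiniteMeasure
  set u := (h (((e, 0), 0), 0)).2
  let z : Cx 𝒟 := (((u.1.1, 0), 0), 0)
  refine (even_components_eq_zero hμ (z := z) fun w hw ho ↦ ?_).1.1
  have h1 : pairing μ w z.1 = pairing μ ((w.1.1, 0), 0) u := by
    simp only [pairing_eq]
    congr 1
    ext x
    simp [pairFun, z]
  have hw' : IsCompact (totSupp (((w.1.1, 0), 0) : 𝒯)) :=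
    isCompact_totSupp_of_subset hw (totSupp_subset (isClosed_totSupp w) fun x hx ↦
      ⟨(apply_eq_zero_of_notMem_totSupp hx).1, rfl, rfl, rfl⟩)
  have h2 : pairing μ ((w.1.1, 0), 0) u = 0 := by
    obtain ⟨f, hf, H⟩ := hL.exists_grPairing_eq hμ hw'
    obtain ⟨c, hc, hfc⟩ := hl f hf
    have h3 := congrArg (coeffAt ∅) (H c hc hfc _ (isPoint_single_even e))
    rw [(variation_spec hμ hc _).2, coeffAt_grPairing, coeffAt_grPairing, grMap_apply,
      Finsupp.single_eq_same] at h3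
    rw [← cxPairing_im ((w.1.1, 0), 0) (h (((e, 0), 0), 0)), h3, cxPairing_im]
    have h4 := variation_empty_im hμ hc (hfc ▸ hr f hf) (Finsupp.single ∅ (((e, 0), 0), 0))
    rw [pairing_eq]
    refine (integral_congr_ae (Eventually.of_forall fun x ↦ ?_)).trans (integral_zero M ℝ)
    simp [pairFun, h4]
  apply Complex.ext
  · rw [cxPairing_re, h1, h2, Complex.zero_re]
  · rw [cxPairing_im, pairing_zero_right, Complex.zero_im]

end FreeTheory

/-! ### The operators of the free theory -/

section FreeOperators

variable {L L' : (M → ℝ) → Functional d F₀ E₀ F₁ E₁}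
  {h h' : Cx (Tot d F₀ E₀ F₁ E₁) →ₗ[ℝ] Cx (Der d F₀ E₀ F₁ E₁)}

/-- The operator `φ ↦ δ_l L/δφ` of an antifield-free Lagrangian. -/
def fieldOp (h : Cx 𝒯 →ₗ[ℝ] Cx 𝒟) :
    FieldOperator d F₀ E₀ F₁ E₁ where
  toFun z := derField (h (ofFields z))
  map_add' z z' := by
    have h1 : (ofFields (z + z') : Cx 𝒯) = ofFields z + ofFields z' := by
      simp [ofFields]
    rw [h1, map_add]
    rfl
  map_smul' a z := by
    have h1 : (ofFields (a • z) : Cx 𝒯) = a • ofFields z := by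
      simp [ofFields]
    rw [h1, map_smul]
    rfl

/-- The operator `φ ↦ δ_l L/δφ‡` of a Lagrangian that is linear in the antifields. -/
def brstOp (h : Cx 𝒯 →ₗ[ℝ] Cx 𝒟) :
    Cx 𝒢 →ₗ[ℝ] Cx 𝒢 where
  toFun z := derAntifield (h (ofFields z))
  map_add' z z' := by
    have h1 : (ofFields (z + z') : Cx 𝒯) = ofFields z + ofFields z' := by
      simp [ofFields]
    rw [h1, map_add]
    rfl
  map_smul' a z := by
    have h1 : (ofFields (a • z) : Cx 𝒯) = a • ofFields z := by
      simp [ofFields]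
    rw [h1, map_smul]
    rfl

/-- The operator `φ‡ ↦ δ_l L/δφ` of a Lagrangian that is linear in the antifields. -/
def dualBrstOp (h : Cx 𝒯 →ₗ[ℝ] Cx 𝒟) :
    Cx 𝒜 →ₗ[ℝ] Cx 𝒜 where
  toFun z := derField (h (ofAntifields z))
  map_add' z z' := by
    have h1 : (ofAntifields (z + z') : Cx 𝒯) =
        ofAntifields z + ofAntifields z' := by
      simp [ofAntifields]
    rw [h1, map_add]
    rfl
  map_smul' a z := by
    have h1 : (ofAntifields (a • z) : Cx 𝒯) = a • ofAntifields z := by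
      simp [ofAntifields]
    rw [h1, map_smul]
    rfl

theorem ofFields_mulI (z : Cx 𝒢) :
    (ofFields (Cx.mulI z) : Cx 𝒯) = Cx.mulI (ofFields z) := by
  simp [ofFields, Cx.mulI]

theorem ofAntifields_mulI (z : Cx 𝒜) :
    (ofAntifields (Cx.mulI z) : Cx 𝒯) = Cx.mulI (ofAntifields z) := by
  simp [ofAntifields, Cx.mulI]

theorem IsLocalOp.fieldOp_mulI (hh : IsLocalOp h) (z) :
    fieldOp h (Cx.mulI z) = Cx.mulI (fieldOp h z) := by
  change derField (h (ofFields (Cx.mulI z))) = _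
  rw [ofFields_mulI, hh.mulI]
  rfl

theorem IsLocalOp.brstOp_mulI (hh : IsLocalOp h) (z) :
    brstOp h (Cx.mulI z) = Cx.mulI (brstOp h z) := by
  change derAntifield (h (ofFields (Cx.mulI z))) = _
  rw [ofFields_mulI, hh.mulI]
  rfl

theorem IsLocalOp.dualBrstOp_mulI (hh : IsLocalOp h) (z) :
    dualBrstOp h (Cx.mulI z) = Cx.mulI (dualBrstOp h z) := by
  change derField (h (ofAntifields (Cx.mulI z))) = _
  rw [ofAntifields_mulI, hh.mulI]
  rfl

theorem supp_subset_cxSupp (z : Cx 𝒢) :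
    totSupp (ofFields z).1 ∪ totSupp (ofFields z).2 ⊆ cxSupp z := by
  refine union_subset ?_ ?_
  · refine totSupp_subset (isClosed_cxSupp z) fun x hx ↦ ?_
    obtain ⟨⟨h1, h2⟩, -⟩ := apply_eq_zero_of_notMem_cxSupp hx
    exact ⟨h1, h2, rfl, rfl⟩
  · refine totSupp_subset (isClosed_cxSupp z) fun x hx ↦ ?_
    obtain ⟨-, h1, h2⟩ := apply_eq_zero_of_notMem_cxSupp hx
    exact ⟨h1, h2, rfl, rfl⟩

theorem supp_subset_cxSupp' (z : Cx 𝒜) :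
    totSupp (ofAntifields z).1 ∪ totSupp (ofAntifields z).2 ⊆ cxSupp z := by
  refine union_subset ?_ ?_
  · refine totSupp_subset (isClosed_cxSupp z) fun x hx ↦ ?_
    obtain ⟨⟨h1, h2⟩, -⟩ := apply_eq_zero_of_notMem_cxSupp hx
    exact ⟨rfl, rfl, h1, h2⟩
  · refine totSupp_subset (isClosed_cxSupp z) fun x hx ↦ ?_
    obtain ⟨-, h1, h2⟩ := apply_eq_zero_of_notMem_cxSupp hx
    exact ⟨rfl, rfl, h1, h2⟩

theorem CxDerOff.cxSupp_derField {K : Set M} (hK : IsClosed K) {u : Cx 𝒟}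
    (hu : CxDerOff K u) : cxSupp (derField u) ⊆ K :=
  cxSupp_subset hK fun x hx ↦ by
    obtain ⟨h1, h2, -⟩ := hu.1 x hx
    obtain ⟨h3, h4, -⟩ := hu.2 x hx
    exact ⟨⟨h1, h2⟩, h3, h4⟩

theorem CxDerOff.cxSupp_derAntifield {K : Set M} (hK : IsClosed K)
    {u : Cx 𝒟} (hu : CxDerOff K u) : cxSupp (derAntifield u) ⊆ K :=
  cxSupp_subset hK fun x hx ↦ by
    obtain ⟨-, -, h1, h2⟩ := hu.1 x hx
    obtain ⟨-, -, h3, h4⟩ := hu.2 x hx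
    exact ⟨⟨h1, h2⟩, h3, h4⟩

theorem IsLocalOp.cxSupp_brstOp (hh : IsLocalOp h) (z) : cxSupp (brstOp h z) ⊆ cxSupp z :=
  CxDerOff.cxSupp_derAntifield (isClosed_cxSupp z) ((hh.off _).mono (supp_subset_cxSupp z))

theorem IsLocalOp.cxSupp_dualBrstOp (hh : IsLocalOp h) (z) :
    cxSupp (dualBrstOp h z) ⊆ cxSupp z :=
  CxDerOff.cxSupp_derField (isClosed_cxSupp z) ((hh.off _).mono (supp_subset_cxSupp' z))

/-- The operator of the field equations is the one that represents the variation. -/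
theorem IsHessian.eq_fieldOp (hμ : IsSmoothDensity d μ) (hL : IsHessian μ L h)
    (hl : IsEvenLocal μ L) {P : FieldOperator d F₀ E₀ F₁ E₁}
    (hP : IsFieldEquation μ L P) : P = fieldOp h := by
  refine LinearMap.ext fun z ↦ ?_
  obtain ⟨Φ, hΦ, hz⟩ := exists_isPoint_add (ofFields z : Cx 𝒯)
  obtain ⟨U, hU, hUP⟩ := hP Φ hΦ
  have h1 : U = grMap h Φ := hU.unique hμ (hL.isLeftDeriv_self hμ hl hΦ)
  have h2 (I) : derField (h (Φ I)) = P (cxFields (Φ I)) := by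
    have h3 := hUP I
    rw [h1, grMap_apply] at h3
    exact h3
  have h4 : z = cxFields (Φ {0, 1}) + cxFields (Φ {0}) := congrArg cxFields hz
  change P z = derField (h (ofFields z))
  rw [hz, map_add, h4, map_add, ← h2, ← h2]
  rfl

/-- The variation of `S₀₀ + θ₀` in terms of the operators `P`, `K` and `K'`. -/
theorem derField_add_apply (hμ : IsSmoothDensity d μ) (hL : IsHessian μ L h)
    (hl : IsEvenLocal μ L) (haf : ∀ f, IsTest d f → HasAntifieldNumber 0 (L f))
    (hL' : IsHessian μ L' h') (hl' : IsEvenLocal μ L')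
    (haf' : ∀ f, IsTest d f → HasAntifieldNumber 1 (L' f)) (z : Cx 𝒯) :
    derField ((h + h') z) = fieldOp h (cxFields z) + dualBrstOp h' (cxAntifields z) := by
  have h1 := (hL.of_antifieldNumber_zero hμ hl haf z).1
  have h2 := (hL'.of_antifieldNumber_one hμ hl' haf' z).1
  exact congrArg₂ (· + ·) h1 h2

/-- The antifield derivative of the free action comes from its part linear in the antifields. -/
theorem derAntifield_add_apply (hμ : IsSmoothDensity d μ) (hL : IsHessian μ L h)
    (hl : IsEvenLocal μ L) (haf : ∀ f, IsTest d f → HasAntifieldNumber 0 (L f))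
    (hL' : IsHessian μ L' h') (hl' : IsEvenLocal μ L')
    (haf' : ∀ f, IsTest d f → HasAntifieldNumber 1 (L' f)) (z : Cx 𝒯) :
    derAntifield ((h + h') z) = brstOp h' (cxFields z) := by
  have h1 := (hL.of_antifieldNumber_zero hμ hl haf z).2
  have h2 := (hL'.of_antifieldNumber_one hμ hl' haf' z).2
  exact (congrArg₂ (· + ·) h1 h2).trans (zero_add _)

/-- The classical master equation of the free action. -/
theorem fieldOp_brstOp (hμ : IsSmoothDensity d μ) (hL : IsHessian μ L h)
    (hl : IsEvenLocal μ L) (haf : ∀ f, IsTest d f → HasAntifieldNumber 0 (L f))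
    (hL' : IsHessian μ L' h') (hl' : IsEvenLocal μ L')
    (haf' : ∀ f, IsTest d f → HasAntifieldNumber 1 (L' f))
    (hnil : ∀ z, (h + h') (cxHam ((h + h') z)) = 0) (z : Cx 𝒢) :
    fieldOp h (brstOp h' z) = dualBrstOp h' (fieldOp h z) := by
  have h1 := congrArg derField (hnil (ofFields z))
  rw [derField_add_apply hμ hL hl haf hL' hl' haf'] at h1
  have h2 : cxFields (cxHam ((h + h') (ofFields z))) = brstOp h' z :=
    derAntifield_add_apply hμ hL hl haf hL' hl' haf' (ofFields z)
  have h3 : cxAntifields (cxHam ((h + h') (ofFields z))) = -fieldOp h z := by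
    have h4 := derField_add_apply hμ hL hl haf hL' hl' haf' (ofFields z)
    have h5 : cxAntifields (ofFields z : Cx 𝒯) = 0 := rfl
    rw [h5, map_zero, add_zero] at h4
    exact congrArg Neg.neg h4
  rw [h2, h3, map_neg] at h1
  exact eq_of_sub_eq_zero ((sub_eq_add_neg _ _).trans h1)

theorem eq_fst_add_mulI_snd {A : Type*} [AddCommGroup A] (z : Cx A) :
    z = (z.1, 0) + Cx.mulI (z.2, 0) := by
  simp [Cx.mulI]

/-- The operator of the field equations commutes with complex conjugation on the even fields and
with the projection to the odd fields. -/
theorem fieldOp_conjFst (hμ : IsSmoothDensity d μ) (hL : IsHessian μ L h)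
    (hl : IsEvenLocal μ L) (hr : ∀ f, IsTest d f → HasRealBody (L f))
    (z : Cx 𝒢) :
    fieldOp h (conjFst z) = conjFst (fieldOp h z) := by
  have hreal (w : 𝒢) : fieldOp h (conjFst (w, 0)) =
      conjFst (fieldOp h (w, 0)) := by
    have h1 : ((w, 0) : Cx 𝒢) = ((w.1, 0), 0) + ((0, w.2), 0) := by simp
    have h2 : conjFst ((w, 0) : Cx 𝒢) = ((w.1, 0), 0) := by simp [conjFst]
    have h3 := hL.derField_even hμ hl w.1
    have h4 := hL.derField_odd hμ hl w.2
    have h5 := hL.derField_real hμ (fun f hf ↦ (hl f hf).imp fun _ h ↦ ⟨h.1, h.2.1⟩) hr w.1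
    rw [h2, h1, map_add, map_add]
    set u : Cx 𝒜 := fieldOp h ((w.1, 0), 0)
    set v : Cx 𝒜 := fieldOp h ((0, w.2), 0)
    have hu1 : u.1.2 = 0 := h3.1
    have hu2 : u.2.2 = 0 := h3.2
    have hu3 : u.2.1 = 0 := h5
    have hv1 : v.1.1 = 0 := h4.1
    have hv2 : v.2.1 = 0 := h4.2
    have e1 : conjFst v = 0 := by
      change ((v.1.1, 0), (-v.2.1, 0)) = _
      rw [hv1, hv2, neg_zero]
      rfl
    have e2 : conjFst u = u := by
      change ((u.1.1, 0), (-u.2.1, 0)) = _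
      rw [← hu1, hu3, neg_zero, ← hu3]
      exact Prod.ext rfl (Prod.ext rfl (hu1.trans hu2.symm))
    rw [e1, e2, add_zero]
  rw [eq_fst_add_mulI_snd z, map_add, map_add, map_add, conjFst_mulI, map_neg, map_add, hreal,
    hL.isLocalOp.fieldOp_mulI, hL.isLocalOp.fieldOp_mulI, conjFst_mulI, hreal]

/-- The field equation preserves parity. -/
theorem fieldOp_projSnd (hμ : IsSmoothDensity d μ) (hL : IsHessian μ L h)
    (hl : IsEvenLocal μ L) (z : Cx 𝒢) :
    fieldOp h (projSnd z) = projSnd (fieldOp h z) := by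
  have hreal (w : 𝒢) : fieldOp h (projSnd (w, 0)) =
      projSnd (fieldOp h (w, 0)) := by
    have h1 : ((w, 0) : Cx 𝒢) = ((w.1, 0), 0) + ((0, w.2), 0) := by simp
    have h2 : projSnd ((w, 0) : Cx 𝒢) = ((0, w.2), 0) := by
      simp [projSnd]
    have h3 := hL.derField_even hμ hl w.1
    have h4 := hL.derField_odd hμ hl w.2
    rw [h2, h1, map_add, map_add]
    set u : Cx 𝒜 := fieldOp h ((w.1, 0), 0)
    set v : Cx 𝒜 := fieldOp h ((0, w.2), 0)
    have hu1 : u.1.2 = 0 := h3.1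
    have hu2 : u.2.2 = 0 := h3.2
    have hv1 : v.1.1 = 0 := h4.1
    have hv2 : v.2.1 = 0 := h4.2
    have e1 : projSnd u = 0 := by
      change ((0, u.1.2), (0, u.2.2)) = _
      rw [hu1, hu2]
      rfl
    have e2 : projSnd v = v := Prod.ext (Prod.ext hv1.symm rfl) (Prod.ext hv2.symm rfl)
    rw [e1, e2, zero_add]
  rw [eq_fst_add_mulI_snd z, map_add, map_add, map_add, projSnd_mulI, map_add, hreal,
    hL.isLocalOp.fieldOp_mulI, hL.isLocalOp.fieldOp_mulI, projSnd_mulI, hreal]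

end FreeOperators

/-! ### The Møller map -/

section Moller

section GreenDirection

variable {J : Set M → Set M} {P : FieldOperator d F₀ E₀ F₁ E₁} {Δ : GreenOperator d F₀ E₀ F₁ E₁}

theorem greenDirection_apply (Δ : GreenOperator d F₀ E₀ F₁ E₁)
    (u : GrVec 𝒜) (I : Finset ℕ) :
    greenDirection Δ u I = ofFields (applyGreen Δ (u I)) := Finsupp.mapRange_apply

theorem greenDirection_add {u v : GrVec 𝒜}
    (hu : HasCompactCoefficients u) (hv : HasCompactCoefficients v) :
    greenDirection Δ (u + v) = greenDirection Δ u + greenDirection Δ v := by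
  ext1 I
  rw [Finsupp.add_apply, greenDirection_apply, greenDirection_apply, greenDirection_apply,
    Finsupp.add_apply, applyGreen_add (hu I) (hv I)]
  simp [ofFields]

theorem greenDirection_mulRight {n : ℕ} {u : GrVec 𝒜}
    (hn : IsFresh n u) :
    greenDirection Δ (GrVec.mulRight n u) = GrVec.mulRight n (greenDirection Δ u) := by
  have hn' : IsFresh n (greenDirection Δ u) := hn.of_support_subset Finsupp.support_mapRange
  ext1 I
  rw [greenDirection_apply, mulRight_apply hn, mulRight_apply hn']
  by_cases hI : n ∈ I
  · rw [if_pos hI, if_pos hI, greenDirection_apply]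
  · rw [if_neg hI, if_neg hI, applyGreen_zero]
    rfl

theorem applyGreen_eq_zero_of_not {z : Cx 𝒜}
    (h : ¬ IsCompact (cxSupp z)) : applyGreen Δ z = 0 := dif_neg h

/-- The Green function maps even antifield derivatives to even fields. -/
theorem applyGreen_even (H : IsSplit Δ) {z : Cx 𝒜} (h1 : z.1.2 = 0) (h2 : z.2.2 = 0) :
    (applyGreen Δ z).1.2 = 0 ∧ (applyGreen Δ z).2.2 = 0 := by
  by_cases hz : IsCompact (cxSupp z)
  · have h3 : restrictProj (⟨z, hz⟩ : ℬ) = 0 := by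
      apply Subtype.ext
      change ((0, z.1.2), (0, z.2.2)) = _
      rw [h1, h2]
      rfl
    rw [applyGreen_of_isCompact hz, H ⟨z, hz⟩, h3, map_zero, map_zero, add_zero]
    exact ⟨rfl, rfl⟩
  · rw [applyGreen_eq_zero_of_not hz]
    exact ⟨rfl, rfl⟩

/-- The Green function maps odd antifield derivatives to odd fields. -/
theorem applyGreen_odd (H : IsSplit Δ) {z : Cx 𝒜} (h1 : z.1.1 = 0) (h2 : z.2.1 = 0) :
    (applyGreen Δ z).1.1 = 0 ∧ (applyGreen Δ z).2.1 = 0 := by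
  by_cases hz : IsCompact (cxSupp z)
  · have h3 : restrictConj (⟨z, hz⟩ : ℬ) = 0 := by
      apply Subtype.ext
      change ((z.1.1, 0), (-z.2.1, 0)) = _
      rw [h1, h2, neg_zero]
      rfl
    rw [applyGreen_of_isCompact hz, H ⟨z, hz⟩, h3, map_zero, map_zero, zero_add]
    exact ⟨rfl, rfl⟩
  · rw [applyGreen_eq_zero_of_not hz]
    exact ⟨rfl, rfl⟩

/-- The Green function is real on the even fields. -/
theorem applyGreen_real (H : IsSplit Δ) {z : Cx 𝒜}
    (h1 : z.1.2 = 0) (h2 : z.2.2 = 0) (h3 : z.2.1 = 0) :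
    (applyGreen Δ z).2 = 0 := by
  refine Prod.ext ?_ (applyGreen_even H h1 h2).2
  by_cases hz : IsCompact (cxSupp z)
  · have h4 : restrictProj (⟨z, hz⟩ : ℬ) = 0 := by
      apply Subtype.ext
      change ((0, z.1.2), (0, z.2.2)) = _
      rw [h1, h2]
      rfl
    have h5 : restrictConj (⟨z, hz⟩ : ℬ) = ⟨z, hz⟩ := by
      apply Subtype.ext
      change ((z.1.1, 0), (-z.2.1, 0)) = z
      rw [h3, neg_zero]
      exact Prod.ext (Prod.ext rfl h1.symm) (Prod.ext h3.symm h2.symm)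
    have h6 := H ⟨z, hz⟩
    rw [h4, h5, map_zero, map_zero, add_zero] at h6
    rw [applyGreen_of_isCompact hz]
    have h7 : (Δ ⟨z, hz⟩).2.1 = -(Δ ⟨z, hz⟩).2.1 :=
      congrArg (fun p : Cx 𝒢 ↦ p.2.1) h6
    have h8 : (2 : ℝ) • (Δ ⟨z, hz⟩).2.1 = 0 := by
      rw [two_smul]
      nth_rewrite 2 [h7]
      exact add_neg_cancel _
    rw [← inv_smul_smul₀ (two_ne_zero (α := ℝ)) (Δ ⟨z, hz⟩).2.1, h8, smul_zero]
    rfl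
  · rw [applyGreen_eq_zero_of_not hz]
    rfl

/-- The part `δ_l/δφ` of the derivatives. -/
def fieldPart (U : GrVec 𝒟) : GrVec 𝒜 :=
  U.mapRange (fun z ↦ (z.1.1, z.2.1)) rfl

theorem fieldPart_apply (U : GrVec 𝒟) (I : Finset ℕ) :
    fieldPart U I = derField (U I) := Finsupp.mapRange_apply

theorem CompactOff.fieldPart {U : GrVec 𝒟} (h : CompactOff U) :
    HasCompactCoefficients (fieldPart U) := fun I ↦ by
  obtain ⟨K, hK, hU⟩ := h
  rw [fieldPart_apply]
  exact isCompact_cxSupp_of_subset hK (CxDerOff.cxSupp_derField hK.isClosed (hU I))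

/-- If the Hamiltonian vector field of `U` is odd, the Green function maps `U` to an even
direction. -/
theorem isEvenConf_greenDirection (H : IsSplit Δ) {U : GrVec 𝒟} (hU : IsOddConf (ham U)) :
    IsEvenConf (greenDirection Δ (fieldPart U)) := by
  refine ⟨fun I hI ↦ ?_, fun I hI ↦ ?_⟩
  · obtain ⟨h1, h2⟩ := hU.1 I hI
    rw [ham_apply] at h1 h2
    have h3 := applyGreen_even H (z := derField (U I))
      (neg_eq_zero.1 (congrArg (fun p : ℰ ↦ p.2) h1))
      (neg_eq_zero.1 (congrArg (fun p : ℰ ↦ p.2) h2))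
    rw [greenDirection_apply, fieldPart_apply]
    exact ⟨Prod.ext h3.1 rfl, Prod.ext h3.2 rfl⟩
  · obtain ⟨h1, h2⟩ := hU.2 I hI
    rw [ham_apply] at h1 h2
    have h3 := applyGreen_odd H (z := derField (U I))
      (neg_eq_zero.1 (congrArg (fun p : 𝒪 ↦ p.2) h1))
      (neg_eq_zero.1 (congrArg (fun p : 𝒪 ↦ p.2) h2))
    rw [greenDirection_apply, fieldPart_apply]
    exact ⟨Prod.ext h3.1 rfl, Prod.ext h3.2 rfl⟩

/-- A direction is odd if its product with a new generator is even. -/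
theorem isOddConf_of_mulRight {n : ℕ} {q : 𝒞} (hn : IsFresh n q)
    (h : IsEvenConf (GrVec.mulRight n q)) : IsOddConf q := by
  have key (I : Finset ℕ) (hI : n ∉ I) : q I = GrVec.mulRight n q (insert n I) := by
    rw [mulRight_apply hn, if_pos (Finset.mem_insert_self n I), Finset.erase_insert hI]
  have h0 (I : Finset ℕ) (hI : n ∈ I) : q I = 0 := by
    by_contra h
    exact hn.notMem (Finsupp.mem_support_iff.2 h) hI
  refine ⟨fun I hI ↦ ?_, fun I hI ↦ ?_⟩
  · by_cases hnI : n ∈ I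
    · rw [h0 I hnI]
      exact ⟨rfl, rfl⟩
    · rw [key I hnI]
      exact h.2 _ (by rw [Finset.card_insert_of_notMem hnI]; exact hI.add_one)
  · by_cases hnI : n ∈ I
    · rw [h0 I hnI]
      exact ⟨rfl, rfl⟩
    · rw [key I hnI]
      exact h.1 _ (by rw [Finset.card_insert_of_notMem hnI]; exact hI.add_one)

end GreenDirection

theorem IsOddConf.add {q q' : 𝒞} (h : IsOddConf q) (h' : IsOddConf q') :
    IsOddConf (q + q') := by
  refine ⟨fun I hI ↦ ?_, fun I hI ↦ ?_⟩
  · rw [Finsupp.add_apply, Prod.fst_add, Prod.snd_add, evenPart_add, evenPart_add,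
      (h.1 I hI).1, (h.1 I hI).2, (h'.1 I hI).1, (h'.1 I hI).2, add_zero]
    exact ⟨rfl, rfl⟩
  · rw [Finsupp.add_apply, Prod.fst_add, Prod.snd_add, oddPart_add, oddPart_add,
      (h.2 I hI).1, (h.2 I hI).2, (h'.2 I hI).1, (h'.2 I hI).2, add_zero]
    exact ⟨rfl, rfl⟩

theorem IsOddConf.neg {q : 𝒞} (h : IsOddConf q) : IsOddConf (-q) := by
  have hev (w : 𝒯) (hw : evenPart w = 0) : evenPart (-w) = 0 :=
    (congrArg Neg.neg hw).trans neg_zero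
  have hod (w : 𝒯) (hw : oddPart w = 0) : oddPart (-w) = 0 :=
    (congrArg Neg.neg hw).trans neg_zero
  exact ⟨fun I hI ↦ ⟨hev _ (h.1 I hI).1, hev _ (h.1 I hI).2⟩,
    fun I hI ↦ ⟨hod _ (h.2 I hI).1, hod _ (h.2 I hI).2⟩⟩

variable {c : Components d F₀ E₀ F₁ E₁}

theorem mulRight_fieldPart {n : ℕ} {U : GrVec 𝒟} (hn : IsFresh n U) :
    fieldPart (GrVec.mulRight n U) = GrVec.mulRight n (fieldPart U) := by
  have hn' : IsFresh n (fieldPart U) := hn.of_support_subset Finsupp.support_mapRange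
  ext1 I
  rw [fieldPart_apply, mulRight_apply hn, mulRight_apply hn']
  by_cases hI : n ∈ I
  · rw [if_pos hI, if_pos hI, fieldPart_apply]
  · rw [if_neg hI, if_neg hI]
    rfl

/-- The Møller map, with the derivative of `V` in terms of its components. -/
theorem mollerField_eval (hμ : IsSmoothDensity d μ) (hc : IsLocal μ c)
    (Δ : GreenOperator d F₀ E₀ F₁ E₁) (Φ : 𝒞) :
    mollerField μ Δ (eval c) Φ = Φ + greenDirection Δ (fieldPart (variation μ c Φ)) := by
  rw [mollerField, fieldDeriv, (isLeftDeriv_eval hμ hc Φ).leftDeriv_eq hμ, fieldPart]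

theorem fieldPart_add (U U' : GrVec 𝒟) :
    fieldPart (U + U') = fieldPart U + fieldPart U' := by
  ext1 I
  rw [Finsupp.add_apply, fieldPart_apply, fieldPart_apply, fieldPart_apply, Finsupp.add_apply]
  rfl

/-- The Møller map sends a first order variation of a configuration to a first order variation. -/
theorem mollerField_add_mulRight (hμ : IsSmoothDensity d μ) (hc : IsLocal μ c)
    (Δ : GreenOperator d F₀ E₀ F₁ E₁) (Φ : 𝒞) {q : 𝒞}
    (hq : IsOddConf q) : ∀ᶠ n : ℕ in atTop,
      mollerField μ Δ (eval c) (Φ + GrVec.mulRight n q) = mollerField μ Δ (eval c) Φ +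
        GrVec.mulRight n (q + greenDirection Δ (fieldPart (secondVariation μ c Φ q))) := by
  have hW := (secondVariation_spec hμ hc Φ q).1
  filter_upwards [variation_add_mulRight hμ hc Φ hq,
    eventually_isFresh (secondVariation μ c Φ q)] with n h1 hn
  have hn' : IsFresh n (fieldPart (secondVariation μ c Φ q)) :=
    hn.of_support_subset Finsupp.support_mapRange
  have hcomp : HasCompactCoefficients
      (GrVec.mulRight n (fieldPart (secondVariation μ c Φ q))) := fun I ↦ by
    rw [mulRight_apply hn']
    split_ifs
    · exact hW.fieldPart _
    · exact (CompactlySupported d (F₀ →L[ℝ] ℝ) (fun x ↦ E₀ x →L[ℝ] ℝ) (F₁ →L[ℝ] ℝ)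
        (fun x ↦ E₁ x →L[ℝ] ℝ)).zero_mem
  rw [mollerField_eval hμ hc, mollerField_eval hμ hc, h1, fieldPart_add, mulRight_fieldPart hn,
    greenDirection_add (variation_spec hμ hc Φ).1.fieldPart hcomp, greenDirection_mulRight hn',
    mulRight_add]
  abel

/-- The Møller map preserves points: this needs `Δ` to preserve parity and to be real on even
fields, and the body of `V` to be real. -/
theorem isPoint_mollerField (hμ : IsSmoothDensity d μ) (hc : IsLocal μ c)
    (he : IsEvenFunctional (eval c)) (hr : HasRealBody (eval c))
    {Δ : GreenOperator d F₀ E₀ F₁ E₁} (H : IsSplit Δ) {Φ : 𝒞}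
    (hΦ : IsPoint Φ) : IsPoint (mollerField μ Δ (eval c) Φ) := by
  have hodd := isOddConf_ham_variation hμ hc he hΦ
  have h1 := isEvenConf_greenDirection H hodd
  have h2 := hΦ.isEvenConf.add h1
  rw [mollerField_eval hμ hc]
  refine ⟨h2.1, h2.2, ?_, ?_⟩
  · obtain ⟨h3, h4⟩ := hodd.1 ∅ (by simp)
    rw [ham_apply] at h3 h4
    have h5 := applyGreen_real H (z := derField (variation μ c Φ ∅))
      (neg_eq_zero.1 (congrArg (fun p : ℰ ↦ p.2) h3))
      (neg_eq_zero.1 (congrArg (fun p : ℰ ↦ p.2) h4))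
      (variation_empty_im hμ hc hr Φ)
    rw [Finsupp.add_apply, Prod.snd_add, hΦ.2.2.1, zero_add, greenDirection_apply, fieldPart_apply]
    exact Prod.ext h5 rfl
  · rw [Finsupp.add_apply, Prod.fst_add, Prod.snd_add, hΦ.2.2.2, zero_add, greenDirection_apply]
    rfl

/-- The derivative of the second variation in an odd direction is odd. -/
theorem isOddConf_greenDirection_secondVariation (hμ : IsSmoothDensity d μ) (hc : IsLocal μ c)
    (he : IsEvenFunctional (eval c))
    {Δ : GreenOperator d F₀ E₀ F₁ E₁} (H : IsSplit Δ) {Φ q : 𝒞}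
    (hΦ : IsPoint Φ) (hq : IsOddConf q) :
    IsOddConf (greenDirection Δ (fieldPart (secondVariation μ c Φ q))) := by
  obtain ⟨n, h1, hn, hnq⟩ := ((variation_add_mulRight hμ hc Φ hq).and
    ((eventually_isFresh (secondVariation μ c Φ q)).and (eventually_isFresh q))).exists
  have hn' : IsFresh n (fieldPart (secondVariation μ c Φ q)) :=
    hn.of_support_subset Finsupp.support_mapRange
  have h2 := isOddConf_ham_variation hμ hc he (hΦ.add_mulRight hq hnq)
  have h3 := (isOddConf_ham_variation hμ hc he hΦ).neg.add h2
  rw [h1, ham_add, neg_add_cancel_left] at h3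
  have h4 := isEvenConf_greenDirection H h3
  rw [mulRight_fieldPart hn, greenDirection_mulRight hn'] at h4
  exact isOddConf_of_mulRight (hn'.of_support_subset Finsupp.support_mapRange) h4

end Moller

/-! ### The intertwining relation -/

section MollerMap

variable {c : Components d F₀ E₀ F₁ E₁} {L L' : (M → ℝ) → Functional d F₀ E₀ F₁ E₁}
  {h h' : Cx (Tot d F₀ E₀ F₁ E₁) →ₗ[ℝ] Cx (Der d F₀ E₀ F₁ E₁)}
  {Δ : GreenOperator d F₀ E₀ F₁ E₁}

theorem IsLocalOp.compactOff_ham (hh : IsLocalOp h) {U W : GrVec 𝒟}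
    (hU : CompactOff U) (hW : CompactOff W) : CompactOff (grMap h (ham U) + W) := by
  refine CompactOff.add ?_ hW
  obtain ⟨K, hK, hU⟩ := hU
  refine ⟨K, hK, fun I ↦ ?_⟩
  rw [grMap_apply, ham_apply_eq]
  have h1 := totSupp_cxHam hK.isClosed (u := U I) (hU I)
  exact (hh.off _).mono (union_subset h1.1 h1.2)

theorem cxHam_eq (u : Cx 𝒟) :
    cxHam u = ofFields (derAntifield u) + ofAntifields (-derField u) :=
  Prod.ext (Prod.ext (add_zero _).symm (zero_add _).symm)
    (Prod.ext (add_zero _).symm (zero_add _).symm)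

theorem ofFields_add (z z' : Cx 𝒢) :
    (ofFields (z + z') : Cx 𝒯) = ofFields z + ofFields z' :=
  Prod.ext (Prod.ext rfl (add_zero _).symm) (Prod.ext rfl (add_zero _).symm)

theorem ofFields_sub (z z' : Cx 𝒢) :
    (ofFields (z - z') : Cx 𝒯) = ofFields z - ofFields z' :=
  Prod.ext (Prod.ext rfl (sub_zero _).symm) (Prod.ext rfl (sub_zero _).symm)

theorem add_add_sub_add {A : Type*} [AddCommGroup A] (x k a b g : A) :
    x + (k + a) + (b - k + g) = x + (b + a) + g := by
  abel

theorem applyGreen_sub {z z' : Cx 𝒜} (hz : IsCompact (cxSupp z))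
    (hz' : IsCompact (cxSupp z')) :
    applyGreen Δ (z - z') = applyGreen Δ z - applyGreen Δ z' := by
  have e : IsCompact (cxSupp (z - z')) :=
    Submodule.sub_mem (CompactlySupported d (F₀ →L[ℝ] ℝ) (fun x ↦ E₀ x →L[ℝ] ℝ)
      (F₁ →L[ℝ] ℝ) (fun x ↦ E₁ x →L[ℝ] ℝ)) hz hz'
  rw [applyGreen_of_isCompact e, applyGreen_of_isCompact hz, applyGreen_of_isCompact hz']
  exact map_sub Δ ⟨z, hz⟩ ⟨z', hz'⟩

/-- The Green function applied to the field components of the derivative of the classical master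
equation of the interacting action. -/
theorem applyGreen_derField (hμ : IsSmoothDensity d μ) (hL : IsHessian μ L h)
    (hl : IsEvenLocal μ L) (haf : ∀ f, IsTest d f → HasAntifieldNumber 0 (L f))
    (hL' : IsHessian μ L' h') (hl' : IsEvenLocal μ L')
    (haf' : ∀ f, IsTest d f → HasAntifieldNumber 1 (L' f))
    {J : Set M → Set M} (hΔ : IsGreen J (fieldOp h) Δ)
    (hK : ∀ u : ℬ, brstOp h' (Δ u) =
      Δ (compactRestrict (dualBrstOp h') hL'.isLocalOp.cxSupp_dualBrstOp u))
    {u w : Cx 𝒟} (huc : IsCompact (cxSupp (derField u)))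
    (huc' : IsCompact (cxSupp (derAntifield u))) (hwc : IsCompact (cxSupp (derField w))) :
    applyGreen Δ (derField ((h + h') (cxHam u) + w)) =
      derAntifield u - brstOp h' (applyGreen Δ (derField u)) + applyGreen Δ (derField w) := by
  have h1 : derField ((h + h') (cxHam u) + w) =
      fieldOp h (derAntifield u) - dualBrstOp h' (derField u) + derField w := by
    have h1 : derField ((h + h') (cxHam u)) =
        fieldOp h (derAntifield u) + dualBrstOp h' (-derField u) :=
      derField_add_apply hμ hL hl haf hL' hl' haf' (cxHam u)
    rw [map_neg, ← sub_eq_add_neg] at h1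
    rw [← h1]
    rfl
  have hPβ : IsCompact (cxSupp (fieldOp h (derAntifield u))) :=
    isCompact_cxSupp_of_subset huc' (CxDerOff.cxSupp_derField (isClosed_cxSupp _)
      ((hL.isLocalOp.off _).mono (supp_subset_cxSupp _)))
  have hKα : IsCompact (cxSupp (dualBrstOp h' (derField u))) :=
    isCompact_cxSupp_of_subset huc (hL'.isLocalOp.cxSupp_dualBrstOp _)
  have e2 : applyGreen Δ (dualBrstOp h' (derField u)) =
      brstOp h' (applyGreen Δ (derField u)) := by
    rw [applyGreen_of_isCompact huc, hK, applyGreen_of_isCompact hKα]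
    exact congrArg Δ (Subtype.ext rfl)
  have e3 : applyGreen Δ (fieldOp h (derAntifield u)) = derAntifield u := by
    rw [applyGreen_of_isCompact hPβ]
    exact hΔ.left_inv _ _ huc' rfl
  have e4 : IsCompact (cxSupp (fieldOp h (derAntifield u) - dualBrstOp h' (derField u))) :=
    Submodule.sub_mem (CompactlySupported d (F₀ →L[ℝ] ℝ) (fun x ↦ E₀ x →L[ℝ] ℝ)
      (F₁ →L[ℝ] ℝ) (fun x ↦ E₁ x →L[ℝ] ℝ)) hPβ hKα
  rw [h1, applyGreen_add e4 hwc, applyGreen_sub hPβ hKα, e2, e3]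

/-- The Hamiltonian vector field of the free action in the direction given by the Green function. -/
theorem cxHam_ofFields_applyGreen (hμ : IsSmoothDensity d μ) (hL : IsHessian μ L h)
    (hl : IsEvenLocal μ L) (haf : ∀ f, IsTest d f → HasAntifieldNumber 0 (L f))
    (hL' : IsHessian μ L' h') (hl' : IsEvenLocal μ L')
    (haf' : ∀ f, IsTest d f → HasAntifieldNumber 1 (L' f))
    {J : Set M → Set M} (hΔ : IsGreen J (fieldOp h) Δ)
    {α : Cx 𝒜} (hα : IsCompact (cxSupp α)) :
    cxHam ((h + h') (ofFields (applyGreen Δ α))) =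
      ofFields (brstOp h' (applyGreen Δ α)) + ofAntifields (-α) := by
  have h1 : derField ((h + h') (ofFields (applyGreen Δ α))) =
      fieldOp h (applyGreen Δ α) + dualBrstOp h' 0 :=
    derField_add_apply hμ hL hl haf hL' hl' haf' (ofFields (applyGreen Δ α))
  have h2 : derAntifield ((h + h') (ofFields (applyGreen Δ α))) = brstOp h' (applyGreen Δ α) :=
    derAntifield_add_apply hμ hL hl haf hL' hl' haf' (ofFields (applyGreen Δ α))
  have h3 : fieldOp h (applyGreen Δ α) = α := by
    rw [applyGreen_of_isCompact hα, hΔ.right_inv]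
  rw [map_zero, add_zero, h3] at h1
  rw [cxHam_eq, h1, h2]

/-- The Hamiltonian vector field of the free action at the image of the Møller map, corrected by
the failure of the classical master equation, is the image of the Hamiltonian vector field of the
interacting action under the derivative of the Møller map. -/
theorem ham_mollerField_add (hμ : IsSmoothDensity d μ) (hL : IsHessian μ L h)
    (hl : IsEvenLocal μ L) (haf : ∀ f, IsTest d f → HasAntifieldNumber 0 (L f))
    (hL' : IsHessian μ L' h') (hl' : IsEvenLocal μ L')
    (haf' : ∀ f, IsTest d f → HasAntifieldNumber 1 (L' f))
    (hnil : ∀ z, (h + h') (cxHam ((h + h') z)) = 0)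
    {J : Set M → Set M} (hΔ : IsGreen J (fieldOp h) Δ)
    (hK : ∀ u : ℬ, brstOp h' (Δ u) =
      Δ (compactRestrict (dualBrstOp h') hL'.isLocalOp.cxSupp_dualBrstOp u))
    {Φ : 𝒞} {U W : GrVec 𝒟} (hU : CompactOff U)
    (hW : CompactOff W) :
    ham (grMap (h + h') (Φ + greenDirection Δ (fieldPart U))) +
        greenDirection Δ (fieldPart (grMap (h + h') (ham (grMap (h + h') Φ + U)) + W)) =
      ham (grMap (h + h') Φ + U) + greenDirection Δ (fieldPart W) := by
  ext1 I
  rw [Finsupp.add_apply, Finsupp.add_apply, ham_apply_eq, grMap_apply, Finsupp.add_apply,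
    greenDirection_apply, greenDirection_apply, greenDirection_apply, fieldPart_apply,
    fieldPart_apply, fieldPart_apply, Finsupp.add_apply, grMap_apply, ham_apply_eq,
    Finsupp.add_apply, grMap_apply, cxHam_add, map_add, map_add, hnil, zero_add, cxHam_add]
  obtain ⟨K, hKc, hUK⟩ := hU
  obtain ⟨K', hKc', hWK⟩ := hW
  have hUc : IsCompact (cxSupp (derField (U I))) :=
    isCompact_cxSupp_of_subset hKc (CxDerOff.cxSupp_derField hKc.isClosed (hUK I))
  have hUc' : IsCompact (cxSupp (derAntifield (U I))) :=
    isCompact_cxSupp_of_subset hKc (CxDerOff.cxSupp_derAntifield hKc.isClosed (hUK I))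
  have hWc : IsCompact (cxSupp (derField (W I))) :=
    isCompact_cxSupp_of_subset hKc' (CxDerOff.cxSupp_derField hKc'.isClosed (hWK I))
  rw [applyGreen_derField hμ hL hl haf hL' hl' haf' hΔ hK hUc hUc' hWc,
    cxHam_ofFields_applyGreen hμ hL hl haf hL' hl' haf' hΔ hUc, cxHam_eq (U I), ofFields_add,
    ofFields_sub]
  exact add_add_sub_add _ _ _ _ _

end MollerMap

/-! ### The formula -/

section Final

theorem IsEvenLocal.add {L L' : (M → ℝ) → ℱ} (hμ : IsSmoothDensity d μ)
    (hl : IsEvenLocal μ L) (hl' : IsEvenLocal μ L') : IsEvenLocal μ (L + L') := by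
  have := hμ.isLocallyFiniteMeasure
  intro f hf
  obtain ⟨c, hc, hfc, he⟩ := hl f hf
  obtain ⟨c', hc', hfc', he'⟩ := hl' f hf
  have h1 : eval (c + c') = eval c + eval c' :=
    funext fun Φ ↦ eval_add hc.isSmoothAlt hc'.isSmoothAlt Φ
  refine ⟨c + c', hc.add hc', ?_, ?_⟩
  · rw [h1, Pi.add_apply, hfc, hfc']
  · rw [h1]
    exact he.add he'

/-- The antibracket after the Møller map: both sides of the formula are values of the right
derivative of `X`. -/
theorem mollerInv_antibracket (g : LorentzStructure d M) (hμ : IsSmoothDensity d μ)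
    {S₀₀ θ₀ : (M → ℝ) → ℱ}
    (hS₀₀ : IsGenLagrangian μ S₀₀) (hθ₀ : IsGenLagrangian μ θ₀)
    (hS₀₀_even : ∀ f, IsTest d f → IsEvenFunctional (S₀₀ f))
    (hθ₀_even : ∀ f, IsTest d f → IsEvenFunctional (θ₀ f))
    (hS₀₀_quad : ∀ f, IsTest d f → IsQuadratic (S₀₀ f))
    (hθ₀_quad : ∀ f, IsTest d f → IsQuadratic (θ₀ f))
    (hS₀₀_af : ∀ f, IsTest d f → HasAntifieldNumber 0 (S₀₀ f))
    (hθ₀_af : ∀ f, IsTest d f → HasAntifieldNumber 1 (θ₀ f))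
    (hS₀₀_real : ∀ f, IsTest d f → HasRealBody (S₀₀ f))
    (hcme : SatisfiesCME μ (S₀₀ + θ₀))
    {P : FieldOperator d F₀ E₀ F₁ E₁} (hP : IsFieldEquation μ S₀₀ P)
    (hP_hyp : GreenHyperbolic g P)
    {ΔR : GreenOperator d F₀ E₀ F₁ E₁} (hΔR : IsGreen g.future P ΔR)
    {c : 𝒦} (hc : IsLocal μ c)
    (hV_even : IsEvenFunctional (eval c)) (hV_real : HasRealBody (eval c))
    {X : ℱ} (hX : X ∈ multilocal d F₀ E₀ F₁ E₁ μ)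
    {Φ : 𝒞} (hΦ : IsPoint Φ) :
    ∃ (A A₀ C : GrVec 𝒟) (a a₀ b : Grassmann),
      CompactOff C ∧ IsPoint (mollerField μ ΔR (eval c) Φ) ∧
      IsLeftDeriv μ (S₀₀ + θ₀) (mollerField μ ΔR (eval c) Φ) A₀ ∧
      IsRightDeriv X (mollerField μ ΔR (eval c) Φ) (ham A₀) a₀ ∧
      IsLeftDeriv μ (fun f ↦ (S₀₀ + θ₀) f + eval c) Φ A ∧
      IsRightDeriv (mollerInv μ ΔR (eval c) X) Φ (ham A) a ∧
      IsLeftDeriv μ (cme μ fun f ↦ (S₀₀ + θ₀) f + eval c) Φ C ∧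
      IsRightDeriv X (mollerField μ ΔR (eval c) Φ) (greenDirection ΔR (fieldPart C)) b ∧
      a₀ = a - b := by
  have hl : IsEvenLocal μ S₀₀ := fun f hf ↦ by
    obtain ⟨c, hc, hfc⟩ := hS₀₀.isLocal f hf
    exact ⟨c, hc, hfc, hfc ▸ hS₀₀_even f hf⟩
  have hl' : IsEvenLocal μ θ₀ := fun f hf ↦ by
    obtain ⟨c, hc, hfc⟩ := hθ₀.isLocal f hf
    exact ⟨c, hc, hfc, hfc ▸ hθ₀_even f hf⟩
  have hl₀ : IsEvenLocal μ (S₀₀ + θ₀) := IsEvenLocal.add hμ hl hl'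
  obtain ⟨h, hh⟩ := hS₀₀.exists_isHessian hμ hS₀₀_quad
  obtain ⟨h', hh'⟩ := hθ₀.exists_isHessian hμ hθ₀_quad
  have hH : IsHessian μ (S₀₀ + θ₀) (h + h') := hh.add hμ hh' hl hl'
  have hnil := hH.nilpotent hμ hl₀ hcme
  obtain rfl : P = fieldOp h := hh.eq_fieldOp hμ hl hP
  have huniq (Δ') (h' : IsGreen g.future (fieldOp h) Δ') : Δ' = ΔR :=
    hP_hyp.1.unique h' hΔR
  have hsplit := hΔR.splitting g.future_mono huniq (fieldOp_conjFst hμ hh hl hS₀₀_real)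
    (fieldOp_projSnd hμ hh hl)
  have hK := hΔR.intertwine g.future_mono huniq hh'.isLocalOp.brstOp_mulI
    hh'.isLocalOp.dualBrstOp_mulI hh'.isLocalOp.cxSupp_brstOp hh'.isLocalOp.cxSupp_dualBrstOp
    (fieldOp_brstOp hμ hh hl hS₀₀_af hh' hl' hθ₀_af hnil)
  have hm := isPoint_mollerField hμ hc hV_even hV_real hsplit hΦ
  have hU := (variation_spec hμ hc Φ).1
  set A := grMap (h + h') Φ + variation μ c Φ with hA
  have hAodd : IsOddConf (ham A) := by
    rw [hA, ham_add]
    exact (hH.isOddConf hμ hl₀ hΦ).add (isOddConf_ham_variation hμ hc hV_even hΦ)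
  have hW := (secondVariation_spec hμ hc Φ (ham A)).1
  set W := secondVariation μ c Φ (ham A) with hWdef
  have hC : CompactOff (grMap (h + h') (ham A) + W) := by
    -- by nilpotency only the compactly supported part of `A` contributes
    have h1 : grMap (h + h') (ham A) = grMap (h + h') (ham (variation μ c Φ)) := by
      ext1 I
      rw [grMap_apply, grMap_apply, ham_apply_eq, ham_apply_eq, hA, Finsupp.add_apply,
        grMap_apply, cxHam_add, map_add, hnil, zero_add]
    rw [h1]
    exact hH.isLocalOp.compactOff_ham hU hW
  have hG : IsOddConf (greenDirection ΔR (fieldPart W)) :=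
    isOddConf_greenDirection_secondVariation hμ hc hV_even hsplit hΦ hAodd
  have hA₀odd := hH.isOddConf hμ hl₀ hm
  have key : ham (grMap (h + h') (mollerField μ ΔR (eval c) Φ)) +
      greenDirection ΔR (fieldPart (grMap (h + h') (ham A) + W)) =
        ham A + greenDirection ΔR (fieldPart W) := by
    rw [mollerField_eval hμ hc]
    exact ham_mollerField_add hμ hh hl hS₀₀_af hh' hl' hθ₀_af hnil hΔR hK hU hW
  have hcorr : IsOddConf (greenDirection ΔR (fieldPart (grMap (h + h') (ham A) + W))) := by
    rw [← neg_add_cancel_left (ham (grMap (h + h') (mollerField μ ΔR (eval c) Φ)))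
      (greenDirection ΔR (fieldPart (grMap (h + h') (ham A) + W))), key]
    exact hA₀odd.neg.add (hAodd.add hG)
  -- the additivity of `a` turns the identity `key` of directions into the formula
  obtain ⟨a, ha, haX⟩ := exists_rightDeriv hμ hX (mollerField μ ΔR (eval c) Φ)
  refine ⟨A, grMap (h + h') (mollerField μ ΔR (eval c) Φ), grMap (h + h') (ham A) + W,
    a (ham A + greenDirection ΔR (fieldPart W)), _, _, hC, hm, hH.isLeftDeriv_self hμ hl₀ hm,
    haX _ hA₀odd, hH.isLeftDeriv hμ hl₀ hc hΦ, ?_,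
    hH.isLeftDeriv_cme hμ hl₀ hc hV_even hΦ, haX _ hcorr, ?_⟩
  · filter_upwards [haX _ (hAodd.add hG), mollerField_add_mulRight hμ hc ΔR Φ hAodd] with n h1 h2
    rw [mollerInv, h2, h1, mollerInv]
  · rw [← key, ha, add_sub_cancel_right]

end Final

end FieldTheory

end BV

end

theorem theorem1 {d : ℕ} {M : Type*} [TopologicalSpace M] [T2Space M] [SigmaCompactSpace M]
    [ChartedSpace (EuclideanSpace ℝ (Fin d)) M] [IsManifold (𝓡 d) ∞ M]
    [MeasurableSpace M] [BorelSpace M]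
    {F₀ : Type*} [NormedAddCommGroup F₀] [NormedSpace ℝ F₀] [FiniteDimensional ℝ F₀]
    {E₀ : M → Type*} [TopologicalSpace (TotalSpace F₀ E₀)] [∀ x, TopologicalSpace (E₀ x)]
    [∀ x, AddCommGroup (E₀ x)] [∀ x, Module ℝ (E₀ x)] [∀ x, IsTopologicalAddGroup (E₀ x)]
    [∀ x, ContinuousSMul ℝ (E₀ x)] [FiberBundle F₀ E₀] [VectorBundle ℝ F₀ E₀]
    [ContMDiffVectorBundle ∞ F₀ E₀ (𝓡 d)]
    {F₁ : Type*} [NormedAddCommGroup F₁] [NormedSpace ℝ F₁] [FiniteDimensional ℝ F₁]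
    {E₁ : M → Type*} [TopologicalSpace (TotalSpace F₁ E₁)] [∀ x, TopologicalSpace (E₁ x)]
    [∀ x, AddCommGroup (E₁ x)] [∀ x, Module ℝ (E₁ x)] [∀ x, IsTopologicalAddGroup (E₁ x)]
    [∀ x, ContinuousSMul ℝ (E₁ x)] [FiberBundle F₁ E₁] [VectorBundle ℝ F₁ E₁]
    [ContMDiffVectorBundle ∞ F₁ E₁ (𝓡 d)]
    (g : BV.LorentzStructure d M) (hg : g.GloballyHyperbolic)
    (μ : Measure M) (hμ : BV.IsSmoothDensity d μ)
    -- the free action `S₀ = S₀₀ + θ₀`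
    (S₀₀ θ₀ : (M → ℝ) → BV.Functional d F₀ E₀ F₁ E₁)
    (hS₀₀ : BV.IsGenLagrangian μ S₀₀) (hθ₀ : BV.IsGenLagrangian μ θ₀)
    (hS₀₀_even : ∀ f, BV.IsTest d f → BV.IsEvenFunctional (S₀₀ f))
    (hθ₀_even : ∀ f, BV.IsTest d f → BV.IsEvenFunctional (θ₀ f))
    (hS₀₀_quad : ∀ f, BV.IsTest d f → BV.IsQuadratic (S₀₀ f))
    (hθ₀_quad : ∀ f, BV.IsTest d f → BV.IsQuadratic (θ₀ f))
    (hS₀₀_af : ∀ f, BV.IsTest d f → BV.HasAntifieldNumber 0 (S₀₀ f))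
    (hθ₀_af : ∀ f, BV.IsTest d f → BV.HasAntifieldNumber 1 (θ₀ f))
    (hS₀₀_real : ∀ f, BV.IsTest d f → BV.HasRealBody (S₀₀ f))
    (hcme : BV.SatisfiesCME μ (S₀₀ + θ₀))
    -- the free field equation and its retarded Green function
    (P : BV.FieldOperator d F₀ E₀ F₁ E₁) (hP : BV.IsFieldEquation μ S₀₀ P)
    (hP_hyp : BV.GreenHyperbolic g P)
    (ΔR : BV.GreenOperator d F₀ E₀ F₁ E₁) (hΔR : BV.IsGreen g.future P ΔR)
    -- the interaction
    (V : BV.Functional d F₀ E₀ F₁ E₁) (hV : V ∈ BV.Floc d F₀ E₀ F₁ E₁ μ)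
    (hV_even : BV.IsEvenFunctional V) (hV_real : BV.HasRealBody V)
    (X : BV.Functional d F₀ E₀ F₁ E₁) (hX : X ∈ BV.multilocal d F₀ E₀ F₁ E₁ μ)
    (Φ : BV.Conf d F₀ E₀ F₁ E₁) (hΦ : BV.IsPoint Φ) :
    let S₀ : (M → ℝ) → BV.Functional d F₀ E₀ F₁ E₁ := S₀₀ + θ₀
    let S : (M → ℝ) → BV.Functional d F₀ E₀ F₁ E₁ := fun f ↦ S₀ f + V
    let correction : BV.Conf d F₀ E₀ F₁ E₁ :=
      BV.greenDirection ΔR (BV.fieldDeriv μ (BV.cme μ S) Φ)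
    -- all objects in the formula are defined
    ((∃ U, BV.IsLeftDeriv μ (fun _ ↦ V) Φ U) ∧
      BV.HasCompactCoefficients (BV.fieldDeriv μ (fun _ ↦ V) Φ) ∧
      BV.IsPoint (BV.mollerField μ ΔR V Φ) ∧
      BV.AntibracketDefined μ X S₀ (BV.mollerField μ ΔR V Φ) ∧
      BV.AntibracketDefined μ (BV.mollerInv μ ΔR V X) S Φ ∧
      (∃ U, BV.IsLeftDeriv μ (BV.cme μ S) Φ U) ∧
      BV.HasCompactCoefficients (BV.fieldDeriv μ (BV.cme μ S) Φ) ∧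
      ∃ a, BV.IsRightDeriv X (BV.mollerField μ ΔR V Φ) correction a) ∧
    -- the formula
    BV.mollerInv μ ΔR V (BV.antibracket μ X S₀) Φ =
      BV.antibracket μ (BV.mollerInv μ ΔR V X) S Φ -
        BV.rightDeriv X (BV.mollerField μ ΔR V Φ) correction := by
  obtain ⟨c, hc, rfl⟩ := hV
  obtain ⟨A, A₀, C, a, a₀, b, hC, hm, hA₀, ha₀, hA, ha, hC', hb, hab⟩ :=
    BV.mollerInv_antibracket g hμ hS₀₀ hθ₀ hS₀₀_even hθ₀_even hS₀₀_quad hθ₀_quad hS₀₀_af hθ₀_af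
      hS₀₀_real hcme hP hP_hyp hΔR hc hV_even hV_real hX hΦ
  intro S₀ S correction
  have hU := BV.isLeftDeriv_eval hμ hc Φ
  have hham : BV.hamiltonian μ S Φ = BV.ham A := by
    rw [BV.hamiltonian_eq, hA.leftDeriv_eq hμ]
  have hham₀ : BV.hamiltonian μ S₀ (BV.mollerField μ ΔR (BV.eval c) Φ) = BV.ham A₀ := by
    rw [BV.hamiltonian_eq, hA₀.leftDeriv_eq hμ]
  have hfield : BV.fieldDeriv μ (BV.cme μ S) Φ = BV.fieldPart C := by
    rw [BV.fieldDeriv, hC'.leftDeriv_eq hμ, BV.fieldPart]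
  have hcorr : correction = BV.greenDirection ΔR (BV.fieldPart C) :=
    congrArg (BV.greenDirection ΔR) hfield
  refine ⟨⟨⟨_, hU⟩, ?_, hm, ⟨⟨_, hA₀⟩, ?_⟩, ⟨⟨_, hA⟩, ?_⟩, ⟨_, hC'⟩, ?_, ?_⟩, ?_⟩
  · rw [BV.fieldDeriv, hU.leftDeriv_eq hμ]
    exact (BV.variation_spec hμ hc Φ).1.fieldPart
  · rw [hham₀]
    exact ⟨_, ha₀⟩
  · rw [hham]
    exact ⟨_, ha⟩
  · rw [hfield]
    exact hC.fieldPart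
  · rw [hcorr]
    exact ⟨_, hb⟩
  · rw [BV.mollerInv, BV.antibracket, BV.antibracket, hham, hham₀, hcorr, ha₀.rightDeriv_eq,
      ha.rightDeriv_eq, hb.rightDeriv_eq, hab]
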